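/- \textbf{Definitions.} A \emph{12-vertex triangulation of the surface of genus $g$} is a connected, orientable abstract simplicial complex $K$ of dimension $2$ on the vertex set $\{1,\dots,12\}$ (all twelve being vertices) in which the link of every vertex is a cycle and whose Euler characteristic is $2-2g$. Two triangulations are \emph{combinatorially distinct} if they are not isomorphic as simplicial complexes. A \emph{polyhedral realization} of $K$ in $\mathbb{R}^3$ is a map $f:\{1,\dots,12\}\to\mathbb{R}^3$ such that $\operatorname{conv} f(F\cap G)=\operatorname{conv} f(F)\cap\operatorname{conv} f(G)$ for all faces $F,G$ of $K$. A \emph{uniform oriented matroid of rank $4$} on a finite set $E$ is given by a chirotope $\chi:E^4\to\{-1,0,1\}$ that is alternating, is nonzero exactly on the $4$-tuples of distinct elements, and satisfies, for all distinct $a,b,x_1,x_2,x_3,x_4\in E$, \[\{-1,+1\}\subseteq\{\chi(a,b,x_1,x_2)\chi(a,b,x_3,x_4),\ -\chi(a,b,x_1,x_3)\chi(a,b,x_2,x_4),\ \chi(a,b,x_1,x_4)\chi(a,b,x_2,x_3)\};\] $\chi$ and $-\chi$ give the same oriented matroid. Its signed circuits are the two opposite signings $\pm C$ of each $5$-element set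 $\{c_1,\dots,c_5\}\subseteq E$ of distinct elements given by $C(c_i)=(-1)^i\chi(c_1,\dots,\widehat{c_i},\dots,c_5)$; write $C^+$ and $C^-$ for the sets of positive and negative elements. It is \emph{acyclic} if no signed circuit has $C^-=\emptyset$. It is \emph{admissible} for a simplicial complex $K$ with vertex set $E$ if there are no disjoint faces $F,G$ of $K$ and no signed circuit $C$ with $C^+\subseteq F$ and $C^-\subseteq G$. Let $K_1,K_2,K_3,K_4$ be the simplicial complexes on $\{1,\dots,12\}$ with the following triangles (these are, up to relabelling, the surfaces $2_{12}^{1,1}$, $2_{12}^{1,2}$, $2_{12}^{1,6}$ and $2_{12}^{5,1}$ of Lutz). $K_1$: $1\,2\,3,\ 1\,2\,12,\ 1\,3\,6,\ 1\,4\,8,\ 1\,4\,11,\ 1\,5\,9,\ 1\,5\,10,\ 1\,6\,9,\ 1\,8\,10,\ 1\,11\,12,\ 2\,3\,4,\ 2\,4\,7,\ 2\,5\,9,\ 2\,5\,12,\ 2\,6\,10,\ 2\,6\,11,\ 2\,7\,10,\ 2\,9\,11,\ 3\,4\,5,\ 3\,5\,8,\ 3\,6\,10,\ 3\,7\,11,\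 3\,7\,12,\ 3\,8\,11,\ 3\,10\,12,\ 4\,5\,6,\ 4\,6\,9,\ 4\,7\,11,\ 4\,8\,12,\ 4\,9\,12,\ 5\,6\,7,\ 5\,7\,10,\ 5\,8\,12,\ 6\,7\,8,\ 6\,8\,11,\ 7\,8\,9,\ 7\,9\,12,\ 8\,9\,10,\ 9\,10\,11,\ 10\,11\,12$. $K_2$: $1\,2\,3,\ 1\,2\,12,\ 1\,3\,6,\ 1\,4\,9,\ 1\,4\,11,\ 1\,5\,8,\ 1\,5\,9,\ 1\,6\,10,\ 1\,8\,10,\ 1\,11\,12,\ 2\,3\,4,\ 2\,4\,7,\ 2\,5\,10,\ 2\,5\,12,\ 2\,6\,9,\ 2\,6\,10,\ 2\,7\,11,\ 2\,9\,11,\ 3\,4\,5,\ 3\,5\,8,\ 3\,6\,11,\ 3\,7\,10,\ 3\,7\,11,\ 3\,8\,12,\ 3\,10\,12,\ 4\,5\,6,\ 4\,6\,9,\ 4\,7\,12,\ 4\,8\,11,\ 4\,8\,12,\ 5\,6\,7,\ 5\,7\,10,\ 5\,9\,12,\ 6\,7\,8,\ 6\,8\,11,\ 7\,8\,9,\ 7\,9\,12,\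 8\,9\,10,\ 9\,10\,11,\ 10\,11\,12$. $K_3$: $1\,2\,4,\ 1\,2\,6,\ 1\,3\,6,\ 1\,3\,12,\ 1\,4\,11,\ 1\,5\,9,\ 1\,5\,12,\ 1\,8\,9,\ 1\,8\,10,\ 1\,10\,11,\ 2\,3\,5,\ 2\,3\,7,\ 2\,4\,7,\ 2\,5\,12,\ 2\,6\,10,\ 2\,9\,10,\ 2\,9\,11,\ 2\,11\,12,\ 3\,4\,6,\ 3\,4\,8,\ 3\,5\,8,\ 3\,7\,11,\ 3\,10\,11,\ 3\,10\,12,\ 4\,5\,7,\ 4\,5\,9,\ 4\,6\,9,\ 4\,8\,12,\ 4\,11\,12,\ 5\,6\,8,\ 5\,6\,10,\ 5\,7\,10,\ 6\,7\,9,\ 6\,7\,11,\ 6\,8\,11,\ 7\,8\,10,\ 7\,8\,12,\ 7\,9\,12,\ 8\,9\,11,\ 9\,10\,12$. $K_4$: $1\,2\,11,\ 1\,2\,12,\ 1\,4\,6,\ 1\,4\,7,\ 1\,5\,9,\ 1\,5\,12,\ 1\,6\,10,\ 1\,7\,8,\ 1\,8\,9,\ 1\,10\,11,\ 2\,3\,5,\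 2\,3\,8,\ 2\,5\,10,\ 2\,6\,9,\ 2\,6\,10,\ 2\,7\,8,\ 2\,7\,11,\ 2\,9\,12,\ 3\,4\,9,\ 3\,4\,10,\ 3\,5\,6,\ 3\,6\,11,\ 3\,7\,10,\ 3\,7\,11,\ 3\,8\,12,\ 3\,9\,12,\ 4\,5\,6,\ 4\,5\,9,\ 4\,7\,12,\ 4\,8\,11,\ 4\,8\,12,\ 4\,10\,11,\ 5\,8\,10,\ 5\,8\,11,\ 5\,11\,12,\ 6\,7\,9,\ 6\,7\,12,\ 6\,11\,12,\ 7\,9\,10,\ 8\,9\,10$. \textbf{Theorem.} $K_1,K_2,K_3$ are pairwise combinatorially distinct 12-vertex triangulations of the surface of genus $5$, and none of them has a polyhedral realization in $\mathbb{R}^3$. Moreover, no uniform oriented matroid of rank $4$ (acyclic or not) is admissible for $K_1$, $K_2$ or $K_3$. In contrast, $K_4$ is a 12-vertex triangulation of the surface of genus $5$ for which there are more than $100\,000$ admissible acyclic uniform oriented matroids of rank $4$. -/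

import Mathlib

/-- The pure complex spanned by a finite set `T` of facets: its faces are the nonempty subsets of
members of `T`, together with all singletons of the vertex type `V`. -/
def complexOf {V : Type*} (T : Finset (Finset V)) : AbstractSimplicialComplex V where
  faces := {s | s.Nonempty ∧ ((∃ v, s = {v}) ∨ ∃ t ∈ T, s ⊆ t)}
  isRelLowerSet_faces := by
    rintro s ⟨hs, h⟩
    refine ⟨hs, fun u hus hu => ⟨hu, ?_⟩⟩
    rcases h with ⟨v, rfl⟩ | ⟨t, ht, hst⟩
    · exact Or.inl ⟨v, (Finset.subset_singleton_iff.mp hus).resolve_left hu.ne_empty⟩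
    · exact Or.inr ⟨t, ht, hus.trans hst⟩
  singleton_mem v := ⟨Finset.singleton_nonempty v, Or.inl ⟨v, rfl⟩⟩

namespace AbstractSimplicialComplex

/-- Combinatorial isomorphism: a bijection of the vertices that maps faces exactly to faces. -/
def IsIsomorphic {V W : Type*} (K : AbstractSimplicialComplex V)
    (L : AbstractSimplicialComplex W) : Prop :=
  ∃ e : V ≃ W, ∀ s : Finset V, s ∈ K ↔ s.map e.toEmbedding ∈ L

/-- The 1-skeleton. -/
def edgeGraph {V : Type*} [DecidableEq V] (K : AbstractSimplicialComplex V) : SimpleGraph V where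
  Adj a b := a ≠ b ∧ ({a, b} : Finset V) ∈ K
  symm := ⟨fun a b h => ⟨h.1.symm, by rw [Finset.pair_comm]; exact h.2⟩⟩
  loopless := ⟨fun _ h => h.1 rfl⟩

/-- The link of the vertex `v` in a 2-dimensional complex, as a graph on the neighbours of `v`:
`a` and `b` are joined when `{v, a, b}` is a triangle. -/
def linkGraph {V : Type*} [DecidableEq V] (K : AbstractSimplicialComplex V) (v : V) :
    SimpleGraph {w : V // K.edgeGraph.Adj v w} where
  Adj a b := a ≠ b ∧ ({v, a.1, b.1} : Finset V) ∈ K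
  symm := ⟨fun a b h => ⟨h.1.symm, by rw [Finset.pair_comm]; exact h.2⟩⟩
  loopless := ⟨fun _ h => h.1 rfl⟩

/-- Coherent orientability of a 2-dimensional complex. `O a b c` says that the triangle `{a, b, c}`
carries the cyclic orientation `a → b → c → a`. Each triangle carries exactly one of its two
cyclic orientations, and no directed edge `a → b` is used by two different triangles. -/
def IsOrientable {V : Type*} [DecidableEq V] (K : AbstractSimplicialComplex V) : Prop :=
  ∃ O : V → V → V → Prop,
    (∀ a b c, O a b c → O b c a) ∧
    (∀ a b c, ({a, b, c} : Finset V) ∈ K → a ≠ b → b ≠ c → a ≠ c → Xor (O a b c) (O b a c)) ∧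
    (∀ a b c, O a b c → ({a, b, c} : Finset V) ∈ K ∧ a ≠ b ∧ b ≠ c ∧ a ≠ c) ∧
    (∀ a b c d, O a b c → O a b d → c = d)

/-- The number of faces with `k` vertices. -/
noncomputable def numFaces {V : Type*} (K : AbstractSimplicialComplex V) (k : ℕ) : ℕ :=
  {s : Finset V | s ∈ K ∧ s.card = k}.ncard

/-- `K` is a triangulation, with vertex set `V`, of the closed connected orientable surface of
genus `g`: it has dimension at most 2, the link of every vertex is a cycle, it is connected and
orientable, and its Euler characteristic is `2 - 2g`. -/
structure IsTriangulatedSurface {V : Type*} [DecidableEq V] [Fintype V]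
    (K : AbstractSimplicialComplex V) (g : ℕ) : Prop where
  card_le : ∀ s ∈ K, s.card ≤ 3
  link_cycle : ∀ v : V, ∃ n : ℕ, 3 ≤ n ∧ Nonempty (K.linkGraph v ≃g SimpleGraph.cycleGraph n)
  connected : K.edgeGraph.Connected
  orientable : K.IsOrientable
  euler : (K.numFaces 1 : ℤ) - K.numFaces 2 + K.numFaces 3 = 2 - 2 * g

/-- `f` places the vertices so that, extending linearly over the faces, any two closed faces meet
exactly in their common face. (Applied to the faces of a single simplex, this forces the images of
the vertices of each face to be affinely independent.) -/
def IsPolyhedralRealization {V : Type*} [DecidableEq V] (K : AbstractSimplicialComplex V) {d : ℕ}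
    (f : V → EuclideanSpace ℝ (Fin d)) : Prop :=
  ∀ F ∈ K, ∀ G ∈ K,
    convexHull ℝ (f '' ((F ∩ G : Finset V) : Set V)) =
      convexHull ℝ (f '' (F : Set V)) ∩ convexHull ℝ (f '' (G : Set V))

end AbstractSimplicialComplex

/-- A uniform oriented matroid of rank 4 on the ground set `E`, given by a chirotope `χ`: an
alternating map, `±1` exactly on tuples of distinct elements (so `0` on the others, as alternation
requires), subject to the three-term Grassmann–Plücker relations. -/
@[ext]
structure UniformOrientedMatroid (E : Type*) where
  χ : (Fin 4 → E) → ℤ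
  eq_zero : ∀ v, ¬ Function.Injective v → χ v = 0
  eq_one_or : ∀ v, Function.Injective v → χ v = 1 ∨ χ v = -1
  alternating : ∀ (v : Fin 4 → E) (π : Equiv.Perm (Fin 4)),
    χ (v ∘ π) = (Equiv.Perm.sign π : ℤ) * χ v
  grassmannPluecker : ∀ a b x₁ x₂ x₃ x₄ : E, Function.Injective ![a, b, x₁, x₂, x₃, x₄] →
    ({1, -1} : Set ℤ) ⊆
      {χ ![a, b, x₁, x₂] * χ ![a, b, x₃, x₄],
        -(χ ![a, b, x₁, x₃] * χ ![a, b, x₂, x₄]),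
        χ ![a, b, x₁, x₄] * χ ![a, b, x₂, x₃]}

namespace UniformOrientedMatroid

/-- `(P, N)` is a signed circuit: on a 5-element set listed as `c 0, …, c 4`, the element `c i` has
sign `s (-1)^i χ(c 0, …, c i omitted, …, c 4)` with a common factor `s = ±1`; `P` is the set of
positive and `N` the set of negative elements. -/
def IsCircuit {E : Type*} (M : UniformOrientedMatroid E) (P N : Finset E) : Prop :=
  ∃ c : Fin 5 → E, Function.Injective c ∧ ∃ s : ℤ, (s = 1 ∨ s = -1) ∧
    (∀ e, e ∈ P ↔ ∃ i : Fin 5, c i = e ∧ s * (-1) ^ (i : ℕ) * M.χ (c ∘ i.succAbove) = 1) ∧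
    (∀ e, e ∈ N ↔ ∃ i : Fin 5, c i = e ∧ s * (-1) ^ (i : ℕ) * M.χ (c ∘ i.succAbove) = -1)

/-- No circuit is totally positive. -/
def IsAcyclic {E : Type*} (M : UniformOrientedMatroid E) : Prop :=
  ∀ P : Finset E, ¬ M.IsCircuit P ∅

/-- Admissibility for a complex on the vertex set `E`: no two disjoint faces `F`, `G` contain the
positive and the negative part of a circuit, respectively. -/
def IsAdmissible {E : Type*} (M : UniformOrientedMatroid E)
    (K : AbstractSimplicialComplex E) : Prop :=
  ∀ F ∈ K, ∀ G ∈ K, Disjoint F G → ∀ P N : Finset E, M.IsCircuit P N → ¬ (P ⊆ F ∧ N ⊆ G)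

/-- Two chirotopes describe the same oriented matroid when they agree up to a global sign. -/
def signSetoid (E : Type*) : Setoid (UniformOrientedMatroid E) where
  r M M' := M.χ = M'.χ ∨ M.χ = -M'.χ
  iseqv :=
    { refl := fun _ => Or.inl rfl
      symm := by
        rintro M M' (h | h)
        · exact Or.inl h.symm
        · exact Or.inr (by rw [h, neg_neg])
      trans := by
        rintro M M' M'' (h | h) (h' | h')
        · exact Or.inl (h.trans h')
        · exact Or.inr (h.trans h')
        · exact Or.inr (by rw [h, h'])
        · exact Or.inl (by rw [h, h', neg_neg]) }

end UniformOrientedMatroid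

/-- The facets of Lutz's surface `2_12^{1,1}`. In this and the following tables the
vertices are labelled `1, …, 12` and read in `Fin 12`, where the numeral `12` denotes `0`. -/
def lutz11Facets : Finset (Finset (Fin 12)) :=
  {{1, 2, 3}, {1, 2, 12}, {1, 3, 6}, {1, 4, 8}, {1, 4, 11}, {1, 5, 9},
   {1, 5, 10}, {1, 6, 9}, {1, 8, 10}, {1, 11, 12}, {2, 3, 4}, {2, 4, 7},
   {2, 5, 9}, {2, 5, 12}, {2, 6, 10}, {2, 6, 11}, {2, 7, 10}, {2, 9, 11},
   {3, 4, 5}, {3, 5, 8}, {3, 6, 10}, {3, 7, 11}, {3, 7, 12}, {3, 8, 11},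
   {3, 10, 12}, {4, 5, 6}, {4, 6, 9}, {4, 7, 11}, {4, 8, 12}, {4, 9, 12},
   {5, 6, 7}, {5, 7, 10}, {5, 8, 12}, {6, 7, 8}, {6, 8, 11}, {7, 8, 9},
   {7, 9, 12}, {8, 9, 10}, {9, 10, 11}, {10, 11, 12}}

/-- Facets of Lutz's surface `2_12^{1,2}`. -/
def lutz12Facets : Finset (Finset (Fin 12)) :=
  {{1, 2, 3}, {1, 2, 12}, {1, 3, 6}, {1, 4, 9}, {1, 4, 11}, {1, 5, 8},
   {1, 5, 9}, {1, 6, 10}, {1, 8, 10}, {1, 11, 12}, {2, 3, 4}, {2, 4, 7},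
   {2, 5, 10}, {2, 5, 12}, {2, 6, 9}, {2, 6, 10}, {2, 7, 11}, {2, 9, 11},
   {3, 4, 5}, {3, 5, 8}, {3, 6, 11}, {3, 7, 10}, {3, 7, 11}, {3, 8, 12},
   {3, 10, 12}, {4, 5, 6}, {4, 6, 9}, {4, 7, 12}, {4, 8, 11}, {4, 8, 12},
   {5, 6, 7}, {5, 7, 10}, {5, 9, 12}, {6, 7, 8}, {6, 8, 11}, {7, 8, 9},
   {7, 9, 12}, {8, 9, 10}, {9, 10, 11}, {10, 11, 12}}

/-- Facets of Lutz's surface `2_12^{1,6}`. -/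
def lutz16Facets : Finset (Finset (Fin 12)) :=
  {{1, 2, 4}, {1, 2, 6}, {1, 3, 6}, {1, 3, 12}, {1, 4, 11}, {1, 5, 9},
   {1, 5, 12}, {1, 8, 9}, {1, 8, 10}, {1, 10, 11}, {2, 3, 5}, {2, 3, 7},
   {2, 4, 7}, {2, 5, 12}, {2, 6, 10}, {2, 9, 10}, {2, 9, 11}, {2, 11, 12},
   {3, 4, 6}, {3, 4, 8}, {3, 5, 8}, {3, 7, 11}, {3, 10, 11}, {3, 10, 12},
   {4, 5, 7}, {4, 5, 9}, {4, 6, 9}, {4, 8, 12}, {4, 11, 12}, {5, 6, 8},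
   {5, 6, 10}, {5, 7, 10}, {6, 7, 9}, {6, 7, 11}, {6, 8, 11}, {7, 8, 10},
   {7, 8, 12}, {7, 9, 12}, {8, 9, 11}, {9, 10, 12}}

/-- Facets of Lutz's surface `2_12^{5,1}`: up to isomorphism, the only 12-vertex
triangulation of the orientable surface of genus 5 with a vertex-transitive action of the dicyclic
group of order 12 (the fifth transitive permutation group of degree 12). -/
def lutz51Facets : Finset (Finset (Fin 12)) :=
  {{1, 2, 11}, {1, 2, 12}, {1, 4, 6}, {1, 4, 7}, {1, 5, 9}, {1, 5, 12},
   {1, 6, 10}, {1, 7, 8}, {1, 8, 9}, {1, 10, 11}, {2, 3, 5}, {2, 3, 8},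
   {2, 5, 10}, {2, 6, 9}, {2, 6, 10}, {2, 7, 8}, {2, 7, 11}, {2, 9, 12},
   {3, 4, 9}, {3, 4, 10}, {3, 5, 6}, {3, 6, 11}, {3, 7, 10}, {3, 7, 11},
   {3, 8, 12}, {3, 9, 12}, {4, 5, 6}, {4, 5, 9}, {4, 7, 12}, {4, 8, 11},
   {4, 8, 12}, {4, 10, 11}, {5, 8, 10}, {5, 8, 11}, {5, 11, 12}, {6, 7, 9},
   {6, 7, 12}, {6, 11, 12}, {7, 9, 10}, {8, 9, 10}}

/-- The triangulated surface `2_12^{1,1}`. -/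
def lutz11 : AbstractSimplicialComplex (Fin 12) := complexOf lutz11Facets

/-- The triangulated surface `2_12^{1,2}`. -/
def lutz12 : AbstractSimplicialComplex (Fin 12) := complexOf lutz12Facets

/-- The triangulated surface `2_12^{1,6}`. -/
def lutz16 : AbstractSimplicialComplex (Fin 12) := complexOf lutz16Facets

/-- The triangulated surface `2_12^{5,1}`. -/
def lutz51 : AbstractSimplicialComplex (Fin 12) := complexOf lutz51Facets

/-!
The four complexes are finite, so that they are triangulated surfaces of genus 5 is checked by
evaluation, from lists of their triangles in coherent orientation. No two of the first three are
isomorphic, since they differ in the numbers of certain strips of triangles.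

A polyhedral realization of a complex yields an admissible oriented matroid: disjoint faces are
strictly separated by a plane, they still are after the vertices have been moved slightly to general
position, and hence no circuit of the moved points is positive on one face and negative on another
(`exists_isAdmissible_of_isPolyhedralRealization`). So the essential claim is that no uniform
oriented matroid is admissible for `lutz11`, `lutz12` or `lutz16`.

The proof of this claim rules out circuits one after another, a circuit being a five-element set
with signs. In the beginning, these are the circuits that separate two disjoint faces. The vertex
rotation `v ↦ v + 1` is an automorphism of each of the three surfaces, and admissibility is
preserved by rotation and by a global change of sign, so along with a circuit its rotations and its
negative are excluded. In order to exclude another circuit, it is assumed that the oriented matroid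
has it. A state records for all five-element sets which circuits are still possible. On six elements
the Grassmann–Plücker relations leave few combinations of circuits, and a filter removes the
circuits that belong to none of these. Filtering for many six-element sets, with a few case
distinctions on the sign of a basis, leaves some five-element set without any circuit. Which sets
are filtered, and which bases are distinguished, is given by lists of hints; soundness
(`not_possibleIn_of_refutes`, `excluded_take_add`) holds whatever the hints are. In the end all
circuits on some five-element set are excluded, which is impossible (`not_exists_isAdmissible`). The
kernel evaluates the procedure, so all of it is written in terms of arithmetic and bitwise
operations on natural numbers, with states of 25408 binary digits.

For `lutz51`, the signs of all but 22 bases are prescribed in such a way that every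
Grassmann–Plücker relation contains terms of both signs without any of the 22 bases, and that every
five-element set has the required properties because of the prescribed signs alone. The signs of the
22 bases can then be chosen arbitrarily (`SignsBetween.isAcyclic_and_isAdmissible`), which gives `2
^ 22` oriented matroids. No two of them are opposite, since they agree on the other bases.
-/


/-! ### Complexes given by lists of triangles -/

/-- The vertex set of a listed triangle. -/
def triangleSet (p : Fin 12 × Fin 12 × Fin 12) : Finset (Fin 12) := {p.1, p.2.1, p.2.2}

/-- The finset of the triangles in a list, built in the order of the list. -/
def facetsOf : List (Fin 12 × Fin 12 × Fin 12) → Finset (Finset (Fin 12))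
  | [] => ∅
  | [p] => {triangleSet p}
  | p :: q :: l => insert (triangleSet p) (facetsOf (q :: l))

theorem mem_facetsOf {t : Finset (Fin 12)} :
    ∀ {L : List (Fin 12 × Fin 12 × Fin 12)}, t ∈ facetsOf L ↔ ∃ p ∈ L, t = triangleSet p
  | [] => by simp [facetsOf]
  | [p] => by simp [facetsOf]
  | p :: q :: l => by
    rw [facetsOf, Finset.mem_insert, mem_facetsOf (L := q :: l)]
    simp

/-- The position of an ordered triple of vertices in a bit table. -/
def tripleIndex (a b c : Fin 12) : ℕ :=
  Nat.add (Nat.mul (Nat.add (Nat.mul a.val 12) b.val) 12) c.val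

/-- The bit table with ones at the listed triples and at their cyclic rotations. -/
def cyclicTable : List (Fin 12 × Fin 12 × Fin 12) → ℕ
  | [] => 0
  | p :: l => Nat.lor (Nat.pow 2 (tripleIndex p.1 p.2.1 p.2.2))
      (Nat.lor (Nat.pow 2 (tripleIndex p.2.1 p.2.2 p.1))
        (Nat.lor (Nat.pow 2 (tripleIndex p.2.2 p.1 p.2.1)) (cyclicTable l)))

/-- Reading a bit table at an ordered triple. -/
def tableAt (n : ℕ) (a b c : Fin 12) : Bool :=
  Nat.beq (Nat.land (Nat.shiftRight n (tripleIndex a b c)) 1) 1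

theorem tripleIndex_inj {a b c a' b' c' : Fin 12} :
    tripleIndex a b c = tripleIndex a' b' c' ↔ a = a' ∧ b = b' ∧ c = c' := by
  simp only [tripleIndex, Nat.add_eq, Nat.mul_eq, Fin.ext_iff]
  omega

theorem tableAt_eq (n : ℕ) (a b c : Fin 12) :
    tableAt n a b c = n.testBit (tripleIndex a b c) := by
  have h : tableAt n a b c = (Nat.beq ((n >>> tripleIndex a b c) &&& 1) 1) := rfl
  rw [h, Nat.testBit, Nat.land_comm, Nat.one_and_eq_mod_two]
  rcases Nat.mod_two_eq_zero_or_one (n >>> tripleIndex a b c) with h | h <;> rw [h] <;> rfl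

theorem testBit_cyclicTable {a b c : Fin 12} : ∀ {L : List (Fin 12 × Fin 12 × Fin 12)},
    (cyclicTable L).testBit (tripleIndex a b c) = true ↔
      (a, b, c) ∈ L ∨ (b, c, a) ∈ L ∨ (c, a, b) ∈ L
  | [] => by simp [cyclicTable]
  | p :: l => by
    have ih := testBit_cyclicTable (a := a) (b := b) (c := c) (L := l)
    have h : cyclicTable (p :: l) = 2 ^ tripleIndex p.1 p.2.1 p.2.2 |||
      (2 ^ tripleIndex p.2.1 p.2.2 p.1 ||| (2 ^ tripleIndex p.2.2 p.1 p.2.1 ||| cyclicTable l)) :=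
      rfl
    obtain ⟨x, y, z⟩ := p
    rw [h]
    simp only [Nat.testBit_or, Nat.testBit_two_pow, Bool.or_eq_true, decide_eq_true_eq, ih,
      tripleIndex_inj, List.mem_cons, Prod.mk.injEq]
    constructor
    · rintro (⟨rfl, rfl, rfl⟩ | ⟨rfl, rfl, rfl⟩ | ⟨rfl, rfl, rfl⟩ | h | h | h) <;> simp [*]
    · rintro ((⟨rfl, rfl, rfl⟩ | h) | (⟨rfl, rfl, rfl⟩ | h) | (⟨rfl, rfl, rfl⟩ | h)) <;> simp [*]

/-- A list of triangles read as cyclically oriented: `(a, b, c)` is listed up to rotation. -/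
def cyc (L : List (Fin 12 × Fin 12 × Fin 12)) (a b c : Fin 12) : Bool :=
  tableAt (cyclicTable L) a b c

theorem cyc_iff {L : List (Fin 12 × Fin 12 × Fin 12)} {a b c : Fin 12} :
    cyc L a b c = true ↔ (a, b, c) ∈ L ∨ (b, c, a) ∈ L ∨ (c, a, b) ∈ L := by
  rw [cyc, tableAt_eq, testBit_cyclicTable]

/-- `{a, b, c}` is one of the listed triangles. -/
def tri (L : List (Fin 12 × Fin 12 × Fin 12)) (a b c : Fin 12) : Bool := cyc L a b c || cyc L b a c

theorem cyc_rotate {L : List (Fin 12 × Fin 12 × Fin 12)} {a b c : Fin 12}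
    (h : cyc L a b c = true) : cyc L b c a = true := by
  rw [cyc_iff] at *; tauto

theorem tri_iff {L : List (Fin 12 × Fin 12 × Fin 12)}
    (hL : ∀ p ∈ L, p.1 ≠ p.2.1 ∧ p.2.1 ≠ p.2.2 ∧ p.1 ≠ p.2.2)
    {a b c : Fin 12} :
    tri L a b c = true ↔ (a ≠ b ∧ b ≠ c ∧ a ≠ c) ∧
      ∃ p ∈ L, ({a, b, c} : Finset (Fin 12)) = triangleSet p := by
  simp only [tri, Bool.or_eq_true, cyc_iff]
  constructor
  · rintro ((h | h | h) | (h | h | h)) <;>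
    · have := hL _ h
      refine ⟨by grind, _, h, ?_⟩
      ext x; simp [triangleSet] <;> tauto
  · rintro ⟨⟨h1, h2, h3⟩, ⟨x, y, z⟩, hp, h⟩
    have := hL _ hp
    simp only [triangleSet, Finset.ext_iff, Finset.mem_insert, Finset.mem_singleton] at h this
    have ha := (h a).1 (by simp)
    have hb := (h b).1 (by simp)
    have hc := (h c).1 (by simp)
    rcases ha with rfl | rfl | rfl <;> rcases hb with rfl | rfl | rfl <;>
      rcases hc with rfl | rfl | rfl <;> simp_all

/-! ### Coherent orientations of the surfaces -/

/-- The list of triangles with those marked by ones of `n` reversed. -/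
def orientBy : ℕ → List (Fin 12 × Fin 12 × Fin 12) → List (Fin 12 × Fin 12 × Fin 12)
  | _, [] => []
  | n, p :: l => (bif Nat.beq (Nat.land n 1) 1 then (p.2.1, p.1, p.2.2) else p) ::
      orientBy (Nat.shiftRight n 1) l

theorem facetsOf_orientBy : ∀ (n : ℕ) (L : List (Fin 12 × Fin 12 × Fin 12)),
    facetsOf (orientBy n L) = facetsOf L
  | _, [] => rfl
  | n, [p] => by
    simp only [orientBy, facetsOf]
    cases Nat.beq (Nat.land n 1) 1
    · rfl
    · simp [triangleSet, Finset.insert_comm]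
  | n, p :: q :: l => by
    have ih := facetsOf_orientBy (Nat.shiftRight n 1) (q :: l)
    rw [orientBy] at ih ⊢
    rw [orientBy, facetsOf, facetsOf, ih]
    cases Nat.beq (Nat.land n 1) 1
    · rfl
    · simp [triangleSet, Finset.insert_comm]

/-- The triangles of `lutz11`, in the order of its definition. -/
def lutz11List : List (Fin 12 × Fin 12 × Fin 12) :=
  [(1, 2, 3), (1, 2, 12), (1, 3, 6), (1, 4, 8), (1, 4, 11), (1, 5, 9), (1, 5, 10), (1, 6, 9),
   (1, 8, 10), (1, 11, 12), (2, 3, 4), (2, 4, 7), (2, 5, 9), (2, 5, 12), (2, 6, 10), (2, 6, 11),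
   (2, 7, 10), (2, 9, 11), (3, 4, 5), (3, 5, 8), (3, 6, 10), (3, 7, 11), (3, 7, 12), (3, 8, 11),
   (3, 10, 12), (4, 5, 6), (4, 6, 9), (4, 7, 11), (4, 8, 12), (4, 9, 12), (5, 6, 7), (5, 7, 10),
   (5, 8, 12), (6, 7, 8), (6, 8, 11), (7, 8, 9), (7, 9, 12), (8, 9, 10), (9, 10, 11), (10, 11,
   12)]

/-- The triangles of `lutz11`, coherently oriented. -/
def lutz11Oriented : List (Fin 12 × Fin 12 × Fin 12) := orientBy 0xa72731ad2a lutz11List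

theorem lutz11_eq : lutz11 = complexOf (facetsOf lutz11Oriented) := by
  rw [lutz11, lutz11Oriented, facetsOf_orientBy]; rfl

/-- The triangles of `lutz12`, in the order of its definition. -/
def lutz12List : List (Fin 12 × Fin 12 × Fin 12) :=
  [(1, 2, 3), (1, 2, 12), (1, 3, 6), (1, 4, 9), (1, 4, 11), (1, 5, 8), (1, 5, 9), (1, 6, 10),
   (1, 8, 10), (1, 11, 12), (2, 3, 4), (2, 4, 7), (2, 5, 10), (2, 5, 12), (2, 6, 9), (2, 6, 10),
   (2, 7, 11), (2, 9, 11), (3, 4, 5), (3, 5, 8), (3, 6, 11), (3, 7, 10), (3, 7, 11), (3, 8, 12),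
   (3, 10, 12), (4, 5, 6), (4, 6, 9), (4, 7, 12), (4, 8, 11), (4, 8, 12), (5, 6, 7), (5, 7, 10),
   (5, 9, 12), (6, 7, 8), (6, 8, 11), (7, 8, 9), (7, 9, 12), (8, 9, 10), (9, 10, 11), (10, 11,
   12)]

/-- The triangles of `lutz12`, coherently oriented. -/
def lutz12Oriented : List (Fin 12 × Fin 12 × Fin 12) := orientBy 0xa72731ad2a lutz12List

theorem lutz12_eq : lutz12 = complexOf (facetsOf lutz12Oriented) := by
  rw [lutz12, lutz12Oriented, facetsOf_orientBy]; rfl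

/-- The triangles of `lutz16`, in the order of its definition. -/
def lutz16List : List (Fin 12 × Fin 12 × Fin 12) :=
  [(1, 2, 4), (1, 2, 6), (1, 3, 6), (1, 3, 12), (1, 4, 11), (1, 5, 9), (1, 5, 12), (1, 8, 9),
   (1, 8, 10), (1, 10, 11), (2, 3, 5), (2, 3, 7), (2, 4, 7), (2, 5, 12), (2, 6, 10), (2, 9, 10),
   (2, 9, 11), (2, 11, 12), (3, 4, 6), (3, 4, 8), (3, 5, 8), (3, 7, 11), (3, 10, 11), (3, 10,
   12), (4, 5, 7), (4, 5, 9), (4, 6, 9), (4, 8, 12), (4, 11, 12), (5, 6, 8), (5, 6, 10), (5, 7,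
   10), (6, 7, 9), (6, 7, 11), (6, 8, 11), (7, 8, 10), (7, 8, 12), (7, 9, 12), (8, 9, 11), (9,
   10, 12)]

/-- The triangles of `lutz16`, coherently oriented. -/
def lutz16Oriented : List (Fin 12 × Fin 12 × Fin 12) := orientBy 0x5555a8b72a lutz16List

theorem lutz16_eq : lutz16 = complexOf (facetsOf lutz16Oriented) := by
  rw [lutz16, lutz16Oriented, facetsOf_orientBy]; rfl

/-- The triangles of `lutz51`, in the order of its definition. -/
def lutz51List : List (Fin 12 × Fin 12 × Fin 12) :=
  [(1, 2, 11), (1, 2, 12), (1, 4, 6), (1, 4, 7), (1, 5, 9), (1, 5, 12), (1, 6, 10), (1, 7, 8),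
   (1, 8, 9), (1, 10, 11), (2, 3, 5), (2, 3, 8), (2, 5, 10), (2, 6, 9), (2, 6, 10), (2, 7, 8),
   (2, 7, 11), (2, 9, 12), (3, 4, 9), (3, 4, 10), (3, 5, 6), (3, 6, 11), (3, 7, 10), (3, 7, 11),
   (3, 8, 12), (3, 9, 12), (4, 5, 6), (4, 5, 9), (4, 7, 12), (4, 8, 11), (4, 8, 12), (4, 10,
   11), (5, 8, 10), (5, 8, 11), (5, 11, 12), (6, 7, 9), (6, 7, 12), (6, 11, 12), (7, 9, 10), (8,
   9, 10)]

/-- The triangles of `lutz51`, coherently oriented. -/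
def lutz51Oriented : List (Fin 12 × Fin 12 × Fin 12) := orientBy 0xa9358ab656 lutz51List

theorem lutz51_eq : lutz51 = complexOf (facetsOf lutz51Oriented) := by
  rw [lutz51, lutz51Oriented, facetsOf_orientBy]; rfl

/-! ### From finite conditions to triangulated surfaces -/

section
variable {L : List (Fin 12 × Fin 12 × Fin 12)}

/-- The vertex following `a` on the oriented link of `v`. -/
def linkNext (L : List (Fin 12 × Fin 12 × Fin 12)) (v a : Fin 12) : Fin 12 :=
  ((List.finRange 12).find? fun c => cyc L v a c).getD 0

/-- The `i`-th vertex on the oriented link of `v`, from a fixed starting point. -/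
def linkVertex (L : List (Fin 12 × Fin 12 × Fin 12)) (v : Fin 12) : ℕ → Fin 12
  | 0 => ((List.finRange 12).find? fun c => (List.finRange 12).any fun d => cyc L v c d).getD 0
  | i + 1 => linkNext L v (linkVertex L v i)

/-- The finitely many conditions under which a list of oriented triangles spans a triangulated
surface on sixty edges in which all vertices have degree ten. -/
structure SurfaceList (L : List (Fin 12 × Fin 12 × Fin 12)) : Prop where
  distinct : ∀ p ∈ L, p.1 ≠ p.2.1 ∧ p.2.1 ≠ p.2.2 ∧ p.1 ≠ p.2.2
  link_inj : ∀ v : Fin 12, ∀ i j : Fin 10, linkVertex L v i = linkVertex L v j → i = j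
  link_surj : ∀ v w c : Fin 12, tri L v w c = true → ∃ i : Fin 10, linkVertex L v i = w
  link_adj : ∀ v : Fin 12, ∀ i j : Fin 10,
    tri L v (linkVertex L v i) (linkVertex L v j) = decide (i - j = 1 ∨ j - i = 1)
  joined : ∀ a b : Fin 12, a = b ∨ ∃ c d e : Fin 12, tri L a c d = true ∧ tri L c b e = true
  oriented : ∀ a b c d : Fin 12, cyc L a b c = true →
    (cyc L b a c = false ∧ (cyc L a b d = true → c = d))
  card_edges : (Finset.univ.filter fun p : Fin 12 × Fin 12 =>
    p.1 < p.2 ∧ ∃ c, tri L p.1 p.2 c = true).card = 60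
  card_triangles : (Finset.univ.filter fun p : Fin 12 × Fin 12 × Fin 12 =>
    p.1 < p.2.1 ∧ p.2.1 < p.2.2 ∧ tri L p.1 p.2.1 p.2.2 = true).card = 40

theorem mem_complexOf {V : Type*} {T : Finset (Finset V)} {s : Finset V} :
    s ∈ complexOf T ↔ s.Nonempty ∧ ((∃ v, s = {v}) ∨ ∃ t ∈ T, s ⊆ t) := Iff.rfl

theorem card_triangleSet_le (p : Fin 12 × Fin 12 × Fin 12) : (triangleSet p).card ≤ 3 :=
  Finset.card_le_three

theorem triple_mem (h : SurfaceList L) {a b c : Fin 12} :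
    ((a ≠ b ∧ b ≠ c ∧ a ≠ c) ∧ ({a, b, c} : Finset (Fin 12)) ∈ complexOf (facetsOf L)) ↔
      tri L a b c = true := by
  rw [tri_iff h.distinct]
  refine and_congr_right fun hd => ?_
  have hcard : ({a, b, c} : Finset (Fin 12)).card = 3 :=
    Finset.card_eq_three.2 ⟨a, b, c, hd.1, hd.2.2, hd.2.1, rfl⟩
  rw [mem_complexOf]
  constructor
  · rintro ⟨-, ⟨v, hv⟩ | ⟨t, ht, hst⟩⟩
    · rw [hv] at hcard; simp at hcard
    · obtain ⟨p, hp, rfl⟩ := mem_facetsOf.1 ht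
      exact ⟨p, hp, Finset.eq_of_subset_of_card_le hst (by rw [hcard]; exact card_triangleSet_le p)⟩
  · rintro ⟨p, hp, h⟩
    exact ⟨by simp, Or.inr ⟨_, mem_facetsOf.2 ⟨p, hp, rfl⟩, h.le⟩⟩

theorem adj_iff (h : SurfaceList L) {a b : Fin 12} :
    (complexOf (facetsOf L)).edgeGraph.Adj a b ↔ ∃ c, tri L a b c = true := by
  constructor
  · rintro ⟨hab, hm⟩
    rw [mem_complexOf] at hm
    obtain ⟨-, ⟨v, hv⟩ | ⟨t, ht, hst⟩⟩ := hm
    · exact absurd (by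
        have ha : a ∈ ({v} : Finset (Fin 12)) := hv ▸ by simp
        have hb : b ∈ ({v} : Finset (Fin 12)) := hv ▸ by simp
        rw [Finset.mem_singleton] at ha hb; rw [ha, hb]) hab
    · obtain ⟨p, hp, rfl⟩ := mem_facetsOf.1 ht
      have hd := h.distinct p hp
      obtain ⟨x, y, z⟩ := p
      have ha : a ∈ triangleSet (x, y, z) := hst (by simp)
      have hb : b ∈ triangleSet (x, y, z) := hst (by simp)
      simp only [triangleSet, Finset.mem_insert, Finset.mem_singleton] at ha hb hd
      simp only [tri, Bool.or_eq_true, cyc_iff]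
      rcases ha with rfl | rfl | rfl <;> rcases hb with rfl | rfl | rfl <;>
        first
          | exact absurd rfl hab
          | exact ⟨_, Or.inl (Or.inl hp)⟩
          | exact ⟨_, Or.inl (Or.inr (Or.inl hp))⟩
          | exact ⟨_, Or.inl (Or.inr (Or.inr hp))⟩
          | exact ⟨_, Or.inr (Or.inl hp)⟩
          | exact ⟨_, Or.inr (Or.inr (Or.inl hp))⟩
          | exact ⟨_, Or.inr (Or.inr (Or.inr hp))⟩
  · rintro ⟨c, hc⟩
    have := (triple_mem h).2 hc
    have hm := mem_complexOf.1 this.2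
    refine ⟨this.1.1, mem_complexOf.2 ⟨by simp, ?_⟩⟩
    have hs : ({a, b} : Finset (Fin 12)) ⊆ {a, b, c} := by
      intro x; simp only [Finset.mem_insert, Finset.mem_singleton]; tauto
    obtain ⟨-, ⟨v, hv⟩ | ⟨t, ht, hst⟩⟩ := hm
    · exact Or.inl ⟨a, by
        have ha : a ∈ ({v} : Finset (Fin 12)) := hv ▸ by simp
        have hb : b ∈ ({v} : Finset (Fin 12)) := hv ▸ by simp
        rw [Finset.mem_singleton] at ha hb; rw [ha, hb]; simp⟩
    · exact Or.inr ⟨t, ht, hs.trans hst⟩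

theorem isTriangulatedSurface_of_surfaceList (h : SurfaceList L) :
    (complexOf (facetsOf L)).IsTriangulatedSurface 5 where
  card_le := by
    intro s hs
    obtain ⟨-, ⟨v, rfl⟩ | ⟨t, ht, hst⟩⟩ := mem_complexOf.1 hs
    · simp
    · obtain ⟨p, hp, rfl⟩ := mem_facetsOf.1 ht
      exact (Finset.card_le_card hst).trans (card_triangleSet_le p)
  link_cycle := by
    intro v
    have hadj : ∀ i : Fin 10, (complexOf (facetsOf L)).edgeGraph.Adj v (linkVertex L v i) := by
      intro i
      rw [adj_iff h]
      refine ⟨linkVertex L v (i + 1 : Fin 10), ?_⟩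
      rw [h.link_adj]; simp
    let φ : Fin 10 → {w : Fin 12 // (complexOf (facetsOf L)).edgeGraph.Adj v w} :=
      fun i => ⟨linkVertex L v i, hadj i⟩
    have hφ : Function.Bijective φ := by
      constructor
      · intro i j hij
        exact h.link_inj v i j (congrArg Subtype.val hij)
      · rintro ⟨w, hw⟩
        obtain ⟨c, hc⟩ := (adj_iff h).1 hw
        obtain ⟨i, hi⟩ := h.link_surj v w c hc
        exact ⟨i, Subtype.ext hi⟩
    refine ⟨10, by norm_num, ⟨RelIso.symm ⟨Equiv.ofBijective φ hφ, ?_⟩⟩⟩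
    intro i j
    have h1 : (SimpleGraph.cycleGraph 10).Adj i j ↔ (i - j = 1 ∨ j - i = 1) :=
      SimpleGraph.cycleGraph_adj
    have h2 := h.link_adj v i j
    rw [h1, ← decide_eq_true_iff (p := i - j = 1 ∨ j - i = 1), ← h2, ← triple_mem h]
    have h3 := (hadj i).ne
    have h4 := (hadj j).ne
    constructor
    · rintro ⟨hij, hm⟩
      exact ⟨⟨h3, fun e => hij (Subtype.ext e), h4⟩, hm⟩
    · rintro ⟨hd, hm⟩
      exact ⟨fun e => hd.2.1 (congrArg Subtype.val e), hm⟩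
  connected := by
    refine ⟨fun a b => ?_⟩
    rcases h.joined a b with rfl | ⟨c, d, e, h1, h2⟩
    · exact SimpleGraph.Reachable.refl _
    · exact ((adj_iff h).2 ⟨d, h1⟩).reachable.trans ((adj_iff h).2 ⟨e, h2⟩).reachable
  orientable := by
    refine ⟨fun a b c => cyc L a b c = true, fun a b c => cyc_rotate, ?_, ?_, ?_⟩
    · intro a b c hm h1 h2 h3
      have ht := (triple_mem h).1 ⟨⟨h1, h2, h3⟩, hm⟩
      rw [tri, Bool.or_eq_true] at ht
      rcases ht with ht | ht
      · exact Or.inl ⟨ht, by simp [(h.oriented a b c 0 ht).1]⟩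
      · exact Or.inr ⟨ht, by simp [(h.oriented b a c 0 ht).1]⟩
    · intro a b c ht
      exact ((triple_mem h).2 (by rw [tri, ht]; rfl)).symm
    · intro a b c d h1 h2
      exact (h.oriented a b c d h1).2 h2
  euler := by
    have e1 : (complexOf (facetsOf L)).numFaces 1 = 12 := by
      have : {s : Finset (Fin 12) | s ∈ complexOf (facetsOf L) ∧ s.card = 1} =
          Set.range (fun v : Fin 12 => ({v} : Finset (Fin 12))) := by
        ext s
        simp only [Set.mem_ofPred_eq, Set.mem_range, Finset.card_eq_one]
        constructor
        · rintro ⟨-, v, rfl⟩; exact ⟨v, rfl⟩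
        · rintro ⟨v, rfl⟩; exact ⟨(complexOf (facetsOf L)).singleton_mem v, v, rfl⟩
      rw [AbstractSimplicialComplex.numFaces, this, ← Set.image_univ,
        Set.ncard_image_of_injective _ Finset.singleton_injective, Set.ncard_univ]
      simp
    have e2 : (complexOf (facetsOf L)).numFaces 2 = 60 := by
      have : {s : Finset (Fin 12) | s ∈ complexOf (facetsOf L) ∧ s.card = 2} =
          (fun p : Fin 12 × Fin 12 => ({p.1, p.2} : Finset (Fin 12))) ''
            (Finset.univ.filter fun p : Fin 12 × Fin 12 =>
              p.1 < p.2 ∧ ∃ c, tri L p.1 p.2 c = true : Finset (Fin 12 × Fin 12)) := by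
        ext s
        simp only [Set.mem_ofPred_eq, Set.mem_image, Finset.coe_filter, Finset.mem_univ, true_and,
          Prod.exists]
        constructor
        · rintro ⟨hm, hc⟩
          obtain ⟨a, b, hab, rfl⟩ := Finset.card_eq_two.1 hc
          rcases lt_or_gt_of_ne hab with hlt | hlt
          · exact ⟨a, b, ⟨hlt, (adj_iff h).1 ⟨hab, hm⟩⟩, rfl⟩
          · exact ⟨b, a, ⟨hlt, (adj_iff h).1 ⟨hab.symm, by rwa [Finset.pair_comm]⟩⟩,
              Finset.pair_comm _ _⟩
        · rintro ⟨a, b, ⟨hlt, hc⟩, rfl⟩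
          exact ⟨((adj_iff h).2 hc).2, Finset.card_pair hlt.ne⟩
      rw [AbstractSimplicialComplex.numFaces, this, Set.InjOn.ncard_image,
        Set.ncard_coe_finset, h.card_edges]
      rintro ⟨a, b⟩ hp ⟨a', b'⟩ hp' he
      simp only [Finset.coe_filter, Finset.mem_univ, true_and, Set.mem_ofPred_eq] at hp hp'
      simp only [Finset.ext_iff, Finset.mem_insert, Finset.mem_singleton] at he
      have q1 := (he a).1 (by simp)
      have q2 := (he b).1 (by simp)
      have q3 := (he a').2 (by simp)
      have := hp.1; have := hp'.1
      simp only [Prod.mk.injEq]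
      constructor <;> omega
    have e3 : (complexOf (facetsOf L)).numFaces 3 = 40 := by
      have : {s : Finset (Fin 12) | s ∈ complexOf (facetsOf L) ∧ s.card = 3} =
          triangleSet '' (Finset.univ.filter fun p : Fin 12 × Fin 12 × Fin 12 =>
            p.1 < p.2.1 ∧ p.2.1 < p.2.2 ∧ tri L p.1 p.2.1 p.2.2 = true :
              Finset (Fin 12 × Fin 12 × Fin 12)) := by
        ext s
        simp only [Set.mem_ofPred_eq, Set.mem_image, Finset.coe_filter, Finset.mem_univ, true_and,
          Prod.exists]
        constructor
        · rintro ⟨hm, hc⟩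
          let g := s.orderEmbOfFin hc
          have hg : s = {g 0, g 1, g 2} := by
            have := Finset.image_orderEmbOfFin_univ s hc
            ext x
            rw [← this, Finset.mem_image]
            simp only [Finset.mem_univ, true_and, Fin.exists_fin_succ, Fin.exists_fin_zero,
              or_false,
              Finset.mem_insert, Finset.mem_singleton, g, eq_comm (a := x)]
            rfl
          have l1 : g 0 < g 1 := g.strictMono (by decide)
          have l2 : g 1 < g 2 := g.strictMono (by decide)
          exact ⟨g 0, g 1, g 2, ⟨l1, l2, (triple_mem h).1
            ⟨⟨l1.ne, l2.ne, (l1.trans l2).ne⟩, hg ▸ hm⟩⟩, hg.symm⟩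
        · rintro ⟨a, b, c, ⟨h1, h2, ht⟩, rfl⟩
          exact ⟨((triple_mem h).2 ht).2,
            Finset.card_eq_three.2 ⟨a, b, c, h1.ne, (h1.trans h2).ne, h2.ne, rfl⟩⟩
      rw [AbstractSimplicialComplex.numFaces, this, Set.InjOn.ncard_image,
        Set.ncard_coe_finset, h.card_triangles]
      rintro ⟨a, b, c⟩ hp ⟨a', b', c'⟩ hp' he
      simp only [Finset.coe_filter, Finset.mem_univ, true_and, Set.mem_ofPred_eq] at hp hp'
      simp only [triangleSet, Finset.ext_iff, Finset.mem_insert, Finset.mem_singleton] at he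
      have q1 := (he a).1 (by simp)
      have q2 := (he b).1 (by simp)
      have q3 := (he c).1 (by simp)
      have q4 := (he a').2 (by simp)
      have q5 := (he b').2 (by simp)
      have q6 := (he c').2 (by simp)
      have := hp.1; have := hp.2.1; have := hp'.1; have := hp'.2.1
      simp only [Prod.mk.injEq]
      refine ⟨?_, ?_, ?_⟩ <;> omega
    rw [e1, e2, e3]; norm_num
end

/-! ### Evaluating the conditions, and telling the surfaces apart -/

/-- Bounded universal quantification over the natural numbers below `n`, by recursion. -/
def allBelow (n : ℕ) (p : ℕ → Bool) : Bool :=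
  Nat.rec true (fun k ih => Bool.rec false ih (p k)) n

theorem allBelow_iff {n : ℕ} {p : ℕ → Bool} : allBelow n p = true ↔ ∀ k < n, p k = true := by
  induction n with
  | zero => simp [allBelow]
  | succ n ih =>
    have h : allBelow (n + 1) p = Bool.rec false (allBelow n p) (p n) := rfl
    rw [h]
    constructor
    · intro h k hk
      rcases hp : p n with _ | _
      · rw [hp] at h; exact absurd h (by simp)
      · rw [hp] at h
        rcases Nat.lt_succ_iff_lt_or_eq.1 hk with hk | rfl
        · exact ih.1 h k hk
        · exact hp
    · intro h
      rw [h n n.lt_succ_self]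
      exact ih.2 fun k hk => h k (hk.trans n.lt_succ_self)

/-- The sum of the values of `f` below `n`, by recursion. -/
def sumBelow (n : ℕ) (f : ℕ → ℕ) : ℕ := Nat.rec 0 (fun k ih => Nat.add ih (f k)) n

theorem sumBelow_eq (n : ℕ) (f : ℕ → ℕ) : sumBelow n f = ∑ k ∈ Finset.range n, f k := by
  induction n with
  | zero => rfl
  | succ n ih => rw [Finset.sum_range_succ, ← ih]; rfl

/-- Reading a table of ordered triples at natural numbers. -/
def tableBit (n a b c : ℕ) : Bool :=
  Nat.beq (Nat.land (Nat.shiftRight n (Nat.add (Nat.mul (Nat.add (Nat.mul a 12) b) 12) c)) 1) 1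

theorem cyc_eq (L : List (Fin 12 × Fin 12 × Fin 12)) (a b c : Fin 12) :
    cyc L a b c = tableBit (cyclicTable L) a b c := rfl

/-- The function `tri` on natural numbers, read from a bit table. -/
def triBit (n a b c : ℕ) : Bool := Bool.rec (tableBit n b a c) true (tableBit n a b c)

/-- Bounded existential quantification over the natural numbers below `n`, by recursion. -/
def anyBelow (n : ℕ) (p : ℕ → Bool) : Bool := Nat.rec false (fun k ih => Bool.rec ih true (p k)) n

theorem anyBelow_iff {n : ℕ} {p : ℕ → Bool} : anyBelow n p = true ↔ ∃ k < n, p k = true := by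
  induction n with
  | zero => simp [anyBelow]
  | succ n ih =>
    have h : anyBelow (n + 1) p = Bool.rec (anyBelow n p) true (p n) := rfl
    rw [h]
    rcases hp : p n with _ | _
    · refine ih.trans ⟨fun ⟨k, hk, h⟩ => ⟨k, hk.trans n.lt_succ_self, h⟩, fun ⟨k, hk, hk'⟩ => ?_⟩
      rcases Nat.lt_succ_iff_lt_or_eq.1 hk with hk | rfl
      · exact ⟨k, hk, hk'⟩
      · rw [hp] at hk'; exact absurd hk' (by simp)
    · exact ⟨fun _ => ⟨n, n.lt_succ_self, hp⟩, fun _ => rfl⟩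

theorem tri_eq (L : List (Fin 12 × Fin 12 × Fin 12)) (a b c : Fin 12) :
    tri L a b c = triBit (cyclicTable L) a b c := by
  rw [tri, cyc_eq, cyc_eq, triBit]
  cases tableBit (cyclicTable L) a b c <;> rfl

/-- The listed triples have distinct entries, and every ordered edge is in at most one of them. -/
def orientedCheck (n : ℕ) : Bool :=
  allBelow 12 fun a => allBelow 12 fun b => allBelow 12 fun c => Bool.rec true
    (!Nat.beq a b && !Nat.beq b c && !Nat.beq a c && !tableBit n b a c &&
      allBelow 12 fun d => Bool.rec true (Nat.beq c d) (tableBit n a b d)) (tableBit n a b c)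

/-- Any two vertices have a common neighbour. -/
def joinedCheck (n : ℕ) : Bool :=
  allBelow 12 fun a => allBelow 12 fun b => Nat.beq a b || anyBelow 12 fun c =>
    anyBelow 12 (fun d => triBit n a c d) && anyBelow 12 (fun e => triBit n c b e)

/-- The number of edges. -/
def edgeCount (n : ℕ) : ℕ :=
  sumBelow 12 fun a => sumBelow 12 fun b => Bool.rec 0 1
    (Nat.ble (Nat.succ a) b && anyBelow 12 fun c => triBit n a b c)

/-- The number of triangles. -/
def triangleCount (n : ℕ) : ℕ :=
  sumBelow 12 fun a => sumBelow 12 fun b => sumBelow 12 fun c => Bool.rec 0 1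
    (Nat.ble (Nat.succ a) b && Nat.ble (Nat.succ b) c && triBit n a b c)

/-- All conditions of `SurfaceList` but those on the links, evaluated on the bit table. -/
def surfaceCheck (n : ℕ) : Bool :=
  orientedCheck n && joinedCheck n && Nat.beq (edgeCount n) 60 && Nat.beq (triangleCount n) 40

theorem boolRec_eq_ite (b : Bool) : (Bool.rec 0 1 b : ℕ) = if b = true then 1 else 0 := by
  cases b <;> rfl

theorem surfaceList_of_check {L : List (Fin 12 × Fin 12 × Fin 12)}
    (h : surfaceCheck (cyclicTable L) = true)
    (h1 : ∀ v : Fin 12, ∀ i j : Fin 10, linkVertex L v i = linkVertex L v j → i = j)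
    (h2 : ∀ v w c : Fin 12, tri L v w c = true → ∃ i : Fin 10, linkVertex L v i = w)
    (h3 : ∀ v : Fin 12, ∀ i j : Fin 10,
      tri L v (linkVertex L v i) (linkVertex L v j) = decide (i - j = 1 ∨ j - i = 1)) :
    SurfaceList L := by
  simp only [surfaceCheck, Bool.and_eq_true, Nat.beq_eq] at h
  obtain ⟨⟨⟨ho, hj⟩, he⟩, ht⟩ := h
  have key : ∀ a b c : Fin 12, cyc L a b c = true → (a ≠ b ∧ b ≠ c ∧ a ≠ c) ∧
      cyc L b a c = false ∧ ∀ d, cyc L a b d = true → c = d := by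
    intro a b c habc
    have := allBelow_iff.1 (allBelow_iff.1 (allBelow_iff.1 ho a a.2) b b.2) c c.2
    rw [cyc_eq] at habc
    rw [habc] at this
    simp only [Bool.and_eq_true, Bool.not_eq_true', allBelow_iff] at this
    obtain ⟨⟨⟨⟨q1, q2⟩, q3⟩, q4⟩, q5⟩ := this
    have hb : ∀ x y : Fin 12, Nat.beq x y = false → x ≠ y := by
      rintro x y h rfl
      rw [Nat.beq_refl] at h; exact absurd h (by simp)
    refine ⟨⟨hb _ _ q1, hb _ _ q2, hb _ _ q3⟩, q4, fun d hd => ?_⟩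
    have := q5 d d.2
    rw [cyc_eq] at hd
    rw [hd] at this
    exact Fin.ext (Nat.eq_of_beq_eq_true this)
  refine ⟨?_, h1, h2, h3, ?_, fun a b c d h => ⟨(key a b c h).2.1, (key a b c h).2.2 d⟩, ?_, ?_⟩
  · rintro ⟨a, b, c⟩ hp
    exact (key a b c (cyc_iff.2 (Or.inl hp))).1
  · intro a b
    have := allBelow_iff.1 (allBelow_iff.1 hj a a.2) b b.2
    simp only [Bool.or_eq_true, Bool.and_eq_true, anyBelow_iff] at this
    rcases this with h | ⟨c, hc, ⟨d, hd, h4⟩, e, he, h5⟩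
    · exact Or.inl (Fin.ext (Nat.eq_of_beq_eq_true h))
    · exact Or.inr ⟨⟨c, hc⟩, ⟨d, hd⟩, ⟨e, he⟩, by rw [tri_eq]; exact h4, by rw [tri_eq]; exact h5⟩
  · rw [← he, Finset.card_filter, Fintype.sum_prod_type]
    simp only [edgeCount, sumBelow_eq, boolRec_eq_ite, Finset.sum_range]
    refine Finset.sum_congr rfl fun a _ => Finset.sum_congr rfl fun b _ => ?_
    refine if_congr ?_ rfl rfl
    rw [Bool.and_eq_true, anyBelow_iff, Nat.ble_eq]
    refine and_congr Iff.rfl ⟨fun ⟨c, h⟩ => ⟨c, c.2, by rwa [← tri_eq]⟩,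
      fun ⟨c, hc, h⟩ => ⟨⟨c, hc⟩, by rwa [tri_eq]⟩⟩
  · rw [← ht, Finset.card_filter, Fintype.sum_prod_type]
    simp only [triangleCount, sumBelow_eq, boolRec_eq_ite, Finset.sum_range, Fintype.sum_prod_type]
    refine Finset.sum_congr rfl fun a _ => Finset.sum_congr rfl fun b _ =>
      Finset.sum_congr rfl fun c _ => ?_
    refine if_congr ?_ rfl rfl
    rw [Bool.and_eq_true, Bool.and_eq_true, Nat.ble_eq, Nat.ble_eq, tri_eq, and_assoc]
    exact Iff.rfl

theorem surfaceList_lutz11 : SurfaceList lutz11Oriented :=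
  surfaceList_of_check (by decide +kernel) (by decide +kernel) (by decide +kernel)
    (by decide +kernel)

theorem surfaceList_lutz12 : SurfaceList lutz12Oriented :=
  surfaceList_of_check (by decide +kernel) (by decide +kernel) (by decide +kernel)
    (by decide +kernel)

theorem surfaceList_lutz16 : SurfaceList lutz16Oriented :=
  surfaceList_of_check (by decide +kernel) (by decide +kernel) (by decide +kernel)
    (by decide +kernel)

theorem surfaceList_lutz51 : SurfaceList lutz51Oriented :=
  surfaceList_of_check (by decide +kernel) (by decide +kernel) (by decide +kernel)
    (by decide +kernel)

/-- The number of strips `abc, bcd` of two triangles whose end vertices `a`, `d` are not joined. -/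
def openStrips2 (t : Fin 12 → Fin 12 → Fin 12 → Bool) : ℕ :=
  ∑ a, ∑ b, ∑ c, bif t a b c then ∑ d, bif t b c d && !decide (∃ x, t a d x = true) &&
      !decide (a = d)
    then 1 else 0 else 0

/-- The number of strips `abc, bcd, cde, def` of four triangles, consecutive ones distinct, whose
end vertices `a`, `f` are not joined. -/
def openStrips4 (t : Fin 12 → Fin 12 → Fin 12 → Bool) : ℕ :=
  ∑ a, ∑ b, ∑ c, bif t a b c then ∑ d, bif t b c d && !decide (a = d) then
    ∑ e, bif t c d e && !decide (b = e) then
      ∑ f, bif t d e f && !decide (c = f) && !decide (∃ x, t a f x = true) then 1 else 0 else 0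
    else 0 else 0

theorem openStrips2_congr (t : Fin 12 → Fin 12 → Fin 12 → Bool) (e : Fin 12 ≃ Fin 12) :
    openStrips2 (fun a b c => t (e a) (e b) (e c)) = openStrips2 t := by
  have hx : ∀ a d, (∃ x, t (e a) (e d) (e x) = true) ↔ ∃ x, t (e a) (e d) x = true := fun a d =>
    ⟨fun ⟨x, h⟩ => ⟨_, h⟩, fun ⟨x, h⟩ => ⟨e.symm x, by simpa using h⟩⟩
  unfold openStrips2
  conv_rhs => rw [← e.sum_comp]
  refine Finset.sum_congr rfl fun a _ => ?_
  conv_rhs => rw [← e.sum_comp]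
  refine Finset.sum_congr rfl fun b _ => ?_
  conv_rhs => rw [← e.sum_comp]
  refine Finset.sum_congr rfl fun c _ => ?_
  congr 1
  conv_rhs => rw [← e.sum_comp]
  refine Finset.sum_congr rfl fun d _ => ?_
  simp only [hx, e.injective.eq_iff]

theorem openStrips4_congr (t : Fin 12 → Fin 12 → Fin 12 → Bool) (e : Fin 12 ≃ Fin 12) :
    openStrips4 (fun a b c => t (e a) (e b) (e c)) = openStrips4 t := by
  have hx : ∀ a d, (∃ x, t (e a) (e d) (e x) = true) ↔ ∃ x, t (e a) (e d) x = true := fun a d =>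
    ⟨fun ⟨x, h⟩ => ⟨_, h⟩, fun ⟨x, h⟩ => ⟨e.symm x, by simpa using h⟩⟩
  have hd : ∀ a d : Fin 12, decide (e a = e d) = decide (a = d) := fun a d => by
    simp only [e.injective.eq_iff]
  unfold openStrips4
  conv_rhs => rw [← e.sum_comp]
  refine Finset.sum_congr rfl fun a _ => ?_
  conv_rhs => rw [← e.sum_comp]
  refine Finset.sum_congr rfl fun b _ => ?_
  conv_rhs => rw [← e.sum_comp]
  refine Finset.sum_congr rfl fun c _ => ?_
  congr 1
  conv_rhs => rw [← e.sum_comp]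
  refine Finset.sum_congr rfl fun d _ => ?_
  rw [hd]; congr 1
  conv_rhs => rw [← e.sum_comp]
  refine Finset.sum_congr rfl fun g _ => ?_
  rw [hd]; congr 1
  conv_rhs => rw [← e.sum_comp]
  refine Finset.sum_congr rfl fun f _ => ?_
  simp only [hx, hd]

theorem exists_equiv_of_isIsomorphic {L L' : List (Fin 12 × Fin 12 × Fin 12)} (h : SurfaceList L)
    (h' : SurfaceList L')
    (hi : (complexOf (facetsOf L)).IsIsomorphic (complexOf (facetsOf L'))) :
    ∃ e : Fin 12 ≃ Fin 12, tri L = fun a b c => tri L' (e a) (e b) (e c) := by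
  obtain ⟨e, he⟩ := hi
  refine ⟨e, ?_⟩
  funext a b c
  rw [Bool.eq_iff_iff, ← triple_mem h, ← triple_mem h', he]
  simp [Finset.map_insert, e.injective.ne_iff]

theorem openStrips_lutz11 : openStrips2 (tri lutz11Oriented) = 48 ∧
    openStrips4 (tri lutz11Oriented) = 48 := by
  decide +kernel
theorem openStrips_lutz12 : openStrips2 (tri lutz12Oriented) = 0 ∧
    openStrips4 (tri lutz12Oriented) = 72 := by
  decide +kernel
theorem openStrips_lutz16 : openStrips2 (tri lutz16Oriented) = 48 ∧
    openStrips4 (tri lutz16Oriented) = 72 := by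
  decide +kernel

theorem not_isIsomorphic_lutz : ¬ lutz11.IsIsomorphic lutz12 ∧ ¬ lutz11.IsIsomorphic lutz16 ∧
    ¬ lutz12.IsIsomorphic lutz16 := by
  rw [lutz11_eq, lutz12_eq, lutz16_eq]
  refine ⟨fun h => ?_, fun h => ?_, fun h => ?_⟩
  · obtain ⟨e, he⟩ := exists_equiv_of_isIsomorphic surfaceList_lutz11 surfaceList_lutz12 h
    have := openStrips_lutz11.1
    rw [he, openStrips2_congr, openStrips_lutz12.1] at this
    exact absurd this (by decide)
  · obtain ⟨e, he⟩ := exists_equiv_of_isIsomorphic surfaceList_lutz11 surfaceList_lutz16 h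
    have := openStrips_lutz11.2
    rw [he, openStrips4_congr, openStrips_lutz16.2] at this
    exact absurd this (by decide)
  · obtain ⟨e, he⟩ := exists_equiv_of_isIsomorphic surfaceList_lutz12 surfaceList_lutz16 h
    have := openStrips_lutz12.1
    rw [he, openStrips2_congr, openStrips_lutz16.1] at this
    exact absurd this (by decide)

/-! ### Oriented matroids of vector configurations -/

/-- Cramer's rule as a linear dependency: five vectors of a four-dimensional space, weighted by the
signed determinants of the complementary four, sum to zero. -/
theorem sum_neg_one_pow_mul_det_smul {R : Type*} [CommRing R] (y : Fin 5 → Fin 4 → R) :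
    ∑ i : Fin 5, ((-1) ^ (i : ℕ) * Matrix.det (Matrix.of (y ∘ i.succAbove))) • y i = 0 := by
  funext j
  let A : Matrix (Fin 5) (Fin 5) R := Matrix.of fun i => Fin.cons (y i j) (y i)
  have h0 : A.det = 0 := Matrix.det_zero_of_column_eq (i := 0) (j := j.succ)
    (Fin.succ_ne_zero j).symm fun i => by simp [A]
  rw [Matrix.det_succ_column_zero] at h0
  rw [Finset.sum_apply, Pi.zero_apply, ← h0]
  refine Finset.sum_congr rfl fun i _ => ?_
  have : A.submatrix i.succAbove Fin.succ = Matrix.of (y ∘ i.succAbove) := by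
    ext k l; simp [A]
  rw [this]
  simp only [Pi.smul_apply, smul_eq_mul, A, Matrix.of_apply, Fin.cons_zero]
  ring

/-- The three-term Grassmann–Plücker identity. -/
theorem det_grassmannPluecker {R : Type*} [CommRing R] (a b x1 x2 x3 x4 : Fin 4 → R) :
    Matrix.det (Matrix.of ![a, b, x1, x2]) * Matrix.det (Matrix.of ![a, b, x3, x4]) -
      Matrix.det (Matrix.of ![a, b, x1, x3]) * Matrix.det (Matrix.of ![a, b, x2, x4]) +
      Matrix.det (Matrix.of ![a, b, x1, x4]) * Matrix.det (Matrix.of ![a, b, x2, x3]) = 0 := by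
  let φ : (Fin 4 → R) →ₗ[R] R :=
    (Matrix.detRowAlternating (n := Fin 4) (R := R)).toMultilinearMap.toLinearMap ![a, b, x1, 0] 3
  have hφ : ∀ z, φ z = Matrix.det (Matrix.of ![a, b, x1, z]) := by
    intro z
    have : Function.update ![a, b, x1, 0] 3 z = ![a, b, x1, z] := by
      funext i; fin_cases i <;> rfl
    simp only [φ, MultilinearMap.toLinearMap_apply, this]
    rfl
  have h := congrArg φ (sum_neg_one_pow_mul_det_smul ![a, b, x2, x3, x4])
  have e0 : ![a, b, x2, x3, x4] ∘ (0 : Fin 5).succAbove = ![b, x2, x3, x4] := by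
    funext i; fin_cases i <;> rfl
  have e1 : ![a, b, x2, x3, x4] ∘ (1 : Fin 5).succAbove = ![a, x2, x3, x4] := by
    funext i; fin_cases i <;> rfl
  have e2 : ![a, b, x2, x3, x4] ∘ (2 : Fin 5).succAbove = ![a, b, x3, x4] := by
    funext i; fin_cases i <;> rfl
  have e3 : ![a, b, x2, x3, x4] ∘ (3 : Fin 5).succAbove = ![a, b, x2, x4] := by
    funext i; fin_cases i <;> rfl
  have e4 : ![a, b, x2, x3, x4] ∘ (4 : Fin 5).succAbove = ![a, b, x2, x3] := by
    funext i; fin_cases i <;> rfl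
  have ha : Matrix.det (Matrix.of ![a, b, x1, a]) = 0 :=
    Matrix.det_zero_of_row_eq (i := 0) (j := 3) (by decide) rfl
  have hb : Matrix.det (Matrix.of ![a, b, x1, b]) = 0 :=
    Matrix.det_zero_of_row_eq (i := 1) (j := 3) (by decide) rfl
  rw [map_sum, map_zero] at h
  simp only [map_smul] at h
  simp only [hφ, Fin.sum_univ_five, e0, e1, e2, e3, e4, smul_eq_mul, Matrix.cons_val, ha, hb] at h
  norm_num at h
  linear_combination h

/-- The chirotope of a configuration of vectors in general position. -/
noncomputable def UniformOrientedMatroid.ofVectors {E : Type*} (y : E → Fin 4 → ℝ)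
    (hy : ∀ v : Fin 4 → E, Function.Injective v → Matrix.det (Matrix.of (y ∘ v)) ≠ 0) :
    UniformOrientedMatroid E where
  χ v := (SignType.sign (Matrix.det (Matrix.of (y ∘ v))) : ℤ)
  eq_zero v hv := by
    simp only [Function.Injective, not_forall] at hv
    obtain ⟨i, j, hij, hne⟩ := hv
    rw [Matrix.det_zero_of_row_eq hne (by funext k; simp [hij])]
    simp
  eq_one_or v hv := by
    rcases lt_or_gt_of_ne (hy v hv) with h | h
    · right; rw [sign_neg h]; rfl
    · left; rw [sign_pos h]; rfl
  alternating v π := by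
    have h : Matrix.of (y ∘ (v ∘ π)) = (Matrix.of (y ∘ v)).submatrix π id := rfl
    rw [h, Matrix.det_permute]
    rcases Int.units_eq_one_or (Equiv.Perm.sign π) with hs | hs <;> rw [hs] <;>
      simp [Left.sign_neg]
  grassmannPluecker a b x1 x2 x3 x4 hinj := by
    have hc : ∀ p q r s : E, y ∘ ![p, q, r, s] = ![y p, y q, y r, y s] := by
      intro p q r s; funext i; fin_cases i <;> rfl
    have hne : ∀ i j : Fin 6, i ≠ j → (i ≠ 0 ∧ i ≠ 1 ∧ j ≠ 0 ∧ j ≠ 1) →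
        Matrix.det (Matrix.of ![y a, y b, y (![a, b, x1, x2, x3, x4] i),
          y (![a, b, x1, x2, x3, x4] j)]) ≠ 0 := by
      intro i j hij hh
      have := hy (![a, b, x1, x2, x3, x4] ∘ ![0, 1, i, j]) (hinj.comp (by
        intro k l; fin_cases k <;> fin_cases l <;> simp [hij, hij.symm, hh, hh.1.symm,
          hh.2.1.symm, hh.2.2.1.symm, hh.2.2.2.symm]))
      rw [show y ∘ (![a, b, x1, x2, x3, x4] ∘ ![0, 1, i, j]) =
        ![y a, y b, y (![a, b, x1, x2, x3, x4] i), y (![a, b, x1, x2, x3, x4] j)] by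
        funext k; fin_cases k <;> rfl] at this
      exact this
    have h12 := hne 2 3 (by decide) (by decide)
    have h34 := hne 4 5 (by decide) (by decide)
    have h13 := hne 2 4 (by decide) (by decide)
    have h24 := hne 3 5 (by decide) (by decide)
    have h14 := hne 2 5 (by decide) (by decide)
    have h23 := hne 3 4 (by decide) (by decide)
    simp only [Matrix.cons_val] at h12 h34 h13 h24 h14 h23
    have hgp := det_grassmannPluecker (y a) (y b) (y x1) (y x2) (y x3) (y x4)
    simp only [hc]
    generalize Matrix.det (Matrix.of ![y a, y b, y x1, y x2]) = d12 at *
    generalize Matrix.det (Matrix.of ![y a, y b, y x3, y x4]) = d34 at *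
    generalize Matrix.det (Matrix.of ![y a, y b, y x1, y x3]) = d13 at *
    generalize Matrix.det (Matrix.of ![y a, y b, y x2, y x4]) = d24 at *
    generalize Matrix.det (Matrix.of ![y a, y b, y x1, y x4]) = d14 at *
    generalize Matrix.det (Matrix.of ![y a, y b, y x2, y x3]) = d23 at *
    have hm : ∀ p q : ℝ, (SignType.sign p : ℤ) * (SignType.sign q : ℤ) =
        (SignType.sign (p * q) : ℤ) := by intro p q; rw [sign_mul]; simp
    rw [hm, hm, hm]
    have n1 := mul_ne_zero h12 h34
    have n2 := mul_ne_zero h13 h24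
    have n3 := mul_ne_zero h14 h23
    generalize d12 * d34 = p1 at *
    generalize d13 * d24 = p2 at *
    generalize d14 * d23 = p3 at *
    rcases lt_or_gt_of_ne n1 with q1 | q1 <;> rcases lt_or_gt_of_ne n2 with q2 | q2 <;>
      rcases lt_or_gt_of_ne n3 with q3 | q3 <;>
      first
        | (exfalso; linarith)
        | (simp only [sign_pos, sign_neg, q1, q2, q3]
           intro z hz
           simp only [Set.mem_insert_iff, Set.mem_singleton_iff] at hz ⊢
           rcases hz with rfl | rfl <;> simp)

/-! ### From polyhedral realizations to admissible oriented matroids -/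

/-- Along a circuit of a vector configuration, the vectors satisfy a linear relation whose
coefficients have the signs of the circuit. -/
theorem UniformOrientedMatroid.IsCircuit.exists_dependency {E : Type*} {y : E → Fin 4 → ℝ}
    {hy : ∀ v : Fin 4 → E, Function.Injective v → Matrix.det (Matrix.of (y ∘ v)) ≠ 0}
    {P N : Finset E} (h : (UniformOrientedMatroid.ofVectors y hy).IsCircuit P N) :
    ∃ (c : Fin 5 → E) (l : Fin 5 → ℝ), ∑ i, l i • y (c i) = 0 ∧
      ∀ i, (c i ∈ P ∧ 0 < l i) ∨ (c i ∈ N ∧ l i < 0) := by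
  obtain ⟨c, hc, s, hs, hP, hN⟩ := h
  let d : Fin 5 → ℝ := fun i => Matrix.det (Matrix.of (y ∘ (c ∘ i.succAbove)))
  refine ⟨c, fun i => (s : ℝ) * ((-1) ^ (i : ℕ) * d i), ?_, fun i => ?_⟩
  · have := sum_neg_one_pow_mul_det_smul (y ∘ c)
    have h2 := congrArg (fun z => (s : ℝ) • z) this
    simp only [Finset.smul_sum, smul_zero, smul_smul] at h2
    exact h2
  · have hd : d i ≠ 0 := hy _ (hc.comp Fin.succAbove_right_injective)
    have hχ : (UniformOrientedMatroid.ofVectors y hy).χ (c ∘ i.succAbove) =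
      (SignType.sign (d i) : ℤ) := rfl
    have he : ((-1 : ℤ) ^ (i : ℕ) = 1 ∧ (-1 : ℝ) ^ (i : ℕ) = 1) ∨
        ((-1 : ℤ) ^ (i : ℕ) = -1 ∧ (-1 : ℝ) ^ (i : ℕ) = -1) := by
      rcases Nat.even_or_odd (i : ℕ) with h | h
      · left; exact ⟨h.neg_one_pow, h.neg_one_pow⟩
      · right; exact ⟨h.neg_one_pow, h.neg_one_pow⟩
    have h1 := fun hh => (hP (c i)).2 ⟨i, rfl, hh⟩
    have h2 := fun hh => (hN (c i)).2 ⟨i, rfl, hh⟩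
    rw [hχ] at h1 h2
    rcases lt_or_gt_of_ne hd with q | q <;> rcases he with ⟨e1, e2⟩ | ⟨e1, e2⟩ <;>
      rcases hs with rfl | rfl <;>
      simp only [sign_pos, sign_neg, q, e1, e2] at h1 h2 ⊢ <;> norm_num at h1 h2 ⊢ <;> tauto

/-- General position is reached on moving a configuration slightly towards the moment curve. For
bookkeeping the configuration is scaled by the large factor `t` instead. -/
theorem eventually_det_ne_zero (g : Fin 12 → Fin 4 → ℝ) (v : Fin 4 → Fin 12)
    (hv : Function.Injective v) :
    ∀ᶠ t : ℝ in Filter.atTop,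
      Matrix.det (Matrix.of
        ((fun (i : Fin 12) (j : Fin 4) => ((i : ℕ) : ℝ) ^ (j : ℕ) + t * g i j) ∘ v)) ≠ 0 := by
  let A : Matrix (Fin 4) (Fin 4) (Polynomial ℝ) := Matrix.of fun k j =>
    Polynomial.C (((v k : ℕ) : ℝ) ^ (j : ℕ)) + Polynomial.X * Polynomial.C (g (v k) j)
  have hA : ∀ t : ℝ, A.det.eval t =
      Matrix.det (Matrix.of
        ((fun (i : Fin 12) (j : Fin 4) => ((i : ℕ) : ℝ) ^ (j : ℕ) + t * g i j) ∘ v)) := by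
    intro t
    rw [← Polynomial.coe_evalRingHom, RingHom.map_det]
    refine congrArg Matrix.det ?_
    ext k j
    simp [A]
    ring
  have h0 : A.det ≠ 0 := by
    intro h
    have h1 := hA 0
    rw [h, Polynomial.eval_zero] at h1
    have h2 : Matrix.of ((fun (i : Fin 12) (j : Fin 4) =>
        ((i : ℕ) : ℝ) ^ (j : ℕ) + 0 * g i j) ∘ v) =
        Matrix.vandermonde fun k => ((v k : ℕ) : ℝ) := by
      ext k j; simp [Matrix.vandermonde]
    rw [h2] at h1
    exact Matrix.det_vandermonde_ne_zero_iff.2 (fun a b hab => by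
      have : ((v a : ℕ) : ℝ) = ((v b : ℕ) : ℝ) := hab
      exact hv (Fin.ext (by exact_mod_cast this))) h1.symm
  filter_upwards [Polynomial.eventually_atTop_not_isRoot A.det h0] with t ht
  rw [← hA]; exact ht

/-- Moving the vertices of a polyhedral realization to general position gives an admissible
oriented matroid: a hyperplane strictly separating the images of two disjoint faces still separates
them after a small move, so no circuit can be positive on one face and negative on the other. -/
theorem exists_isAdmissible_of_isPolyhedralRealization {K : AbstractSimplicialComplex (Fin 12)}
    {f : Fin 12 → EuclideanSpace ℝ (Fin 3)} (hf : K.IsPolyhedralRealization f) :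
    ∃ M : UniformOrientedMatroid (Fin 12), M.IsAdmissible K := by
  classical
  let g : Fin 12 → Fin 4 → ℝ := fun i => Fin.cons 0 fun k => f i k
  let y : ℝ → Fin 12 → Fin 4 → ℝ := fun t i j => ((i : ℕ) : ℝ) ^ (j : ℕ) + t * g i j
  -- `m i` is the affine part of the point of the moment curve
  let m : Fin 12 → EuclideanSpace ℝ (Fin 3) := fun i =>
    WithLp.toLp 2 fun k => ((i : ℕ) : ℝ) ^ (k.succ : ℕ)
  have hy0 : ∀ t i, y t i 0 = 1 := by intro t i; simp [y, g]
  have hys : ∀ t i (k : Fin 3), y t i k.succ = (m i + t • f i) k := by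
    intro t i k; simp [y, g, m]
  have hsep : ∀ F G : Finset (Fin 12), ∃ l : EuclideanSpace ℝ (Fin 3) →L[ℝ] ℝ, ∃ u : ℝ,
      F ∈ K → G ∈ K → Disjoint F G → (∀ i ∈ F, l (f i) < u) ∧ ∀ i ∈ G, u < l (f i) := by
    intro F G
    by_cases h : F ∈ K ∧ G ∈ K ∧ Disjoint F G
    · obtain ⟨hF, hG, hd⟩ := h
      have he := hf F hF G hG
      rw [Finset.disjoint_iff_inter_eq_empty.1 hd] at he
      simp only [Finset.coe_empty, Set.image_empty, convexHull_empty] at he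
      obtain ⟨l, u, v, h1, h2, h3⟩ := geometric_hahn_banach_compact_closed
        (convex_convexHull ℝ (f '' (F : Set (Fin 12))))
        ((F.finite_toSet.image f).isCompact_convexHull ℝ)
        (convex_convexHull ℝ (f '' (G : Set (Fin 12))))
        ((G.finite_toSet.image f).isCompact_convexHull ℝ).isClosed
        (Set.disjoint_iff_inter_eq_empty.2 he.symm)
      exact ⟨l, u, fun _ _ _ => ⟨fun i hi => h1 _ (subset_convexHull ℝ _ ⟨i, hi, rfl⟩),
        fun i hi => h2.trans (h3 _ (subset_convexHull ℝ _ ⟨i, hi, rfl⟩))⟩⟩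
    · exact ⟨0, 0, fun hF hG hd => absurd ⟨hF, hG, hd⟩ h⟩
  choose l u hlu using hsep
  have hlin : ∀ a b : ℝ, 0 < b → ∀ᶠ t : ℝ in Filter.atTop, a < t * b := by
    intro a b hb
    exact (Filter.tendsto_id.atTop_mul_const hb).eventually_gt_atTop a
  have hev : ∀ᶠ t : ℝ in Filter.atTop, (∀ v : Fin 4 → Fin 12, Function.Injective v →
      Matrix.det (Matrix.of (y t ∘ v)) ≠ 0) ∧
      ∀ F G : Finset (Fin 12), F ∈ K → G ∈ K → Disjoint F G →
        (∀ i ∈ F, l F G (m i + t • f i) < t * u F G) ∧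
          ∀ i ∈ G, t * u F G < l F G (m i + t • f i) := by
    rw [Filter.eventually_and]
    constructor
    · rw [Filter.eventually_all]
      intro v
      by_cases hv : Function.Injective v
      · filter_upwards [eventually_det_ne_zero g v hv] with t ht _ using ht
      · exact Filter.Eventually.of_forall fun t h => absurd h hv
    · rw [Filter.eventually_all]
      intro F
      rw [Filter.eventually_all]
      intro G
      by_cases h : F ∈ K ∧ G ∈ K ∧ Disjoint F G
      · have h' := hlu F G h.1 h.2.1 h.2.2
        have e1 : ∀ᶠ t : ℝ in Filter.atTop, ∀ i, i ∈ F → l F G (m i + t • f i) < t * u F G := by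
          rw [Filter.eventually_all]
          intro i
          by_cases hi : i ∈ F
          · filter_upwards [hlin (l F G (m i)) (u F G - l F G (f i)) (by linarith [h'.1 i hi])]
              with t ht _
            rw [map_add, map_smul, smul_eq_mul]; linarith
          · exact Filter.Eventually.of_forall fun t h => absurd h hi
        have e2 : ∀ᶠ t : ℝ in Filter.atTop, ∀ i, i ∈ G → t * u F G < l F G (m i + t • f i) := by
          rw [Filter.eventually_all]
          intro i
          by_cases hi : i ∈ G
          · filter_upwards [hlin (-l F G (m i)) (l F G (f i) - u F G) (by linarith [h'.2 i hi])]
              with t ht _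
            rw [map_add, map_smul, smul_eq_mul]; linarith
          · exact Filter.Eventually.of_forall fun t h => absurd h hi
        filter_upwards [e1, e2] with t h1 h2 _ _ _ using ⟨h1, h2⟩
      · exact Filter.Eventually.of_forall fun t h1 h2 h3 => absurd ⟨h1, h2, h3⟩ h
  obtain ⟨t, hdet, hst⟩ := hev.exists
  refine ⟨UniformOrientedMatroid.ofVectors (y t) hdet, ?_⟩
  intro F hF G hG hFG P N hPN hsub
  obtain ⟨c, w, hsum, hw⟩ := hPN.exists_dependency
  obtain ⟨h1, h2⟩ := hst F G hF hG hFG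
  have hw0 : ∑ i, w i = 0 := by
    have := congrFun hsum 0
    simpa [Finset.sum_apply, hy0] using this
  have hwx : ∑ i, w i • (m (c i) + t • f (c i)) = 0 := by
    ext k
    have := congrFun hsum k.succ
    simp only [Finset.sum_apply, Pi.smul_apply, hys, Pi.zero_apply] at this
    simpa [mul_add] using this
  have hl := congrArg (l F G) hwx
  rw [map_sum, map_zero] at hl
  simp only [map_smul, smul_eq_mul] at hl
  -- every term of the relation is strictly negative after subtracting the separating level
  have hneg : ∀ i, w i * (l F G (m (c i) + t • f (c i)) - t * u F G) < 0 := by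
    intro i
    rcases hw i with ⟨hi, hp⟩ | ⟨hi, hn⟩
    · exact mul_neg_of_pos_of_neg hp (by linarith [h1 _ (hsub.1 hi)])
    · exact mul_neg_of_neg_of_pos hn (by linarith [h2 _ (hsub.2 hi)])
  have hlt : ∑ i, w i * (l F G (m (c i) + t • f (c i)) - t * u F G) < 0 :=
    Finset.sum_neg (fun i _ => hneg i) Finset.univ_nonempty
  simp only [mul_sub, Finset.sum_sub_distrib, ← Finset.sum_mul] at hlt
  simp only [map_add, map_smul, smul_eq_mul] at hl hlt
  rw [hl, hw0] at hlt
  simp at hlt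

/-! ### Filtering the circuit signatures of a six-element set -/

/-!
The dual of a uniform oriented matroid of rank 4 on six elements has rank 2, so it is an arrangement
of six lines through the origin of the plane. In the course of half a turn that starts at the line
number 5, a ray crosses the other lines one after another, and the six circuits are the sign vectors
of the ray at the six crossings. The signs at the crossing of line `o` are therefore those at the
start, except that the signs of the lines crossed in between have changed.

Accordingly, a position of the transition graph is a number `32 * s + b`, where the digits of `s`
are the signs at the start and those of `b` mark the lines that have been crossed. A transition
changes digit `o` of `b` from `0` to `1`, and it is present if the corresponding circuit is among
the possible ones for the five-element set that omits `o`. The filter keeps the circuits that belong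
to a path from `b = 0` to `b = 31`. All sets of positions and transitions are numbers of 1024 binary
digits.

No property of the filter is derived from this description: it is verified by evaluation that the
filter keeps the circuits of every oriented matroid, and it is monotone by construction.
-/

namespace SixFilter

/-- The number with `n` binary digits `1` at distance `s`, starting with the lowest digit. -/
def ticks (s n : ℕ) : ℕ := Nat.div (Nat.sub (Nat.pow 2 (Nat.mul s n)) 1) (Nat.sub (Nat.pow 2 s) 1)

/-- The number with `n` consecutive binary digits `1`. -/
def ones (n : ℕ) : ℕ := Nat.sub (Nat.pow 2 n) 1

/-! #### Spreading and collecting binary digits -/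

-- The digits that are moved and those that are kept by the steps of `spread`.
def spreadHi0 : ℕ := Nat.mul (ticks 1024 1) 0xffff0000
def spreadLo0 : ℕ := 0xffff
def spreadHi1 : ℕ := Nat.mul (ticks 512 2) 0xff00
def spreadLo1 : ℕ := Nat.mul (ticks 512 2) 0xff
def spreadHi2 : ℕ := Nat.mul (ticks 256 4) 0xf0
def spreadLo2 : ℕ := Nat.mul (ticks 256 4) 0xf
def spreadHi3 : ℕ := Nat.mul (ticks 128 8) 12
def spreadLo3 : ℕ := Nat.mul (ticks 128 8) 3
def spreadHi4 : ℕ := Nat.mul (ticks 64 16) 2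
def spreadLo4 : ℕ := ticks 64 16

/-- One step of `spread`: the digits selected by `hi` move up by `s`. -/
def moveUp (lo hi s z : ℕ) : ℕ := Nat.lor (Nat.land z lo) (Nat.shiftLeft (Nat.land z hi) s)

/-- One step of `collect`: the digits that arrive at `hi` when moving down by `s`. -/
def moveDown (lo hi s z : ℕ) : ℕ := Nat.lor (Nat.land z lo) (Nat.land (Nat.shiftRight z s) hi)

/-- Digit `i < 32` moves to position `32 * i`. -/
def spread (z : ℕ) : ℕ :=
  moveUp spreadLo4 spreadHi4 31 <| moveUp spreadLo3 spreadHi3 62 <|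
  moveUp spreadLo2 spreadHi2 124 <| moveUp spreadLo1 spreadHi1 248 <|
  moveUp spreadLo0 spreadHi0 496 z

/-- The inverse of `spread`. -/
def collect (z : ℕ) : ℕ :=
  moveDown spreadLo0 spreadHi0 496 <| moveDown spreadLo1 spreadHi1 248 <|
  moveDown spreadLo2 spreadHi2 124 <| moveDown spreadLo3 spreadHi3 62 <|
  moveDown spreadLo4 spreadHi4 31 z

/-! #### From the word of a five-element set to the transition table -/

-- The digits that are moved and those that are kept by the steps of `insertZero`.
def insHi0 : ℕ := Nat.mul (ticks 1024 4) 0xff00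
def insHi1 : ℕ := Nat.mul (ticks 1024 3) 0x00f000f0
def insHi2 : ℕ := Nat.mul (ticks 1024 2) 0x0c0c0c0c
def insHi3 : ℕ := 0x22222222
def insAll : ℕ := Nat.mul (ticks 1024 5) (ones 32)
def insLo0 : ℕ := Nat.sub insAll insHi0
def insLo1 : ℕ := Nat.sub insAll insHi1
def insLo2 : ℕ := Nat.sub insAll insHi2
def insLo3 : ℕ := Nat.sub insAll insHi3

/-- In the block number `o` of 1024 digits (`o < 5`), the digit with index `y < 16` moves to the
index obtained from `y` by inserting a binary digit `0` at place `o`. -/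
def insertZero (z : ℕ) : ℕ :=
  moveUp insLo3 insHi3 1 <| moveUp insLo2 insHi2 2 <| moveUp insLo1 insHi1 4 <|
  moveUp insLo0 insHi0 8 z

-- The same for `deleteZero`. A digit is kept if it is at neither end of a move.
def two512 : ℕ := Nat.add 1 (Nat.pow 2 512)
def delHi0 : ℕ := Nat.mul insHi0 two512
def delHi1 : ℕ := Nat.mul insHi1 two512
def delHi2 : ℕ := Nat.mul insHi2 two512
def delHi3 : ℕ := Nat.mul insHi3 two512
def delAll : ℕ := Nat.mul insAll two512
def delLo0 : ℕ := Nat.sub delAll (Nat.mul delHi0 257)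
def delLo1 : ℕ := Nat.sub delAll (Nat.mul delHi1 17)
def delLo2 : ℕ := Nat.sub delAll (Nat.mul delHi2 5)
def delLo3 : ℕ := Nat.sub delAll (Nat.mul delHi3 3)

/-- The inverse of `insertZero`, on both halves of each block. -/
def deleteZero (z : ℕ) : ℕ :=
  moveDown delLo0 delHi0 8 <| moveDown delLo1 delHi1 4 <| moveDown delLo2 delHi2 2 <|
  moveDown delLo3 delHi3 1 z

-- The places whose index has digit number `k` equal to `0`.
def flipLo0 : ℕ := Nat.mul (ticks 32 160) 0x55555555
def flipLo1 : ℕ := Nat.mul (ticks 32 160) 0x33333333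
def flipLo2 : ℕ := Nat.mul (ticks 32 160) 0x0f0f0f0f
def flipLo3 : ℕ := Nat.mul (ticks 32 160) 0x00ff00ff

/-- Every digit of `z` changes its place with the digit whose index differs by `s`, a power of 2;
`lo` selects the lower places. -/
def flip (lo s z : ℕ) : ℕ :=
  Nat.lor (Nat.shiftLeft (Nat.land z lo) s) (Nat.land (Nat.shiftRight z s) lo)

-- All blocks but one.
def convField0 : ℕ := Nat.sub (ones 5120) (ones 1024)
def convField1 : ℕ := Nat.sub (ones 5120) (Nat.shiftLeft (ones 1024) 1024)
def convField2 : ℕ := Nat.sub (ones 5120) (Nat.shiftLeft (ones 1024) 2048)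
def convField3 : ℕ := Nat.sub (ones 5120) (Nat.shiftLeft (ones 1024) 3072)

/-- One step of `unfold`. -/
def unfoldStep (field lo s d z : ℕ) : ℕ :=
  Nat.lor z (Nat.shiftLeft (flip lo s (Nat.land z field)) d)

/-- For `k < 4` and in all blocks but number `k`, copies a digit with index `b` to the place
`32 * 2 ^ k` higher and with digit number `k` of `b` changed. -/
def unfold (z : ℕ) : ℕ :=
  unfoldStep convField3 flipLo3 8 256 <| unfoldStep convField2 flipLo2 4 128 <|
  unfoldStep convField1 flipLo1 2 64 <| unfoldStep convField0 flipLo0 1 32 z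

-- The places with digit number `5 + k` equal to `0`, where `foldBack` collects the copies.
def low0 : ℕ := Nat.mul (ticks 64 80) (ones 32)
def low1 : ℕ := Nat.mul (ticks 128 40) (ones 64)
def low2 : ℕ := Nat.mul (ticks 256 20) (ones 128)
def low3 : ℕ := Nat.mul (ticks 512 10) (ones 256)

/-- One step of `foldBack`. -/
def foldStep (low lo s d z : ℕ) : ℕ :=
  Nat.land (Nat.lor z (flip lo s (Nat.shiftRight z d))) low

/-- Projects all copies made by `unfold` back to the original. -/
def foldBack (z : ℕ) : ℕ :=
  foldStep low0 flipLo0 1 32 <| foldStep low1 flipLo1 2 64 <| foldStep low2 flipLo2 4 128 <|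
  foldStep low3 flipLo3 8 256 z

def half : ℕ := 0xffff
def ones1024 : ℕ := ones 1024

/-- The 16 low digits of the words number `0, …, 4`, the odd ones with halves exchanged, in blocks
of 1024 digits. -/
def lowHalves (w : ℕ) : ℕ :=
  Nat.lor (Nat.land w half) <|
  Nat.lor (Nat.shiftLeft (Nat.land (Nat.shiftRight w 48) half) 1024) <|
  Nat.lor (Nat.shiftLeft (Nat.land (Nat.shiftRight w 64) half) 2048) <|
  Nat.lor (Nat.shiftLeft (Nat.land (Nat.shiftRight w 112) half) 3072) <|
  Nat.shiftLeft (Nat.land (Nat.shiftRight w 128) half) 4096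

/-- The other halves of these words. -/
def highHalves (w : ℕ) : ℕ :=
  Nat.lor (Nat.land (Nat.shiftRight w 16) half) <|
  Nat.lor (Nat.shiftLeft (Nat.land (Nat.shiftRight w 32) half) 1024) <|
  Nat.lor (Nat.shiftLeft (Nat.land (Nat.shiftRight w 80) half) 2048) <|
  Nat.lor (Nat.shiftLeft (Nat.land (Nat.shiftRight w 96) half) 3072) <|
  Nat.shiftLeft (Nat.land (Nat.shiftRight w 144) half) 4096

/-- The block of 1024 digits at place `s`. -/
def block (z s : ℕ) : ℕ := Nat.land (Nat.shiftRight z s) ones1024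

/-- The transition table of the word number `o < 4`, from the two halves; `d = 32 * 2 ^ o`. -/
def fourCopies (d x y : ℕ) : ℕ :=
  Nat.lor (Nat.lor x (Nat.shiftLeft x (Nat.add d 512)))
    (Nat.lor (Nat.shiftLeft y d) (Nat.shiftLeft y 512))

/-- The transition table of the word number 4. -/
def twoCopies (x y : ℕ) : ℕ := Nat.lor x (Nat.shiftLeft y 512)

/-- One step forward in the transition graph. -/
def stepUp (s e f : ℕ) : ℕ := Nat.lor f (Nat.shiftLeft (Nat.land f e) s)

/-- One step backward in the transition graph. -/
def stepDown (s e b : ℕ) : ℕ := Nat.lor b (Nat.land (Nat.shiftRight b s) e)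

/-- All positions reachable from `f`. The order of the steps contains every permutation of the
five elements as a subsequence. -/
def reach (e0 e1 e2 e3 e4 f : ℕ) : ℕ :=
  stepUp 2 e1 <| stepUp 4 e2 <| stepUp 16 e4 <| stepUp 8 e3 <| stepUp 1 e0 <| stepUp 2 e1 <|
  stepUp 16 e4 <| stepUp 4 e2 <| stepUp 8 e3 <| stepUp 2 e1 <| stepUp 1 e0 <| stepUp 4 e2 <|
  stepUp 16 e4 <| stepUp 2 e1 <| stepUp 8 e3 <| stepUp 1 e0 <| stepUp 16 e4 <| stepUp 4 e2 <|
  stepUp 2 e1 f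

/-- All positions from which `b` is reachable. -/
def coreach (e0 e1 e2 e3 e4 b : ℕ) : ℕ :=
  stepDown 2 e1 <| stepDown 4 e2 <| stepDown 16 e4 <| stepDown 1 e0 <| stepDown 8 e3 <|
  stepDown 2 e1 <| stepDown 16 e4 <| stepDown 4 e2 <| stepDown 1 e0 <| stepDown 2 e1 <|
  stepDown 8 e3 <| stepDown 4 e2 <| stepDown 16 e4 <| stepDown 2 e1 <| stepDown 1 e0 <|
  stepDown 8 e3 <| stepDown 16 e4 <| stepDown 4 e2 <| stepDown 2 e1 b

/-- The positions with `b = 31`. -/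
def tops : ℕ := Nat.shiftLeft (ticks 32 32) 31

/-- The transitions that lie on a complete path. -/
def used (s e f b : ℕ) : ℕ := Nat.land (Nat.land f e) (Nat.shiftRight b s)

-- The places where `gatherEven` and `gatherOdd` collect the copies made by `fourCopies`.
def can0 : ℕ := Nat.mul (ticks 64 8) (ones 32)
def can1 : ℕ := Nat.mul (ticks 128 4) (ones 64)
def can2 : ℕ := Nat.mul (ticks 256 2) (ones 128)
def can3 : ℕ := ones 256

/-- The inverse of `fourCopies` for `o = 0, 2`, with the halves at distance 512. -/
def gatherEven (can d z : ℕ) : ℕ :=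
  Nat.lor (Nat.land (Nat.lor z (Nat.shiftRight z (Nat.add d 512))) can)
    (Nat.shiftLeft (Nat.land (Nat.lor (Nat.shiftRight z d) (Nat.shiftRight z 512)) can) 512)

/-- The inverse of `fourCopies` for `o = 1, 3`. -/
def gatherOdd (can d z : ℕ) : ℕ :=
  Nat.lor (Nat.shiftLeft (Nat.land (Nat.lor z (Nat.shiftRight z (Nat.add d 512))) can) 512)
    (Nat.land (Nat.lor (Nat.shiftRight z d) (Nat.shiftRight z 512)) can)

/-- Packs five blocks of 1024 digits. -/
def pack (z0 z1 z2 z3 z4 : ℕ) : ℕ :=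
  Nat.lor z0 <| Nat.lor (Nat.shiftLeft z1 1024) <| Nat.lor (Nat.shiftLeft z2 2048) <|
  Nat.lor (Nat.shiftLeft z3 3072) (Nat.shiftLeft z4 4096)

-- The places of five words.
def word0 : ℕ := ones 32
def word1 : ℕ := Nat.shiftLeft (ones 32) 32
def word2 : ℕ := Nat.shiftLeft (ones 32) 64
def word3 : ℕ := Nat.shiftLeft (ones 32) 96
def word4 : ℕ := Nat.shiftLeft (ones 32) 128

/-- The five words that belong to a table of used transitions. -/
def words (z : ℕ) : ℕ :=
  Nat.lor (Nat.land z word0) <| Nat.lor (Nat.land (Nat.shiftRight z 992) word1) <|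
  Nat.lor (Nat.land (Nat.shiftRight z 1984) word2) <|
  Nat.lor (Nat.land (Nat.shiftRight z 2976) word3) (Nat.land (Nat.shiftRight z 3968) word4)

/-- Unites the two halves of all words. -/
def joinHalves (z : ℕ) : ℕ := Nat.lor z (Nat.shiftRight z 496)

/-- The words of all circuits used by the transitions and positions on complete paths, given the
transition tables, the starting positions `s`, and the positions `f` reachable from the start and
`b` from which the end is reachable. -/
def assemble (e0 e1 e2 e3 e4 s f b : ℕ) : ℕ :=
  Nat.lor (Nat.shiftLeft (collect (Nat.land b s)) 160) <|
  words <| joinHalves <| deleteZero <| foldBack <|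
  pack (gatherEven can0 32 (used 1 e0 f b)) (gatherOdd can1 64 (used 2 e1 f b))
    (gatherEven can2 128 (used 4 e2 f b)) (gatherOdd can3 256 (used 8 e3 f b))
    (used 16 e4 f b)

def backward (e0 e1 e2 e3 e4 s f : ℕ) : ℕ :=
  assemble e0 e1 e2 e3 e4 s f (coreach e0 e1 e2 e3 e4 (Nat.land f tops))

def forward (e0 e1 e2 e3 e4 s : ℕ) : ℕ :=
  backward e0 e1 e2 e3 e4 s (reach e0 e1 e2 e3 e4 s)

def transitions (x y s : ℕ) : ℕ :=
  forward (fourCopies 32 (block x 0) (block y 0)) (fourCopies 64 (block x 1024) (block y 1024))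
    (fourCopies 128 (block x 2048) (block y 2048)) (fourCopies 256 (block x 3072) (block y 3072))
    (twoCopies (block x 4096) (block y 4096)) s

/-- The filter. -/
def filter (w : ℕ) : ℕ :=
  transitions (unfold (insertZero (lowHalves w))) (unfold (insertZero (highHalves w)))
    (spread (Nat.shiftRight w 160))

end SixFilter

/-! ### The filter keeps the circuits of oriented matroids -/

namespace SixFilter

/-- Every binary digit `1` of `a` is one of `b`. -/
def Below (a b : ℕ) : Prop := ∀ i, a.testBit i = true → b.testBit i = true

theorem Below.refl (a : ℕ) : Below a a := fun _ h => h

theorem Below.land {a b c d : ℕ} (h : Below a b) (h' : Below c d) :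
    Below (Nat.land a c) (Nat.land b d) := fun i hi => by
  change (a &&& c).testBit i = true at hi
  change (b &&& d).testBit i = true
  rw [Nat.testBit_land, Bool.and_eq_true] at hi ⊢
  exact ⟨h i hi.1, h' i hi.2⟩

theorem Below.lor {a b c d : ℕ} (h : Below a b) (h' : Below c d) :
    Below (Nat.lor a c) (Nat.lor b d) := fun i hi => by
  change (a ||| c).testBit i = true at hi
  change (b ||| d).testBit i = true
  rw [Nat.testBit_lor, Bool.or_eq_true] at hi ⊢
  exact hi.imp (h i) (h' i)

theorem Below.shiftRight {a b : ℕ} (h : Below a b) (s : ℕ) :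
    Below (Nat.shiftRight a s) (Nat.shiftRight b s) := fun i hi => by
  change (a >>> s).testBit i = true at hi
  change (b >>> s).testBit i = true
  rw [Nat.testBit_shiftRight] at hi ⊢
  exact h _ hi

theorem Below.shiftLeft {a b : ℕ} (h : Below a b) (s : ℕ) :
    Below (Nat.shiftLeft a s) (Nat.shiftLeft b s) := fun i hi => by
  change (a <<< s).testBit i = true at hi
  change (b <<< s).testBit i = true
  rw [Nat.testBit_shiftLeft, Bool.and_eq_true] at hi ⊢
  exact ⟨hi.1, h _ hi.2⟩

theorem Below.moveUp {a b : ℕ} (h : Below a b) (lo hi s : ℕ) :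
    Below (moveUp lo hi s a) (moveUp lo hi s b) :=
  (h.land (.refl _)).lor ((h.land (.refl _)).shiftLeft _)

theorem Below.moveDown {a b : ℕ} (h : Below a b) (lo hi s : ℕ) :
    Below (moveDown lo hi s a) (moveDown lo hi s b) :=
  (h.land (.refl _)).lor ((h.shiftRight _).land (.refl _))

theorem Below.flip {a b : ℕ} (h : Below a b) (lo s : ℕ) : Below (flip lo s a) (flip lo s b) :=
  ((h.land (.refl _)).shiftLeft _).lor ((h.shiftRight _).land (.refl _))

theorem Below.unfoldStep {a b : ℕ} (h : Below a b) (field lo s d : ℕ) :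
    Below (unfoldStep field lo s d a) (unfoldStep field lo s d b) :=
  h.lor (((h.land (.refl _)).flip _ _).shiftLeft _)

theorem Below.foldStep {a b : ℕ} (h : Below a b) (low lo s d : ℕ) :
    Below (foldStep low lo s d a) (foldStep low lo s d b) :=
  (h.lor ((h.shiftRight _).flip _ _)).land (.refl _)

theorem Below.stepUp {e f e' f' : ℕ} (h : Below e e') (h' : Below f f') (s : ℕ) :
    Below (stepUp s e f) (stepUp s e' f') :=
  h'.lor ((h'.land h).shiftLeft _)

theorem Below.stepDown {e f e' f' : ℕ} (h : Below e e') (h' : Below f f') (s : ℕ) :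
    Below (stepDown s e f) (stepDown s e' f') :=
  h'.lor ((h'.shiftRight _).land h)

theorem Below.used {e f b e' f' b' : ℕ} (h : Below e e') (h' : Below f f') (h'' : Below b b')
    (s : ℕ) : Below (used s e f b) (used s e' f' b') :=
  (h'.land h).land (h''.shiftRight _)

theorem Below.block {a b : ℕ} (h : Below a b) (s : ℕ) : Below (block a s) (block b s) :=
  (h.shiftRight _).land (.refl _)

theorem Below.spread {a b : ℕ} (h : Below a b) : Below (spread a) (spread b) := by
  unfold SixFilter.spread
  exact ((((h.moveUp _ _ _).moveUp _ _ _).moveUp _ _ _).moveUp _ _ _).moveUp _ _ _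

theorem Below.collect {a b : ℕ} (h : Below a b) : Below (collect a) (collect b) := by
  unfold SixFilter.collect
  exact ((((h.moveDown _ _ _).moveDown _ _ _).moveDown _ _ _).moveDown _ _ _).moveDown _ _ _

theorem Below.insertZero {a b : ℕ} (h : Below a b) : Below (insertZero a) (insertZero b) := by
  unfold SixFilter.insertZero
  exact (((h.moveUp _ _ _).moveUp _ _ _).moveUp _ _ _).moveUp _ _ _

theorem Below.deleteZero {a b : ℕ} (h : Below a b) : Below (deleteZero a) (deleteZero b) := by
  unfold SixFilter.deleteZero
  exact (((h.moveDown _ _ _).moveDown _ _ _).moveDown _ _ _).moveDown _ _ _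

theorem Below.unfold {a b : ℕ} (h : Below a b) : Below (unfold a) (unfold b) := by
  unfold SixFilter.unfold
  exact (((h.unfoldStep _ _ _ _).unfoldStep _ _ _ _).unfoldStep _ _ _ _).unfoldStep _ _ _ _

theorem Below.foldBack {a b : ℕ} (h : Below a b) : Below (foldBack a) (foldBack b) := by
  unfold SixFilter.foldBack
  exact (((h.foldStep _ _ _ _).foldStep _ _ _ _).foldStep _ _ _ _).foldStep _ _ _ _

theorem Below.fourCopies {x y x' y' : ℕ} (h : Below x x') (h' : Below y y') (d : ℕ) :
    Below (fourCopies d x y) (fourCopies d x' y') :=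
  (h.lor (h.shiftLeft _)).lor ((h'.shiftLeft _).lor (h'.shiftLeft _))

theorem Below.gatherEven {a b : ℕ} (h : Below a b) (can d : ℕ) :
    Below (gatherEven can d a) (gatherEven can d b) :=
  ((h.lor (h.shiftRight _)).land (.refl _)).lor
    ((((h.shiftRight _).lor (h.shiftRight _)).land (.refl _)).shiftLeft _)

theorem Below.gatherOdd {a b : ℕ} (h : Below a b) (can d : ℕ) :
    Below (gatherOdd can d a) (gatherOdd can d b) :=
  (((h.lor (h.shiftRight _)).land (.refl _)).shiftLeft _).lor
    (((h.shiftRight _).lor (h.shiftRight _)).land (.refl _))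

theorem Below.words {a b : ℕ} (h : Below a b) : Below (words a) (words b) :=
  Below.lor (h.land (.refl _)) <| Below.lor ((h.shiftRight _).land (.refl _)) <|
    Below.lor ((h.shiftRight _).land (.refl _)) <| Below.lor ((h.shiftRight _).land (.refl _)) <|
    (h.shiftRight _).land (.refl _)

theorem Below.joinHalves {a b : ℕ} (h : Below a b) : Below (joinHalves a) (joinHalves b) :=
  h.lor (h.shiftRight _)

theorem Below.pack {a b c d e a' b' c' d' e' : ℕ} (ha : Below a a') (hb : Below b b')
    (hc : Below c c') (hd : Below d d') (he : Below e e') :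
    Below (pack a b c d e) (pack a' b' c' d' e') :=
  ha.lor ((hb.shiftLeft _).lor ((hc.shiftLeft _).lor ((hd.shiftLeft _).lor (he.shiftLeft _))))

theorem Below.lowHalves {a b : ℕ} (h : Below a b) : Below (lowHalves a) (lowHalves b) :=
  Below.lor (h.land (.refl _)) <| Below.lor (((h.shiftRight _).land (.refl _)).shiftLeft _) <|
    Below.lor (((h.shiftRight _).land (.refl _)).shiftLeft _) <|
    Below.lor (((h.shiftRight _).land (.refl _)).shiftLeft _) <|
    ((h.shiftRight _).land (.refl _)).shiftLeft _

theorem Below.highHalves {a b : ℕ} (h : Below a b) : Below (highHalves a) (highHalves b) :=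
  Below.lor ((h.shiftRight _).land (.refl _)) <|
    Below.lor (((h.shiftRight _).land (.refl _)).shiftLeft _) <|
    Below.lor (((h.shiftRight _).land (.refl _)).shiftLeft _) <|
    Below.lor (((h.shiftRight _).land (.refl _)).shiftLeft _) <|
    ((h.shiftRight _).land (.refl _)).shiftLeft _

section
variable {e0 e1 e2 e3 e4 s e0' e1' e2' e3' e4' s' f f' b b' : ℕ} (h0 : Below e0 e0')
    (h1 : Below e1 e1') (h2 : Below e2 e2') (h3 : Below e3 e3') (h4 : Below e4 e4')
    (h : Below s s')
include h0 h1 h2 h3 h4 h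

theorem Below.reach : Below (reach e0 e1 e2 e3 e4 s) (reach e0' e1' e2' e3' e4' s') := by
  unfold SixFilter.reach
  repeat' first | assumption | apply Below.stepUp

theorem Below.coreach : Below (coreach e0 e1 e2 e3 e4 s) (coreach e0' e1' e2' e3' e4' s') := by
  unfold SixFilter.coreach
  repeat' first | assumption | apply Below.stepDown

theorem Below.assemble (hf : Below f f') (hb : Below b b') :
    Below (assemble e0 e1 e2 e3 e4 s f b) (assemble e0' e1' e2' e3' e4' s' f' b') :=
  ((hb.land h).collect.shiftLeft _).lor
    (Below.words (Below.joinHalves (Below.deleteZero (Below.foldBack (Below.pack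
      ((h0.used hf hb _).gatherEven _ _) ((h1.used hf hb _).gatherOdd _ _)
      ((h2.used hf hb _).gatherEven _ _) ((h3.used hf hb _).gatherOdd _ _)
      (h4.used hf hb _))))))

theorem Below.forward : Below (forward e0 e1 e2 e3 e4 s) (forward e0' e1' e2' e3' e4' s') := by
  have hr := Below.reach h0 h1 h2 h3 h4 h
  exact Below.assemble h0 h1 h2 h3 h4 h hr (Below.coreach h0 h1 h2 h3 h4 (hr.land (.refl _)))

end

theorem Below.transitions {x y s x' y' s' : ℕ} (hx : Below x x') (hy : Below y y')
    (hs : Below s s') : Below (transitions x y s) (transitions x' y' s') :=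
  Below.forward ((hx.block _).fourCopies (hy.block _) _) ((hx.block _).fourCopies (hy.block _) _)
    ((hx.block _).fourCopies (hy.block _) _) ((hx.block _).fourCopies (hy.block _) _)
    ((hx.block _).lor ((hy.block _).shiftLeft _)) hs

/-- The filter is monotone, being composed of conjunctions, disjunctions and shifts. -/
theorem Below.filter {a b : ℕ} (h : Below a b) : Below (filter a) (filter b) :=
  Below.transitions h.lowHalves.insertZero.unfold h.highHalves.insertZero.unfold
    (h.shiftRight _).spread

end SixFilter

/-- The three-term Grassmann–Plücker relation, as a condition on six signs given by digits (`1` for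
positive, `0` for negative): the three products are not all equal. -/
def plueckerRel (a b c d e f : ℕ) : Bool :=
  Nat.ble 1 (Nat.lor (Nat.xor (Nat.xor a b) (Nat.xor 1 (Nat.xor c d)))
    (Nat.xor (Nat.xor a b) (Nat.xor e f)))

/-- The index of the circuit on a five-element set whose signs are given by the digits `c`: its
binary digits say whether the first four signs differ from the last sign, and the last sign. -/
def circuitIndex (c0 c1 c2 c3 c4 : ℕ) : ℕ :=
  Nat.add (Nat.add (Nat.add (Nat.xor c0 c4) (Nat.mul 2 (Nat.xor c1 c4)))
    (Nat.add (Nat.mul 4 (Nat.xor c2 c4)) (Nat.mul 8 (Nat.xor c3 c4)))) (Nat.mul 16 c4)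

/-- The index of the circuit of a five-element set, from the signs of its bases; the `i`-th of these
omits the `i`-th element. -/
def signatureIndex (x0 x1 x2 x3 x4 : ℕ) : ℕ :=
  circuitIndex x0 (Nat.xor 1 x1) x2 (Nat.xor 1 x3) x4

/-- The signs of the fifteen bases of a six-element set; `bijkl` is the sign of the basis that
consists of the elements number `i < j < k < l`. -/
structure SixSigns where
  (b0123 b0124 b0125 b0134 b0135 : ℕ)
  (b0145 b0234 b0235 b0245 b0345 : ℕ)
  (b1234 b1235 b1245 b1345 b2345 : ℕ)

namespace SixSigns

/-- The relations for the pairs of elements that contain the element number `0`. -/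
def validFirst (b : SixSigns) : Bool :=
  plueckerRel b.b0123 b.b0145 b.b0124 b.b0135 b.b0125 b.b0134 &&
  plueckerRel b.b0123 b.b0245 b.b0124 b.b0235 b.b0125 b.b0234 &&
  plueckerRel b.b0123 b.b0345 b.b0134 b.b0235 b.b0135 b.b0234 &&
  plueckerRel b.b0124 b.b0345 b.b0134 b.b0245 b.b0145 b.b0234 &&
  plueckerRel b.b0125 b.b0345 b.b0135 b.b0245 b.b0145 b.b0235

/-- The remaining relations. -/
def validRest (b : SixSigns) : Bool :=
  plueckerRel b.b0123 b.b1245 b.b0124 b.b1235 b.b0125 b.b1234 &&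
  plueckerRel b.b0123 b.b1345 b.b0134 b.b1235 b.b0135 b.b1234 &&
  plueckerRel b.b0124 b.b1345 b.b0134 b.b1245 b.b0145 b.b1234 &&
  plueckerRel b.b0125 b.b1345 b.b0135 b.b1245 b.b0145 b.b1235 &&
  plueckerRel b.b0123 b.b2345 b.b0234 b.b1235 b.b0235 b.b1234 &&
  plueckerRel b.b0124 b.b2345 b.b0234 b.b1245 b.b0245 b.b1234 &&
  plueckerRel b.b0125 b.b2345 b.b0235 b.b1245 b.b0245 b.b1235 &&
  plueckerRel b.b0134 b.b2345 b.b0234 b.b1345 b.b0345 b.b1234 &&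
  plueckerRel b.b0135 b.b2345 b.b0235 b.b1345 b.b0345 b.b1235 &&
  plueckerRel b.b0145 b.b2345 b.b0245 b.b1345 b.b0345 b.b1245

/-- The indices of the circuits of the six five-element subsets, as one digit in each of six words;
the word number `o` belongs to the subset that omits the element number `o`. -/
def word (b : SixSigns) : ℕ :=
  Nat.lor (Nat.shiftLeft 1 (Nat.add 0
      (signatureIndex b.b2345 b.b1345 b.b1245 b.b1235 b.b1234))) <|
  Nat.lor (Nat.shiftLeft 1 (Nat.add 32
      (signatureIndex b.b2345 b.b0345 b.b0245 b.b0235 b.b0234))) <|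
  Nat.lor (Nat.shiftLeft 1 (Nat.add 64
      (signatureIndex b.b1345 b.b0345 b.b0145 b.b0135 b.b0134))) <|
  Nat.lor (Nat.shiftLeft 1 (Nat.add 96
      (signatureIndex b.b1245 b.b0245 b.b0145 b.b0125 b.b0124))) <|
  Nat.lor (Nat.shiftLeft 1 (Nat.add 128
      (signatureIndex b.b1235 b.b0235 b.b0135 b.b0125 b.b0123))) <|
  (Nat.shiftLeft 1 (Nat.add 160
      (signatureIndex b.b1234 b.b0234 b.b0134 b.b0124 b.b0123)))

end SixSigns

/-- Evaluates `k x` after reducing `x` to a literal. -/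
def evalFirst {α : Type} (x : ℕ) (k : ℕ → α) : α := Nat.rec (k 0) (fun p _ => k p) (Nat.add x 1)

theorem evalFirst_eq {α : Type} (x : ℕ) (k : ℕ → α) : evalFirst x k = k x := rfl

/-- A number that contains `w` above its 64 lowest digits. These are filled with a hash value: the
kernel hashes a literal by its 64 lowest digits, so its caches work only if they vary. -/
def tagged (w : ℕ) : ℕ :=
  Nat.add (Nat.mul w 0x10000000000000000) (Nat.mod w 0xffffffffffffffc5)

theorem tagged_shiftRight (w : ℕ) : Nat.shiftRight (tagged w) 64 = w := by
  change (w * 0x10000000000000000 + w % 0xffffffffffffffc5) >>> 64 = w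
  rw [Nat.shiftRight_eq_div_pow]
  omega

/-- The filter keeps all digits of `w`. -/
def SixFilter.keeps (w : ℕ) : Bool :=
  evalFirst (tagged w) fun v =>
    Nat.beq (Nat.land (Nat.shiftRight v 64) (filter (Nat.shiftRight v 64))) (Nat.shiftRight v 64)

theorem SixFilter.keeps_iff {w : ℕ} : keeps w = true ↔ Below w (filter w) := by
  rw [keeps, evalFirst_eq, tagged_shiftRight]
  refine ⟨fun h i hi => ?_, fun h => Nat.beq_eq.mpr ?_⟩
  · have h : w &&& filter w = w := Nat.eq_of_beq_eq_true h
    rw [← h, Nat.testBit_land, Bool.and_eq_true] at hi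
    exact hi.2
  · refine Nat.eq_of_testBit_eq fun i => ?_
    change (w &&& filter w).testBit i = _
    rw [Nat.testBit_land]
    cases hw : w.testBit i
    · rfl
    · rw [h i hw]; rfl

/-- Conjunction over both digits. -/
def allDigits (p : ℕ → Bool) : Bool := p 0 && p 1

theorem allDigits_iff {p : ℕ → Bool} : allDigits p = true ↔ ∀ x < 2, p x = true := by
  rw [allDigits, Bool.and_eq_true]
  refine ⟨fun h x hx => ?_, fun h => ⟨h 0 (by norm_num), h 1 (by norm_num)⟩⟩
  interval_cases x
  exacts [h.1, h.2]

/-- The filter keeps the circuit signatures of every system of signs that satisfies the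
Grassmann–Plücker relations. -/
def filterKeepsAll : Bool :=
  allDigits fun b0123 => allDigits fun b0124 => allDigits fun b0125 => allDigits fun b0134 =>
  allDigits fun b0135 =>
  allDigits fun b0145 => allDigits fun b0234 => allDigits fun b0235 => allDigits fun b0245 =>
  allDigits fun b0345 =>
  Bool.rec true
    (allDigits fun b1234 => allDigits fun b1235 => allDigits fun b1245 => allDigits fun b1345 =>
      allDigits fun b2345 =>
      Bool.rec true
        (SixFilter.keeps (SixSigns.word ⟨b0123, b0124, b0125, b0134, b0135, b0145, b0234, b0235,
          b0245, b0345, b1234, b1235, b1245, b1345, b2345⟩))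
        (SixSigns.validRest ⟨b0123, b0124, b0125, b0134, b0135, b0145, b0234, b0235,
            b0245, b0345, b1234, b1235, b1245, b1345, b2345⟩))
    (SixSigns.validFirst ⟨b0123, b0124, b0125, b0134, b0135, b0145, b0234, b0235,
            b0245, b0345, 1, 1, 1, 1, 1⟩)

theorem filterKeepsAll_eq_true : filterKeepsAll = true := by decide +kernel

/-- All digits of `b` are `0` or `1`. -/
structure SixSigns.IsBinary (b : SixSigns) : Prop where
  lt0123 : b.b0123 < 2
  lt0124 : b.b0124 < 2
  lt0125 : b.b0125 < 2
  lt0134 : b.b0134 < 2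
  lt0135 : b.b0135 < 2
  lt0145 : b.b0145 < 2
  lt0234 : b.b0234 < 2
  lt0235 : b.b0235 < 2
  lt0245 : b.b0245 < 2
  lt0345 : b.b0345 < 2
  lt1234 : b.b1234 < 2
  lt1235 : b.b1235 < 2
  lt1245 : b.b1245 < 2
  lt1345 : b.b1345 < 2
  lt2345 : b.b2345 < 2

theorem SixSigns.word_below_filter {b : SixSigns} (hb : b.IsBinary) (h : b.validFirst = true)
    (h' : b.validRest = true) : SixFilter.Below b.word (SixFilter.filter b.word) := by
  have k := filterKeepsAll_eq_true
  rw [filterKeepsAll] at k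
  have k := allDigits_iff.1 k b.b0123 hb.lt0123
  have k := allDigits_iff.1 k b.b0124 hb.lt0124
  have k := allDigits_iff.1 k b.b0125 hb.lt0125
  have k := allDigits_iff.1 k b.b0134 hb.lt0134
  have k := allDigits_iff.1 k b.b0135 hb.lt0135
  have k := allDigits_iff.1 k b.b0145 hb.lt0145
  have k := allDigits_iff.1 k b.b0234 hb.lt0234
  have k := allDigits_iff.1 k b.b0235 hb.lt0235
  have k := allDigits_iff.1 k b.b0245 hb.lt0245
  have k := allDigits_iff.1 k b.b0345 hb.lt0345
  change (Bool.rec true _ (b.validFirst) : Bool) = true at k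
  rw [h] at k
  have k := allDigits_iff.1 k b.b1234 hb.lt1234
  have k := allDigits_iff.1 k b.b1235 hb.lt1235
  have k := allDigits_iff.1 k b.b1245 hb.lt1245
  have k := allDigits_iff.1 k b.b1345 hb.lt1345
  have k := allDigits_iff.1 k b.b2345 hb.lt2345
  change (Bool.rec true _ (b.validRest) : Bool) = true at k
  rw [h'] at k
  exact SixFilter.keeps_iff.1 k

/-! ### Signs of bases and circuits of an oriented matroid -/

namespace UniformOrientedMatroid

section
variable {E : Type*} (M : UniformOrientedMatroid E)

theorem swap_zero_one (a b c d : E) : M.χ ![b, a, c, d] = -M.χ ![a, b, c, d] := by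
  have h := M.alternating ![a, b, c, d] (Equiv.swap 0 1)
  rw [Equiv.Perm.sign_swap (by decide)] at h
  have e : ![a, b, c, d] ∘ Equiv.swap (0 : Fin 4) 1 = ![b, a, c, d] := by
    ext i; fin_cases i <;> rfl
  rw [← e, h]; simp

theorem swap_one_two (a b c d : E) : M.χ ![a, c, b, d] = -M.χ ![a, b, c, d] := by
  have h := M.alternating ![a, b, c, d] (Equiv.swap 1 2)
  rw [Equiv.Perm.sign_swap (by decide)] at h
  have e : ![a, b, c, d] ∘ Equiv.swap (1 : Fin 4) 2 = ![a, c, b, d] := by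
    ext i; fin_cases i <;> rfl
  rw [← e, h]; simp

theorem swap_two_three (a b c d : E) : M.χ ![a, b, d, c] = -M.χ ![a, b, c, d] := by
  have h := M.alternating ![a, b, c, d] (Equiv.swap 2 3)
  rw [Equiv.Perm.sign_swap (by decide)] at h
  have e : ![a, b, c, d] ∘ Equiv.swap (2 : Fin 4) 3 = ![a, b, d, c] := by
    ext i; fin_cases i <;> rfl
  rw [← e, h]; simp

/-- The pullback along an injective map. -/
def comap {D : Type*} (f : D → E) (hf : Function.Injective f) : UniformOrientedMatroid D where
  χ v := M.χ (f ∘ v)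
  eq_zero v hv := M.eq_zero _ fun h => hv (Function.Injective.of_comp h)
  eq_one_or v hv := M.eq_one_or _ (hf.comp hv)
  alternating v π := M.alternating (f ∘ v) π
  grassmannPluecker a b x1 x2 x3 x4 h := by
    have e : ∀ p q r s : D, f ∘ ![p, q, r, s] = ![f p, f q, f r, f s] := by
      intro p q r s; ext i; fin_cases i <;> rfl
    simp only [e]
    refine M.grassmannPluecker _ _ _ _ _ _ ?_
    convert hf.comp h using 1
    ext i; fin_cases i <;> rfl

/-- The reorientation by a global sign. -/
def neg : UniformOrientedMatroid E where
  χ v := -M.χ v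
  eq_zero v hv := by rw [M.eq_zero v hv, neg_zero]
  eq_one_or v hv := by rcases M.eq_one_or v hv with h | h <;> rw [h] <;> simp
  alternating v π := by rw [M.alternating]; ring
  grassmannPluecker a b x1 x2 x3 x4 h := by
    simp only [neg_mul_neg]
    exact M.grassmannPluecker _ _ _ _ _ _ h

variable {M}

theorem IsCircuit.of_neg {P N : Finset E} (h : M.neg.IsCircuit P N) : M.IsCircuit P N := by
  obtain ⟨c, hc, s, hs, hP, hN⟩ := h
  refine ⟨c, hc, -s, by rcases hs with rfl | rfl <;> simp, ?_, ?_⟩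
  · intro e; rw [hP]; simp [neg]
  · intro e; rw [hN]; simp [neg]

theorem IsAdmissible.neg {K : AbstractSimplicialComplex E} (h : M.IsAdmissible K) :
    M.neg.IsAdmissible K :=
  fun F hF G hG d P N c => h F hF G hG d P N c.of_neg

theorem IsCircuit.of_comap {D : Type*} [DecidableEq E] {f : D → E} {hf : Function.Injective f}
    {P N : Finset D} (h : (M.comap f hf).IsCircuit P N) :
    M.IsCircuit (P.map ⟨f, hf⟩) (N.map ⟨f, hf⟩) := by
  obtain ⟨c, hc, s, hs, hP, hN⟩ := h
  refine ⟨f ∘ c, hf.comp hc, s, hs, ?_, ?_⟩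
  · intro e
    simp only [Finset.mem_map, Function.Embedding.coeFn_mk, hP]
    constructor
    · rintro ⟨_, ⟨i, rfl, h⟩, rfl⟩; exact ⟨i, rfl, h⟩
    · rintro ⟨i, rfl, h⟩; exact ⟨_, ⟨i, rfl, h⟩, rfl⟩
  · intro e
    simp only [Finset.mem_map, Function.Embedding.coeFn_mk, hN]
    constructor
    · rintro ⟨_, ⟨i, rfl, h⟩, rfl⟩; exact ⟨i, rfl, h⟩
    · rintro ⟨i, rfl, h⟩; exact ⟨_, ⟨i, rfl, h⟩, rfl⟩

end

/-- The digit that stands for a sign: `1` for `+` and `0` for `-`. -/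
def signDigit (z : ℤ) : ℕ := if z = 1 then 1 else 0

theorem signDigit_lt (z : ℤ) : signDigit z < 2 := by
  unfold signDigit; split <;> norm_num

theorem signDigit_neg {z : ℤ} (h : z = 1 ∨ z = -1) : signDigit (-z) = Nat.xor 1 (signDigit z) := by
  rcases h with rfl | rfl <;> decide

theorem plueckerRel_of_subset {p q r s t u : ℤ} (hp : p = 1 ∨ p = -1) (hq : q = 1 ∨ q = -1)
    (hr : r = 1 ∨ r = -1) (hs : s = 1 ∨ s = -1) (ht : t = 1 ∨ t = -1) (hu : u = 1 ∨ u = -1)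
    (h : ({1, -1} : Set ℤ) ⊆ {p * q, -(r * s), t * u}) :
    plueckerRel (signDigit p) (signDigit q) (signDigit r) (signDigit s) (signDigit t)
      (signDigit u) = true := by
  have h1 := h (show (1 : ℤ) ∈ ({1, -1} : Set ℤ) by simp)
  have h2 := h (show (-1 : ℤ) ∈ ({1, -1} : Set ℤ) by simp)
  simp only [Set.mem_insert_iff, Set.mem_singleton_iff] at h1 h2
  rcases hp with rfl | rfl <;> rcases hq with rfl | rfl <;> rcases hr with rfl | rfl <;>
    rcases hs with rfl | rfl <;> rcases ht with rfl | rfl <;> rcases hu with rfl | rfl <;>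
    first | decide | (exfalso; revert h1 h2; decide)

section
variable {E : Type*} (M : UniformOrientedMatroid E)

/-- The digit for the sign of a basis. -/
noncomputable def digit (a b c d : E) : ℕ := signDigit (M.χ ![a, b, c, d])

theorem digit_lt (a b c d : E) : M.digit a b c d < 2 := signDigit_lt _

/-- The signs of the bases of a six-element set. -/
noncomputable def sixSigns (e0 e1 e2 e3 e4 e5 : E) : SixSigns where
  b0123 := M.digit e0 e1 e2 e3
  b0124 := M.digit e0 e1 e2 e4
  b0125 := M.digit e0 e1 e2 e5
  b0134 := M.digit e0 e1 e3 e4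
  b0135 := M.digit e0 e1 e3 e5
  b0145 := M.digit e0 e1 e4 e5
  b0234 := M.digit e0 e2 e3 e4
  b0235 := M.digit e0 e2 e3 e5
  b0245 := M.digit e0 e2 e4 e5
  b0345 := M.digit e0 e3 e4 e5
  b1234 := M.digit e1 e2 e3 e4
  b1235 := M.digit e1 e2 e3 e5
  b1245 := M.digit e1 e2 e4 e5
  b1345 := M.digit e1 e3 e4 e5
  b2345 := M.digit e2 e3 e4 e5

theorem isBinary_sixSigns (e0 e1 e2 e3 e4 e5 : E) : (M.sixSigns e0 e1 e2 e3 e4 e5).IsBinary := by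
  constructor <;> exact M.digit_lt _ _ _ _

theorem plueckerRel_congr {a b c d e f a' b' c' d' e' f' s : ℕ}
    (h₁ : Nat.xor a b = Nat.xor s (Nat.xor a' b')) (h₂ : Nat.xor c d = Nat.xor s (Nat.xor c' d'))
    (h₃ : Nat.xor e f = Nat.xor s (Nat.xor e' f')) :
    plueckerRel a b c d e f = plueckerRel a' b' c' d' e' f' := by
  have key : ∀ p q : ℕ, Nat.xor (Nat.xor s p) (Nat.xor s q) = Nat.xor p q := by
    intro p q
    change (s ^^^ p) ^^^ (s ^^^ q) = p ^^^ q
    rw [Nat.xor_comm s p, Nat.xor_assoc, ← Nat.xor_assoc s s q, Nat.xor_self, Nat.zero_xor]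
  have swap : ∀ p : ℕ, Nat.xor 1 (Nat.xor s p) = Nat.xor s (Nat.xor 1 p) := by
    intro p
    change 1 ^^^ (s ^^^ p) = s ^^^ (1 ^^^ p)
    rw [← Nat.xor_assoc, ← Nat.xor_assoc, Nat.xor_comm 1 s]
  rw [plueckerRel, plueckerRel, h₁, h₂, h₃, swap, key, key]

end

section
variable {E : Type*} [LinearOrder E] (M : UniformOrientedMatroid E)

/-- For `a < b` and `i < j`, the digit of the basis `{a, b, i, j}` listed in increasing order. -/
noncomputable def mergedDigit (a b i j : E) : ℕ :=
  if b < i then M.digit a b i j else if j < a then M.digit i j a b else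
    if a < i then if j < b then M.digit a i j b else M.digit a i b j
    else if j < b then M.digit i a j b else M.digit i a b j

/-- The digit `1` if `i` is between `a` and `b`. -/
def betweenDigit (a b i : E) : ℕ := if a < i ∧ i < b then 1 else 0

theorem digit_eq_mergedDigit {a b i j : E} (hab : a < b) (hij : i < j) (hai : a ≠ i)
    (hbi : b ≠ i) (haj : a ≠ j) (hbj : b ≠ j) :
    M.digit a b i j = Nat.xor (Nat.xor (betweenDigit a b i) (betweenDigit a b j))
      (M.mergedDigit a b i j) := by
  have inj : ∀ {p q r s : E}, p ≠ q → p ≠ r → p ≠ s → q ≠ r → q ≠ s → r ≠ s →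
      M.χ ![p, q, r, s] = 1 ∨ M.χ ![p, q, r, s] = -1 := by
    intro p q r s h1 h2 h3 h4 h5 h6
    refine M.eq_one_or _ fun x y h => ?_
    fin_cases x <;> fin_cases y <;> simp_all
  have zx : ∀ n : ℕ, Nat.xor 0 n = n := Nat.zero_xor
  have e00 : Nat.xor 0 0 = 0 := rfl
  have e11 : Nat.xor 1 1 = 0 := rfl
  have e01 : Nat.xor 0 1 = 1 := rfl
  have e10 : Nat.xor 1 0 = 1 := rfl
  unfold mergedDigit betweenDigit digit
  rcases lt_or_gt_of_ne hai with h1 | h1 <;> rcases lt_or_gt_of_ne hbi with h2 | h2 <;>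
    rcases lt_or_gt_of_ne haj with h3 | h3 <;> rcases lt_or_gt_of_ne hbj with h4 | h4 <;>
    first
    | (exfalso; order)
    | simp only [h1, h2, h3, h4, h1.not_gt, h2.not_gt, h3.not_gt, h4.not_gt, and_true, and_false,
        if_true, if_false, e00, e01, e10, e11, zx]
  · rw [swap_one_two M a i b j, signDigit_neg (inj hai hab.ne haj hbi.symm hij.ne hbj)]
  · rw [swap_one_two M a i b j, swap_two_three M a i j b, neg_neg]
  · rw [swap_one_two M a i b j, swap_zero_one M i a b j, neg_neg]
  · rw [swap_one_two M a i b j, swap_zero_one M i a b j, neg_neg, swap_two_three M i a j b,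
      signDigit_neg (inj hai.symm hij.ne hbi.symm haj hab.ne hbj.symm)]
  · rw [swap_one_two M a i b j, swap_zero_one M i a b j, neg_neg, swap_two_three M i a j b,
      swap_one_two M i j a b, neg_neg]

theorem plueckerRel_mergedDigit {a b x1 x2 x3 x4 : E} (hab : a < b) (h₁ : x1 < x2) (h₂ : x2 < x3)
    (h₃ : x3 < x4) (ha1 : a ≠ x1) (ha2 : a ≠ x2) (ha3 : a ≠ x3) (ha4 : a ≠ x4) (hb1 : b ≠ x1)
    (hb2 : b ≠ x2) (hb3 : b ≠ x3) (hb4 : b ≠ x4) :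
    plueckerRel (M.mergedDigit a b x1 x2) (M.mergedDigit a b x3 x4) (M.mergedDigit a b x1 x3)
      (M.mergedDigit a b x2 x4) (M.mergedDigit a b x1 x4) (M.mergedDigit a b x2 x3) = true := by
  have h13 := h₁.trans h₂
  have h24 := h₂.trans h₃
  have h14 := h13.trans h₃
  have inj : Function.Injective ![a, b, x1, x2, x3, x4] := by
    intro x y h
    fin_cases x <;> fin_cases y <;> first | rfl | (exfalso; simp at h; order)
  have pm : ∀ {i j : E}, a ≠ i → a ≠ j → b ≠ i → b ≠ j → i < j →
      M.χ ![a, b, i, j] = 1 ∨ M.χ ![a, b, i, j] = -1 := by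
    intro i j h1 h2 h3 h4 h5
    refine M.eq_one_or _ fun x y h => ?_
    fin_cases x <;> fin_cases y <;> first | rfl | (exfalso; simp at h; order)
  have k := plueckerRel_of_subset (pm ha1 ha2 hb1 hb2 h₁) (pm ha3 ha4 hb3 hb4 h₃)
    (pm ha1 ha3 hb1 hb3 h13) (pm ha2 ha4 hb2 hb4 h24) (pm ha1 ha4 hb1 hb4 h14)
    (pm ha2 ha3 hb2 hb3 h₂) (M.grassmannPluecker a b x1 x2 x3 x4 inj)
  change plueckerRel (M.digit a b x1 x2) (M.digit a b x3 x4) (M.digit a b x1 x3)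
    (M.digit a b x2 x4) (M.digit a b x1 x4) (M.digit a b x2 x3) = true at k
  rw [M.digit_eq_mergedDigit hab h₁ ha1 hb1 ha2 hb2, M.digit_eq_mergedDigit hab h₃ ha3 hb3 ha4 hb4,
    M.digit_eq_mergedDigit hab h13 ha1 hb1 ha3 hb3, M.digit_eq_mergedDigit hab h24 ha2 hb2 ha4 hb4,
    M.digit_eq_mergedDigit hab h14 ha1 hb1 ha4 hb4,
    M.digit_eq_mergedDigit hab h₂ ha2 hb2 ha3 hb3] at k
  refine (plueckerRel_congr (s := Nat.xor (Nat.xor (betweenDigit a b x1) (betweenDigit a b x2))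
    (Nat.xor (betweenDigit a b x3) (betweenDigit a b x4))) ?_ ?_ ?_).symm.trans k
  all_goals
    simp only [Nat.xor_eq]
    ac_rfl

end

section
variable {E : Type*} (M : UniformOrientedMatroid E)

theorem sixSigns_comap {e : Fin 6 → E} (he : Function.Injective e) :
    (M.comap e he).sixSigns 0 1 2 3 4 5 = M.sixSigns (e 0) (e 1) (e 2) (e 3) (e 4) (e 5) := by
  have key : ∀ i j k l : Fin 6, (M.comap e he).digit i j k l =
      M.digit (e i) (e j) (e k) (e l) := by
    intro i j k l
    have h : e ∘ ![i, j, k, l] = ![e i, e j, e k, e l] := by ext x; fin_cases x <;> rfl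
    rw [digit, digit, ← h]; rfl
  simp only [sixSigns, key]

theorem sixSigns_valid {e : Fin 6 → E} (he : Function.Injective e) :
    (M.sixSigns (e 0) (e 1) (e 2) (e 3) (e 4) (e 5)).validFirst = true ∧
      (M.sixSigns (e 0) (e 1) (e 2) (e 3) (e 4) (e 5)).validRest = true := by
  rw [← M.sixSigns_comap he]
  generalize M.comap e he = N
  have key := fun (a b x1 x2 x3 x4 : Fin 6) h₁ h₂ h₃ h₄ h₅ h₆ h7 h8 h9 h10 h11 h12 =>
    N.plueckerRel_mergedDigit (a := a) (b := b) (x1 := x1) (x2 := x2) (x3 := x3) (x4 := x4)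
      h₁ h₂ h₃ h₄ h₅ h₆ h7 h8 h9 h10 h11 h12
  simp only [SixSigns.validFirst, SixSigns.validRest, Bool.and_eq_true]
  refine ⟨⟨⟨⟨⟨?_, ?_⟩, ?_⟩, ?_⟩, ?_⟩, ⟨⟨⟨⟨⟨⟨⟨⟨⟨?_, ?_⟩, ?_⟩, ?_⟩, ?_⟩, ?_⟩, ?_⟩, ?_⟩, ?_⟩, ?_⟩⟩
  · exact key 0 1 2 3 4 5 (by decide) (by decide) (by decide) (by decide) (by decide) (by decide)
      (by decide) (by decide) (by decide) (by decide) (by decide) (by decide)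
  · exact key 0 2 1 3 4 5 (by decide) (by decide) (by decide) (by decide) (by decide) (by decide)
      (by decide) (by decide) (by decide) (by decide) (by decide) (by decide)
  · exact key 0 3 1 2 4 5 (by decide) (by decide) (by decide) (by decide) (by decide) (by decide)
      (by decide) (by decide) (by decide) (by decide) (by decide) (by decide)
  · exact key 0 4 1 2 3 5 (by decide) (by decide) (by decide) (by decide) (by decide) (by decide)
      (by decide) (by decide) (by decide) (by decide) (by decide) (by decide)
  · exact key 0 5 1 2 3 4 (by decide) (by decide) (by decide) (by decide) (by decide) (by decide)
      (by decide) (by decide) (by decide) (by decide) (by decide) (by decide)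
  · exact key 1 2 0 3 4 5 (by decide) (by decide) (by decide) (by decide) (by decide) (by decide)
      (by decide) (by decide) (by decide) (by decide) (by decide) (by decide)
  · exact key 1 3 0 2 4 5 (by decide) (by decide) (by decide) (by decide) (by decide) (by decide)
      (by decide) (by decide) (by decide) (by decide) (by decide) (by decide)
  · exact key 1 4 0 2 3 5 (by decide) (by decide) (by decide) (by decide) (by decide) (by decide)
      (by decide) (by decide) (by decide) (by decide) (by decide) (by decide)
  · exact key 1 5 0 2 3 4 (by decide) (by decide) (by decide) (by decide) (by decide) (by decide)
      (by decide) (by decide) (by decide) (by decide) (by decide) (by decide)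
  · exact key 2 3 0 1 4 5 (by decide) (by decide) (by decide) (by decide) (by decide) (by decide)
      (by decide) (by decide) (by decide) (by decide) (by decide) (by decide)
  · exact key 2 4 0 1 3 5 (by decide) (by decide) (by decide) (by decide) (by decide) (by decide)
      (by decide) (by decide) (by decide) (by decide) (by decide) (by decide)
  · exact key 2 5 0 1 3 4 (by decide) (by decide) (by decide) (by decide) (by decide) (by decide)
      (by decide) (by decide) (by decide) (by decide) (by decide) (by decide)
  · exact key 3 4 0 1 2 5 (by decide) (by decide) (by decide) (by decide) (by decide) (by decide)
      (by decide) (by decide) (by decide) (by decide) (by decide) (by decide)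
  · exact key 3 5 0 1 2 4 (by decide) (by decide) (by decide) (by decide) (by decide) (by decide)
      (by decide) (by decide) (by decide) (by decide) (by decide) (by decide)
  · exact key 4 5 0 1 2 3 (by decide) (by decide) (by decide) (by decide) (by decide) (by decide)
      (by decide) (by decide) (by decide) (by decide) (by decide) (by decide)

end

end UniformOrientedMatroid

/-! ### The filtering procedure on the set of all five-element subsets -/

/-- Bitwise disjunction of the values of `f` below `n`, by recursion. -/
def orBelow (n : ℕ) (f : ℕ → ℕ) : ℕ := Nat.rec 0 (fun k ih => Nat.lor ih (f k)) n

-- Binomial coefficients in closed form, which the kernel evaluates by its built-in arithmetic.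
def binom2 (n : ℕ) : ℕ := Nat.div (Nat.mul n (Nat.sub n 1)) 2
def binom3 (n : ℕ) : ℕ := Nat.div (Nat.mul (Nat.mul n (Nat.sub n 1)) (Nat.sub n 2)) 6
def binom4 (n : ℕ) : ℕ :=
  Nat.div (Nat.mul (Nat.mul (Nat.mul n (Nat.sub n 1)) (Nat.sub n 2)) (Nat.sub n 3)) 24
def binom5 (n : ℕ) : ℕ :=
  Nat.div (Nat.mul (Nat.mul (Nat.mul (Nat.mul n (Nat.sub n 1)) (Nat.sub n 2)) (Nat.sub n 3))
    (Nat.sub n 4)) 120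
def binom6 (n : ℕ) : ℕ :=
  Nat.div (Nat.mul (Nat.mul (Nat.mul (Nat.mul (Nat.mul n (Nat.sub n 1)) (Nat.sub n 2))
    (Nat.sub n 3)) (Nat.sub n 4)) (Nat.sub n 5)) 720

/-- The position of the word of the five-element set `{g0 < g1 < g2 < g3 < g4}` in a state, a number
that contains a word of 32 digits for each of these sets, in colexicographic order. The digits of
the word say which circuits are still possible. The 64 lowest digits of the state are arbitrary. -/
def place (g0 g1 g2 g3 g4 : ℕ) : ℕ :=
  Nat.add 64 (Nat.mul 32 (Nat.add (Nat.add (Nat.add g0 (binom2 g1)) (Nat.add (binom3 g2)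
    (binom4 g3))) (binom5 g4)))

/-- The number of a six-element set in colexicographic order. -/
def sixRank (e0 e1 e2 e3 e4 e5 : ℕ) : ℕ :=
  Nat.add (Nat.add (Nat.add e0 (binom2 e1)) (Nat.add (binom3 e2) (binom4 e3)))
    (Nat.add (binom5 e4) (binom6 e5))

/-- The places of the five-element subsets of a six-element set, as six digits to the base `2 ^ 16`;
the digit number `o` belongs to the subset that omits the element number `o`. -/
def sixPlaces (e0 e1 e2 e3 e4 e5 : ℕ) : ℕ :=
  Nat.lor (place e1 e2 e3 e4 e5) <| Nat.lor (Nat.shiftLeft (place e0 e2 e3 e4 e5) 16) <|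
  Nat.lor (Nat.shiftLeft (place e0 e1 e3 e4 e5) 32) <|
  Nat.lor (Nat.shiftLeft (place e0 e1 e2 e4 e5) 48) <|
  Nat.lor (Nat.shiftLeft (place e0 e1 e2 e3 e5) 64) (Nat.shiftLeft (place e0 e1 e2 e3 e4) 80)

/-- The values `sixPlaces` for all six-element sets in colexicographic order, as digits to the base
`2 ^ 96`. -/
def sixTable : ℕ :=
  orBelow 12 fun e5 => orBelow e5 fun e4 => orBelow e4 fun e3 => orBelow e3 fun e2 =>
  orBelow e2 fun e1 => orBelow e1 fun e0 =>
    Nat.shiftLeft (sixPlaces e0 e1 e2 e3 e4 e5) (Nat.mul 96 (sixRank e0 e1 e2 e3 e4 e5))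

/-- For all seven-element sets in colexicographic order, the numbers of their six-element subsets,
as digits to the base `2 ^ 10`, again in colexicographic order. -/
def sevenTable : ℕ :=
  orBelow 12 fun u6 => orBelow u6 fun u5 => orBelow u5 fun u4 => orBelow u4 fun u3 =>
  orBelow u3 fun u2 => orBelow u2 fun u1 => orBelow u1 fun u0 =>
    Nat.shiftLeft
      (Nat.lor (sixRank u0 u1 u2 u3 u4 u5) <|
        Nat.lor (Nat.shiftLeft (sixRank u0 u1 u2 u3 u4 u6) 10) <|
        Nat.lor (Nat.shiftLeft (sixRank u0 u1 u2 u3 u5 u6) 20) <|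
        Nat.lor (Nat.shiftLeft (sixRank u0 u1 u2 u4 u5 u6) 30) <|
        Nat.lor (Nat.shiftLeft (sixRank u0 u1 u3 u4 u5 u6) 40) <|
        Nat.lor (Nat.shiftLeft (sixRank u0 u2 u3 u4 u5 u6) 50)
          (Nat.shiftLeft (sixRank u1 u2 u3 u4 u5 u6) 60))
      (Nat.mul 70 (Nat.add (sixRank u0 u1 u2 u3 u4 u5)
        (Nat.div (Nat.mul (binom6 u6) (Nat.sub u6 6)) 7)))

/-- The word at a place of a state. -/
def wordAt (st p : ℕ) : ℕ := Nat.land (Nat.shiftRight st p) 0xffffffff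

/-- The digit number `o` of `sixPlaces`. -/
def placeOf (ps o : ℕ) : ℕ := Nat.land (Nat.shiftRight ps (Nat.mul 16 o)) 0xffff

/-- The words of a state at six places, put together. -/
def gather (st ps : ℕ) : ℕ :=
  Nat.lor (wordAt st (placeOf ps 0)) <| Nat.lor (Nat.shiftLeft (wordAt st (placeOf ps 1)) 32) <|
  Nat.lor (Nat.shiftLeft (wordAt st (placeOf ps 2)) 64) <|
  Nat.lor (Nat.shiftLeft (wordAt st (placeOf ps 3)) 96) <|
  Nat.lor (Nat.shiftLeft (wordAt st (placeOf ps 4)) 128)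
    (Nat.shiftLeft (wordAt st (placeOf ps 5)) 160)

/-- Changes the digits of the words of a state at six places that are marked by the digits of `d`.
The lowest digits of the state are changed as well, for the reason given at `tagged`. -/
def scatter (st ps d : ℕ) : ℕ :=
  Nat.xor (Nat.xor st (Nat.mod (Nat.mul d (Nat.add ps 0x9e3779b97f4a7c15)) 0xffffffffffffffc5)) <|
  Nat.xor (Nat.shiftLeft (wordAt d 0) (placeOf ps 0)) <|
  Nat.xor (Nat.shiftLeft (wordAt d 32) (placeOf ps 1)) <|
  Nat.xor (Nat.shiftLeft (wordAt d 64) (placeOf ps 2)) <|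
  Nat.xor (Nat.shiftLeft (wordAt d 96) (placeOf ps 3)) <|
  Nat.xor (Nat.shiftLeft (wordAt d 128) (placeOf ps 4))
    (Nat.shiftLeft (wordAt d 160) (placeOf ps 5))

/-- Continues with the new state, given the words `w` before and `v` after filtering. It is `0` if
there is no possibility left. -/
def proceed (st ps w v : ℕ) (k : ℕ → Bool) : Bool :=
  Bool.rec (Bool.rec (evalFirst (scatter st ps (Nat.xor w v)) k) (k st) (Nat.beq v w)) (k 0)
    (Nat.beq v 0)

/-- Filters the words `w` and continues. -/
def proceedFrom (st ps w : ℕ) (k : ℕ → Bool) : Bool := proceed st ps w (SixFilter.filter w) k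

/-- The entry of the table of places for a six-element set. -/
def sixEntry (table s : ℕ) : ℕ :=
  Nat.land (Nat.shiftRight table (Nat.mul 96 s)) 0xffffffffffffffffffffffff

/-- Filters the words of the five-element subsets of the six-element set number `s`. -/
def filterSix (table s st : ℕ) (k : ℕ → Bool) : Bool :=
  Bool.rec
    (Bool.rec false
      (evalFirst (sixEntry table s) fun ps => proceedFrom st ps (gather st ps) k)
      (Nat.ble s 923))
    (k 0) (Nat.beq st 0)

/-- Filters for those of seven six-element sets that are marked by the digits of `h`. -/
def filterSeven (table sixes h : ℕ) : ℕ → (ℕ → Bool) → Bool :=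
  Nat.rec (fun st k => k st)
    (fun j ih st k => ih st fun st =>
      Bool.rec (k st)
        (filterSix table (Nat.land (Nat.shiftRight sixes (Nat.mul 10 j)) 0x3ff) st k)
        (Nat.beq (Nat.land (Nat.shiftRight h j) 1) 1))
    7

/-- The part of a state that contradicts the sign with digit `x` for the basis `{a < b < c < d}`.
Of the five masks, the `i`-th selects the circuits with a positive element number `i`. -/
def against (a b c d x : ℕ) : ℕ :=
  Nat.lor (orBelow a fun e =>
    Nat.shiftLeft (Nat.xor 0x5555aaaa (Nat.mul 0xffffffff x)) (place e a b c d)) <|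
  Nat.lor (orBelow (Nat.sub (Nat.sub b a) 1) fun k =>
    Nat.shiftLeft (Nat.xor 0x3333cccc (Nat.mul 0xffffffff (Nat.xor 1 x)))
      (place a (Nat.add (Nat.add a 1) k) b c d)) <|
  Nat.lor (orBelow (Nat.sub (Nat.sub c b) 1) fun k =>
    Nat.shiftLeft (Nat.xor 0x0f0ff0f0 (Nat.mul 0xffffffff x))
      (place a b (Nat.add (Nat.add b 1) k) c d)) <|
  Nat.lor (orBelow (Nat.sub (Nat.sub d c) 1) fun k =>
    Nat.shiftLeft (Nat.xor 0x00ffff00 (Nat.mul 0xffffffff (Nat.xor 1 x)))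
      (place a b c (Nat.add (Nat.add c 1) k) d))
  (orBelow (Nat.sub 11 d) fun k =>
    Nat.shiftLeft (Nat.xor 0xffff0000 (Nat.mul 0xffffffff x))
      (place a b c d (Nat.add (Nat.add d 1) k)))

/-- Removes from a state all digits that are `1` in `m`. -/
def without (st m : ℕ) : ℕ := Nat.xor st (Nat.land st m)

/-- The digit number `i` of `n` to the base 16. -/
def hexDigit (n i : ℕ) : ℕ := Nat.land (Nat.shiftRight n (Nat.mul 4 i)) 15

/-- The part of a state that contradicts the sign with digit `x` for a basis, which is given by its
elements as digits to the base 16. -/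
def againstBasis (basis x : ℕ) : ℕ :=
  against (hexDigit basis 0) (hexDigit basis 1) (hexDigit basis 2) (hexDigit basis 3) x

/-- The elements of a basis are in increasing order. -/
def basisSorted (basis : ℕ) : Bool :=
  Nat.ble (Nat.succ (hexDigit basis 0)) (hexDigit basis 1) &&
  Nat.ble (Nat.succ (hexDigit basis 1)) (hexDigit basis 2) &&
  Nat.ble (Nat.succ (hexDigit basis 2)) (hexDigit basis 3) && Nat.ble (hexDigit basis 3) 11

/-- The elements of the four-element sets as digits to the base 16, in colexicographic order. -/
def basisTable : ℕ :=
  orBelow 12 fun d => orBelow d fun c => orBelow c fun b => orBelow b fun a =>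
    Nat.shiftLeft (Nat.add (Nat.add a (Nat.mul 16 b)) (Nat.add (Nat.mul 256 c) (Nat.mul 4096 d)))
      (Nat.mul 16 (Nat.add (Nat.add a (binom2 b)) (Nat.add (binom3 c) (binom4 d))))

/-- The selections of six-element subsets of a seven-element set that occur in hints, as digits to
the base `2 ^ 7`. -/
def selections : ℕ := 0x7fcd6de83

/-- Continues with the first state of the stack `l` instead of `st` if `st` is `0`; the answer is
`true` if there is none. -/
def skipZero (st : ℕ) (l : List ℕ) (k : ℕ → List ℕ → Bool) : Bool :=
  Bool.rec (k st l) (List.rec true (fun st l _ => k st l) l) (Nat.beq st 0)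

/-- Interprets a hint `t`, given a state and a stack of further states. If `t < 3960`, then it
consists of the number of a seven-element set and a selection of its six-element subsets, for which
the state is filtered. Otherwise it is the number of a basis, and the signs of this basis are
distinguished: the state for the positive sign is put on the stack. -/
def readHint (table sevens bases t st : ℕ) (l : List ℕ) (k : ℕ → List ℕ → Bool) : Bool :=
  Bool.rec
    (evalFirst (Nat.land (Nat.shiftRight bases (Nat.mul 16 (Nat.sub t 3960))) 0xffff) fun basis =>
      basisSorted basis && evalFirst (without st (againstBasis basis 0)) fun s =>
      evalFirst (without st (againstBasis basis 1)) fun s' => k s (List.cons s' l))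
    (evalFirst (Nat.land (Nat.shiftRight sevens (Nat.mul 70 (Nat.mod t 792)))
        0x3fffffffffffffffff) fun sixes =>
      evalFirst (Nat.land (Nat.shiftRight selections (Nat.mul 7 (Nat.div t 792))) 0x7f) fun h =>
      filterSeven table sixes h st fun st => skipZero st l k)
    (Nat.blt t 3960)

/-- Interprets the `n` lowest digits of `x` to the base 4455. -/
def readHints (table sevens bases n : ℕ) : ℕ → ℕ → List ℕ → (ℕ → List ℕ → Bool) → Bool :=
  Nat.rec (fun _ st l k => k st l)
    (fun _ ih x st l k => evalFirst (Nat.mod x 4455) fun t => evalFirst (Nat.div x 4455) fun x =>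
      readHint table sevens bases t st l fun st l => ih x st l k)
    n

/-- Checks that a list of hints leads to a contradiction for `st` and for all states of the stack.
The hints amount to a proof by cases, written down in depth-first order. -/
def refutes (table sevens bases : ℕ) (hints : List ℕ) : ℕ → List ℕ → Bool :=
  List.rec (fun _ _ => false)
    (fun h _ ih st l => readHints table sevens bases 32 h st l fun st l => ih st l) hints

/-- The digits of a state for the circuits on `{g0 < ⋯ < g4}` with signs `±y`, and for all rotated
circuits, `n` times. The digits of `y` say which of the first four signs differ from the last. When
the last element passes to the first place, so does its sign. -/
def orbitMask (n : ℕ) : ℕ → ℕ → ℕ → ℕ → ℕ → ℕ → ℕ :=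
  Nat.rec (fun _ _ _ _ _ _ => 0)
    (fun _ ih g0 g1 g2 g3 g4 y =>
      Nat.lor (Nat.shiftLeft (Nat.shiftLeft 0x10001 y) (place g0 g1 g2 g3 g4))
        (Bool.rec
          (ih (Nat.add g0 1) (Nat.add g1 1) (Nat.add g2 1) (Nat.add g3 1) (Nat.add g4 1) y)
          (ih 0 (Nat.add g0 1) (Nat.add g1 1) (Nat.add g2 1) (Nat.add g3 1)
            (Nat.xor (Nat.land (Nat.mul 2 y) 15) (Nat.mul 15 (Nat.shiftRight y 3))))
          (Nat.beq g4 11)))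
    n

/-- The mask for a circuit up to sign, given by `y` and its elements as digits to the base 16, and
for all its rotations. -/
def circuitMask (c : ℕ) : ℕ :=
  orbitMask 12 (hexDigit c 0) (hexDigit c 1) (hexDigit c 2) (hexDigit c 3) (hexDigit c 4)
    (hexDigit c 5)

/-- The mask for a list of circuits. -/
def circuitMasks (l : List ℕ) : ℕ := List.rec 0 (fun c _ ih => Nat.lor (circuitMask c) ih) l

/-- The set of all digits of a state. -/
def fullState : ℕ := Nat.sub (Nat.pow 2 25408) 1

/-- The state in which the circuits marked in `f` are excluded and the circuit `c` is prescribed. -/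
def stateWith (f c : ℕ) : ℕ :=
  without (Nat.xor fullState f)
    (Nat.shiftLeft (Nat.xor 0xffffffff (Nat.shiftLeft 1 (hexDigit c 5)))
      (place (hexDigit c 0) (hexDigit c 1) (hexDigit c 2) (hexDigit c 3) (hexDigit c 4)))

/-- The elements of a circuit code are in increasing order. -/
def codeSorted (c : ℕ) : Bool :=
  Nat.ble (Nat.succ (hexDigit c 0)) (hexDigit c 1) &&
  (Nat.ble (Nat.succ (hexDigit c 1)) (hexDigit c 2) &&
  (Nat.ble (Nat.succ (hexDigit c 2)) (hexDigit c 3) &&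
  (Nat.ble (Nat.succ (hexDigit c 3)) (hexDigit c 4) && Nat.ble (hexDigit c 4) 11)))

/-- Checks that each of the listed circuits is refuted by its hints, using that the circuits marked
in `f` and the circuits before it in the list are excluded. -/
noncomputable def refutesAll (table sevens bases : ℕ) (l : List (ℕ × List ℕ)) : ℕ → Bool :=
  List.rec (fun _ => true)
    (fun c _ ih f => (codeSorted c.1 &&
      evalFirst (stateWith f c.1) fun st => refutes table sevens bases c.2 st List.nil) &&
      evalFirst (Nat.lor f (circuitMask c.1)) ih) l

/-- Checks the listed circuits, using that the circuits in `known` are excluded. -/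
noncomputable def refutesAllFrom (known : List ℕ) (l : List (ℕ × List ℕ)) : Bool :=
  evalFirst sixTable fun table => evalFirst sevenTable fun sevens =>
    evalFirst basisTable fun bases =>
    evalFirst (circuitMasks known) (refutesAll table sevens bases l)

/-! ### Soundness of the filtering procedure -/

theorem testBit_orBelow {n : ℕ} {f : ℕ → ℕ} {i : ℕ} :
    (orBelow n f).testBit i = true ↔ ∃ k < n, (f k).testBit i = true := by
  induction n with
  | zero => simp [orBelow]
  | succ n ih =>
    have e : orBelow (n + 1) f = orBelow n f ||| f n := rfl
    rw [e, Nat.testBit_lor, Bool.or_eq_true, ih]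
    constructor
    · rintro (⟨k, hk, h⟩ | h)
      · exact ⟨k, by omega, h⟩
      · exact ⟨n, by omega, h⟩
    · rintro ⟨k, hk, h⟩
      rcases Nat.lt_succ_iff_lt_or_eq.1 hk with hk | rfl
      · exact Or.inl ⟨k, hk, h⟩
      · exact Or.inr h

theorem testBit_wordAt (st p i : ℕ) :
    (wordAt st p).testBit i = (decide (i < 32) && st.testBit (p + i)) := by
  change ((st >>> p) &&& (2 ^ 32 - 1)).testBit i = _
  rw [Nat.testBit_land, Nat.testBit_two_pow_sub_one, Nat.testBit_shiftRight, Bool.and_comm]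

theorem wordAt_lt (st p : ℕ) : wordAt st p < 2 ^ 32 :=
  lt_of_le_of_lt Nat.and_le_right (by norm_num)

/-- The elements of a five-element set as digits to the base 16. -/
def fiveCode (g0 g1 g2 g3 g4 : ℕ) : ℕ :=
  Nat.add (Nat.add (Nat.add g0 (Nat.mul 16 g1)) (Nat.add (Nat.mul 256 g2) (Nat.mul 4096 g3)))
    (Nat.mul 65536 g4)

/-- The codes of the five-element sets, at their places. -/
def fiveTable : ℕ :=
  orBelow 12 fun g4 => orBelow g4 fun g3 => orBelow g3 fun g2 => orBelow g2 fun g1 =>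
  orBelow g1 fun g0 => Nat.shiftLeft (fiveCode g0 g1 g2 g3 g4) (place g0 g1 g2 g3 g4)

/-- `table` has the codes of the five-element sets at their places, which are within a state. -/
def placesCheck (table : ℕ) : Bool :=
  allBelow 12 fun g4 => allBelow g4 fun g3 => allBelow g3 fun g2 => allBelow g2 fun g1 =>
  allBelow g1 fun g0 =>
    Nat.beq (wordAt table (place g0 g1 g2 g3 g4)) (fiveCode g0 g1 g2 g3 g4) &&
    Nat.ble (place g0 g1 g2 g3 g4) 25376

theorem placesCheck_eq_true : evalFirst fiveTable placesCheck = true := by decide +kernel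

theorem place_spec {g0 g1 g2 g3 g4 : ℕ} (h0 : g0 < g1) (h₁ : g1 < g2) (h₂ : g2 < g3) (h₃ : g3 < g4)
    (h₄ : g4 < 12) : wordAt fiveTable (place g0 g1 g2 g3 g4) = fiveCode g0 g1 g2 g3 g4 ∧
      place g0 g1 g2 g3 g4 ≤ 25376 := by
  have h := placesCheck_eq_true
  rw [evalFirst_eq] at h
  have h := allBelow_iff.1 (allBelow_iff.1 (allBelow_iff.1 (allBelow_iff.1 (allBelow_iff.1 h
    g4 h₄) g3 h₃) g2 h₂) g1 h₁) g0 h0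
  rw [Bool.and_eq_true] at h
  exact ⟨Nat.eq_of_beq_eq_true h.1, Nat.le_of_ble_eq_true h.2⟩

theorem place_eq (g0 g1 g2 g3 g4 : ℕ) : ∃ r, place g0 g1 g2 g3 g4 = 64 + 32 * r := ⟨_, rfl⟩

theorem place_inj {g0 g1 g2 g3 g4 g0' g1' g2' g3' g4' : ℕ} (h0 : g0 < g1) (h₁ : g1 < g2)
    (h₂ : g2 < g3) (h₃ : g3 < g4) (h₄ : g4 < 12) (h0' : g0' < g1') (h1' : g1' < g2')
    (h2' : g2' < g3') (h3' : g3' < g4') (h4' : g4' < 12)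
    (h : place g0 g1 g2 g3 g4 = place g0' g1' g2' g3' g4') :
    g0 = g0' ∧ g1 = g1' ∧ g2 = g2' ∧ g3 = g3' ∧ g4 = g4' := by
  have e := (place_spec h0 h₁ h₂ h₃ h₄).1
  rw [h, (place_spec h0' h1' h2' h3' h4').1] at e
  simp only [fiveCode, Nat.add_eq, Nat.mul_eq] at e
  have e0 : g0 = g0' := by omega
  have e1 : g1 = g1' := by omega
  have e2 : g2 = g2' := by omega
  have e3 : g3 = g3' := by omega
  exact ⟨e0, e1, e2, e3, by omega⟩

/-- A word that is put at the place of one five-element set has no digits elsewhere. -/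
theorem testBit_shiftLeft_place {g0 g1 g2 g3 g4 g0' g1' g2' g3' g4' m i : ℕ} (h0 : g0 < g1)
    (h₁ : g1 < g2) (h₂ : g2 < g3) (h₃ : g3 < g4) (h₄ : g4 < 12) (h0' : g0' < g1') (h1' : g1' < g2')
    (h2' : g2' < g3') (h3' : g3' < g4') (h4' : g4' < 12) (hm : m < 2 ^ 32) (hi : i < 32)
    (h : (Nat.shiftLeft m (place g0' g1' g2' g3' g4')).testBit (place g0 g1 g2 g3 g4 + i) = true) :
    (g0 = g0' ∧ g1 = g1' ∧ g2 = g2' ∧ g3 = g3' ∧ g4 = g4') ∧ m.testBit i = true := by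
  change (m <<< place g0' g1' g2' g3' g4').testBit _ = true at h
  rw [Nat.testBit_shiftLeft, Bool.and_eq_true, decide_eq_true_eq] at h
  obtain ⟨r, hr⟩ := place_eq g0 g1 g2 g3 g4
  obtain ⟨r', hr'⟩ := place_eq g0' g1' g2' g3' g4'
  have hlt : place g0 g1 g2 g3 g4 + i - place g0' g1' g2' g3' g4' < 32 := by
    by_contra hc
    rw [Nat.testBit_lt_two_pow (hm.trans_le (Nat.pow_le_pow_right (by norm_num)
      (not_lt.1 hc)))] at h
    exact absurd h.2 (by simp)
  have e : place g0 g1 g2 g3 g4 = place g0' g1' g2' g3' g4' := by omega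
  refine ⟨place_inj h0 h₁ h₂ h₃ h₄ h0' h1' h2' h3' h4' e, ?_⟩
  rw [e, Nat.add_sub_cancel_left] at h
  exact h.2

theorem signatureIndex_lt {x0 x1 x2 x3 x4 : ℕ} (h0 : x0 < 2) (h₁ : x1 < 2) (h₂ : x2 < 2)
    (h₃ : x3 < 2) (h₄ : x4 < 2) : signatureIndex x0 x1 x2 x3 x4 < 32 := by
  interval_cases x0 <;> interval_cases x1 <;> interval_cases x2 <;> interval_cases x3 <;>
    interval_cases x4 <;> decide

/-- The vertex with a given number. -/
def vertex (n : ℕ) : Fin 12 := Fin.ofNat 12 n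

theorem vertex_inj {a b : ℕ} (ha : a < 12) (hb : b < 12) (h : vertex a = vertex b) : a = b := by
  have h := congrArg Fin.val h
  simp only [vertex, Fin.ofNat] at h
  rwa [Nat.mod_eq_of_lt ha, Nat.mod_eq_of_lt hb] at h

namespace UniformOrientedMatroid
variable (M : UniformOrientedMatroid (Fin 12))

/-- The digit for the sign of a basis, with elements given by natural numbers. -/
noncomputable def digitAt (a b c d : ℕ) : ℕ := M.digit (vertex a) (vertex b) (vertex c) (vertex d)

theorem digitAt_lt (a b c d : ℕ) : M.digitAt a b c d < 2 := M.digit_lt _ _ _ _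

/-- The index of the circuit of `M` on a five-element set. -/
noncomputable def circuitAt (g0 g1 g2 g3 g4 : ℕ) : ℕ :=
  signatureIndex (M.digitAt g1 g2 g3 g4) (M.digitAt g0 g2 g3 g4) (M.digitAt g0 g1 g3 g4)
    (M.digitAt g0 g1 g2 g4) (M.digitAt g0 g1 g2 g3)

theorem circuitAt_lt (g0 g1 g2 g3 g4 : ℕ) : M.circuitAt g0 g1 g2 g3 g4 < 32 :=
  signatureIndex_lt (M.digitAt_lt _ _ _ _) (M.digitAt_lt _ _ _ _) (M.digitAt_lt _ _ _ _)
    (M.digitAt_lt _ _ _ _) (M.digitAt_lt _ _ _ _)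

/-- All circuits of `M` are possible in the state `st`. -/
def PossibleIn (st : ℕ) : Prop :=
  ∀ g0 g1 g2 g3 g4, g0 < g1 → g1 < g2 → g2 < g3 → g3 < g4 → g4 < 12 →
    st.testBit (place g0 g1 g2 g3 g4 + M.circuitAt g0 g1 g2 g3 g4) = true

/-- No circuit of `M` is marked in `f`. -/
def Avoids (f : ℕ) : Prop :=
  ∀ g0 g1 g2 g3 g4, g0 < g1 → g1 < g2 → g2 < g3 → g3 < g4 → g4 < 12 →
    f.testBit (place g0 g1 g2 g3 g4 + M.circuitAt g0 g1 g2 g3 g4) = false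

end UniformOrientedMatroid

/-- The elements of the six-element sets, as digits to the base 16, in colexicographic order. -/
def sixCodes : ℕ :=
  orBelow 12 fun e5 => orBelow e5 fun e4 => orBelow e4 fun e3 => orBelow e3 fun e2 =>
  orBelow e2 fun e1 => orBelow e1 fun e0 =>
    Nat.shiftLeft (Nat.add (fiveCode e0 e1 e2 e3 e4) (Nat.mul 1048576 e5))
      (Nat.mul 24 (sixRank e0 e1 e2 e3 e4 e5))

/-- The entry `ps` belongs to the six-element set whose elements are the digits of `c`. -/
def entryCheck (ps c : ℕ) : Bool :=
  Nat.ble (Nat.succ (hexDigit c 0)) (hexDigit c 1) &&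
  (Nat.ble (Nat.succ (hexDigit c 1)) (hexDigit c 2) &&
  (Nat.ble (Nat.succ (hexDigit c 2)) (hexDigit c 3) &&
  (Nat.ble (Nat.succ (hexDigit c 3)) (hexDigit c 4) &&
  (Nat.ble (Nat.succ (hexDigit c 4)) (hexDigit c 5) &&
  (Nat.ble (Nat.succ (hexDigit c 5)) 12 &&
  (Nat.beq (placeOf ps 0)
    (place (hexDigit c 1) (hexDigit c 2) (hexDigit c 3) (hexDigit c 4) (hexDigit c 5)) &&
  (Nat.beq (placeOf ps 1)
    (place (hexDigit c 0) (hexDigit c 2) (hexDigit c 3) (hexDigit c 4) (hexDigit c 5)) &&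
  (Nat.beq (placeOf ps 2)
    (place (hexDigit c 0) (hexDigit c 1) (hexDigit c 3) (hexDigit c 4) (hexDigit c 5)) &&
  (Nat.beq (placeOf ps 3)
    (place (hexDigit c 0) (hexDigit c 1) (hexDigit c 2) (hexDigit c 4) (hexDigit c 5)) &&
  (Nat.beq (placeOf ps 4)
    (place (hexDigit c 0) (hexDigit c 1) (hexDigit c 2) (hexDigit c 3) (hexDigit c 5)) &&
  Nat.beq (placeOf ps 5)
    (place (hexDigit c 0) (hexDigit c 1) (hexDigit c 2) (hexDigit c 3) (hexDigit c 4))))))))))))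

/-- The table of places is correct for all six-element sets. -/
def entriesCheck (table codes : ℕ) : Bool :=
  allBelow 924 fun s => entryCheck (sixEntry table s)
    (Nat.land (Nat.shiftRight codes (Nat.mul 24 s)) 0xffffff)

theorem entriesCheck_eq_true :
    (evalFirst sixTable fun table => evalFirst sixCodes (entriesCheck table)) = true := by
  decide +kernel

theorem sixEntry_spec {s : ℕ} (hs : s < 924) :
    ∃ e0 e1 e2 e3 e4 e5, e0 < e1 ∧ e1 < e2 ∧ e2 < e3 ∧ e3 < e4 ∧ e4 < e5 ∧ e5 < 12 ∧
      placeOf (sixEntry sixTable s) 0 = place e1 e2 e3 e4 e5 ∧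
      placeOf (sixEntry sixTable s) 1 = place e0 e2 e3 e4 e5 ∧
      placeOf (sixEntry sixTable s) 2 = place e0 e1 e3 e4 e5 ∧
      placeOf (sixEntry sixTable s) 3 = place e0 e1 e2 e4 e5 ∧
      placeOf (sixEntry sixTable s) 4 = place e0 e1 e2 e3 e5 ∧
      placeOf (sixEntry sixTable s) 5 = place e0 e1 e2 e3 e4 := by
  have h := entriesCheck_eq_true
  rw [evalFirst_eq, evalFirst_eq] at h
  have h := allBelow_iff.1 h s hs
  simp only [entryCheck, Bool.and_eq_true] at h
  obtain ⟨h1, h2, h3, h4, h5, h6, h7, h8, h9, h10, h11, h12⟩ := h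
  exact ⟨_, _, _, _, _, _, Nat.le_of_ble_eq_true h1, Nat.le_of_ble_eq_true h2,
    Nat.le_of_ble_eq_true h3, Nat.le_of_ble_eq_true h4, Nat.le_of_ble_eq_true h5,
    Nat.le_of_ble_eq_true h6, Nat.eq_of_beq_eq_true h7, Nat.eq_of_beq_eq_true h8,
    Nat.eq_of_beq_eq_true h9, Nat.eq_of_beq_eq_true h10, Nat.eq_of_beq_eq_true h11,
    Nat.eq_of_beq_eq_true h12⟩

namespace UniformOrientedMatroid
variable {M : UniformOrientedMatroid (Fin 12)}

theorem testBit_gather_of {w0 w1 w2 w3 w4 w5 i0 i1 i2 i3 i4 i5 : ℕ} (h0 : w0.testBit i0 = true)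
    (h₁ : w1.testBit i1 = true) (h₂ : w2.testBit i2 = true) (h₃ : w3.testBit i3 = true)
    (h₄ : w4.testBit i4 = true) (h₅ : w5.testBit i5 = true) :
    SixFilter.Below
      (Nat.lor (Nat.shiftLeft 1 (Nat.add 0 i0)) <| Nat.lor (Nat.shiftLeft 1 (Nat.add 32 i1)) <|
        Nat.lor (Nat.shiftLeft 1 (Nat.add 64 i2)) <| Nat.lor (Nat.shiftLeft 1 (Nat.add 96 i3)) <|
        Nat.lor (Nat.shiftLeft 1 (Nat.add 128 i4)) (Nat.shiftLeft 1 (Nat.add 160 i5)))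
      (Nat.lor w0 <| Nat.lor (Nat.shiftLeft w1 32) <| Nat.lor (Nat.shiftLeft w2 64) <|
        Nat.lor (Nat.shiftLeft w3 96) <| Nat.lor (Nat.shiftLeft w4 128) (Nat.shiftLeft
          w5 160)) := by
  have key : ∀ {w i : ℕ} (s : ℕ), w.testBit i = true →
      SixFilter.Below (Nat.shiftLeft 1 (Nat.add s i)) (Nat.shiftLeft w s) := by
    intro w i s h j hj
    change (1 <<< (s + i)).testBit j = true at hj
    change (w <<< s).testBit j = true
    rw [Nat.one_shiftLeft, Nat.testBit_two_pow, decide_eq_true_eq] at hj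
    rw [← hj, Nat.testBit_shiftLeft]
    simp [h]
  exact (key 0 h0).lor ((key _ h₁).lor ((key _ h₂).lor ((key _ h₃).lor ((key _ h₄).lor
    (key _ h₅)))))

/-- The six circuits of `M` on the subsets of a six-element set. -/
noncomputable def wordOfSix (M : UniformOrientedMatroid (Fin 12)) (e0 e1 e2 e3 e4 e5 : ℕ) : ℕ :=
  (M.sixSigns (vertex e0) (vertex e1) (vertex e2) (vertex e3) (vertex e4)
    (vertex e5)).word

theorem wordOfSix_below_filter {e0 e1 e2 e3 e4 e5 : ℕ} (h0 : e0 < e1) (h₁ : e1 < e2) (h₂ : e2 < e3)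
    (h₃ : e3 < e4) (h₄ : e4 < e5) (h₅ : e5 < 12) :
    SixFilter.Below (M.wordOfSix e0 e1 e2 e3 e4 e5)
      (SixFilter.filter (M.wordOfSix e0 e1 e2 e3 e4 e5)) := by
  have inj : Function.Injective (fun i : Fin 6 => vertex (![e0, e1, e2, e3, e4, e5] i)) := by
    intro x y h
    have h := vertex_inj (by fin_cases x <;> simp <;> omega)
      (by fin_cases y <;> simp <;> omega) h
    fin_cases x <;> fin_cases y <;> first | rfl | (exfalso; simp at h; omega)
  exact SixSigns.word_below_filter (M.isBinary_sixSigns _ _ _ _ _ _) (M.sixSigns_valid inj).1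
    (M.sixSigns_valid inj).2

end UniformOrientedMatroid

/-! ### Soundness of refutations -/

namespace UniformOrientedMatroid
variable {M : UniformOrientedMatroid (Fin 12)}

theorem PossibleIn.below_gather {st ps : ℕ} (h : M.PossibleIn st) {e0 e1 e2 e3 e4 e5 : ℕ}
    (h0 : e0 < e1) (h1 : e1 < e2) (h2 : e2 < e3) (h3 : e3 < e4) (h4 : e4 < e5) (h5 : e5 < 12)
    (p0 : placeOf ps 0 = place e1 e2 e3 e4 e5) (p1 : placeOf ps 1 = place e0 e2 e3 e4 e5)
    (p2 : placeOf ps 2 = place e0 e1 e3 e4 e5) (p3 : placeOf ps 3 = place e0 e1 e2 e4 e5)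
    (p4 : placeOf ps 4 = place e0 e1 e2 e3 e5) (p5 : placeOf ps 5 = place e0 e1 e2 e3 e4) :
    SixFilter.Below (M.wordOfSix e0 e1 e2 e3 e4 e5) (gather st ps) := by
  have key : ∀ {g0 g1 g2 g3 g4 : ℕ}, g0 < g1 → g1 < g2 → g2 < g3 → g3 < g4 → g4 < 12 →
      (wordAt st (place g0 g1 g2 g3 g4)).testBit (M.circuitAt g0 g1 g2 g3 g4) = true := by
    intro g0 g1 g2 g3 g4 k0 k1 k2 k3 k4
    rw [testBit_wordAt, h _ _ _ _ _ k0 k1 k2 k3 k4, Bool.and_true, decide_eq_true_eq]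
    exact M.circuitAt_lt _ _ _ _ _
  unfold gather
  rw [p0, p1, p2, p3, p4, p5]
  exact testBit_gather_of (key h1 h2 h3 h4 h5) (key (h0.trans h1) h2 h3 h4 h5)
    (key h0 (h1.trans h2) h3 h4 h5) (key h0 h1 (h2.trans h3) h4 h5)
    (key h0 h1 h2 (h3.trans h4) h5) (key h0 h1 h2 h3 (h4.trans h5))

theorem testBit_wordOfSix (e0 e1 e2 e3 e4 e5 : ℕ) :
    (M.wordOfSix e0 e1 e2 e3 e4 e5).testBit (0 + M.circuitAt e1 e2 e3 e4 e5) = true ∧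
    (M.wordOfSix e0 e1 e2 e3 e4 e5).testBit (32 + M.circuitAt e0 e2 e3 e4 e5) = true ∧
    (M.wordOfSix e0 e1 e2 e3 e4 e5).testBit (64 + M.circuitAt e0 e1 e3 e4 e5) = true ∧
    (M.wordOfSix e0 e1 e2 e3 e4 e5).testBit (96 + M.circuitAt e0 e1 e2 e4 e5) = true ∧
    (M.wordOfSix e0 e1 e2 e3 e4 e5).testBit (128 + M.circuitAt e0 e1 e2 e3 e5) = true ∧
    (M.wordOfSix e0 e1 e2 e3 e4 e5).testBit (160 + M.circuitAt e0 e1 e2 e3 e4) = true := by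
  have h : M.wordOfSix e0 e1 e2 e3 e4 e5 =
      2 ^ (0 + M.circuitAt e1 e2 e3 e4 e5) ||| (2 ^ (32 + M.circuitAt e0 e2 e3 e4 e5) |||
      (2 ^ (64 + M.circuitAt e0 e1 e3 e4 e5) ||| (2 ^ (96 + M.circuitAt e0 e1 e2 e4 e5) |||
      (2 ^ (128 + M.circuitAt e0 e1 e2 e3 e5) ||| 2 ^ (160 + M.circuitAt e0 e1 e2 e3 e4))))) := by
    simp only [← Nat.one_shiftLeft]; rfl
  rw [h]
  simp only [Nat.testBit_lor, Nat.testBit_two_pow_self, Bool.or_true, Bool.true_or, and_self]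

theorem PossibleIn.scatter {st ps d : ℕ} (h : M.PossibleIn st) {e0 e1 e2 e3 e4 e5 : ℕ}
    (h0 : e0 < e1) (h1 : e1 < e2) (h2 : e2 < e3) (h3 : e3 < e4) (h4 : e4 < e5) (h5 : e5 < 12)
    (p0 : placeOf ps 0 = place e1 e2 e3 e4 e5) (p1 : placeOf ps 1 = place e0 e2 e3 e4 e5)
    (p2 : placeOf ps 2 = place e0 e1 e3 e4 e5) (p3 : placeOf ps 3 = place e0 e1 e2 e4 e5)
    (p4 : placeOf ps 4 = place e0 e1 e2 e3 e5) (p5 : placeOf ps 5 = place e0 e1 e2 e3 e4)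
    (hd : ∀ i, (M.wordOfSix e0 e1 e2 e3 e4 e5).testBit i = true → d.testBit i = false) :
    M.PossibleIn (scatter st ps d) := by
  intro g0 g1 g2 g3 g4 k0 k1 k2 k3 k4
  obtain ⟨b0, b1, b2, b3, b4, b5⟩ := testBit_wordOfSix (M := M) e0 e1 e2 e3 e4 e5
  have key : ∀ {s f0 f1 f2 f3 f4 : ℕ}, f0 < f1 → f1 < f2 → f2 < f3 → f3 < f4 → f4 < 12 →
      (M.wordOfSix e0 e1 e2 e3 e4 e5).testBit (s + M.circuitAt f0 f1 f2 f3 f4) = true →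
      (Nat.shiftLeft (wordAt d s) (place f0 f1 f2 f3 f4)).testBit
        (place g0 g1 g2 g3 g4 + M.circuitAt g0 g1 g2 g3 g4) = false := by
    intro s f0 f1 f2 f3 f4 l0 l1 l2 l3 l4 hb
    rw [← Bool.not_eq_true]
    intro hc
    obtain ⟨⟨rfl, rfl, rfl, rfl, rfl⟩, hc'⟩ := testBit_shiftLeft_place k0 k1 k2 k3 k4 l0 l1 l2 l3 l4
      (wordAt_lt _ _) (M.circuitAt_lt _ _ _ _ _) hc
    rw [testBit_wordAt, hd _ hb, Bool.and_false] at hc'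
    exact absurd hc' (by simp)
  have low : (Nat.mod (Nat.mul d (Nat.add ps 0x9e3779b97f4a7c15)) 0xffffffffffffffc5).testBit
      (place g0 g1 g2 g3 g4 + M.circuitAt g0 g1 g2 g3 g4) = false := by
    obtain ⟨r, hr⟩ := place_eq g0 g1 g2 g3 g4
    refine Nat.testBit_lt_two_pow (lt_of_lt_of_le (Nat.mod_lt _ (by norm_num)) ?_)
    exact le_trans (by norm_num : 0xffffffffffffffc5 ≤ 2 ^ 64)
      (Nat.pow_le_pow_right (by norm_num) (by omega))
  unfold _root_.scatter
  rw [p0, p1, p2, p3, p4, p5]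
  simp only [Nat.xor_eq, Nat.testBit_xor, h _ _ _ _ _ k0 k1 k2 k3 k4, low,
    key h1 h2 h3 h4 h5 b0, key (h0.trans h1) h2 h3 h4 h5 b1, key h0 (h1.trans h2) h3 h4 h5 b2,
    key h0 h1 (h2.trans h3) h4 h5 b3, key h0 h1 h2 (h3.trans h4) h5 b4,
    key h0 h1 h2 h3 (h4.trans h5) b5]
  rfl

theorem not_possibleIn_zero : ¬ M.PossibleIn 0 := fun h => by
  simpa using h 0 1 2 3 4 (by omega) (by omega) (by omega) (by omega) (by omega)

/-- If the procedure succeeds, then its continuation succeeds on some state, in which `M` is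
possible if it is in the original one. -/
theorem exists_of_filterSix {s st : ℕ} {k : ℕ → Bool} (hk : filterSix sixTable s st k = true) :
    ∃ st', k st' = true ∧ (M.PossibleIn st → M.PossibleIn st') := by
  unfold filterSix at hk
  rcases hz : Nat.beq st 0 with _ | _
  swap
  · rw [hz] at hk
    exact ⟨0, hk, fun h => Nat.eq_of_beq_eq_true hz ▸ h⟩
  rcases hs : Nat.ble s 923 with _ | _
  · rw [hz, hs] at hk; exact absurd hk (by simp)
  rw [hz, hs] at hk
  change evalFirst _ _ = true at hk
  rw [evalFirst_eq] at hk
  obtain ⟨e0, e1, e2, e3, e4, e5, h0, h1, h2, h3, h4, h5, p0, p1, p2, p3, p4, p5⟩ :=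
    sixEntry_spec (Nat.lt_succ_of_le (Nat.le_of_ble_eq_true hs))
  generalize sixEntry sixTable s = ps at *
  have hb := fun h : M.PossibleIn st => h.below_gather h0 h1 h2 h3 h4 h5 p0 p1 p2 p3 p4 p5
  have hf : M.PossibleIn st →
      SixFilter.Below (M.wordOfSix e0 e1 e2 e3 e4 e5) (SixFilter.filter (gather st ps)) :=
    fun h i hi => (hb h).filter i (wordOfSix_below_filter h0 h1 h2 h3 h4 h5 i hi)
  unfold proceedFrom proceed at hk
  generalize gather st ps = w at *
  generalize SixFilter.filter w = v at *
  rcases hv : Nat.beq v 0 with _ | _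
  · rw [hv] at hk
    rcases hw : Nat.beq v w with _ | _
    · rw [hw] at hk
      change evalFirst _ _ = true at hk
      rw [evalFirst_eq] at hk
      refine ⟨_, hk, fun h => h.scatter h0 h1 h2 h3 h4 h5 p0 p1 p2 p3 p4 p5 (fun i hi => ?_)⟩
      rw [Nat.xor_eq, Nat.testBit_xor, hb h i hi, hf h i hi]; rfl
    · rw [hw] at hk
      exact ⟨st, hk, id⟩
  · rw [hv] at hk
    refine ⟨0, hk, fun h => ?_⟩
    have := hf h _ (testBit_wordOfSix e0 e1 e2 e3 e4 e5).1
    rw [Nat.eq_of_beq_eq_true hv, Nat.zero_testBit] at this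
    exact absurd this (by simp)

theorem exists_of_filterSeven {sixes t st : ℕ} {k : ℕ → Bool}
    (hk : filterSeven sixTable sixes t st k = true) :
    ∃ st', k st' = true ∧ (M.PossibleIn st → M.PossibleIn st') := by
  unfold filterSeven at hk
  generalize 7 = n at hk
  induction n generalizing st k with
  | zero => exact ⟨st, hk, id⟩
  | succ n ih =>
    obtain ⟨st', hk', h'⟩ := ih hk
    rcases hb : Nat.beq (Nat.land (Nat.shiftRight t n) 1) 1 with _ | _
    · rw [hb] at hk'; exact ⟨st', hk', h'⟩
    · rw [hb] at hk'
      obtain ⟨st'', hk'', h''⟩ := exists_of_filterSix hk'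
      exact ⟨st'', hk'', h'' ∘ h'⟩

theorem PossibleIn.without {st m : ℕ} (h : M.PossibleIn st) (hm : M.Avoids m) :
    M.PossibleIn (without st m) := by
  intro g0 g1 g2 g3 g4 k0 k1 k2 k3 k4
  unfold _root_.without
  rw [Nat.xor_eq, Nat.testBit_xor, Nat.land_eq, Nat.testBit_land, h _ _ _ _ _ k0 k1 k2 k3 k4,
    hm _ _ _ _ _ k0 k1 k2 k3 k4]
  rfl

theorem Avoids.lor {a b : ℕ} (ha : M.Avoids a) (hb : M.Avoids b) : M.Avoids (Nat.lor a b) := by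
  intro g0 g1 g2 g3 g4 k0 k1 k2 k3 k4
  rw [Nat.lor_eq, Nat.testBit_lor, ha _ _ _ _ _ k0 k1 k2 k3 k4, hb _ _ _ _ _ k0 k1 k2 k3 k4]
  rfl

theorem avoids_orBelow {n : ℕ} {f : ℕ → ℕ} (h : ∀ k < n, M.Avoids (f k)) :
    M.Avoids (orBelow n f) := by
  intro g0 g1 g2 g3 g4 k0 k1 k2 k3 k4
  rw [← Bool.not_eq_true, testBit_orBelow]
  rintro ⟨k, hk, hb⟩
  rw [h k hk _ _ _ _ _ k0 k1 k2 k3 k4] at hb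
  exact absurd hb (by simp)

theorem avoids_shiftLeft_place {m g0 g1 g2 g3 g4 : ℕ} (h0 : g0 < g1) (h1 : g1 < g2) (h2 : g2 < g3)
    (h3 : g3 < g4) (h4 : g4 < 12) (hm : m < 2 ^ 32)
    (h : m.testBit (M.circuitAt g0 g1 g2 g3 g4) = false) :
    M.Avoids (Nat.shiftLeft m (place g0 g1 g2 g3 g4)) := by
  intro f0 f1 f2 f3 f4 k0 k1 k2 k3 k4
  rw [← Bool.not_eq_true]
  intro hc
  obtain ⟨⟨rfl, rfl, rfl, rfl, rfl⟩, hc'⟩ := testBit_shiftLeft_place k0 k1 k2 k3 k4 h0 h1 h2 h3 h4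
    hm (M.circuitAt_lt _ _ _ _ _) hc
  rw [h] at hc'
  exact absurd hc' (by simp)

theorem testBit_signatureIndex {x0 x1 x2 x3 x4 : ℕ} (h0 : x0 < 2) (h1 : x1 < 2) (h2 : x2 < 2)
    (h3 : x3 < 2) (h4 : x4 < 2) :
    (Nat.xor 0x5555aaaa (Nat.mul 0xffffffff x0)).testBit (signatureIndex x0 x1 x2 x3 x4) = false ∧
    (Nat.xor 0x3333cccc (Nat.mul 0xffffffff (Nat.xor 1 x1))).testBit
      (signatureIndex x0 x1 x2 x3 x4) = false ∧
    (Nat.xor 0x0f0ff0f0 (Nat.mul 0xffffffff x2)).testBit (signatureIndex x0 x1 x2 x3 x4) = false ∧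
    (Nat.xor 0x00ffff00 (Nat.mul 0xffffffff (Nat.xor 1 x3))).testBit
      (signatureIndex x0 x1 x2 x3 x4) = false ∧
    (Nat.xor 0xffff0000 (Nat.mul 0xffffffff x4)).testBit
      (signatureIndex x0 x1 x2 x3 x4) = false := by
  interval_cases x0 <;> interval_cases x1 <;> interval_cases x2 <;> interval_cases x3 <;>
    interval_cases x4 <;> decide

theorem avoids_against {a b c d : ℕ} (hab : a < b) (hbc : b < c) (hcd : c < d) (hd : d < 12) :
    M.Avoids (against a b c d (M.digitAt a b c d)) := by
  have key := fun p q r s t => testBit_signatureIndex (M.digitAt_lt q r s t) (M.digitAt_lt p r s t)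
    (M.digitAt_lt p q s t) (M.digitAt_lt p q r t) (M.digitAt_lt p q r s)
  have lt : ∀ n < 2 ^ 32, ∀ x < 2, Nat.xor n (Nat.mul 0xffffffff x) < 2 ^ 32 := by
    intro n hn x hx
    refine Nat.xor_lt_two_pow hn ?_
    interval_cases x <;> decide
  have lt1 := M.digitAt_lt a b c d
  have lt2 : Nat.xor 1 (M.digitAt a b c d) < 2 := by
    interval_cases M.digitAt a b c d <;> decide
  refine Avoids.lor (avoids_orBelow fun k hk => ?_) (Avoids.lor (avoids_orBelow fun k hk => ?_)
    (Avoids.lor (avoids_orBelow fun k hk => ?_) (Avoids.lor (avoids_orBelow fun k hk => ?_)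
      (avoids_orBelow fun k hk => ?_))))
  all_goals try simp only [Nat.sub_eq, Nat.add_eq] at hk ⊢
  · exact avoids_shiftLeft_place hk hab hbc hcd hd (lt _ (by norm_num) _ lt1) (key _ _ _ _ _).1
  · exact avoids_shiftLeft_place (by omega) (by omega) hbc hcd hd (lt _ (by norm_num) _ lt2)
      (key _ _ _ _ _).2.1
  · exact avoids_shiftLeft_place hab (by omega) (by omega) hcd hd (lt _ (by norm_num) _ lt1)
      (key _ _ _ _ _).2.2.1
  · exact avoids_shiftLeft_place hab hbc (by omega) (by omega) hd (lt _ (by norm_num) _ lt2)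
      (key _ _ _ _ _).2.2.2.1
  · exact avoids_shiftLeft_place hab hbc hcd (by omega) (by omega) (lt _ (by norm_num) _ lt1)
      (key _ _ _ _ _).2.2.2.2

/-- `M` is impossible in each of the states if the continuation of the procedure guarantees this. -/
theorem not_possibleIn_of_readHint {sevens bases t st : ℕ} {l : List ℕ} {k : ℕ → List ℕ → Bool}
    (h : readHint sixTable sevens bases t st l k = true)
    (hk : ∀ st l, k st l = true → ∀ s ∈ st :: l, ¬ M.PossibleIn s) :
    ∀ s ∈ st :: l, ¬ M.PossibleIn s := by
  unfold readHint at h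
  rcases ht : Nat.blt t 3960 with _ | _
  · rw [ht] at h
    change evalFirst _ _ = true at h
    rw [evalFirst_eq] at h
    generalize Nat.land _ 0xffff = basis at h
    rw [Bool.and_eq_true, evalFirst_eq, evalFirst_eq] at h
    obtain ⟨hs, h⟩ := h
    obtain ⟨h0, h⟩ := List.forall_mem_cons.1 (hk _ _ h)
    obtain ⟨h1, h⟩ := List.forall_mem_cons.1 h
    simp only [basisSorted, Bool.and_eq_true] at hs
    obtain ⟨⟨⟨hab, hbc⟩, hcd⟩, hd⟩ := hs
    have ha := avoids_against (M := M) (Nat.le_of_ble_eq_true hab) (Nat.le_of_ble_eq_true hbc)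
      (Nat.le_of_ble_eq_true hcd) (Nat.lt_succ_of_le (Nat.le_of_ble_eq_true hd))
    have hx := M.digitAt_lt (hexDigit basis 0) (hexDigit basis 1) (hexDigit basis 2)
      (hexDigit basis 3)
    generalize M.digitAt (hexDigit basis 0) (hexDigit basis 1) (hexDigit basis 2)
      (hexDigit basis 3) = x at *
    refine List.forall_mem_cons.2 ⟨fun hp => ?_, h⟩
    interval_cases x
    · exact h0 (hp.without ha)
    · exact h1 (hp.without ha)
  · rw [ht] at h
    change evalFirst _ _ = true at h
    rw [evalFirst_eq, evalFirst_eq] at h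
    obtain ⟨st', h, h'⟩ := exists_of_filterSeven (M := M) h
    unfold skipZero at h
    rcases hz : Nat.beq st' 0 with _ | _
    · rw [hz] at h
      have h := List.forall_mem_cons.1 (hk _ _ h)
      exact List.forall_mem_cons.2 ⟨fun hp => h.1 (h' hp), h.2⟩
    · rw [hz] at h
      refine List.forall_mem_cons.2
        ⟨fun hp => not_possibleIn_zero (Nat.eq_of_beq_eq_true hz ▸ h' hp), ?_⟩
      cases l with
      | nil => simp
      | cons s l => exact hk _ _ h

theorem not_possibleIn_of_readHints {sevens bases n x st : ℕ} {l : List ℕ}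
    {k : ℕ → List ℕ → Bool} (h : readHints sixTable sevens bases n x st l k = true)
    (hk : ∀ st l, k st l = true → ∀ s ∈ st :: l, ¬ M.PossibleIn s) :
    ∀ s ∈ st :: l, ¬ M.PossibleIn s := by
  induction n generalizing x st l with
  | zero => exact hk _ _ h
  | succ n ih =>
    have h : readHint sixTable sevens bases (Nat.mod x 4455) st l
      (readHints sixTable sevens bases n (Nat.div x 4455) · · k) = true := h
    exact not_possibleIn_of_readHint h fun _ _ h => ih h

theorem not_possibleIn_of_refutes {sevens bases st : ℕ} {hints l : List ℕ}
    (h : refutes sixTable sevens bases hints st l = true) : ∀ s ∈ st :: l, ¬ M.PossibleIn s := by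
  induction hints generalizing st l with
  | nil => exact absurd h (by simp [refutes])
  | cons x hints ih =>
    have h : readHints sixTable sevens bases 32 x st l
      (refutes sixTable sevens bases hints) = true := h
    exact not_possibleIn_of_readHints h fun _ _ h => ih h

end UniformOrientedMatroid

/-! ### Excluded circuits of rotation-invariant complexes -/

/-- The rotation of the vertices. -/
def vertexRotation : Fin 12 ↪ Fin 12 := ⟨fun v => v + 1, fun _ _ h => add_right_cancel h⟩

@[simp] theorem vertexRotation_apply (v : Fin 12) : vertexRotation v = v + 1 := rfl

/-- The rotation of the vertices maps faces to faces. -/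
def RotationInvariant (K : AbstractSimplicialComplex (Fin 12)) : Prop :=
  ∀ s ∈ K, s.map vertexRotation ∈ K

theorem mem_complexOf_of_subset {V : Type*} {T : Finset (Finset V)} {s t : Finset V}
    (ht : t ∈ complexOf T) (hst : s ⊆ t) (hs : s.Nonempty) : s ∈ complexOf T := by
  obtain ⟨-, ⟨v, rfl⟩ | ⟨u, hu, htu⟩⟩ := mem_complexOf.1 ht
  · exact mem_complexOf.2 ⟨hs, Or.inl ⟨v, (Finset.subset_singleton_iff.1 hst).resolve_left
      hs.ne_empty⟩⟩
  · exact mem_complexOf.2 ⟨hs, Or.inr ⟨u, hu, hst.trans htu⟩⟩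

theorem rotationInvariant_of_list {L : List (Fin 12 × Fin 12 × Fin 12)} (h : SurfaceList L)
    (hr : ∀ p ∈ L, tri L (p.1 + 1) (p.2.1 + 1) (p.2.2 + 1) = true) :
    RotationInvariant (complexOf (facetsOf L)) := by
  intro s hs
  have hne : s.Nonempty := (mem_complexOf.1 hs).1
  obtain ⟨-, ⟨v, rfl⟩ | ⟨t, ht, hst⟩⟩ := mem_complexOf.1 hs
  · exact mem_complexOf.2 ⟨by simp, Or.inl ⟨v + 1, by simp⟩⟩
  · obtain ⟨p, hp, rfl⟩ := mem_facetsOf.1 ht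
    refine mem_complexOf_of_subset ((triple_mem h).2 (hr p hp)).2 ?_ (by simpa using hne)
    intro x hx
    obtain ⟨y, hy, rfl⟩ := Finset.mem_map.1 hx
    have hy := hst hy
    simp only [triangleSet, Finset.mem_insert, Finset.mem_singleton] at hy
    rcases hy with rfl | rfl | rfl <;> simp

/-- No oriented matroid that is admissible for `K` has one of the circuits `±y` on
`{g0 < ⋯ < g4}`. -/
def ExcludedAt (K : AbstractSimplicialComplex (Fin 12)) (g0 g1 g2 g3 g4 y : ℕ) : Prop :=
  ∀ M : UniformOrientedMatroid (Fin 12), M.IsAdmissible K →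
    Nat.land (M.circuitAt g0 g1 g2 g3 g4) 15 ≠ y

/-- The signs of the rotated circuit when the last element passes to the first place. -/
def wrapSigns (y : ℕ) : ℕ := Nat.xor (Nat.land (Nat.mul 2 y) 15) (Nat.mul 15 (Nat.shiftRight y 3))

theorem signatureIndex_wrap {x0 x1 x2 x3 x4 : ℕ} (h₀ : x0 < 2) (h₁ : x1 < 2)
    (h₂ : x2 < 2) (h₃ : x3 < 2) (h₄ : x4 < 2) :
    wrapSigns (Nat.land (signatureIndex (Nat.xor 1 x0) (Nat.xor 1 x1) (Nat.xor 1 x2) (Nat.xor 1 x3)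
      x4) 15) = Nat.land (signatureIndex x4 x0 x1 x2 x3) 15 := by
  interval_cases x0 <;> interval_cases x1 <;> interval_cases x2 <;> interval_cases x3 <;>
    interval_cases x4 <;> decide

theorem wrapSigns_lt : ∀ y < 16, wrapSigns y < 16 := by
  decide +kernel

theorem wrapSigns_inj : ∀ y < 16, ∀ z < 16, wrapSigns y = wrapSigns z → y = z := by
  decide +kernel

namespace UniformOrientedMatroid
variable {M : UniformOrientedMatroid (Fin 12)} {K : AbstractSimplicialComplex (Fin 12)}

/-- The pullback along the rotation. -/
def rotate (M : UniformOrientedMatroid (Fin 12)) : UniformOrientedMatroid (Fin 12) :=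
  M.comap vertexRotation vertexRotation.injective

theorem IsAdmissible.rotate (hK : RotationInvariant K) (h : M.IsAdmissible K) :
    M.rotate.IsAdmissible K := by
  intro F hF G hG hd P N hc hPN
  exact h _ (hK F hF) _ (hK G hG) ((Finset.disjoint_map vertexRotation).2 hd) _ _ hc.of_comap
    ⟨Finset.map_subset_map.2 hPN.1, Finset.map_subset_map.2 hPN.2⟩

theorem rotation_vertex {a : ℕ} : vertexRotation (vertex a) = vertex (a + 1) := by
  apply Fin.ext
  simp [vertex, Fin.ofNat, Fin.val_add]

theorem digitAt_rotate (a b c d : ℕ) :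
    M.rotate.digitAt a b c d = M.digitAt (a + 1) (b + 1) (c + 1) (d + 1) := by
  unfold digitAt digit
  rw [← rotation_vertex, ← rotation_vertex, ← rotation_vertex, ← rotation_vertex]
  have e : vertexRotation ∘ ![vertex a, vertex b, vertex c, vertex d] = ![vertexRotation (vertex a),
      vertexRotation (vertex b), vertexRotation (vertex c), vertexRotation (vertex d)] := by
    ext x; fin_cases x <;> rfl
  rw [← e]; rfl

theorem digitAt_wrap {a b c : ℕ} (hab : a < b) (hbc : b < c) (hc : c < 11) :
    M.digitAt (a + 1) (b + 1) (c + 1) 12 = Nat.xor 1 (M.digitAt 0 (a + 1) (b + 1) (c + 1)) := by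
  have e : vertex 12 = vertex 0 := rfl
  unfold digitAt digit
  rw [e, ← signDigit_neg]
  · rw [swap_two_three, swap_one_two, swap_zero_one, neg_neg]
  · refine M.eq_one_or _ fun x y h => ?_
    have inj : ∀ {p q : ℕ}, p < 12 → q < 12 → p ≠ q → vertex p ≠ vertex q :=
      fun hp hq hpq h => hpq (vertex_inj hp hq h)
    have h1 := inj (p := 0) (q := a + 1) (by omega) (by omega) (by omega)
    have h2 := inj (p := 0) (q := b + 1) (by omega) (by omega) (by omega)
    have h3 := inj (p := 0) (q := c + 1) (by omega) (by omega) (by omega)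
    have h4 := inj (p := a + 1) (q := b + 1) (by omega) (by omega) (by omega)
    have h5 := inj (p := a + 1) (q := c + 1) (by omega) (by omega) (by omega)
    have h6 := inj (p := b + 1) (q := c + 1) (by omega) (by omega) (by omega)
    fin_cases x <;> fin_cases y <;> first | rfl | (exfalso; simp at h; tauto)

theorem circuitAt_rotate (g0 g1 g2 g3 g4 : ℕ) : M.rotate.circuitAt g0 g1 g2 g3 g4 =
    M.circuitAt (g0 + 1) (g1 + 1) (g2 + 1) (g3 + 1) (g4 + 1) := by
  simp only [circuitAt, digitAt_rotate]

theorem circuitAt_wrap {g0 g1 g2 g3 : ℕ} (h₀ : g0 < g1) (h₁ : g1 < g2) (h₂ : g2 < g3)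
    (h₃ : g3 < 11) : wrapSigns (Nat.land (M.rotate.circuitAt g0 g1 g2 g3 11) 15) =
      Nat.land (M.circuitAt 0 (g0 + 1) (g1 + 1) (g2 + 1) (g3 + 1)) 15 := by
  rw [circuitAt_rotate]
  unfold circuitAt
  rw [digitAt_wrap h₁ h₂ h₃, digitAt_wrap (h₀.trans h₁) h₂ h₃, digitAt_wrap h₀ (h₁.trans h₂) h₃,
    digitAt_wrap h₀ h₁ (h₂.trans h₃)]
  exact signatureIndex_wrap (M.digitAt_lt _ _ _ _) (M.digitAt_lt _ _ _ _) (M.digitAt_lt _ _ _ _)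
    (M.digitAt_lt _ _ _ _) (M.digitAt_lt _ _ _ _)

end UniformOrientedMatroid

theorem land_fifteen_lt (n : ℕ) : Nat.land n 15 < 16 :=
  lt_of_le_of_lt Nat.and_le_right (by norm_num)

open UniformOrientedMatroid in
theorem avoids_orbitMask {K : AbstractSimplicialComplex (Fin 12)} (hK : RotationInvariant K) :
    ∀ (n : ℕ) {g0 g1 g2 g3 g4 y : ℕ}, g0 < g1 → g1 < g2 → g2 < g3 → g3 < g4 → g4 < 12 → y < 16 →
      ExcludedAt K g0 g1 g2 g3 g4 y → ∀ M : UniformOrientedMatroid (Fin 12), M.IsAdmissible K →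
        M.Avoids (orbitMask n g0 g1 g2 g3 g4 y)
  | 0, _, _, _, _, _, _, _, _, _, _, _, _, _, _, _ =>
    fun _ _ _ _ _ _ _ _ _ _ => Nat.zero_testBit _
  | n + 1, g0, g1, g2, g3, g4, y, h₀, h₁, h₂, h₃, h₄, hy, h, M, hM => by
    refine Avoids.lor (a := Nat.shiftLeft (Nat.shiftLeft 0x10001 y) (place g0 g1 g2 g3 g4)) ?_ ?_
    · refine avoids_shiftLeft_place h₀ h₁ h₂ h₃ h₄ ?_ ?_
      · interval_cases y <;> decide
      · have hl := M.circuitAt_lt g0 g1 g2 g3 g4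
        have hn := h M hM
        generalize M.circuitAt g0 g1 g2 g3 g4 = i at *
        revert hn
        revert hl; revert i
        interval_cases y <;> decide
    · rcases hb : Nat.beq g4 11 with _ | _
      · have hne : g4 ≠ 11 := fun e => by rw [e] at hb; exact absurd hb (by decide)
        exact avoids_orbitMask hK n (by simp only [Nat.add_eq]; omega)
          (by simp only [Nat.add_eq]; omega) (by simp only [Nat.add_eq]; omega)
          (by simp only [Nat.add_eq]; omega) (by simp only [Nat.add_eq]; omega) hy
          (fun M hM he => h _ (hM.rotate hK) (by rw [circuitAt_rotate]; exact he)) M hM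
      · obtain rfl := Nat.eq_of_beq_eq_true hb
        refine avoids_orbitMask hK n (y := wrapSigns y) (Nat.succ_pos _)
          (by simp only [Nat.add_eq]; omega) (by simp only [Nat.add_eq]; omega)
          (by simp only [Nat.add_eq]; omega) (by simp only [Nat.add_eq]; omega) ?_
          (fun M hM he => h _ (hM.rotate hK) ?_) M hM
        · exact wrapSigns_lt y hy
        · exact wrapSigns_inj _ (land_fifteen_lt _) _ hy ((circuitAt_wrap h₀ h₁ h₂ h₃).trans he)

/-- The circuit with code `c` is excluded for `K`. -/
def Excluded (K : AbstractSimplicialComplex (Fin 12)) (c : ℕ) : Prop :=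
  codeSorted c = true ∧
    ExcludedAt K (hexDigit c 0) (hexDigit c 1) (hexDigit c 2) (hexDigit c 3) (hexDigit c 4)
      (hexDigit c 5)

theorem codeSorted_iff {c : ℕ} : codeSorted c = true ↔ hexDigit c 0 < hexDigit c 1 ∧
    hexDigit c 1 < hexDigit c 2 ∧ hexDigit c 2 < hexDigit c 3 ∧ hexDigit c 3 < hexDigit c 4 ∧
      hexDigit c 4 < 12 := by
  simp only [codeSorted, Bool.and_eq_true, Nat.ble_eq, Nat.succ_le_iff]
  rw [Nat.lt_succ_iff]

theorem avoids_circuitMasks {K : AbstractSimplicialComplex (Fin 12)} (hK : RotationInvariant K)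
    {l : List ℕ} (hl : ∀ c ∈ l, Excluded K c) {M : UniformOrientedMatroid (Fin 12)}
    (hM : M.IsAdmissible K) : M.Avoids (circuitMasks l) := by
  induction l with
  | nil => exact fun _ _ _ _ _ _ _ _ _ _ => Nat.zero_testBit _
  | cons c l ih =>
    obtain ⟨hs, hc⟩ := hl c (by simp)
    obtain ⟨h₀, h₁, h₂, h₃, h₄⟩ := codeSorted_iff.1 hs
    exact (avoids_orbitMask hK 12 h₀ h₁ h₂ h₃ h₄ (land_fifteen_lt _) hc M hM).lor
      (ih fun c h => hl c (by simp [h]))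

namespace UniformOrientedMatroid
variable {M : UniformOrientedMatroid (Fin 12)}

theorem signatureIndex_neg {x0 x1 x2 x3 x4 : ℕ} (h₀ : x0 < 2) (h₁ : x1 < 2)
    (h₂ : x2 < 2) (h₃ : x3 < 2) (h₄ : x4 < 2) :
    signatureIndex (Nat.xor 1 x0) (Nat.xor 1 x1) (Nat.xor 1 x2) (Nat.xor 1 x3) (Nat.xor 1 x4) =
      Nat.xor 16 (signatureIndex x0 x1 x2 x3 x4) := by
  interval_cases x0 <;> interval_cases x1 <;> interval_cases x2 <;> interval_cases x3 <;>
    interval_cases x4 <;> decide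

theorem digitAt_neg {a b c d : ℕ} (hab : a < b) (hbc : b < c) (hcd : c < d) (hd : d < 12) :
    M.neg.digitAt a b c d = Nat.xor 1 (M.digitAt a b c d) := by
  refine signDigit_neg (M.eq_one_or _ fun x y h => ?_)
  have inj : ∀ {p q : ℕ}, p < 12 → q < 12 → p ≠ q → vertex p ≠ vertex q :=
    fun hp hq hpq h => hpq (vertex_inj hp hq h)
  have h1 := inj (p := a) (q := b) (by omega) (by omega) (by omega)
  have h2 := inj (p := a) (q := c) (by omega) (by omega) (by omega)
  have h3 := inj (p := a) (q := d) (by omega) (by omega) (by omega)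
  have h4 := inj (p := b) (q := c) (by omega) (by omega) (by omega)
  have h5 := inj (p := b) (q := d) (by omega) (by omega) (by omega)
  have h6 := inj (p := c) (q := d) (by omega) (by omega) (by omega)
  fin_cases x <;> fin_cases y <;> first | rfl | (exfalso; simp at h; tauto)

theorem circuitAt_neg {g0 g1 g2 g3 g4 : ℕ} (h₀ : g0 < g1) (h₁ : g1 < g2) (h₂ : g2 < g3)
    (h₃ : g3 < g4) (h₄ : g4 < 12) :
    M.neg.circuitAt g0 g1 g2 g3 g4 = Nat.xor 16 (M.circuitAt g0 g1 g2 g3 g4) := by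
  unfold circuitAt
  rw [digitAt_neg h₁ h₂ h₃ h₄, digitAt_neg (h₀.trans h₁) h₂ h₃ h₄,
    digitAt_neg h₀ (h₁.trans h₂) h₃ h₄, digitAt_neg h₀ h₁ (h₂.trans h₃) h₄,
    digitAt_neg h₀ h₁ h₂ (h₃.trans h₄)]
  exact signatureIndex_neg (M.digitAt_lt _ _ _ _) (M.digitAt_lt _ _ _ _) (M.digitAt_lt _ _ _ _)
    (M.digitAt_lt _ _ _ _) (M.digitAt_lt _ _ _ _)

theorem testBit_fullState {i : ℕ} (h : i < 25408) : fullState.testBit i = true := by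
  -- the exponent is generalized in order to keep the power unevaluated
  obtain ⟨n, hn⟩ : ∃ n, n = 25408 := ⟨_, rfl⟩
  unfold fullState
  rw [← hn] at h ⊢
  exact (Nat.testBit_two_pow_sub_one n i).trans (decide_eq_true h)

theorem possibleIn_stateWith {f c : ℕ} (hf : M.Avoids f) (hs : codeSorted c = true)
    (hc : M.circuitAt (hexDigit c 0) (hexDigit c 1) (hexDigit c 2) (hexDigit c 3)
      (hexDigit c 4) = hexDigit c 5) : M.PossibleIn (stateWith f c) := by
  obtain ⟨h₀, h₁, h₂, h₃, h₄⟩ := codeSorted_iff.1 hs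
  have hy : hexDigit c 5 < 16 := land_fifteen_lt _
  refine PossibleIn.without ?_ (avoids_shiftLeft_place h₀ h₁ h₂ h₃ h₄ ?_ ?_)
  · intro g0 g1 g2 g3 g4 k0 k1 k2 k3 k4
    rw [Nat.xor_eq, Nat.testBit_xor, hf _ _ _ _ _ k0 k1 k2 k3 k4, Bool.xor_false]
    refine testBit_fullState ?_
    have := (place_spec k0 k1 k2 k3 k4).2
    have := M.circuitAt_lt g0 g1 g2 g3 g4
    omega
  · generalize hexDigit c 5 = y at *
    interval_cases y <;> decide
  · rw [hc]
    generalize hexDigit c 5 = y at *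
    interval_cases y <;> decide

end UniformOrientedMatroid

open UniformOrientedMatroid in
theorem excluded_of_refutes {K : AbstractSimplicialComplex (Fin 12)} {f c : ℕ}
    (hf : ∀ M : UniformOrientedMatroid (Fin 12), M.IsAdmissible K → M.Avoids f)
    (hs : codeSorted c = true) {sevens bases : ℕ} {r : List ℕ}
    (h : refutes sixTable sevens bases r (stateWith f c) [] = true) : Excluded K c := by
  refine ⟨hs, fun M hM hc => ?_⟩
  obtain ⟨h₀, h₁, h₂, h₃, h₄⟩ := codeSorted_iff.1 hs
  have hn := circuitAt_neg (M := M) h₀ h₁ h₂ h₃ h₄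
  have hl := M.circuitAt_lt (hexDigit c 0) (hexDigit c 1) (hexDigit c 2) (hexDigit c 3)
    (hexDigit c 4)
  -- replacing `M` by `-M` if necessary, the last sign of the circuit is negative
  have key : ∀ i < 32, i = Nat.land i 15 ∨ Nat.xor 16 i = Nat.land i 15 := by decide
  rcases key _ hl with e | e
  · exact not_possibleIn_of_refutes h _ (by simp) (possibleIn_stateWith (hf M hM) hs (e.trans hc))
  · exact not_possibleIn_of_refutes h _ (by simp)
      (possibleIn_stateWith (hf _ hM.neg) hs (hn.trans (e.trans hc)))

theorem excluded_of_refutesAll {K : AbstractSimplicialComplex (Fin 12)} (hK : RotationInvariant K)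
    {sevens bases : ℕ} {l : List (ℕ × List ℕ)} : ∀ {f : ℕ},
      (∀ M : UniformOrientedMatroid (Fin 12), M.IsAdmissible K → M.Avoids f) →
      refutesAll sixTable sevens bases l f = true → ∀ p ∈ l, Excluded K p.1 := by
  induction l with
  | nil => simp
  | cons c l ih =>
    intro f hf h p hp
    change ((codeSorted c.1 && evalFirst (stateWith f c.1) fun st =>
      refutes sixTable sevens bases c.2 st []) &&
      evalFirst (Nat.lor f (circuitMask c.1)) (refutesAll sixTable sevens bases l)) = true at h
    rw [evalFirst_eq, evalFirst_eq, Bool.and_eq_true, Bool.and_eq_true] at h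
    have hc := excluded_of_refutes hf h.1.1 h.1.2
    rcases List.mem_cons.1 hp with rfl | hp
    · exact hc
    · obtain ⟨h₀, h₁, h₂, h₃, h₄⟩ := codeSorted_iff.1 hc.1
      exact ih (fun M hM => (hf M hM).lor
        (avoids_orbitMask hK 12 h₀ h₁ h₂ h₃ h₄ (land_fifteen_lt _) hc.2 M hM)) h.2 p hp

/-- If the circuits in the list `known` are excluded, then so are the circuits that are refuted
using them. -/
theorem excluded_append {K : AbstractSimplicialComplex (Fin 12)} (hK : RotationInvariant K)
    {known : List ℕ} {l : List (ℕ × List ℕ)} (hl : ∀ c ∈ known, Excluded K c)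
    (h : refutesAllFrom known l = true) : ∀ c ∈ known ++ l.map Prod.fst, Excluded K c := by
  intro c hc
  rcases List.mem_append.1 hc with hc | hc
  · exact hl c hc
  · obtain ⟨p, hp, rfl⟩ := List.mem_map.1 hc
    rw [refutesAllFrom, evalFirst_eq, evalFirst_eq, evalFirst_eq, evalFirst_eq] at h
    exact excluded_of_refutesAll hK (fun M hM => avoids_circuitMasks hK hl hM) h p hp

/-- If all circuits on some five-element set are excluded, then there is no admissible oriented
matroid. -/
theorem not_exists_isAdmissible {K : AbstractSimplicialComplex (Fin 12)} (hK : RotationInvariant K)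
    {l : List ℕ} (hl : ∀ c ∈ l, Excluded K c) (c : ℕ) (hs : codeSorted c = true)
    (h : Nat.beq (wordAt (circuitMasks l) (place (hexDigit c 0) (hexDigit c 1) (hexDigit c 2)
      (hexDigit c 3) (hexDigit c 4))) 0xffffffff = true) :
    ¬ ∃ M : UniformOrientedMatroid (Fin 12), M.IsAdmissible K := by
  rintro ⟨M, hM⟩
  obtain ⟨h₀, h₁, h₂, h₃, h₄⟩ := codeSorted_iff.1 hs
  have ha := avoids_circuitMasks hK hl hM _ _ _ _ _ h₀ h₁ h₂ h₃ h₄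
  have hl := M.circuitAt_lt (hexDigit c 0) (hexDigit c 1) (hexDigit c 2) (hexDigit c 3)
    (hexDigit c 4)
  have h := congrArg (fun n => n.testBit (M.circuitAt (hexDigit c 0) (hexDigit c 1) (hexDigit c 2)
    (hexDigit c 3) (hexDigit c 4))) (Nat.eq_of_beq_eq_true h)
  simp only [testBit_wordAt, ha, Bool.and_false] at h
  rw [show (0xffffffff : ℕ) = 2 ^ 32 - 1 by norm_num, Nat.testBit_two_pow_sub_one] at h
  simp [hl] at h

/-! ### Circuits excluded by a pair of disjoint faces -/

/-- Whether a list of distinct vertices is a face of the surface with table `n`. -/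
def triBitFace (n : ℕ) : List ℕ → Bool
  | [_] => true
  | [a, b] => anyBelow 12 fun c => triBit n a b c
  | [a, b, c] => triBit n a b c
  | _ => false

/-- Those of the elements `g 0, …, g 4` whose bit in `w` is `x`. -/
def sideList (g : ℕ → ℕ) (w x : ℕ) : List ℕ :=
  (List.filter (fun k => Nat.beq (Nat.land (Nat.shiftRight w k) 1) x) [0, 1, 2, 3, 4]).map g

/-- The positive and the negative elements of the circuit with code `c` both form a face. -/
def separatesFaces (n c : ℕ) : Bool :=
  codeSorted c && (triBitFace n (sideList (hexDigit c) (hexDigit c 5) 0) &&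
    triBitFace n (sideList (hexDigit c) (hexDigit c 5) 1))

theorem val_vertex {a : ℕ} (ha : a < 12) : (vertex a).val = a := Nat.mod_eq_of_lt ha

theorem mem_of_triBitFace {L : List (Fin 12 × Fin 12 × Fin 12)} (h : SurfaceList L) {l : List ℕ}
    (hl : ∀ a ∈ l, a < 12) (hf : triBitFace (cyclicTable L) l = true) :
    (l.map vertex).toFinset ∈ complexOf (facetsOf L) := by
  match l, hf with
  | [a], _ => exact mem_complexOf.2 ⟨by simp, Or.inl ⟨vertex a, by simp⟩⟩
  | [a, b], hf =>
    change anyBelow 12 (fun c => triBit (cyclicTable L) a b c) = true at hf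
    obtain ⟨c, hc, hf⟩ := anyBelow_iff.1 hf
    rw [← val_vertex (hl a (by simp)), ← val_vertex (hl b (by simp)), ← val_vertex hc,
      ← tri_eq] at hf
    simpa using ((adj_iff h).2 ⟨_, hf⟩).2
  | [a, b, c], hf =>
    change triBit _ a b c = true at hf
    rw [← val_vertex (hl a (by simp)), ← val_vertex (hl b (by simp)),
      ← val_vertex (hl c (by simp)), ← tri_eq] at hf
    simpa using ((triple_mem h).2 hf).2

theorem triBitFace_of_mem {L : List (Fin 12 × Fin 12 × Fin 12)} (h : SurfaceList L) {l : List ℕ}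
    (hl : ∀ a ∈ l, a < 12) (hd : l.Nodup)
    (hf : (l.map vertex).toFinset ∈ complexOf (facetsOf L)) :
    triBitFace (cyclicTable L) l = true := by
  match l, hd, hf with
  | [], _, hf => exact absurd (mem_complexOf.1 hf).1 (by simp)
  | [a], _, _ => rfl
  | [a, b], hd, hf =>
    have hab : vertex a ≠ vertex b := fun e => by
      simp [vertex_inj (hl a (by simp)) (hl b (by simp)) e] at hd
    obtain ⟨c, hc⟩ := (adj_iff h).1 ⟨hab, by simpa using hf⟩
    rw [tri_eq, val_vertex (hl a (by simp)), val_vertex (hl b (by simp))] at hc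
    exact anyBelow_iff.2 ⟨c, c.isLt, hc⟩
  | [a, b, c], hd, hf =>
    have inj : ∀ x ∈ [a, b, c], ∀ y ∈ [a, b, c], vertex x = vertex y → x = y :=
      fun x hx y hy e => vertex_inj (hl x hx) (hl y hy) e
    simp only [List.nodup_cons, List.mem_cons, List.not_mem_nil, or_false, not_or] at hd
    have hc := (triple_mem h).1 ⟨⟨fun e => hd.1.1 (inj a (by simp) b (by simp) e),
      fun e => hd.2.1 (inj b (by simp) c (by simp) e),
      fun e => hd.1.2 (inj a (by simp) c (by simp) e)⟩, by simpa using hf⟩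
    rwa [tri_eq, val_vertex (hl a (by simp)), val_vertex (hl b (by simp)),
      val_vertex (hl c (by simp))] at hc
  | a :: b :: c :: d :: l, hd, hf =>
    exfalso
    have hn : ((a :: b :: c :: d :: l).map vertex).Nodup :=
      hd.map_on fun x hx y hy e => vertex_inj (hl x hx) (hl y hy) e
    have hcard : ((a :: b :: c :: d :: l).map vertex).toFinset.card = l.length + 4 := by
      rw [List.toFinset_card_of_nodup hn]; simp
    have := (isTriangulatedSurface_of_surfaceList h).card_le _ hf
    omega

theorem mem_sideList {g : ℕ → ℕ} {w x : ℕ} {v : Fin 12} :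
    v ∈ ((sideList g w x).map vertex).toFinset ↔
      ∃ i : Fin 5, vertex (g i) = v ∧ Nat.land (Nat.shiftRight w i) 1 = x := by
  rw [List.mem_toFinset, List.mem_map]
  constructor
  · rintro ⟨a, ha, rfl⟩
    obtain ⟨k, hk, rfl⟩ := List.mem_map.1 ha
    obtain ⟨hk, hx⟩ := List.mem_filter.1 hk
    have hk : k < 5 := by simp at hk; omega
    exact ⟨⟨k, hk⟩, rfl, Nat.eq_of_beq_eq_true hx⟩
  · rintro ⟨i, rfl, hi⟩
    refine ⟨g i, List.mem_map.2 ⟨i, List.mem_filter.2 ⟨?_, by rw [hi]; exact Nat.beq_refl x⟩,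
      rfl⟩, rfl⟩
    fin_cases i <;> simp

open UniformOrientedMatroid in
theorem bit_signatureIndex {z : Fin 5 → ℤ} (hz : ∀ i, z i = 1 ∨ z i = -1) (i : Fin 5) :
    (-z 4 * (-1) ^ (i : ℕ) * z i = 1 ↔ Nat.land (Nat.shiftRight (Nat.land (signatureIndex
      (signDigit (z 0)) (signDigit (z 1)) (signDigit (z 2)) (signDigit (z 3)) (signDigit (z 4)))
        15) i) 1 = 1) ∧
    (-z 4 * (-1) ^ (i : ℕ) * z i = -1 ↔ Nat.land (Nat.shiftRight (Nat.land (signatureIndex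
      (signDigit (z 0)) (signDigit (z 1)) (signDigit (z 2)) (signDigit (z 3)) (signDigit (z 4)))
        15) i) 1 = 0) := by
  have h0 := hz 0
  have h1 := hz 1
  have h2 := hz 2
  have h3 := hz 3
  have h4 := hz 4
  fin_cases i <;> rcases h0 with h0 | h0 <;> rcases h1 with h1 | h1 <;>
    rcases h2 with h2 | h2 <;> rcases h3 with h3 | h3 <;> rcases h4 with h4 | h4 <;>
    simp only [Fin.zero_eta, Fin.mk_one, Fin.reduceFinMk, h0, h1, h2, h3, h4] <;> decide

open UniformOrientedMatroid in
theorem excluded_of_separatesFaces {L : List (Fin 12 × Fin 12 × Fin 12)} (h : SurfaceList L)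
    {c : ℕ} (hc : separatesFaces (cyclicTable L) c = true) :
    Excluded (complexOf (facetsOf L)) c := by
  rw [separatesFaces, Bool.and_eq_true, Bool.and_eq_true] at hc
  obtain ⟨hs, h0, h1⟩ := hc
  refine ⟨hs, fun M hM he => ?_⟩
  obtain ⟨l0, l1, l2, l3, l4⟩ := codeSorted_iff.1 hs
  have lt : ∀ k ∈ [0, 1, 2, 3, 4], hexDigit c k < 12 := by
    intro k hk
    simp only [List.mem_cons, List.not_mem_nil, or_false] at hk
    rcases hk with rfl | rfl | rfl | rfl | rfl <;> omega
  have lts : ∀ x, ∀ a ∈ sideList (hexDigit c) (hexDigit c 5) x, a < 12 := by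
    intro x a ha
    obtain ⟨k, hk, rfl⟩ := List.mem_map.1 ha
    exact lt k (List.mem_filter.1 hk).1
  have inj : Function.Injective fun i : Fin 5 => vertex (hexDigit c i) := by
    intro i j hij
    have hij := vertex_inj (lt i (by fin_cases i <;> simp)) (lt j (by fin_cases j <;> simp)) hij
    fin_cases i <;> fin_cases j <;> first | rfl | (exfalso; simp at hij; omega)
  set g : Fin 5 → Fin 12 := fun i => vertex (hexDigit c i)
  have hz : ∀ i : Fin 5, M.χ (g ∘ i.succAbove) = 1 ∨ M.χ (g ∘ i.succAbove) = -1 := fun i =>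
    M.eq_one_or _ (inj.comp Fin.succAbove_right_injective)
  have hw : hexDigit c 5 = Nat.land (signatureIndex (signDigit (M.χ (g ∘ (0 : Fin 5).succAbove)))
      (signDigit (M.χ (g ∘ (1 : Fin 5).succAbove))) (signDigit (M.χ (g ∘ (2 : Fin 5).succAbove)))
      (signDigit (M.χ (g ∘ (3 : Fin 5).succAbove))) (signDigit (M.χ (g ∘ (4 : Fin 5).succAbove))))
      15 := by
    rw [← he]
    congr 1
    unfold circuitAt digitAt digit
    congr 3 <;> (ext i; fin_cases i <;> rfl)
  have hb := bit_signatureIndex hz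
  simp only [← hw] at hb
  refine hM _ (mem_of_triBitFace h (lts 1) h1) _ (mem_of_triBitFace h (lts 0) h0) ?_
    ((sideList (hexDigit c) (hexDigit c 5) 1).map vertex).toFinset
    ((sideList (hexDigit c) (hexDigit c 5) 0).map vertex).toFinset
    ⟨g, inj, -M.χ (g ∘ (4 : Fin 5).succAbove), ?_, fun e => ?_, fun e => ?_⟩
    ⟨subset_rfl, subset_rfl⟩
  · rw [Finset.disjoint_left]
    intro v hv hv'
    obtain ⟨i, rfl, hi⟩ := mem_sideList.1 hv
    obtain ⟨j, hj, hj'⟩ := mem_sideList.1 hv'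
    obtain rfl := inj hj
    rw [hi] at hj'
    exact one_ne_zero hj'
  · rcases hz 4 with h | h <;> simp [h]
  · rw [mem_sideList]
    exact exists_congr fun i => and_congr_right fun _ => (hb i).1.symm
  · rw [mem_sideList]
    exact exists_congr fun i => and_congr_right fun _ => (hb i).2.symm

/-- The refutations in `r` from number `k` on may use the preceding ones. -/
theorem excluded_take_add {K : AbstractSimplicialComplex (Fin 12)} (hK : RotationInvariant K)
    {known : List ℕ} {r : List (ℕ × List ℕ)} {k : ℕ} (n : ℕ)
    (hr : ∀ c ∈ known ++ (r.take k).map Prod.fst, Excluded K c)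
    (h : refutesAllFrom (known ++ (r.take k).map Prod.fst) ((r.drop k).take n) = true) :
    ∀ c ∈ known ++ (r.take (k + n)).map Prod.fst, Excluded K c := by
  rw [List.take_add, List.map_append, ← List.append_assoc]
  exact excluded_append hK hr h

/-! ### Refutations for `lutz11` -/

/-- Codes of the circuits of the pairs of disjoint faces of `lutz11`, one from each orbit of the
rotation. -/
def lutz11FacePairs : List ℕ := [
0x343210, 0x743210, 0xe43210, 0x753210, 0xa53210, 0xe53210, 0x754210, 0xa54210, 0x354310, 0x354320,
0xc54320, 0xe54320, 0x563210, 0x763210, 0x764210, 0x964310, 0x765210, 0xd65210, 0x965310, 0xb65320,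
0x365410, 0x365420, 0xb65420, 0x365430, 0x673210, 0x773210, 0xe73210, 0x374210, 0x774210, 0xa74310,
0x574320, 0xa74320, 0xe74320, 0x775210, 0xa75310, 0xa75320, 0xb75320, 0x975420, 0xb75420, 0xc75430,
0xe75430, 0x776210, 0xa76310, 0xe76310, 0xa76320, 0xc76430, 0x376510, 0x376520, 0x776520, 0x376530,
0xc76530, 0x376540, 0xe76540, 0x584210, 0x684210, 0x784210, 0x584310, 0x684310, 0x684320, 0xe84320,
0x685210, 0x785210, 0xd85210, 0x385310, 0x685310, 0x385320, 0x685320, 0xb85320, 0x685410, 0x985410,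
0xa85410, 0x685420, 0xa85420, 0xb85420, 0x585430, 0x685430, 0xa85430, 0xe85430, 0x786210, 0xe86310,
0xa86410, 0xa86420, 0xa86430, 0xa86510, 0x786520, 0xa86520, 0xa86530, 0x987410, 0xa87420, 0xe87420,
0xa87430, 0xb87430, 0x787520, 0xa87520, 0x987530, 0xa87530, 0xb87530, 0x387630, 0xb87630, 0x596310,
0xe96310, 0x396410, 0x596410, 0xa96410, 0x396420, 0xa96420, 0x796520, 0x697420, 0xa97420, 0xe97420]

/-- Circuits that no admissible oriented matroid of `lutz11` has, each with hints that refute it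
using the preceding ones. -/
def lutz11Refutations : List (ℕ × List ℕ) := [
(0x297420, [
0x4fbeac9f642bff2d76e25689297d43ebd0034ac92f6db9e775f54b09159dd26e152603978b83e5585029d16de06953307,
0xcf1b427f52e018302c199230b2d7065b744e554fd31a80bb7ff23c6d64844cb4b4bc1067977a28d07be04115a6d1d5cb3,
0xbe6ad6cac420fef0a03bcca637da60aa44b4de1821ac29e31c7c8656c9ba662a2ec112dc57295c4875ffed33237e37834,
0xc91d58462449c84d1b71738f564d85f783089c19cae86b3a86c8c2c93fc048452c861bfc5fb1b3cfcf932643998fa8f47,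
0x3b24564d2bc567e7fbc21ca1c4257d04c69dbeb4a3f5ce6aa69ccafd73e91004d772ab525ba9294a035a3b9d10fbe9793,
0xc2a55378439c6feeaf575e1c74da819f5266fd122771e6676b36d1ec1b110f0b4c917243e770debaa7a3c7f9a4c466695,
0xb857ac705a1987cb01efeb516531ea445131d7feb97d084efcba2d5711d3a260a50d38fc20018bb8e34d49b10428e4b64,
0x2d819362014f710cecd77f66595af79940f67cce6cbef8ee4982688b30c23871343d201215719f6f5dc7d92c814b8fd4d,
0x82363a221aec1b6f5c4e6c7e828d8992d76573018be213fd3d360ed1c16d9d8136f0b2b1e44db3068fbf48de089841c8a,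
0x24979352f01f53222090f4804cc7d897a6a63d87a0c3bfd9ff5407ea1800a89461264f3bcbf358bb32060b40d3ec4ee32,
0x39486de5da69c7cc9ff0c7981645308293fd14e112f36600f9ad4a5cd304da53e656cba93e816250c06ded95684bfab26,
0x6ffc32b66fdc74a422795bf7f55742c0ed4b2a7dca90177fa5f037790a7bd015fc7df9c9169cd093b484f016a75cbb664,
0x56c6992ebdab9c23fed1117028596e01c77cf507ad283e876a239dec81c748f7ff9dcf50f66d0c4472b8fb3d35ffeac53,
0xaae7fd91de6b2a59e72b02932fa7d37fda16e8968a1ccc492e73144d27a1eb446222c936f5d1acb7fcebd441857d24358,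
0x9cec52dccba7a4e5cd8e08ff89ff11b75c0ff986240f6b08c70c63c68eab2b2a2c70d4456d6efa5c6def3ff77625ce483,
0x533874613fd11d18e37b160ef82b4b7206b196595cadb252a4c4b34a33da57903a7f47e480243c20d88b778858ac25cf8,
0x914aaeab8366561b9106825320ea30e157bea9c3b6491eb9b795d8c3cc8e26a7a73e55f91314cab1a23f77cbd51cbf3ad,
0xcd6dbb95858bfcb7d23611634a9deff87b4222669b6ae9b536a449db355945af08eb1667c543cd2744807bbe0b8586ddb,
0x3774b1cada0af13c28db9e55bbed6b77709cb0d6af2b7096beac784fe64bff9f3b4e7cd43c755b8fda6e613fe64db0049,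
0x3902f86765496ae14dec0a947e6121fd923d7f272184af821c4e954bdcbbf713a06f7b2b1129fc499a93f16a3cafeed08,
0x635ab6cc5028c9bc60eaea53f6e946f186a241d192edb32e8d4c95cc2b5e0774035d1a3e7b9ac18da768db852acaf322,
0x6c13561f6da95947ef865aec39f946dfe58bcf802f237cf6707cf86de3f45379f14413af9127c947d33a2fa70ec77f475,
0x1845cda70f572eeb8afee34789824797df7864316c98ec10f76d64a3c854d3f34e636222063bbcb02d017aa3395155e4,
0xc93436e5000d85e89341028a32a9ace829faa5453ef9a865985439911e4df62b3d740d39509562d786e1816ca1b1e1066,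
0xaf28d8184473b0405f0294a06b0a42644bb91ee3e65f5da26fa0a151c59e13260a975fd1ede42d985d77a9539e9870f1b,
0x72151c38dd47dc141c95bf06050e8944912e93a409c7ea9338ab1da9786b33a0ebfcb0f3abff450c0c29281dfbca9c02d,
0x34bd368ca0f537fdb559a8e5e0b432d8e8deb607e21fef6ba4f4bfc1fdb7b1eace17e6d6f9dd0d848c37841a8bae52c9b,
0x5e841c473e69c6c124fc6d25cf92d512998c7465255dc395fe38ef9fc852a75b38fd9a0ddc6de58ddc9c151c402df6d36,
0x67e28b53455cd61f2bbc316cf22e642a9eb98faac9c561d7601b63407650f8dbea24c1dcce0da54b065b34fbdb2e879db,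
0x149e84e675bc75d9cf3c0c7c62dcf243d851a9523020810f5b9e753f9777ed7403d98e87ff78f73ca4fcc08015937afb7,
0x7c8015cf88593af588f6cb76a7d4c61698ef21a45308bced4e1c20f519b59099e8c3d8848b4c80581f0d73a1a6dd6e3a5,
0x3b2130408bcfc697e98af496ebef61d47bfe5dc2aa276a5721c2e4e47de966203a1dd462440a3324a92924b0e1e8078a7,
0xba3b6a3963e20436dfab675c07f0a60b98274fb114a370ec3e25e602231001f4a4c645086fe22f64b540804bcea91e821,
0xa7d48bbbbcc1d3beb56182089bcff747394cc07fa0a45ea3c660a125654c7bb26f1c8b0008762569e201a7c74d1f15f18,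
0x5b4d487979754fea4394d736bf3e569956661c0cbb7a0ad447f383b38a7072069bf5c1ecd9a96256cefceaaa5958e4067,
0x83c337162f14f6e2b27c06111665c5f29af651230bafbf245f743925bb91b7e90dedd4aff522e17da3448975de90a1e26,
0x583da71ce3b41a6580834bd220cd87f6a8938dd74795632124e197d0b4b3ea43df7a2b45b6ec0c7f1567f11824b7d2de6,
0x8012024310b60a61682533aa40a1b09c24117df339dc43aaa27868c238f8ba5f6f924d166e866c60fb7e1265320a6822d,
0x71db4e8dd0947fc627199acd65a01fc1ab6fdeff75ee95be5531f8086db23ddc49a8cf6aa4f8f79d7f89df723e2b68e0b,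
0x2982b11af9f3a436a8569480ac721dade7f29563ce004444b74cbfee131ccb119e05c6a9a87734f13340983f4b710398b,
0x4f52ce313472f242f84b78f73735375578fe5700494d2d766d764c4f7b2823a5cffbbea5b88709e2b519e719896f264d4,
0xc91e1bada89a2f1ffbaa94c1b8a2bf518d69b65eb39fab541b5dba427de33d481de6707da6a7d9f24123b5b5b8632f097,
0x56645221b7b40b5dc7f4d751d8e8797bb024112a5433de7e5e915cbf1f37e31f8cf0995546a8211a43231f726ad2b1074,
0x3a04f7c7e93e225635173854556b8ee5ce26973aef61cc5260f5b19e6aa4abb679ea5ea1657aa1e6494002241f58d347c,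
0x7597603c066f9be3b8b9946c4fe261196a98613ec7b89f86619c716facb39a5de5550f7a08f0ffbfbe86a22ffa2f93829,
0x9c4c4ea6d2440078a84650fd7bef8fc2caf6fe7382329047bcdafd0023394e8d0e215b91722e872f2d55855e75b9ae78b,
0x709d8a34458a013f628c6099d078762c2108e4d145c83e57243753b0122f002af202026da5c1c970d9767583128191419,
0xc6139e8bacfee345c5f4cea3eab3365dfd337d8b6f34d62f61135ccae95d60086fbb8e293e97d0dcfb3061a0e70cc6666,
0x75e5ad047be19695d7f90f710711d1984c5f5821882db6eb271b5a5ada0e5e258923b69157581203b800e7218d53368aa,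
0xc47286677969de25093c0ba51ceac1c6f4a3e38bb7d40e6cd46e36e001d234d47a381da0ea306a2eb61fd03106f20b5ce,
0xd8449c7dbd209046163669cedefbad6aa79bef6c0a9d07371c55e60527b1d6c8e9455786edc1cc4eb50d5c819d67c05af,
0xe0a1dcc03eb7eafd96b3bf4d5787bde9f204429f19e39deab60276bde00cbf33024cbbff39f4ec5620a84423974f14,
0x9a3a1308b46cc09a6939279592fd53e22d0fd8d325242f65c17b0c533ff97727449b56b06511f0e333807b69dd8f17b85,
0x736c82d0d8ee65a3e0367d1f5e8b2c913bc6c5638e6668c8931c924c4f9a72e156397013378c555527ae2ba9cb6fccc3f,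
0x42a90a9c63b0e01cd209ae0e55087c47c3ad04150df1b3ea6e0f12af6d090c32a982354b5519158803b633b4b89f27bf1,
0x8e92942d648587444f7261c3a248c75ea3adc8b49bd1a63b5cba9932a24b7099e4e3bec7555e31e75863f2e932710f88a,
0x420babd92b05d65f976011510b36ce86ba895bc26b46006bda76e1db724084dea74c5aeedf77b7cc090cfea4bb9cd4318,
0x3c018b0df2f5e595333bc1a8d1d969fb36826be8cde89f335d908060455731ee44ca7be88b0d7c2285317efb21b98c1dc,
0xa47ebfa6d4376888912b5160b1be14bb91373cbe1406fb5c02ca358fdc42e5920a5cba79822fad7a42668eff31022571b,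
0x79bf6291a679ee78271ebd00159a791e9b9180e959763c6ca88f93a657fa8b2fbb1a6dd7f5bba8c7bf20963780f3da959,
0x4120cd3633f9ff4899b73257d2ffda95029ceba92c5130875dada0eb91fa655ef2c19bba91978b6eab5929d1bc58faf86,
0x5e92db5b32c505f0f9bedb70f8f57f8f98a6cbc6f0cebf2070226fb5b1e3055369cdd6c24a3aff483ed8416c4c1fe0144,
0xd0980224de8ff637f217cbf3e5695e7eb50821c048926bdeeaa41c052d5b99a1b1025d19e51253e9e7ba80e4b8bbcdd32,
0xbf647e0007e9c1bc5c9ac2e388775f903fdfb3014ae99c90426512125213453a0bd3f7e178868a946a42308cc85b7e2a9,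
0x69ad01d6d63305555576066ae695874b1d8cfcf47fb02f73aef0bc31aaf6350a10ab033fecfb55550778d5b4158fcc976,
0x300ab581db22879b0e74e307d7865e2ff1ee850cf65c4f263ce0d5d5beb2980c8402dbc967db9a878d843cbfda10a05b0,
0xefe07f98d5799d620eb22d64ae76138a427cc5128d7fb3ae0ea529c430f2cbb747ca69e82242de410c176fbfdc9eae16,
0x24bed7d9fdf3f50c18bd66481589c7ff2a9e40de16051becfdcccd68afa7027269a27af1ba5c14305f52e59428c9fbeea,
0xce7abd0c236aaa9d9e6a39ec7332618ccc85cad43f7a92c3f2e91437ff158dccdfc4c07662eaaed192936c262a8d2ddc8,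
0x5e0b11cc4c7817078463606cab014989540a4c3b317f2b38d431cf6952475dca58eb12fe0adb9ef58c4beed94727a7c9,
0x24f3a85dd803133eb20882edc2a8a9eb7b959b8070f862c93aaf35298211921d6e5dc311a7612d483bcb952051e6b60fc,
0x64fbdf686d19cb05801566d0aa7dc97c21ab4fd75dfa0dbaf230b863151d27e5c9741e3b4d3922c1800527d7f0a10dcf8,
0x8cc7b3c3edd39c675c8c15a263276872238d6d7213370574a8fefa9504f7136940f3d8deba83fd80c45f41a7fdfc50404,
0x57a9af5b02c5f06736244ada27e83e85c544af9b6f7d7a3c731b4b64e756f696a78c4ecee5342e4c766f757a08e0a67b2,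
0x3745c7d306d8c97d084a1d1fcc57638f1c12bff907f68f135a5686ef57ab9b0158aa259a70f6eb8721aafd8baf2acae60,
0xa0c14aa3b2d8e1b1127f08fd702dde8efdd45a404ae09e44a5ee77615fe2e0e10fe86377d085dfa0d51c0f499ae5995bf,
0x39340ac134efcb6e06e734de0a4237ad0b2ceae66e02cafeefb96fad2e43d9cad5290baac8536d40dd0569e2a111305aa,
0x61c0ee3cae2581a11242a2d55bb4b8c1c16187b3ef0a99767294e68801feb115cc7b2aba04daccbaff6938d8511f58571,
0x92adeb821a24bddeffa23dadebacb34aed2eb919da3568e952fe14f6b86a8b4f5d3c823a764575bbbf456d60a32501e7b,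
0xab9aa04179c6ac0777e13c7e8d6425828009cd09dcdfc47c93b0ad497a4b3d1bfd83ae7bea6e96b66f7b94dc3418ada99,
0x23b8f11a7a9c85a97fc13f1d0450974321c7f4a9718cce26a24267f1ddd5116fd4a154a5574a149432452c1f8f3ed63ae,
0xa7158e66876969e5c30da4216de057f045fe7189d578069b87cf8f25c7678708b62a63fa15591cc3f269729139ab6d7eb,
0xba4c53421f30e3c1af8490a4d2a6bce4fd0bacd82b7725bdde675a73c9d77a2861dbaa09ac37a034fdccc7096438e7aac,
0x58df811f453666df5f5861b077d9036f4bef915ab7565e7401fc691eff159f06364135cdae3a836e90e767e4ff64fafd0,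
0xd4709a90b117576468e3b306c3c3dedb52606d9794b7cba27b9030dbdb90eb6f95bec175ed5997c468187c641865d4c89,
0x720ac110e3cd897ddae752dc53c7dd14afa9947c952c510a05771bbcd6a9f48fd76e65f6f1c1e91ebb94f69f4f259bf5d,
0x9b83ae1bab87bda8732a6e7e5247513b4d8b50bf4097fff288ceb16f420b4bb1d83cbf09540d541fe680afaf03c387c51,
0x1acc79d5a058dbf2d179e5f37ebe44ede28c6849acb74f67e8260fca2d354084f4fb86770f7905239e33c040592ee0820,
0xc5a6a7b4a1743b297e276241cebfc0b15e72ba681a9749051cc1b9f18fb314ce03c0793b4c12192e9800b36777c69d3c0,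
0x82cfd0bd1799b10277d4a9935c5df0e4ad396789a2ae5013b127ceaa31c0fa5316fe026367094cfab1f37032ff2fe2863,
0xa345ba3e4a246a2c5d260be8b2dc799009235511bfca9f5a67640de9ca8509cac9dfd9f086e476b0e9293bb6817ef99c9,
0x4389c1c934628b5514d1c6df41afbdad04982131af01761b49b76cf50de128ee3e511da43f7bfd6c93c4c04b84c9ec909,
0x7408260d6706cc3a96e2e0e0b99d6397552611ca162b37efc39a2edc878e616aa004611282c64c7a24fda52868812fe91,
0xabc2a28392ccf2ae361e485617fd5d25002b47b02c332570d63928ee6bc649f4d9d32c7e98f93c7d86f05b01c516443ae,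
0xbb8926b1064ca58abe9a76081fb6891bc6001c6a4c801b161fae04134eb65223263606b25f1cc7afd977af8f3fb005e29,
0xa48e5850bc6c3c29323308454fa5487c40423456ebb848e6da94d95d5b3b8c29a0541b84d363f783b6fc0909a7829f3b1,
0x3b9ef333df970b5aa40dac92315ee3c139412e79e32b0fb5ca2a32e760f29210e7e3e18da9b3fc130af50be1329038ffc,
0x2f73564c2fb09522cae67771fa8157e1e7a67bd527746759bcccac64433aba24a795ec2258886ed79b7ee80c0b38ad714,
0xab8cafccb18d2f3cf1a89593bd7f8986baefde5dbfd938e1aeb99d65be7aa77fbfa934871377b41e912c386eda5a38748,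
0x44665d63f440800f98b79554501984be00d0add65ff80aca8c4bfe864ae6e73222565116ededb43965842314dcc3b3fc3,
0xfebbb5c3380d84fa8d19ecfde3de8b4d41d4587933e44e6268be246c6718f3fb4d12bcc6c50206055d83c1445825440d,
0x7f487f81629c62a8c788d8ed5e932b5a5cf2a96c59e9fbd2c43953814a548d9f23976258f7f66ab7e8c013424ba7b4df2,
0x29015bbdac81f3dfcb6952aea4ad194af35e8de3fc59078c263b8c0d21e4ef9fa3dd5c903568ac1414b36d0b64cd5235b,
0x64e431ebdc0bc8ae69c04b92757b969b6ebea16a96bb726e318914f505f026a92598bd95f9f0eb2695c3961af56d18c5f,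
0xcd993a66f775530d29e83b8aa1fc06d50f64c94b321cd30872b9410731966c8dcc01be444e94ded82daf387047b1767fd,
0xa778dcee07b6a98464c2405026879d1e17fd4ac5405349883a0295a98089777c3d26a0530ed8855b488edf4031fd832d3,
0x3c77355604a9ec5396b670b309651c45aeb6bb041008f6508a93c7edc690462a98c0969d8f23a3436945e1dcc7df2d283,
0x7bf44a3d25e74a3bed09e5e6944d3f59e22d944ed6b3782b9ace513677d81e50c4446de7950c95e23cbaf243b53ab9664,
0x4600e3fa96ad2d02f946bdc7c418d93560d2425327424d77f25ee82a8078dcc25aba15efa54e9a5c1fb6d5f748b879fbc,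
0xad95a0f66728b7fa5d013fc4141aba08161f2c25bdd9ff949a176b0bc46d8eb699b7cb15669dd7d36a21eeae078efaa01,
0x25885a595ba6376a7a544e3acdc752b3e8913759a33fe8f9bbab30e9f70433e19ca3d6f1724e1585c981a9cb29a840ce1,
0x71f492c55bb6dca138be964e4974752ef626bb6c0a60e1f63079c6c06053d8fd0c9af2fad7306c6a992a91591bb34a640,
0x695e02eb51f7f3f2d4a51261f4ac332a58c1f4fec659829878f51b50b224ee2fe614bad3da507692897b910154a872511,
0x2b8ad27462c121f720adb56f94c54e0ae07f932b2b4d22ad07af28c8f07a2111e9bb2dd39feb52b030d75bddca9610bdb,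
0x7fc334e6bd1b7df23dcf8caa81d8b0758e120e1f118d4afa5ce17beaef0fa7cf2cd0b2afa37d73b182855b1998affff15,
0x5253c17d5a6020a5c3ec28b4925948639c6aa8c08b438135e2a0e48107d4ea9d55a1157b01f51f18272dc7f8a8542508,
0x9a11b06d0933536847cbf6aeebe59b6cff5d6fee70736b385184aee6795cd7e7f3d1f4c3de4da74348acb4391cb68962,
0xbe2dbf07d04db19010022f39586fd749b6578db3526eb00e1bcafb71d2362f9288221ee9c7570543833899fe49905b927,
0x2192d98c38e62c9e383eac6028dd7ebc538d06bf95784506847b2cd7baf44f2200da07f8f9f4bac1f1840b3934110553f,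
0x3c6a10]), (0x887530, [
0x64804e656d47c09374fbce4526e7151ddaabdc72d5fe6c48217ac2ba9e6575539e1b0253cd8d9b0637b851b638edd5ed2,
0x51f7aca5fecdef21a7ad93ab3ba2f4b7607c7e2cad2ec266a8430034ac90ec2ab8705246b980265cd91e3bac2bb6eb8dd,
0xd0e68d7d3e94046d4db803f3c0f1734266d36ddc84d74b0688c9ea27806fc81308d41adcec49e205c0a53c0d665d5b4fd,
0x6fbfaafe7bb059535d25a6310d7b845e886bda850b7d62854439dd6c258a0c87333000c5f5adc57e7ffad1baaf0d99085,
0x5e0ad08047c848714fc666b67a2ce384bdb046cff7236d512619a1fe608ef6c4a9d3ba9c7efebca78a6ad6213a471ed0e,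
0x75d61c7a11db7454f81749f4589f9cb77c034a9851601aef2b1b985d5fa11a85612f714dbec7c2a073da4e4b052cd7acc,
0x2fe2ccdf3b51b619e052b738de3fecf771828b2971d288756f7c34bb80f308f4e9c089da8d24f2de2cb7d4527d8075352,
0x6154e98fd3112e4074b385b785e2aa51a0987a7e0858f9538fc513f6f452f2c8497abbcd6ce93a2bc5957dddd34b2766,
0x114d468297ff4ef9ddd5f163fd243dadca5c8343b62cde20cd6770e0157de0308eecf7758f406e969e56786ea44782d25,
0x23dc129749b1ada51b56620ef002c0464aa5484f4ccfe77797bb226049e34b56e1a06ebbfa9e341ed07eb0893e6c63ced,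
0x5df108a66ddd527f96ab3463b3f9107c5ffff655bf7a3d6c18a78c80a163a8646d5e06800cb520eb16162a4612fc1d20f,
0xbaf8bd70ef9211e01eb316d318d0e0fcd06711310cad8c86c4c573091aff2689497986c2b49b8a23bf10900f87033266e,
0x340e95a7e8b38f046cdaaf1306ae9a4cad18f9feaa579a25b70de40781fed72a2a4e454cf55423b8c536c315652bae959,
0x49faeb57bdc2142e08f73f5bd576abd682123c6b1dc115b182dc09dca7d090972a53ebaf94017a50ea66748efddd91131,
0x2eae230dd79b29c84e199a9d739b97f67d3a0690bf289e40005f009cd644b470a0023313dfeb8a2a7e0daf9627a40649c,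
0x7e548843bf2cddf343033b23f18487bf890f531e8bbfb016e4e12d172f43ce462df0eca050fc07a60f2b476f073aaa35d,
0x2331ebee447b73dd626922c91ca47b318e17d3bcb98cc2106652906a0ec05cde65bf52b2ebb7f7dbe7c60fad1e29ca070,
0x9da9a108ed09c569660e8e9480270b709c34b0dd2bcf3e96e1228b740ae8773463716b728618833167d7018ae81b5bfb8,
0xa4a570d31f54f4f9511587cb01316c95862d6370cfe5b7539873c830959a0702c1f9418a20d25cc6390f4f7a571f15e04,
0x261dc08af58dfff10c960a10b92c90e494f10099f48c27bcecc2f92a95279aacf54dafe063655be70ffe6f165f8509627,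
0xad7644b0017ef6b74d74a8ccb95d82023e39c3a68573146ada5336b205ceebad515472153f560c45d346877b72c15b8bf,
0xc6a25d674a46ebf2c6e24bd13c2baaec552694ab4eab6840d7222dc8448043c64e0d4c9bf6191d0524940e92a62d696b1,
0x35adc9d60c1abf5ce8c86a6e23f074421659cb90bae3e26fac8d5ef1adbcbefd0ecf5990a6facb717ed1b67263e540b05,
0x8e5e93137a04aaa343ad4a627863b6c9dade0d2ae83a8ffbac041ceb861e4b016daa26f708157493b8e0fafe4f2e9c988,
0x7cf522c344c1689bb32c4d1f08968922ff30ad25d8bc31586a4f74a07657a8991b421fe8bed09d8544cfd9a3a1048e142,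
0xd0ab8469195e8fdcb25ac18d4857defe2a479e5c5b1882cd4f6c10539c0e60eebaf877618ff39d8f0520bb97b4fbedf28,
0x9e6e04d09968d37aa1b5ea2a4d44137057bac9ffe21c528c53428470451cc8facd56652f9cccb02ca2311621a5ef01974,
0xaf848a048e2a6338bc141d37970d00f3713f6d16ee38f2e697f155a5d8c8007e5ae81d4365bf264b20efe013596cbc3b7,
0x49a7cc1519066d52972b23248872b714275be42b6ae39c90406ffcf9845d89c719defe18063954805ca0ab3f6f7153ace,
0xb5ad109513d5323df132f159a9d159e96f7ac6ad4fe22d6327ebd6bf63b4ffa675fa71df3425366ec0a16c1939a608e5c,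
0xf03f861999e9cc8ead05a6e96c14bfbc33906eb15147a41ebca17e9f24d6ca3d3c9c705b78a7b4b27de979d21d2bb9d7,
0x9cd5b54b5ae3471608875fe0cb6aa85058e7a1bbc6485b42e3b7e64721ed930aaeea9897528eb61e185a802c2f59374c3,
0xbb5861139f92433582c03ee39e892fd56268febd4ecbfb32e6279b9d6e8f36789142146cc643bb1f8e5b56d526d304c55,
0x1a1aa76c7f9988dd1cbb1ce765187afeb3f0da5baa9751cd922659f1df5700488b2f3c80e7827c496cab5c6d9163417a5,
0x153fd56506984c4a3f9ceacaef42c4a895eba1eada38f8a4486d5ce7db9c6d30b6a28d649e961a89eebad7354ed07d192,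
0xac4d5837c1f58fb032e7a981720f505c52280b5127ceeaace7dea2ccb0f888e329c42ecefe869b6d3bcc9331b8794403,
0x319bc17105435d34c389738068a8ea98ae7e4c93a1945feb4c2ed6e0ac77159013ac49499628c2feef366014f90a35a91,
0x20b01ee4bd8962946909911796dd8ef0a1211181684cf32de303f4d997ded8f100d9f9dd2d7952db450943efdad4cb88,
0xb509b415afa79f738810f52a4907ad9c64b2e1103ebfc54892d6ae1ae160d36e898db0a447f245082dd0f1cb18b38e004,
0xa1d2565c8f0d6046b1e8acd76c8a030219e26a1d8ce94ec1f0b708708cd28bcc538c32c53f945f01c18e48046b22285f1,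
0x8fd42032953c285b0139dfee92ededc663f0f1c837edcb2086ebc2ef5712ab2db09d9edf6f05d9d707d4b55a92a34b5a6,
0x3ad8bb9e63fb9286a72d8b9c242e9a71f8700c9666c3ca9c5359b354325fb61d0aa79bb5269a6cc6d5f4db95a6a05ed21,
0x44cbf87c20c891a5d5928fe1a5446328b66e4fe6c8c70ee68b4dec1b67af7d51f588637ac3515a71dd2ae1b77d794c251,
0x51ba5fe5f4913a4c70b5aea8d7f9d67c7757958fb82788bb707523e3186f3065ba4a574cb29fbc2683659f4bfa9fecc48,
0xadcf9881f074dea4fb6211aa2f94973f8447309fd4a76ba8fbf052781812012baa672e553b9af4e2ee9b3a418b95ba9ff,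
0x1252381a96cd6055b128a306b1d387bd1e3d44836c54409b91a238831b912f3d2c81dbd9a6f8ba9a36e8bc58356f8c042,
0x293038646912e897dc6346cbfe5a07ece89190582f68fe3bdcf7c9b8ff3255244c84337207c1a7dd27038393de39b1637,
0x4d90f9dbfe362c2c80db299a0d7545438471aae3b7187d4c63abc928be56ee43e0f5ede8dfb41faaeb3986dd92360614c,
0x5ab3bb28f255aa1c373ec74534dc114c2ea6c968df2bf64675abf2ba7f509c3de0f62a1ee8e59229c62f9f1aab87a43b0,
0x31d1a79a4ee7f760224f3168928db0f6b8c52792ae3569ac7f8352f0261254908df1ae13720c0ec9c41678ed89662b5fa,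
0x3b516dba074ea63b90e8504a8efe65e7b9ca679e71035a5e7e04519cc20c9e482bb64002d8c541f6da8ccf4f8631bc7aa,
0xa2ac78bfa42dc334ecca36a567cb995a43a62290142be6697a5003221c12030f5e7e2f48605d75c3ef8716af717d2aae3,
0x25c1d33001481e6216e54874bca48b2f9648d314d30b0fe8203d36a4d664d69a3205455ea3d1a26f5d151862e56aaef18,
0x9a3c097a3a781ee8ad5fc1642dbf23673212b1f045edebf656004f6e0c764320c0bf5b955cfb6275c7c796a3b54d3b681,
0x5b482bedfe415f012a0b5cedcd7a625baa2bc8373052e3a77921214f1286e51cec81b1bfd49c2835bc0981fc1b252fe33,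
0xaaa1cc86fceb0dbbc750ab6e63916369aed7a907bd288b4cbb166d2af76c13add468cd8e060598a13fe90dea21317a1ed,
0xc480059078db425fdcbe83822fe8d27fde4d194d537ac1503df9ad6e3be1f006a09fc3679b8783e1e6c769b6221390b9e,
0x5325f7af65c75becc4457836cad35b2be8c96200d07d6fd2cccaddc1cb810f5fa01ea162ca4a48558f0016ab2e382fc29,
0x760b7eb1741ddb2482d647cb7f07530d25256801808890c32c3ca48271169ea2ce07ac3afdd5ad0e90e9486230d79d3fb,
0x8005016c779f8fff2d88757f66e8e6ac7818a8273fcd5798e345372012e59923a4e324a43360e65324329764a2dd0a076,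
0x62773f79bed91a7d069be4755f865b78b4c983d3397a90667091e1172c1544d7fc5ec252c1da03dd88d21ea4e7d82aa8,
0x760bb76870392c3aec384d4c644bb00e1400cfe0f375de258aeed769506a1081783af184a1166d8c6c5daabaa9cf9aec9,
0x2c540f646fb1ffc5151c146b077730a1c740523012aed9b49d138a484222373028c4c2f6093097b567f4f63cf31e76712,
0x4ea863c7cb13384f24a18741b74c7fbc2b9ae5e808eaf04db441d08e1b9e0b70f9b5665aa395ac935e0e5c4a6de8eea62,
0x5062b93183a8063d57146f05aab1e8bda127f93018272b35ddb4a3f54a0fa48cece096caedecb80a128863717098d79d6,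
0x46e2bb6e7fe845ee7b8d8ef80246765eb57cf614a296f891420dc46156139ab9504a230d9641282aee8dbd37485473e44,
0x5e32fb0a365d5c25b1c64fd127a52a6b9aa8f93b11ac40b94805cc35cdd0353fc0d38e02143b9a9072b369b3dd1815656,
0x1cd5b4fdade7cc57be3ef1461a6b2898dbd46ace942c15f91a8d2afdc4aef7a773073d277eebab1fa59feaa270005f27,
0x5dd0836ff53aa0e0b0f7324623aaa2a640dd58053da3a13a0930ab1632c5c38baed7bc6e3b195a54a6b8c30dc3dbe0cba,
0x89b4f56730fbbd7e7aff8451d409c041f56525220631f5d66309190b921efcbf63730f50705b1147d4f36d08091082068,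
0x81e8c79089073d248306e90051937893e861570da50d6dd8f29f8653de7b02fc558b73b515d4e50144303b731b5c03697,
0x4f4a2f169d218ae4af9a513869ac063e38104be050da2da0042b7c290e7ae58a0d445bb8ad75bbbbf4a49b827c355bbfd,
0x2975009e29df4cebf92b73d7ab784215e95b568caa1fe38d34122a734e351ec8ad7afd97fb65d5b2f20cf4d85410a1465,
0xcccb135660eccce55863d0eb77779b2e52fe8452f8c49745c39e33197f40ab4a6efb304ab01f0c38372b1dd728d65c19b,
0x11ab5a65afcc21a0]), (0x886530, [
0x723df58c502886393c7adcf752bcc4822d96313d3db6657bb563a5edca246305e818b5787137d9779e7ed37f29907b4da,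
0xc8cacf0cba391f31f6f4eeeb69c5f94993c1650069f8fd997e25bb633d7b0f40bed1675b0de7ef19dfe5372dd975590d0,
0x552435df5ab91c6d00a5b4a3416087a62ec94cc075abd5c99c9120c5d2977cd5607ceb5ad210b3d30c3d65d4a5fa28fb5,
0x3ca33afe15ff1e24275f1c1aa7c1f9b40e670fbc51b211867f7682e320c3e17834cd50a29fa697d669df281aca0245112,
0xb6d3660aeeb54583e52f01ce7313a18ffe787f9b51290ca5c12c4824cd032d28777dd5ecb0743e146a44f5b4f0727b1fa,
0x313941772fa24cf633c7cf08f77c22ca10a5ea8b4185a85d5a8241cca20491ebe27c84fd6b0f4eda8cd9c93555d07f847,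
0x5dd98766ec777aa5ef9c075d8b9d9f23ccea826c05395647d020e7fabb1318621de0885fa3034c5ccf745d829f9cd9868,
0x7d3f889684728a44383911e8b6b9617128fbf35ae312e5fe4ec63b5006e06733c7e73f069ba2543bc8d135ba8160c52a1,
0xa4a9e0071aa967d44b139151b039d28b672574381ccd74e7a7152136fdfc74175f3fb603d510e7402122c0d3aacbdb770,
0x6b98ce04d7c70e32700c07b2289661271c30caac8178a301a618b8170782c2cc5ed1ad45f8768eedf4e45e46478dc2ce9,
0x514bce5bb9d777f1b2fc57e7463afcc5de0208c55fb80fd26650447f32965c97b749885a5540690888d7bdc4210c8748f,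
0x5cc8009fe9fd83040d20e3d415510760eca99e09a0ce6ba147296ead7b512753f5ac4a2b3ef10a4c7da0a15f7de5f01e6,
0x4ed6b78588c2dc77ad429fa5b7218eda78d175feadbaa153b4a2ca8788f6572c7e67f46cfdfe0066e1652e89229590e3,
0x251fa5390c08090cb403610a10e6cb4dc2dfa27aeaa331d797a3ce77b2bd78436f14c94263883193d625b78ea094605fb,
0xcd6373609fe90bdd554b3fcfb520b43ee6af44688a0cda3856685de6452b191d89c9fb5a99ccbb19e2fa398dc1dff8b90,
0x5ff4df857218c659339209bc28e7e5a33067db72b13bcd0c2eca38b9c68ffdf7175eee978798a418e111f6808a09b0c34,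
0x5bf5831877fe6805efd76740ad621c3ae91dd9645bdade7294028af2c87500626287141a960be13a2890bbae56a13ab61,
0x76d22f8f8cdb4f6bc77ba36e2def5410f476f9a2afb90937f9ed834d3b4b55b2f819b7c9fad70cd318a337935547182a0,
0xc38271ebe9a3a5ef40120ac16901de30c2c9eaf815a1ff1e4f68b5daa03a930a62cbf28f4d1f5606a6e60fb4c67118039,
0x4cf082ea1accf6037bf1dde9a3f1b40e184338fdbad79e7590fedd814c750bd61d3815b2bef6cb44366d619b395b6d14b,
0xbc2b83acb7241a8dbbc847a4645455c4f2559a6154434b1452c9982aff2869fbeedafb3e8e56244d0c0ba3cb40e6e3f26,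
0xb8b0f734da0e2d13a0bb4588278c1d9b21db4680a7ae7ca09181540bb3cd1d0e6de6f9f62c9afcf5e08f1029601aab8d2,
0x5ca730c7356382b5e72e6e36779caa384af6ad65ced181546db0299f789ed40d653bf263563821dfca149b66c04f502e8,
0x25a970df3fa87d3a5ad6cdd483e44d212ca4e8ba0813cb018ecd1770bed4d8ae52c33f1a45682055165e80182d403d870,
0x102888c09de9e09d247ecc508467a869fb9b886f843ae8cdb97bd0c3f18351ecb1e3c6b92832f4c5c6e2535caf2520407,
0x5cf1b7fdb28b23c156fed166e09bea77c6604b16b9b18d90f06529e367006529bee76a266ecba91b1b370ab0a750da14b,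
0x80c4de970ff2faaf7a34eb6e97492af533260f2cdbb5748fb1d8a975609d9d09ce40489f67e7ac7c07978002d9bf18563,
0xcecb7cca2f942f72b02665ddad1b04289dce163999de6c8824cee53779142517e9146e685051d9ff119a826386200d486,
0xb09428f50910fe346be71c3bc067334adcbed6a3750394c90d182e5bfc9a3be5814a023381ed67622ad0f37a169b73dde,
0x6f7c25fcdc61b279b70c90ce83ae4fe6c249a4cfc3cb66462e4144d21a1116bbc2ecfd670fb39f86dd4eea94e8fbcfca9,
0xbcff24e54f1e6fc4047ec739b42b9ade3f65e0ec89040df69fd4b7154055cf3186e2e4fb14cf4e677bd41c2bfbbcca15f,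
0xb75c3d38a73bb93d1f46e3ba1bfaced10a0b7091da5c11fd8c8637249c33b1730b43c1caf9bebbb20ddb65c3da2be1e91,
0x698bcf1c59c23bb1a6db8ed8f7380523e6fd91022c7759fdcaa1e675c4517baba467096165f3f9e9a289f71a2f528b250,
0x9cef58d764a5332a56214b486d92ffde34175c39f3137b215e97b22a74458fd33c4bce5a0f9ed0d4ee8161077b56ca186,
0x9c2f0ce507bc49cd739e754e567f71a4c97f76314271e623e2387fe12c7683585b23732ee74aef07f7ef45ee24fe7d955,
0x32f2063ab96b59b61c3b119477b0c63d37a4469f9e46d8efe99df2eb0d006db97de7a062e4d001a7bb65b71c069fd4f83,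
0x3dfb26d051929e99373053da24311665f812a76ea786072e3f42fc1ca5e318b3528212282e97616bee171388a590b4d81,
0x330a3613348e7733c6b61c48d7175a829e4a2101c04d4fb80e79c74e35fea1115349c6748899dab816dd7647533020317,
0x47e49f629a5021bf9fbc43c7e993f83b1071c194b43c94aa986c0412d950f841fb4572de44aa172feee1411e8bcb036f8,
0x2b127e04c2a71fc34fdc86c50b58f899cba483459cd5318c293b248bd0951f49ed64e2f69353107855d3a30849b5d0a8d,
0x61048ab62574e2d390d21538f6471e806a8adee700d563573b1e8cdb37b702728076c8d85d7446985428ac01920bd868,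
0x4df6280758d5d2d27833873adc27bb77250634fdb14fe7a0117a96436d1f1db5abcc75690c0aebed72c6750bd6492ab,
0x83448e7ae797d52591b10ca64bb5d12396b467872b796d8a128a9650b0d8e342c2347260713f111086a4895c1f3fd37d5,
0x9b5ae84145f6d53073231ad22fde40b98093b2d3262d38bdfac3bfcfb23bfed3a4028d56dc783b35a466369336221c396,
0xb1eb10a30c3f9aea384fbf78c51a293a35b8744793d8bed52cba967e8a9c8950ae459670b2b55acfb6dd2bb1086d8ae5c,
0x7fe6f842dacd38d555c5413204025517c817d5501a49fd1c784256a91e60c4bbdf29153fa621d3ab35aaf96c8fd685527,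
0x77bd7bed583b7d3a8d925793df061bf31c96a96e6c264068c1f6ca96298c14d87eb9b85af77bbccea63e259842fd241f,
0x105b3875b5d2e18308ba557cfa337e5fa39fcaff47900a4e561109659f9b9ff64ff6352cd3e76fa980b4eb83bb0b0397c,
0x89bccc69eb895914a2d29daf9aa26c3c08957c7d99139807c318c16cea19826263bc58485c56b48efc3736e074160dfbb,
0x37eef859a275ce7242a2e7fdb2c8e460c92a75e166e6522d6b81a7e6f668af59c465aa01d93bc0c341df851dabce046ce,
0xaacf062acbbeacba09acd302ac47b16101a047c0ef59cafd37dc1815d1c0c9cbaffc461e20d494f630c0d7dd06321c64,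
0xaaea23070e2cb9af7f195f1930d74c619da75d40e8f05310ffa0e8f9db7880bb127c703e0a36a732101e6350dc647d204,
0xb56e21e1b6a7261944841d797c5ae02668e5e929654f73231ef88f87d355a7ba3e25fa10ee1a41f3f962576483447f327,
0xb5377121ac003d48dfb1ff851c6aad5a072c10d9470aae36cd05cb275170c1fb4e784345d5ef1b947e66b530ba0cec804,
0x4be913db1b96caf9d2a7370861da2b177293b88200ec80e735ad42254f2dc75c25dcc76ed2134141b06f1a58339bbc9d6,
0x5108b4b7b664bb2bea960c5bc02268aeed57c5a20d807f10cef5c2a5fcbab839d12f602991e10e483e3468ec01745d74d,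
0x5d90369571160a9cdeb17941d46223d091fb4ceb6d4907009926d5449cb2d001ed491e43329958824f4014e282e902747,
0xb91582a2fee73c2aab68d941aee3d09b2aa3f4b10438393bff2b97826966ecf748c78b8bf1245ec2db78968a530af4812,
0x7d4e6ca2bb268173f877decb64d0eec92abf28c1f7ef2cf4eed6ff7cff33b467c587f1998d55fcf9f79668395f5cdb45a,
0x7d7d0df1b5f37e3279aab7e6d67935a6e3d6479c6c2d8f6b91520ba6db1e502c2d36866cc2245b4f6427673fd80678c80,
0x3940fbd468b727c7b1754d959af3cf002370c0945851d8d300018929bdc61bd3976b970ef5cf6e692f92c5afeaa72684f,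
0x3455f83698015d797620dfae074de2ed4d7e3f8b138cc0917c859469023637f79d328cb4be43ce8333aa6dc9a1852d1d7,
0xa44b64cebeef314e8125db0715404e19bf2d19017c3593a7031bd14cec5e817b8a31f673fc81be376d76a60b8e475c9e7,
0xa9b612397a015a8bec1c03fb22f41906a2d433e056211d8dc7852bcf637b288f6aacec26a678af339540450a0c1e392d4,
0x610440fa94c5435e9224b2033b86428d9b8210023e5309cc3e35570287dcab3bbaed6b944e006642331e7b69d77c1d6e8,
0xc0cd210bf8dbd325aab0c656138a8ba67141a648fabaf66af5ea290bb96b1362a42978bd6a51bd5782c7720743841c26e,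
0x3dcd5e9b9658a15fe16578dd6f72b0927b73829acbc9e98f0dda31c02a6618bf677c9f183a74170778915868f00c0aae1,
0x24efcee0d810898498239c437786592c2c4dfd2d08bcfd062bbef393008e18b7a903e64c17f862536919fd59c8396969d,
0xafca9c7ef21f41166a75accc946f6d1b226ea8a3406897db89924b541535325dabd747377f3f27caceb46c4c2d1d7812c,
0x349d2e379190523054cea5500b91cb87408782d1290db90f9c2477d0e3b280d2643d2e1eed6cd3da161dc9b11d706f0a0,
0xc6e58434c378a9fdf990a3b44b9ba223942f85ccb63fff91b267af1d2653687e467df28990c081d2f73a8079560f59808,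
0x4ee99a662bbe46e604f7423427094ec242de80060fe3d8558b751368b10653f64fb9993cd082e4e31f075aeff4e49c952,
0x2c31218ebc4575bdc9a15e49c96c99136]), (0x776530, [
0x64bdb845c1492f228cdf7590dfe559a8a329d563a35f29c139135f74ef29a7ef450fee82163e06003e4f191652d8ae27,
0xca1eaa9aac66931284d2d994570cf37d010800a1a807904ce470f563c5ea3c398991f36787133f0c3b8c3e240432f4c5f,
0xbad4ead17e0ce4392f6e470a803241aa3a60c8a5444a934d55de5861caae655fb801e701a6ef993b6c19b6519d3225108,
0x9f7282cd30d43b215862b2458071bd6268d43f8436c5cfc83ad8240caf0d288cf19f94823fd0f46d8eb62a05104462bdc,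
0x1170b90c8b8a9ff621b54f4238d877ec7369cad4d1bd30968777a7730d7a9d92798b2d2d569e4f59d5354f97bd633e004,
0x7d8217b4ae4b500373d209cd73422ec264f2f34b7a450a405d178b4a773a1cca9b7c96f6ffef225de2f6a970cee271fe4,
0xc55893fae22264d0e57fb95a4fc5f98e6d1054cc07f89487d8e6ae44dfe45179a41f0e88103a243e001c846cd6943ff35,
0x50376aba2d335e35ae442f87c98f82f4d51dd6dbe4a0eec60afcd09eef0c170518acec80fc5a389d5d52492980be29fdb,
0x2ba42bfbf23dde8a9860587e19b5b1e90484672d39e362308fba704866af4909854dab3e61f0af66f007d7554dd9d8d62,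
0x47a64e127d177bacfcf405bac7070cf1588b3fd5c042596b87a73d88800fa729bbf42bd3278caeba06444cf422820800f,
0x509cab63645933d3678b69993cbb5151b8b58bf8ddff179dfa4360db3bd41df7f0d23af4ca0ce9ae2134832860e49ff9a,
0x76c9d8e3b909271ba8fa1f3afc671d4ac0696bf08d644f3b09aaa9b99180c9502f4ee9e155535b0ecbcb69a7a0f1d917d,
0x3a2024f42e21f611e7cf62f7d8ca5c4896acbca86316bdd4591292db1c06b6153dbe54c371d122a76cba76768a59375f1,
0xd42c72b7556b481ec0bf3f9aec6f389f131563edfe4fb0e5c96615e9fec5b682b6f98fb4ef365d930fb8a7ec1645d8732,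
0xaf85934c63924a615c0c6304368c6e9fa465721cea576075561fecb7759aa76c0a2a8a4f0b0cbe796714875a02548c29e,
0x7a78d32bb4475523ce5e8dba6dc11c6343c57f21b2bdaa7c6992be5b62d23decfe8cee44aacd45f3838a128cdbf544720,
0x53d11b6d3e579328d0dac4b6b8cc884b45f5a61f637065aabf1147500256d798d67e8d4aaf80a324b75f485af00134134,
0x4a3c11a034cff246486614dc17a7c8bce729220369a706e8746242934193c028dfe028490ebcdc8d631a661d3731f5f3c,
0x8cdce4df975f266775eec3c101d3a651c30704a116fb6ecb97e077addfd7ad67b04ec10e7911dd0469aff949f3bd5dd30,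
0x58b6eaf8a621633752b95971bb1c80d3514bd5de6c4797257d6dd711b0cd27f03ab696a74d420b088350525334a599dfa,
0x9069c663f8d6c101b68b4380f52eb38b9f58e855dcca2290bf87f6617bbf2c1d6c70c98a3001e142f219228a0c06c265a,
0xd12b7093ad5cc5edfa969ba9a7a1ca27fc8951ed025a19df0ed185fea40e705010737623f764d1c7f3e08daa206242041,
0xc68653952637ed94a78e493cfed7d3e0d44482e8fc1e86bd115eb177b407d2ac6991b786acb7cbbf9da834912e9cefc85,
0x50dcebba25b1ae93978d64a8afd72174148461daf718b948a61fb457cb02bb21b561e27794364c2daddeff584516e1de,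
0x68763a2e3d87a9f9373307aae0850f4fbbf5437c4edd567f547464b389bdac3720af2bf7efe682f7fb650b30fb68a8a5e,
0xd04873e69d68e979abf5d234d043d7b151fa289a296f21c4568077560b88b05fa6768291308449546def50aca0e44fb81,
0x1ddb48515df0ad3c3dc71f07103e3b3c1da3646fad6d3f3af2dd50f0679433d94fc64e114ce04160079d0639d0a05d2a,
0xa07a0ba8b79e5de8cc0692cd0fafc5cf3e1098a53d1262ba752416689933a6442884d49368bbf4bf2ddcfaa9fd4c6838b,
0xcfdd84421b96f1e69e00b369ed83890b5e5d09fa4febf49174cd9c00568bd184c841c76466dc1494182ff4a1a139c628e,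
0xc6a1dd17ccb602cee17c6bac1661bb0e865023ffff50ce4752637076a87823356606c47b829a8b65283165cc054abf17d,
0x26a4d51b4cf9171d97d81428e25b56cf80de4c91b00a310aa94488ca4360db2a87f21250576c5c13bc4f23cc9721bcb75,
0xa8f6c5dc0681ae466d8404713543343a00bb2f2a6b232ba644f6700636a57ba83a068b3201b1c267cbac6e212a041f010,
0xb8a01e29f09194299abd31a4f442952397a9c4dcf76dcd7d0a026cad75643230d26924c00b6cf5a2ca55504542bd7d942,
0x7526fbbedaee7cfd6763b179d73bcb3e740b6c1295d6318d2fd4bf21875bf286ea13640dfc6d7ca025f1e3a5f4181f80e,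
0x5e08dc9b02599063ec038d45c64a873e78761e7256951371c6bd7e8cc3b7479f9b8d9ded24bb59a94bb7f414b587c61a5,
0x114f5190058ab2e1852e73324220059c84a8b1d3af00871028aa232a18b5ad520d5c84ca32e75e287ac6a2585c764ce33,
0x3edf0a0e4c030ceb6f50009d8e370b740dcb46c41b199b2d5e23529db5d422bb139edb4799c2d14beb34858b25ff111e0,
0x4c09f7f11fded5b3bc54c5f798573632cdde41464163edbb29404dc922e920fa3c4b40914422715454e15cf3c40e2b61e,
0xcd86d47f9121dae29f8633a0d1b02eb96802abdfe55c87b5d17407fbbce5d6c17e8fd2e59358eec0e3b64e784025cf133,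
0xc649c76adb0970008904895adabc4c936f5fcd983facdfd76bd5ee43b794f648fdddfb180946f9fb27baaeb92dd46c59f,
0x2b84348891dd6dd81f14c9cd0929a77d6665c3d38458431c2d8db3e412bd1611df50da5340729c16a4d6c22381e4c8edc,
0xa2d6786be1bb4798460a2cfa619c6aa180aaac698548abab090efda877790b1aea15132c0c6e63ef17e30a40905fb0713,
0xbdbcb443cd1532cd5a372142bb903ad264039a0af1c5fc11908e70c85531aecddf0431fb3f1c043279e2fc40c29a33a36,
0xaab91e29d88c8a6325dcfcda9c74cc333d8ea22b5d3d1b9a104828ee352a13ac4b853b2692f05ef57053da411e51e3a4f,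
0x7deea1188f54e8371ffa273eeca08cf8d9f5e83612af99bb0259c505a84c2c2901abdb9ec082792c47b4372a7d21c59f5,
0x331deae65c22355c8f112df8e23adc75b8103ecca8246480b13cf3eda45b0dd76f2465e194b2f0fcc64b95c87244a549e,
0x5dfc5ea3c8ae107b047eb5198be89875125e94e7d0b33ea1c1981d750835372fc87564966f66455c281d963fee162cc85,
0x3acf81983e056fd3f1b2a029119b6bae90b9cd170190d0e551a64ef7359b50002d984a061b7c7445a19541c3b515c6077,
0x2ccd14743fe1e16db700f764cc1b95cd1e433734616c0f90f06123867467c72903fdb7268121d4f4a7014f48618594456,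
0x7e7eceea0f157b9feb67a2bb4f58d8d1aa477ef8c516cbd38b12863a2106b14d03a9b83b1d896a8e3f0cd2f574d8dc2c8,
0x5d4254a8ddfa462646dc5586db6fc288ff346c3ed1f9f508f3d0f6bdf01a4bd4a048f42c754e41a162e7e426361127ff6,
0x9ae31c34f5c5366bf1ea601b911bbc46942165c2ee831b11e0b55857c4322fe1960ffa31caede5d949bec387fbd8113d2,
0x4e3433bd0f54eff895d8d0be9caa27a2484d08110838fd9b81070ed4902208ca5569258f686711232291047cfb3245208,
0x752667f7c3f0ded4b7c5701928a70ae738e9b80466773def987a5eb539d2a52d5618f690c3b063f9325a0732d3810a5ce,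
0xbcee3e16608c8485373a7e82fe20aa1255287cfb61f91ef5426e4507631b6a9ca93c6ec64256136073b04e923bba79400,
0x1adffc15c4731a18d100efe2c75aaf2a78f493d4a68efe494402c7786ae907b76119cb15be4823d738e6655e698631778,
0x3b03cac6f381ae55d690126a40d65e46f29f9c432a348018362d949c26593fa4bd309d46c48b678ed1ea2723190d680af,
0x534365cfde09fa88c1fc6120e91fc1f2767c81afb4a5759dcde42caf4f25d3f0bfbc221a838bb58724397d1209c7ff5c4,
0xf28a308d3ed11037b4b9052407c3494a927f3a564ffe4d1655c465822ec96fe423b90716938c755fe79d70f61a7f1c54,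
0x2d3da21549939ba8a68e2bd361f80bd5fa902e7c9da92b3756b45402cf4f61a85b385f05e2c9005507942abba384199a9,
0x37e5e688d194813505a6334f3061c73168bc6a80052df1a9d5ea59fc08e80df2a38aefe87fbab5e36abe75602ccb22fa1,
0xa694d8a073cae10a5f1356fd88288763a2064bf7c75ee07213023cf7fbb59152bb4c220dcbf1cdb2bbc9097c46be17207,
0xbced0e14aa4b838b050d81a798f3800e4694f4cbe64aa8236cb953d01d0d65466fc35d261e3ec510860429cbb28f2d6e6,
0x6c55c96bcb24f408f9eeeee841a5032e835363f104c140b9eb1146cea96acaec120f9390720f5a3e0959ccb02e0116d80,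
0xc2309daabd33d1e768b786a4d01a0f0992816dea479f70f4463361af890a44653d20a531186bda2eee18f4dde52275b28,
0x85342db01da6c7e3d6a5e98c264cc1581fdecf65e03273af8ba990600606891975f92cafd06e4ef78fbadb49ddcc4719a,
0x566a33a5152bb75b8e7f498a426fe3f39147e15e9ca2ede61b7d60899580d246c685332de21d89379c4e28d1ae711f21,
0x9ddff276b42a3626732b0ff1c9d78d7859d7409f7481c4b492fc46364b72ab9b53c4fbcf551ef46bab478e3f94debf87b,
0x149f73bb6b1ab26913c491203808cfee2f8fab0fd4d2ea150]), (0xc87630, [0x71]), (0x585310, [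
0x4be9f316cc8ace0d2283348f145f14f0d269850b95008e717b703ec4693640bae1b9ce931cfa4e612b49996a1fb081cd1,
0x9fc37b06874a9d99956c7df49c1159874b73a7aebe69be26b7ba87ba87db0a71853d7b9984276bed69e3239a6c2fb1691,
0x2ac2a04861ea3342fbfbcb52829c1c2a1d8a077cc207e30febcab0b5f9f71a51658b459ace9ae9b58ee350cc17ba1cb64,
0xb9312403738d1013d7c651d14e76efbfba45fddb3eeff88765a6a9bb17dc65e7142e60688dff5ff8d86915ccaa6448edf,
0x9c0ac3f7ca484eecdd9ffc423c950aadb4f792a02506954aa86ac64b799ec76818c6fb1909432e73804ed448320ccef59,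
0x3620f6f86d3efdbd72b5c59ecfd5392b2d0dc19debbf61aa736896c04262b6f1e3dddaeca62322bf5bea952e1c0894c9c,
0x931f7e482197d46d21c5da7328d098b2af7e9c4a73aee99e37170e7a265c407c99ebc6d99f23453730c4dedf5c00bce7c,
0x8dcf02644738453dab0f13fe27bc82a3cd48fdd4113e879d82dd277f827cc9113e91c7f22b227fbec6315f5fffb4618f0,
0x75d8ba3875c241d56e7f55f81f6144aaca591bc885a2a9a6cd37d122162a58ba79a845a1f0ba67fcad4ba6b456bf10e1b,
0xd3bea113ec75e83b0d7802665887d7ea1ce8132d0df47e9aa6f16d9d30fb980537a579dc7372471060b1c824628b90638,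
0x5e6d1dfe49a1324c8e160c400193d4a9319ba3e8bc7cdf346abf4234f82e2bbd4a547c0ecdafebc1cfd0e281375662e57,
0x9b76456952e5de7c9cb863ae367cd1bd0d66253fd575b3deb5693be17d4fc4f9aecd9f433bc1016ab285e215e43ebb5e1,
0x9ef2fafb9df784564b41fe2ddec76f92602755efdefabef33e934a9e37875eb82089c23c4a9b0f52ddc26aeace991104d,
0xca79f4f2a23395f1df2bd5cc8e5fcb84121afd263bab4290a1d1c78983bb69513d246f3789e00cce64f6fb5a85418dd70,
0x649c08678b3a0957ea99c2608c24d1e930d901fa1770e2d5d694f5ec7b457af2bb0c01b4fd99ec59416001314034dc191,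
0x5c9f3f91e71fabfc8816a4dbc50b1c412c4b4bd2064a32021244c9834e38c436c23a56192b3c764d6af13a3b6e97c9d9d,
0x2955d1c57b5bd04b4e3965b8e52b99409e9c02c299e4fd9ea9e3f292bdab3961bfcce623035138e03641c91f07f0617d4,
0x3036a828588417c3ff8a3d0530fb6ac5369107c59e9b6d7f062a00992d7a9a483033179725f88b107757311e5a15cf7,
0xa820320e14c9d4a627ace050fc019c6abb49f86d13d8893608d94f35b3fff3e74bb93694e66733aeda2da6c6493f3a0e3,
0x83dde741c9467ff0cd1c0fd801f63276d9f90bf8a6a0d766dc75ef1aef03a115e70d5b71452df84fc320a67bc5bea80aa,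
0x3906b72572060e870a08db67c03bf3c4ceb206fc073c4bba6e5e0b84a990624f38abf09b2cd7f21da8e84a4bc2e920336,
0x306e8c138b0f78704a2187e72fc550227a22abb73c65f39d1cb63906231f8ddf5a6c463cb6f243ecd511501958b86f6df,
0x4be15e2713698461dae1b85e1ca145f487b8a7284632332e02b622c19cc5ae0908a891042cb5ee6898dd8b642e2b5558f,
0x847999683e4581bd679b5039241ffae4c37d0ff1c1951be70245b0cb8c8480e118695a585f338dfb29219434080463f15,
0x198dd08e508f82365f85a5ee6ee088c8784f50075fbd5891512ea7ffc2563a913557897daf9baf63ea0fe28c463545d4f,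
0xc68fca2de458755f21a00605d4a815c3cebd561cf7156bfe586c41a0335a08da4425c38554f0c6aa00096e901acf829ff,
0xc990a53cabc28a9d249be0d891402fc7a777fa901ec814e121a61225dd8b95f4347e70c0d02ad91f4996e7c05e2736b21,
0xc635325b975c19fbdce5ea96f4485800b7534e5cd3d1b796e517c1e5d8eb89cfd09f9f72279c64d657381888e3bffba45,
0xaeacbf18ac4150cc3a2a12ff803cec9585ad41de3cd17d3b31186cc6f10de7ea76defcf7240d30c08e85080724684989d,
0xae7fe96eccf12cdbd50501cc59a93827d9ecf5d8cef90c52d608dd2cb0345bad482a05c7620bcdfd89c49ba8576e01e88,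
0xb0af7b2db9c726c757bb185dbf11f4602ef224f641588ffa8ce2bcf36dfec61da284286a637d60d3573fa79d085e3a6da,
0x47dd6810c493f5bb38add439652d2c058c9cdfc7414b87a9fa272c26f8499e652b10b4c5ce6008b08ba8ca3a7d6f53035,
0x847fae206edd9650ffae7579d40d6b02eb2498ae3837b1dba9603d61b3352aab33ab2920a3d400b81fe8c007ca3dcea4e,
0x3d69211b33a993fb2072862f4a646d867edb81be0140bdd435e8c4aa2fc956268675be49447421c03ae5bc1d97390dca6,
0xc9315566686c12557da4a5f029969b055b546d0e45a1e98395e3fc3c2d80e535520f8c9dc878a9dd49594220872a051e8,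
0x87d4520939a5e192fe56fc8dda4789346c94cd2eb344c7286d11474786ebcb05bfb513b664d715ff0f5fce7a11f6fac42,
0xbb89d079c7b6762ac51a7c2a202406a37a25da1106daf5e87ff07286e997004eed9e45c412284d3e580804dfca3ddc680,
0xb701a2e402bca234bb3d1f293dba57d32e0cd4c4f35088a471576a202d6194ac6a890acd5fc4dccc190d275453baefa58,
0x271c3e3c7bf6b414b20540088a45b5817d60d88151e28d235bbcda554f67131f9c11a7a8a29888b31dfdee6c35f40060f,
0xc92a7ddd9c9a62d817c9805a713893591c0bd5bbf21f79a5790f2c1337d03c68ffd67606e55829078bc2e6f2213fdc2dc,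
0xb7b009b93ec9a6b25b5704e02531f6c9fe79434ce71f67fe657d79183e49791e2b2f30db4a82f05b2b5c44d3401010790,
0x533d2d4ac9e171cd50fa307e275069a9204fe18bba388c937ba0f3b2660c5ff3799cc39fb84680cce57adabd098614ec9,
0x435744f7e6107587057eda97f58ee6a3a991a4c7e94731ef61991a3d5bf3c1a18ecc1471bbde14749462b7c5b52f75150,
0x5e86866e3efd0c3bc0ff703ae0ba22ddff7a03af5731d3d107a95e5329fe13d0fddf8149812b69d835b274e47dad1fe02,
0x198b2e21c182f09365dc6cb4cd26c58e8f45aac1027e0188aab8bebba96ea22d372f6cc1b555cf90b4ff60040da17ec49,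
0x9a22ba44adce3a80402062f51c6bf0084367b77809a9106bf84d94f23b43a393d3e41840ee4ed776a41bc6ba074e217de,
0x405becbf30458b6ae842d7b2ae3032c063061d8e4bf00fdbc15113e109d7e91e119e34cd0e76cd6f79b799ffbcfdb21a5,
0x47fd50a6042f936c97c2b09b5ea8b7b5b9e0c781c447d488b6bc85639bea45fc3697a5605f237b7]), (0xc97420, [
0x5f]), (0x285310, [
0x4c16b480fc6b24810fbf0b366ab7442dfb739e9577d4fde0772e83e98a5bb1ac09eb19c559499cf427e0afb50da2a44fc,
0xbd170554e945b3f7b16a20e58a0d24b595d99ceb803ba35a73fcc36450be12e256a9b606f88fb73ce43e18f335dec52d7,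
0x86d1a67b298f9dbbf6881a5b7b408be72d168ff9a42092c0be373a428851dfe10590285445ae7dc2382227b126b43060d,
0x8b8ba9ea8a76d4a4eaad24bcb59cbfe84a1e77f47cbe75f616462fc39a181f7534b65f0f06b1d50a620afb46b2ef900ca,
0xdc5cd98265f0a0b52521c22446635104719180698e7fecb03920cbc9ee20fcb5569e7255d5b424855eb6e4e78e3bad653,
0x5a0b2628636c761680d353e5352029e44970f7470ce5e51bb2c584ba0b6a8fe6c276e2db045826359c4006135d364dbb8,
0x7759db2be0b2c5ec51cd951f6e9616b6ba9295ba50bf1633fa9ca5de5482fca09c739d7b6d026e10c1852ae0d424d55ea,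
0x8ff680c29db097b34bc094bf86346ff079771beeca580e449c0f6149547741f151bab495c23218f65e2ff11557e3f0357,
0x848716072799b79e1409d6844050b6de558bdec74800012b4d7d64f0e84cfbb1fc6c5c42ac85f952097d64e0dd1aa66f2,
0x4c3542b5c1497fb3905e8973d064c5ca56532e2e367f938e4820ed9429bc401dc585cc0e07d5d4f42c1db6b6e4f960dbd,
0xba3acdc8fd111408be26118579d9a8ac4784b96ced7017635fcf1e580a6d8d9541fb7d1a8101cb83847c0dd8127825a1b,
0x2d5f4ef5125f22f2092c0b3eeb99522692827071b64e218b2257514bab9d92c2f01014dbbfd8c0f728c9cffb1cdd094cc,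
0x5c4cc0779b9527f03bdea0e07acdbd3b61143b5ba2b8b345b47c5f8364019d849074c0e6db3d8296e013bfe012fd9babe,
0xc01502a84b9a0f3db82fbc0851d90b075aa9e3a4278ba9d2e5e5a37a3809f4f5874b6710ad165bad20a7d65a76c0e4d1f,
0x5c8018999fec4a4b5283b385b4fdf06d210a547bf14202014dc75ed9d318a829ff0e2f7acc9a8c3c5c8271d2ad83b4f1a,
0x90c1ef8c3d4fe633b15ef0b418a33a7393ccc5301c63d6146170e54a57fccfb69f9c6ede81f8c5d981bdd9615d1053cd4,
0x667860f41351bd1337ac9621970ee02131b71c4cedfbd8516ea91b71fa3cd3ba22169e8806848a639d1f61a0ba4b10af7,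
0x2e31d7438f5a9e1b381d4570bacbb82f5c532d192d3b4b6a992a863ebeba0e5bef2bb64221cf5a0433b1af630a50dd9ed,
0x43ba53365e7d8bf3865ba2a0e96795ef0fd43095cfbbc5bf994f2ddd3530782c394c68e7df34729398d4f6626ed43c5,
0xa966be06f24caf9787dfdada8cbc473aefdc52aabf45e7764e60a651728cb614afbb3f1fe9638bc25521bded31f9f8290,
0x2ed371cd4a92f8481326c7dd5731eb43f313ee2631bd93182299a9c9bfa1be9fc88182447685ebcc39734fa472654a70f,
0xaca4626b1cef94cd1b3bd38647087f878]), (0xa75420, [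
0x3810bb193fe7dd84247c25cc646800770935cf406d9c171f3738f424ef08c4e74294cf1d12d994985f1a5cfe88e33dc18,
0x6ad0c11ba62aa9973c46c68669da940aa6b58b1ebdacd1c6020057e91c56ffb8c6da90a1dabd40f0035bd1e52369b2ba2,
0x6d8db50fec3036a1dbb3f86233d142e6f16cfdc0279281b322984c58909a4aa00eb1c07a97bffb180f016879c61782c86,
0x76d651db152ba75b624014422968c5899dc16e2347a79779f625ebec27760933d8a662b5ba8f9439e1684308168ea2259,
0x6fdffe875974c791690dc34ee3e2cb9c04ee3e8e8a654fd3b2abcb854c9fdc16cd4ab6798a30a674a4d9c7e05addcf50c,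
0x45b4a4d9f2f9c0c705aa7ff38b194feec9843f1ba819877c06d33b12f658ceebcd2d1cbd43dc7c60ff207f1f206d271eb,
0x90e75b4f554f7c5c45ef8040b09993c3e9ef16aa09854a3818f509eb2beba2d57b4c821e3943ca7d4834ecf4f1ba2aa7b,
0x3c7e9b4bdacb8f84c1f00b187ae1a0caaaeb78ef8b4f3c89d689e4740954dd238793d33f661922d01a2c44c180a328168,
0x2ac0b89e5f28648fdc887c36d010d7a9e28532e75ff99e92a21c41c45c539057ada98b4594d2d777d0bd96249875e7b91,
0x9929bca3cdde90510d4e1fa4195a1a09fdac08a81dfd19d4a50bc7d69718ebc156512d32d305ea9338932b97dcae42549,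
0x6d0156846b932f8a8d5e1be99a82cc12ae94ba779623048165a767b46f0237ba2768427cfe56017032a9a486fce3610f4,
0x3fd635fec559cf4a69f7c894e9f4b51dad793da2828d1b90856a5066b5149e1c8a98357bcc66f3eb0481aa90680d966db,
0x4d3a139231afed75bff294a1c59fb205fa828dc59d6fa4c5447281c729e8548a04dca3]), (0x575320, [0xb0]),
(0xa86310, [
0xad588c82db86973255aa264f92324f482b31a11d3825538a55055c0feee8be0b0c81de1879c03969810ed0406c2426d0d,
0x66ca6ae04d6e30207dc2ac3b2c7b6746da0994924385b7d2e1dbb811cf08fb865a61501e2506941868c898089d238a13a,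
0x55e6e64a05a0978643aad6028dcd40b24f8cdf50f0e696624bb89cdccbc83088f2006c422e3731197d24728560cc25ec9,
0x62ff09889d03af93450962f2326351546b9815a6d37aa706b526912e239a02a1cf69eed1f57e5a4f85424cd8b4e55b6d2,
0x417c61923be7d0a08d4d3357f1affd0a07c1c6c7936dc119e2f3c9862aa53df8132ac5146ff42e546caff12d4492e3489,
0xab1f47feb38c36e668d5bf7de093103c2442fe84f5d44f216a39117c01b39872d56d97d887348b0e1ccb8c2cd9d71b0eb,
0x2d698d0e3c9101cd68ac582c9d2b078299825f835a1c8df6c81d3ab739de62242b4aeab9d9998003db4b03ddac7aaa20f,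
0x2757067d11ea0a30f8ab7756b75ee5da4a4c730a49ac73cc348e4989058740a11f1af2d32]), (0xd65310, [0x1b]),
(0x953210, [
0x3cf8bae626b5ef43e00033437ad3cf1589690fd91193f4f818b596c2751459529c0f174fe5371623006292889f01d60c3,
0x9cf0a466bf101c69e7511301b15c2ae797ad7df54b8c8fa6849096c49d8b0860b0f257db918325de4949fbb04fcb3cbed,
0x2332545f8449ebc33149721b29a6286175228ffc8e859f4920111a428b3817358ad7ad97ae8cebebe9dee03c925773e4f,
0x2ca6c4a4ccba3670e46d93f05eb90262f0905aa875d77436a30eb4f954f58958153b1a5d15e4a1a94e606e67e0b077cf4,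
0x2bc0b2fcf14df8940abb210d4020a93af075268897ebb378a91270be179d7ba0225290771a5d4df4f41463e31d6265dee,
0xc09ecac7ca2f306abcfbf4ff318ce32541d1176a6a8b1ba2082619b6b294dd531b26370ee4a8d1fe3995746b6a1ce33f6,
0x3621289ac565af4ce7490c05e0e0f4ee4886305003688629752ba5d62c53ba762964fa653e56c08bf14ecd7701c49e7b8,
0xf72c66eaf1cc0cbc6578287c8d25c8f37a2c40fb666d17c215c6bb2947576edfef54cf9ba2195f252cd035d3c12e59df,
0x3fd54ff5ee3b152155204c591141403e29b9f998e33c281f3e7f42b68ada1fd6ab16c0a322f0f12c83feeeff91fe76323,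
0xb974c3b18fed55999d4e826790db4ea6886fbdbba928d434d324002dbd02851b1cd12cfa1c04badab9510a2a7f4a0412d,
0xbbba181c0f5a17f34f250e05024e08bc7d3950b79497954b81bc78d0bad956325ddcfe548de52f3bf31bb98a4698dd39d,
0x26beda93e506271afdd53b01b39b41e60b54420d5180a7337c6300e4f86c0aab402fbf33e]), (0xe75210, [
0xfcead3983975053dc471ac9e2d6a4a05faee0eb8bc769ebffa36e0d9b7c8c16398ef76215da0b8b4a3aee35ed5e817a8,
0x7c5262996a4c21a88acb87c737692e6537a0a05acbb0fde7755fddb3342e751f9dbe5da1797d5470a06b4e1476d200d6e,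
0xa76755f8eaaaea75fb47cf30adf02952e75f363f0e36cca5b533337320fba5c54d636afac9180cf83b5e792bc8acb2f75,
0x6e4f7473025b18ae039cd622af41daad1c163ea37b7720dab47917f4ba6bf44e5d03d934da9cd59d48f2fd5bdb9e9d626,
0x3fd7d28ea7f96d072a17387e76d391ebbc10b3e00975c6267a028bdd28052a12bd61d034b926624fcec112f6d88386dfa,
0x69e559845267a742ae5418989ca011ed9e4cf156ec0907eb8216ef12da272c09f0c403db7e92ada9fc21a65077d8ff414,
0x4245cfb0d1e3e2edf64554ca61af9a0a16ad982a9a425d2274d33c3433e966ef586d9e7a5a1fba5bf43966c27f4bd540f,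
0x517322b528cc91fd4dc83d2e8d509775eefb0e6eeae8c850b943d0f4210a12d85eec062292e57200582695dd8afd26f07,
0xba7af1384969651e0ab38503b0107244f07ffeeae4f73721fedbd4643404e0c6a0336358e5ce1813ae0c8eee071b00740,
0x12ca4d6104149dccd08]), (0xb64210, [0x158]), (0x385430, [
0xec2feb1025414cccc0d1e85536ff3ce6945d6a71f1a4867cd6dd308b611103ab5a5ae22218e26e1495f7365e45fcb303,
0x9ffc18c9cee3f1db5db7b2b4e996832da51c24faa39308258be625f4adf70a17346d2bba0908c079293391eb90ac64cd9,
0x7cc729756fb0e5c435359c901ec22606d5f25a7f52a764a00a8f20eb5631b1a2fa635069675512548ad89c9ecf73a2191,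
0x2651af7bd71cd4da67b83882c4aef78c9fd97e7147015a529083881]), (0x786410, [0x1e9]), (0x787410, [
0x4c3fd58dcc70eb63e5cf286b43baf0657eaba4104d910ed5e934a1aae2902afa2bd48f2e08b473e86fded811093fae35f,
0x7c711740420c52b2a854b2812c58f44243194d7cb1f5199b0d7f67f7d2e9b3e5536c8a1b6c7b0951a37c8d257b1559c27,
0x2ee2a5b365b95643fc0cec7bedd56cfb37c726029c8fd10e8b904f14978f2e57cf413805c2087d20774f5e717817f61aa,
0x7cf79e8075de32d6e73bf50f3145ca219703206850b2819bf7e51ac3b61d5d192773b9dfcaa79bf3145feb491f14f491b,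
0xed1e0668f1d51419d97176644f22c42b7169920697521fe8f3a92b]), (0xb74210, [
0x1e7d11d979797320a49fc5d5330715e2445422f389ec0331b697e2dcb5f9c652dfebb6bbc9c5901e0f3c33611a3b90eb,
0x4f56d9515456b4d43e5a040fa457f801e57dd359d8ca4814576b7a60b53c53f69f10c1923207912456cb4bc20f4f40d4d,
0x45d24e87f6ff27775045c190194031d66004a4d7883e0925eebfde87150c8e17674]), (0x776410, [0x68]),
(0xc86530, [
0x23842ace10c17b398c1d64e4f58b2c9edbd08a03cc6c30bf9df0d7f0b496a0dffde95ccb51620b6ecf1faa3071cd82586,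
0xab6bea73aca4ca39565651ed76aee73965e7cc3dcf9626fd6d3ef7e152d797676e15374fbe70dad32cd1fa6f3e3778f88,
0x6c85f7f3c2181f04f2db65bda59bf954c7e918db5927f3548352d66eca149b3262ec5b460543adfa3c3b8d0e8500e5db4,
0xcfb2094e6be1fb08c6226c08cb673033720975829eef32f0abe001fcd7c922b44e25d1277b1061e92b13b15498749acda,
0x7bbbf319e9d05b9dcc6625811cce38a32538e75483918c9ebcea295f38fae94412ece415e2e55ba6be26ee2dbc3208927,
0x514c564c6108285d109e4da51f84bbbf9d8a8b834c7f49c20a4d2b2fe3c3c9212f0e17eff50427481909decd8c8128576,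
0x26f74e242561410a03e5b478d3dfaf7e4b7316b23f6f8e98efcc2173cf5506a7c84bc7e5fecc0d6461febf9547ec7439e,
0x31022894a3f65618b620f7d443868a3e32ac44106f3a0c80b235e2369b2e8fdb177b7aad8c11b48c1c3baa2552401b0c4,
0x5344bf8b61f708ac867b3ef6f402cc449401d1f8cccf6df12c08c8f6bd5f89dcddfc85505915735831d719cf344fad516,
0xd0d88fa545b5fe88f58171e8b492d227921434fd300fad9a66b06a242d22bdadd23ce16293a15eb32383f8adc95948c83,
0x9174d4345f4c1c9be6d720c9b1bb68d56402560b4d0093ad38c3cbd6131e15f1d178656f29071318f793af350dcdde060,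
0x672207a27087b9e1b9f7dc0dfe327cd452b2b15cd31756331af31b3b8b7723534ff54131e15be2a9d9e5d7e07d413afce,
0x933d08d0c0f5c21fd10153da5253f4c0319fe4789cc1680bd4d26f73992efa0520fe84a152b4ae3cf215522cb24604a70,
0x60aabefc0d9977474ea9dc0981051dfaedbd5b1a3811a75436b87654223a55feb2400b]), (0xb64310, [
0xae4d18e8efb414d3cfc45e7e16e4d0e88d8ee2b89350ee9c47655c5622676bbeac5db4cc6d4980d11751c65a506820e38,
0x29e2bc650ab76b3763144f6ec4bb20700794a0afa2e762208911c30bbba53acc65498c803ab74ac359bf90a04ba6b3012,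
0xaaa8fbf3c1bab271474abdfce9c63d608803c87123d287572139403f5b5123cd4b1c73fda4ec805033ba10717d857d530,
0x5a21829324c9cce74d67a986a89382cc3ac9e98f011e726df3187952a426d2e65d9]), (0xb74310, [
0xf3f365b1df30e339aa]), (0x775410, [
0x416121dfecb239b91894b59fe8882bc55e3e410891739993a8b07d01fdb2f76a769f0b3956b5e0d12a0c7e654c8499022,
0x6d865f6075446124a9c0907343cda9f4f8a30a17cbe6f17d99c032b15a3125abed928b53a3dce041f2c34d523239cdc4c,
0x6d0aa523b4e3d0d1871844c516260d107afb19605f24654a83abd20b384183c02b277cbba08bb99aa10e26a9ab6e59e3d,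
0xb246aff8b17899ffe8e1eb28a6c34516beb512ae0517e1db16daac68347c203d593671f9666a489e28d3eb26a8f0d09fa,
0x3c13993da193387c8d7143767ef18c1a043b3f99c569444fff155c0]), (0x875430, [
0xa77ca9c80113c626136c37f108f5145c5dc7e73a97f916495fd8c255b043d3df8187540d29e6fd493256e5d5f40a0c06e,
0xc91d6d63d9e893ef59e7f3ac00fa7a2b888ca44089a13d0d347f3a04070d0b45b8c7db9c8cbf2663266166fa8bf3ac0fd,
0xa026bb0fb64cdb8aa4e0e8d7f05a68df613ce61bfeeaa0c5075278b2fbe3b96b6876eccba54a68b9c73211574efa408be,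
0x21d66020bf07abae0b45cb8eb729af306714a]), (0x775430, [
0x4a01aaa05568fa5e80e24c01510b9d64b71d7eb2f543d514f3b48b005983b64917483d6ee5e0298fc066a90ff66a1227b,
0x55fa5a117827117d2c14bce6492776f4120d377306f5cc3e74242e1afad93895d4ee1f36bb8957e36f837550f3fd119,
0x33f8a896f23b9ef0addfae5d5a77feeda793e03455e5dd254b7f7d6a3c8ea6612ecebdd794379ce0cbc0b6cbcc29f5586,
0xaca263944d95616fcfca61cd238eb9808c69938ebd3e9c2460b366f8bf188f053847db0fbd3b647b39378864fb804ad36,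
0xbac830f54c5d6fea22d338eb3b444c7a6cd8163e5dade905ea9d014139f3212c2a538ea7b3818d8773a43ed12c01440a7,
0x1106cf6d2ce4787d]), (0x376310, [0x19ac373c9ed904a77d180c0baad6061712b766163fa729a80838604b5e144]),
(0xe76320, [
0x5875b741afcd8b00214f5854b4bf5786256261d5d7c05341111705df4eaf19f4dec942f4518fe88e91571015e00]),
(0x376320, [
0xa1a3f7bc645e799bb811151c5d641b6368eb47d3e305c190f346db01acd76b517ac3e416ad4d5b47aa74ae04988edf065,
0x3041828b28ab6a3fb05ce620295091bf5414b0d6403d65]), (0xa76420, [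
0x2cae623cd8119029cf8d2a3923e71cb19eb2f8e680dda94905a46fdbec24de42f7862fd96841a8355c600cc12b8824b8b,
0x545bab025d67762ea66ee44b2451993c8162e177cf87ae2f8634c0c0d38cf6a57b736167feaac98befbd86a7f97e6520,
0x433178d96]), (0x876430, [
0xa98a967ef41f9d2526fde0d5cf0475ca30176f302ab9fccfd35f67c6d863eab45284f5514fa9fff1d6a35537c577850b0,
0x615202271336d4f4fcb48448e4f76a8a933475a85874638cab32f5005895262f12d79c50527837809cd43c5c238]),
(0x776430, [0x3877156ae9f71556fa213e9148037026e1d3949d61d1c0b751ebcf265cc76db854d98efcd452]),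
(0x576430, [0x49b0ec9249c99ca331e59ad24efeb8e88d1bab76542b31e9f397adbabfb61]), (0xe76510, [
0x42436b95c1d430b2b521ec73e7391a88f936f02b152b2d1fec809662e93d724e792142ed45c9172b9f4a6403cd288d42c,
0x47d769126746e5eb6546721a0b123bb8acbdc305e179df82e1dc70eb5a0b6cde412271229]), (0x776510, [
0xc0cf89ff0403bb6e9c3567ebe840707ff1beff7cfc6114bf1dd4fc5015e3813b8f86dd65cb3527d69bebd6382a33c4820,
0x9ddbc3682923307fa130f0c9689f15761d11908502195f9721c31b1736daf896a82adb64f6877a2eb62e75dabe417a5b5,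
0x526258b56291f9bf29f6540389e364bc958c784afac1022e858c0b49ce59d9dc9882790eafc5e5a27d6268b1c5fb06b8b,
0x36418e0e39fb818760cd61fb8cf357b9af1561f2230bfcbf1daaf4c047347eaead99df201d13952]), (0xe76520, [
0x6f]), (0x176520, [
0x851b8bed7f09d5190e989465aced4250cf1ad8bb151dde0f3f2c95ebe5a041c8a1f35622ffdf32ff0863895167167f044,
0x51d1b4bdd84e33cfeabb4ecf3364a96b9153bef42337f4083ad248f4da68a0a2f20bac8f1c3c8e7a143d1e2fc1a5964,
0x26c4d85eb0ed61c1ce081f1973a7052e22f3fa42af1c227cb880a2d246e3410971f3da76dcba7f669bf6c55a94792f6f4,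
0x2a32cd3cf803f1a93d24884659d0d1c7b4305449178cbfc47a1c6368ad70f1cabb7145b5f]), (0x576520, [
0x975393badcf4dc087d216559d0b9bf9b05051d3ef7575e4b10a3de4252ac0d273e4d044560fed85c75161c25f3f3cf0f,
0x48ec33b881e07fa1dcdcfdcfe7dd30c5ea39e3cb67acd84db053077db11e2cedba347381546d547862d2add2be1f2b953,
0x7b574bd16570ce132e85e13ccf8]), (0x576530, [0xfc330588386be1503c02544fc6040a]), (0xc76540, [
0x68eb0bc0e20aa441c3a0f]), (0x776540, [0x124f7261747e32d8]), (0xc84210, [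
0xb958bd5d7d04b0590b444b04712107f50a70ad1691567ec02a5b522e1a02eaea347f026cd59ac9c0baa4b5677823ee6a9,
0xdd9389d7d6a43b993aa6c43b04e67099ad5fba6410fc79b138605b196fefa2514c3c8e]), (0x484210, [
0x149e037129e1ea27079fb082d]), (0xa84310, [
0x2ee5e3f01fb0e0fe10be964201f90b6572b598d940598dccde5f21334324d83a13d5ddc1ba8f34a0e7412d7053a7928bb,
0xd04c5c1f80473ed126facac7b03]), (0xb84310, [0x61085d43f1e8]), (0x884310, [
0xfb348ecf2ea8a6c3d33f1c4cba873a79c7f6b21aadd05a52d200985ade11c5104170e9079dae733fa4b6fb32f0ab956b,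
0x6304543ff3c487c5464089763f71339133fd11ebfc8d9e82b3611abfdbb1a96ad8c23498181860e6cf60cdf9a9cf42723,
0xab93dae008deb26c40f188d4c6f51daad0d37fe23d5f823205508664c28adedf06bd6c142f51bfa384c2b6f0e2196ad9d,
0xbd3ed4685d256b409215eafdfa1f237d6ec6e7c814b84e6f36b17a0f17375d6595617053cab8c7de5e7454e45232aadd7,
0x5a978e473]), (0x984310, [
0x383b109b0fb959eb964b2ad8e641af95e50bdd7272580a05becbc6401923c834e1e1e2543a5f4a4057bea0dd60ddf4a31,
0xc0d6a4c99070ed745e74bdabb7323dd8f07c1dd78273f01881d2f587a35d39454cccf7d63d7532cc305f45cd5f679fa9c,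
0x7eb5a1903efaf0cf778f14cbe13096b9b891cc5be714244809604affec6fa2b03c042a30de418ea962dbb6ee04bf3513c,
0xf4dbc566394c33a64d2c9]), (0xe84310, [
0x3c24e2b2255fbd899e9cc3e032dcc3bde573b7deb685e73cfa03affee9423a46e6edfc79c7f7af48ff38952071e68bb42,
0x77e487c3429f35738cd1ec62f6e51813558231096c813cf04063539ee7c51c639ee6dd26947bccbd352e2f84742]),
(0xf84310, [
0x970ffcd440e7fefc9f0ba4daaebcbdc9c1fe63e3233dbd6b651755edfcfdf58b08c35ee0079e6f87d9c36ba19b5514c,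
0xbc0be78c50f0909b7f8ecc268290b15fb1c75ab6a1d9acc5b477e7c079215f83f64eb2be84aeb5cb4443322d7b2d8e948,
0x4ff7bf41b9a6933ce62cdc301b278515a5cbb6558a6001f97b81858a513e65e11ca91f60229a4a4a4a02867e4d26a20e4,
0x561db7]), (0xc84310, [0x8]), (0xd84310, [
0x243c34323ebd560dc9257f61be36333c16a787f99c5d58b933bfbe2e7aa4e0e16659be87d761f842a378950c37e013bbe
]), (0x284310, [0xa37b9ec0f7e9dc0278c0d148cbc85256626441367c052]), (0x384310, [
0x3e6f7ce287291a11bb470d0c015a8313c4a18c365482a19eee93cd92761d4d0b64f0060fb30ee048b9fd6d63ce47c642d,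
0x70650de1cb2451810adacc95]), (0x084310, [
0x4493fd151af30a22cb7cdc475d326ae46e07c7b7e526b90a508d73d523a8596394bfae915ed187e81c2693ee7b85325d3,
0x133adb2e8d5c9bd4956]), (0x184310, [
0x3e8305ec469ce9b7be6d190d3b78c9cd8f401c26ee2075761d29a8ca566a97d90fcd81be8b18cccf5fded3a1db4074387,
0x7bd9455c9fb5e6e7fe]), (0x784310, [
0x673897ac265afe28ff8b9327a8677f1e3301d3cb03b9167da3343e105719ce4e49b890f66514169]), (0x484310, [
0x40])]

theorem rotationInvariant_lutz11 : RotationInvariant lutz11 := by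
  rw [lutz11_eq]
  exact rotationInvariant_of_list surfaceList_lutz11 (by decide +kernel)

theorem excluded_lutz11FacePairs : ∀ c ∈ lutz11FacePairs, Excluded lutz11 c := by
  intro c hc
  rw [lutz11_eq]
  refine excluded_of_separatesFaces surfaceList_lutz11 (List.all_eq_true.1 ?_ c hc)
  decide +kernel

set_option maxHeartbeats 0 in
theorem not_exists_isAdmissible_lutz11 :
    ¬ ∃ M : UniformOrientedMatroid (Fin 12), M.IsAdmissible lutz11 := by
  have hK := rotationInvariant_lutz11
  have h : ∀ c ∈ lutz11FacePairs ++ (lutz11Refutations.take 0).map Prod.fst, Excluded lutz11 c := by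
    simpa using excluded_lutz11FacePairs
  replace h := excluded_take_add hK 1 h (by decide +kernel)
  replace h := excluded_take_add hK 1 h (by decide +kernel)
  replace h := excluded_take_add hK 1 h (by decide +kernel)
  replace h := excluded_take_add hK 1 h (by decide +kernel)
  replace h := excluded_take_add hK 3 h (by decide +kernel)
  replace h := excluded_take_add hK 6 h (by decide +kernel)
  replace h := excluded_take_add hK 19 h (by decide +kernel)
  replace h := excluded_take_add hK 25 h (by decide +kernel)
  exact not_exists_isAdmissible hK h 0x084310 (by decide +kernel) (by decide +kernel)

/-! ### Refutations for `lutz12` -/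

/-- Codes of the circuits of the pairs of disjoint faces of `lutz12`, one from each orbit of the
rotation. -/
def lutz12FacePairs : List ℕ := [
0x343210, 0x743210, 0xe43210, 0x753210, 0xa53210, 0xe53210, 0x754210, 0xa54210, 0x354310, 0x354320,
0xc54320, 0xe54320, 0x563210, 0x763210, 0x764210, 0x964310, 0x765210, 0xd65210, 0x965310, 0xb65320,
0x365410, 0x365420, 0xb65420, 0x365430, 0x773210, 0xe73210, 0x374210, 0x674210, 0x774210, 0x674310,
0x574320, 0x674320, 0xe74320, 0x775210, 0xb75320, 0xa75410, 0x975420, 0xa75420, 0xb75420, 0xa75430,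
0xe75430, 0x776210, 0xe76310, 0xa76410, 0xa76420, 0xa76430, 0x376510, 0x376520, 0x776520, 0x376530,
0x376540, 0xc76540, 0xe76540, 0x684210, 0x784210, 0x684310, 0xa84310, 0x684320, 0xa84320, 0xe84320,
0x585210, 0x785210, 0xd85210, 0x385310, 0x585310, 0xa85310, 0x385320, 0xa85320, 0xb85320, 0x585410,
0xa85410, 0xa85420, 0xb85420, 0x585430, 0xa85430, 0xc85430, 0xe85430, 0x786210, 0xa86310, 0xe86310,
0xa86320, 0xa86410, 0xa86420, 0xa86430, 0xc86430, 0x786520, 0xc86530, 0xa87320, 0xd87410, 0xa87420,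
0xe87420, 0xa87430, 0xc87430, 0xd87430, 0x787520, 0x987530, 0xc87530, 0x387630, 0xc87630, 0xe96310,
0x596320, 0x396410, 0x396420, 0x596420, 0x596520, 0x796520, 0xa96520, 0x697420, 0xd97420, 0xe97420]

/-- Circuits that no admissible oriented matroid of `lutz12` has, each with hints that refute it
using the preceding ones. -/
def lutz12Refutations : List (ℕ × List ℕ) := [
(0x875420, [
0x1414771e4a6dd2f13668faf5dcf24688d34a999e0438271fa77ef69efaca0477fd7e586a3cf80ed564f076b8d4a0676ee,
0x4f79324ac0903799d8d19219dfe6bcef9fda378e79fb4979a07ba84f982ec730d7318deef650dd06dc69413c76144dcb1,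
0x3d01de7d63747a1b4520b804bec5d25800fc188837024de51669243739c47495747ec31898a80966b508eb55079001f7c,
0x43298b0d727bd3e8d71c5070bf30407fd008fa440d74504c368298f4258d1ce82362b1f980982e1cd07b6a5d83ca77d4d,
0xb4e213229628949cc171c5712b78a5f4926075e4a5ea8e7c929ccf42a06883751d09733b497b493e7cbcb69cc53116b3f,
0x40ebcec7e8398ea2e7220504f7708966be75b1e103026f7f28d53bf13140dc78dedd775b731f67f28d051bb1198935152,
0x8ec141b3526a5dd56f58df725b45ff88440466603bf7f2672512e1b1c7573e3ad59dbdd46d413bd7ca57b8ee1568f5c97,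
0xf47db917c475deb1e477c643d0ed3182b5288082bb73e48f7a51d1377147a968c24cc5ce479cef4bdc1eadb9e556a410,
0xcd6432cced35dd2036ed025030aa449779feae1b7375c6523837475a3373356b0d47fcd6844bd8660c5c14daa127917be,
0xc0cb84a1675e1be0e0fdcf0ef1de779bf7297149d33335d2d5f854ea6ff66371d4fcb6c3403c3d12282188ac4e8564516,
0xf19f52c91bf7f5d82fa3d02d01fa3e326345c8d0a6b4471b8c90da8222ef818c5f726baab22a451334fa1a6b2a8e7f5a,
0x37c5fd666014477a735b9a7ab167b0e1c59af2d429749f57a56e751da0b4293d34ef487ab1b2ec262ace51b87a0e8c67e,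
0xb6419e12bbdd780bc4c90f801cfa6cef56bce0aab4fbb66eebc4b7b5ea419f0f0bbaab6ea59a5d46c24a774a5704101cd,
0x83c7744c199c2dba676b40f973d584ae9655493550715e3f45f2b7488c1875844dc0cc3a59b21ceb31530915413ac031b,
0x66a32e871afdb5af04adb7c311338af41aea6001be1c01f176eddb936e4d0ef37706e4e838af2dd0ca8ebfe7bde089c95,
0x798b008e9865923971b6fda51c3239e8f4ec9ce7384d9d3c3d443bdf3cf6724e373a7edc3d582a59a05520bc697ac0392,
0xc1480ca6b8e4ca0fa08b576b4ef4e6fcbb7df41f28cdb0e004e8a66f75e45de7a00389cf2a73f2d757ac6efb7a8778c44,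
0x689d322f62aa6e5eca4d64617fc450aa4cbfd3d57a3e68cfba3f4c27aab9e154709217bca49b54749d464be0b26848d5f,
0x99914fa2a5220403a5f602b2cd19c4c9ec3e5a21b5707213a8c45535a563abc8769998b81bdd5b3d7b6a970877ad398c0,
0x1097af207601b5a39a6f99d91ddf48b0f81557a46bf3ad8034861f68cd0ac31e160369980458b040e757a55f23dedc9db,
0x496d5b57da1287658bb385e31245bd44ebb1b86237572cca73d3fb4609142a22932b030e8308ecc67c549518e3094761b,
0x4b45028314fba514bf2495eeed13fccad087d68e18a160f4512dff99668510ac1a3b48917f3e516fff3a6641772934d98,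
0x3a26d5921b9540082c3b243d802adee1b7b9be99bd4a5248dbf14297b6fe0f3c3bb5b5aa9db65a535384bf6aeb73561bb,
0x18f6d28301507b21e7b2a0677c747df45f032d529d5f63d86a45f55b3528afcbcb967ac77c9e4bc81cee2f8967cb3268f,
0xbbe10d5f7e13fe050f89769d68f8fb2327dcfd51779e32d306103f0e3da1a6bc8647cbe6365ce7c0b88026a4ee3332937,
0x2d48fe78ff24043e8940cd52c6cac1b2a263fac9a9cc140e4e02451c9401093180ddb9cbf978242aaf7d8018a43b8a898,
0x2ee876bdab4e57715f0a8217f8880d41b1981fb5273229cf6d58fbafec734d2d6523d57956ae5969792c18055c4afd84a,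
0x32d38651a8da2b37dbb85c70d78958cb3bbf8dd64c331eca83c01e69b2997c70c9eda1c012d18fa9c7e87d1b80154c229,
0x9b7b6099a6e986299f8fbfdfc1f15d1fa9f50b6c777c320da9f19df570b311771f3b4f2f06e15177b629ed21890c485b8,
0x49a768ce46ff4c56b85093cdd3949d12522b83893b10bd3a1fec24627019580f99fe303e4489dc00e9f2b8a5da20964ef,
0x4c0a664d2e45f2148d485e75851d92ca7f826fc839831f2882b7cf17f6d0e926a77f6e89ab14631af6aefafda67eceead,
0x4968268799b27defe89c1090023fe9cc4a7f6eba438ba3864b8636c0dccfde70342a08350a9d109275aa0e38df584cd01,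
0x2e9e997f0859ff82c5554abe5dd4fc52e480f831777c8af08ca3a36a47f2ced53c1bb06bec77d2ad98a4147962b43fde8,
0x26ebbedd66f2e041f458b85286be7b418fd52ca4c611d269be5917bcdf54959bc0af66da4af022228c89183aeec1a55be,
0xb7c3e1a43814f0e99ca3e02f512056c2342a1330cf94b8c7b5428b669d8984b78cf9b0b765e779fc36f1c8f44a81794a4,
0x25603c9c5feecdac93b09dd7e922f2decc7863b947e227532f7aeea4915e87c03096cdf39e635bc2f5b07d7270b22d6ec,
0xa2902610eea63a2c45495aef9bd1208cf3f4af4b6672014ddd1de73a5ca97e3df60ee58bf9cf8e589c9b9f8fb98ac7da6,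
0x295f4c486dc53ef72cd9a0b7193a73932fc670b4d5c36ec8eb0c9f7b2e6b916377cb75170d37fe3a3a634c5174ecb6e31,
0x290776fac0d6bd198a1e66a99201c4d3690384f360f82451740a0c68b8f9d556162bf0b2131d4144aadc39dbea234836e,
0x6fefb8b9ee3a6bd5b05c4b3561587409d4a3b9be425125442971c194f97517dd1402383685bc83285d2b033eca83660a6,
0x2c148c02f79d6bf7a04b7ead039c5f2ac6d1da13083f3cf7bfada325f5037ce9aed411ab192048c7754eaee8905548f35,
0xc583c542681f8b6946ea8f21f933e672b45266fc2ff7ed443fcdfe2b7eca77f2ca117914936f2dad29552d8c576ba5fd0,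
0xb8afff234e7dbf736d5ccbba461d28cd490b7f6ebdbbad44cc9d5d955af2f721765df328666e003f51e6de22daa2ecdd2,
0x9bb8129bd22d732b6fd37996635deabc59c0e0c2d87635bbf90655f453409a9cc9ab3d2c4b0a13f5e5f801d803ea736e3,
0xa3f58f968a11073cb23dbd755854e4cc1e553cc677c475a8ad30e0b2e04d11bf23c8b8ee4056d23e2f5ed848025e5e7bc,
0x2c55241f6dbca8f0d156e200c6ad4b33c06a2e8bad26f7d8f6a2de13b2eaa9e52d571f71d204f8a965c808152ef9ec0eb,
0xaea834b87be1d4ca541975a31798fcd8d222f8ff322104642932c15c0023de65378003ada730b182d1455be6632e629ae,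
0x450d50123f81c7b790f8e27b037dba5c110e4dd726c802973f2acae4adceb9ffd12792cbedb0407237989bd40bd3e311b,
0x51a5ba3bec2998a6e62ab0b01177b4f139b07d6687abde274bd38daa10edf0af6675c287dc36b75e6da8bf449be2b143d,
0xbe83b40999b4f19b2a6cd1a26f9ed2e34ff8a973f96b06c2ca8bf8eece5fa904fb137a08165ac88c7089dfd039e3dc2c3,
0xa9e8316756934123758f06d3f5317b8a5f66e4883c8cab93faa842a0bdb6c7807aa235decafab7dd53498f0f1ad3fba95,
0x6fbfd05cd3a3ebfe113f3142402c3f20b2b93b50b608d0f12aeb07752730ca342ee07ce31613ae4edb205548d06ff4acf,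
0x939056affcf5375b6befcc864ea343d401923c8254fd4aa02150befbeec36c0ec3f6fb5f10164a68a24e0b27615834b9c,
0x378b7ac4d52727eb9e92981e7db958b47d4556f423335be7cb4526948ba6b9049e39ae2247d07971213b710a847913893,
0x61e5c5379fb11db93381f29e083898bd821d4affe1c1b29ba75d22951c6e5ed08d058612d058a1353016864a13e79ef92,
0xc420c5b31d7db07e7afd7930f90e9659ef2d4e2ed829e73b72262bfcd5281a4463d313ba5d11d9883043b79f31aece72a,
0xd1dcff41bd0f7c62a0da0f774b738f8d23d5deb7071b56fa4e3d4061ddfd1c15fba41927ecf12ca32a6fa1437e48184df,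
0xd0c7353ae800dc9f92c466b1a88562fcd76c34e8b2484b9924761d2122def12c83002b078a5f0a890ec64177af05155b3,
0x6950e46f84b523b86833df271a36c4d89aa2e06f334dc58b288243124e2d8c5b8be4243a621eccc7585e92bf62822d9a2,
0x7fc226894239ff1189d84f39db0c89a1ade5f45c3d9e2d002e5242b89748e48accacac330d400ba7a4e7ab743cc257d0c,
0xc21df35b736b9a50609a6da13b37cb9cdfe61165c734e2ff11abf0966c06b507a8b27657aeec2980431ccf2383dc73c9e,
0x6d9da2be6b1519c91aea2fefef0ec84e053f9a9fc103436236a2402c8ebb42e09324085a9f55263e83bf836cee3d87186,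
0x349645b7ac93bc0ea7ee2958ee14f19e8e9effe4ba196d19198ba4d3bf285ce0c19765f934345a5315c5bdfc15ea03182,
0x2a931ad6c413db204b77175ae5dc54abcebcd2526db4c79be81c5ede22faf42de597b96fe132d8a6be1b7a3488af8f96,
0x2720e0fc757d09573b3959db22820e524e804ad4fc2bfcc52f795e4ec3725a28a121ebf0d9bab9c3e8b678a8831703d66,
0x48bc61ee3b9b8e09257aec6c4496c7efa1cbfa31a049ad70992e6a356f8ada20dd41b9289877bee8f0a6bd6767b0f6735,
0x6e835b45f9e954d156e9e6b1a9355221a5332417dd40bd9bf2882fcb3b7843055334698960bfa4f0f17ab850ed36afd03,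
0x50c546af6cf07a62e9bc02cb7cdbac7fc6225d04242b48d5a950fd70bf37488d608c54d22c2fbae7a88394252f8cb9e28,
0x824aaae4092f8ab9a008aa1830068dc6e0352e947ce410f0a6b0e05df78d14991f4c0864a0a66d397f4a82077e5aedfc7,
0x9a6e741ec26d8fe616d914fb3d10419f48e17a73a2de3a4757eb763fe2ea31c24f6d8fd47a64b0f82d3a2e07aba8ce421,
0x26e05327c25f027b0b9808ac343a5ac891bcb05ad6d3ee00288473d44eca8ca69f587f101734a9f5d2f3328b25bce6cf3,
0x3fe8597dc71345dfd3c512499dcb7ce945012983a25c2c7c7ff56815b57a0146cfeffc70869e035220920bca4a3dd9168,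
0xbfc9c26778b8010183aad00f9e324859e2263716d5082cf4f3ca7b4b3dac285bf55da47e4d6110796a465b6765db91455,
0x3b8c8002f53e3474eadd86a0a10711d27df0c70dbae93b62953006d368b3859c33f866ab9e825e23daf234c5bb1090fe3,
0xca03a578d5923244c20ca3ebce80b4fce22343ce621fc1b53925cb74fa0c1887ac8f48e77eee7386451fee0a15a251406,
0xa4127bc3a21385cc14d0da9ddabda3d81571d775bffb2f12300000cfb0ae238d51c4178f1019d7e224718aaf676cf6455,
0x3df90222d0313a37b416c4a9eea430f46232eb9485af213a97b4bab9bd68446f0d0e782b24fa465da119b07166dc7297a,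
0xabad63a0869bfcc0db8624ab20effd34fcde54f3b0941ddbea6281c4a328febf221238b60c0bcadd738ae4b36076993e3,
0xa0e5106b2847ca185e0c9326883712fdf0a3a8a18f1bc6e9a38a1c1732244b93b61b368e83f98808ab7310bec653c2f0e,
0x2ed27c33d9a3f2a2754d927a5867268320da6ace06d9aec9e3a15216573e73d0f7156336afd048b66b6aca7493cb754f5,
0xb6769a7144607fec5c223aa98a264ed11ce32b62713d9f53d7ec2f16e61060d0d98bde76fc3471fa8bce07978c82faac6,
0x68af3747e30f2843ff55b77e7712cc8de982ca84099a35b6abb6236aad1c01543be1f7c47e8674cdb02b22e71ac244ccc,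
0xabc9ff2198db2bf36255f66960b6f33002c4c062a6521a1841998952a98a32078722f50f90f480e4b79d84ee34868f4d4,
0x5eff1b63382dea8b3a04cf585dee5b19c2748360033139b3014346aa03efde06b1652196919d08553e33e1db4e76593f2,
0x7a017b99771123008b97a2fe029cc38f1679ab0576fcddda906f0fdef6761511c8c7e4a5adfaa121fe48d3ae3b202e4a,
0x77d3939f9bdbf374c215054c4b2c892f58172ef4b3f322a93ddab30daef22c6d6df8d566f442e9e36bd58d89a8338e915,
0x90f0e5b1a5978b219b19f55155431cd8ebf555d0944a4d6a8cc8be42bf137a14e81a4193bb101139c1cbd45272bc3438c,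
0x2cb5d25af6de15cd94ae5502bfc8e0dc5cf0966c91a5ef18a664d1bfe0657cf0957275f2f0472ae4bd5ef8ed9d1f47ea3,
0x9d7fb310271f7a0e1affc7b23d2d94f4066c6bfaccffa98ea775466d4ba5784827feb20b45f39cbb308c7da84a73fd76,
0x23f1398c62ff5e450055aa3ca8080cc96fb0069a15e9a03265dbdb579223a80cecc707517d60ee2988c917c1d39bb03a9,
0xaea407900b025040c6387fcdeb05a4243632252458a1355c3c5dc28d4befeb03a3d79a7857f2fadacaa6665fdd30cdc42,
0xa7ceb3eae6bdb1a641b7c3affdc1086af0164e760642ae170e6ab845e42bdc417a8b0827fc710a6569e89a58c4842e0e9,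
0x12288b0f54143dc621d168d3355d5ee4d81e15a5d6b6b2269f55ae42f47ee9202c26abcf6f520813fa28ab76ddc54d693,
0xbabc5fb7acaa8396b5065d08850a676c2cc4d94383fe2931c2e058b75b490fbdadd650e4784db1f9e1e5338c0f364c0e9,
0x4fae59c4d7d5de5266d566667c59578f99cb6d9b506b28434570951558ccfda034a656c261e26d1b777a0e7fb616b026,
0x83c2dfee75b818fd2f4364f0f9df2fe72ef10bede4ac1ae661c703b8502aa2998ce95a8d03f2898abb1285a7066829640,
0x25852a431232591614ea2b21763821f37d0b1fc4afc4e1dcf88e185e50801aa07aeea129459b6067686114a3386b55810,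
0x854d45eb6e7a2e3394297546d466ff15685e8a7d709ea9bfee17389971b666eb3423d2a69ec3b50f92cbcb58e13c34b75,
0x7589250f91c668b7d2052e9792020b8ef218b38f765bfc4d5dbf7667fc8c447d3614857a6ff3b9db4af7bc1b6908e784d,
0x14bd4dba6ead6a22a3cc1dc1e12bff87a0294ae913d35003e2efae55a2b78630c9bb4fae0ca280ad55ff072d01cb77b0,
0xd0bb429c108950ead35dde4815c85806593d381314b733dafa5ed18a678cd6624fcfaa1d5681922a651948568b09a58a1,
0x585ed6a60735891f55b1d7087a98284129534e83a1da6853b69a18fe0f02602354b83b989b7b30220ce6ea106a832f872,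
0x67908dfec99ddb3ec8430e3f78733a9390c49028368052ae58f05289627a403b1ae2c4b2f8813d78761d36a41bf449d74,
0xc5d6532bbea2af79904d076ce448ef2172c2f08a8dd735b9d4c810854f76e1a5d7f2d4278f6db2c3b5db739db450abd9d,
0x96a2bc55a6d9ca725fc7cde4eac17fa4bc811fe92154a4da00d14e66b0e0b466903474047ae0b28cf919cd3c3721c8537,
0xbc4ced98e4600f253b736018e5a0a84587e3e1ae699f86735ef897c31813899d3f914e8dfd609c1cd89980e8f324d7385,
0x196e1f4758fe6064e0f10b6e9b57ffccb1fd6d5e366cd91bee30fe0af7df4c867d56937069cc1119ace885e0ab14c81e5,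
0xb1f6270325e302d0e77e214febcac5f2e499ab36701960fa958448716f1d4bb05b1aef606006d88fc96833e3a0453ab86,
0x5bcb3c3b3e2c17c86faf1faa65f2f85d4c233611b496e84c72b81dd59eca5cf3cb966f49ef95158a2cc2876fc177bedcb,
0x41e3a734318f896c811f352f54cd4a0090f1c70e850548c0844962058c0ee913964a0e34eab93b267855ee786015cc553,
0xd0bef660412937d3d37555cdd687314f864ed7ce5bb4096a1d9dadb574fd2d19685e1619a64ac5ab5c719215c37412fe6,
0xa94f62c944c652176c55db9bf4d1700860e22fff304b646803a3c2fe38906118bcd0040b7f7b12e9c88e81817d9b581a5,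
0x49798d680798e8ccd3297bd77e63357011352c5e86a062d01b0327c32d3d87531d4c3907ae8672c9ac3374f4927e29f4f,
0x40e10ce65b0de82199c7aa97a7198766d9854b18cc814a8c2055d1dffd35dd34dd11ce7624c4532eb8684b3acd0589ef3,
0xd33232d7d5cb9a3fa8ba53347e10110f5aa5cf4dc8790715710f5b4ae60e776860606a84a3a0f9f788d1a59a1d8f1a08b,
0x5e38d18d1422a4385b219908a7a6ed494f3a3a0df1654602e03f9b1977c6bccf501e558939347b9a4b174dfb719af544f,
0x4d1d58f09d8bac08af4f3c54f69b91c4e232d7c544ce7bf96b67c1baf249a235ccbf838910e9c1888eae94c5ca0355494,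
0x851e91782d291f9904c289ee654649d15779d38185502d31b16a95949ebe6821b8275f0ff584f03d039b0deb9e8b0fd5b,
0xa789cc9354ed64dfcf6ce8374c1c0ecddc2e5c54b5a4f99ed33144a0993500beea232878e5fdc0ef6514663911a0c5692,
0x2d48ef379d77593024d9ae23b7d52c402f350757a225c6baee3f5fc53e383e7ccdcf5166a4ab4f2836f547045a1d3ac5e,
0xb1c2c5d4193ac4c1464bc5aaf9af76bc74b50b47b7eac4ec5e4df4e4d0c0ff80ff70b293767f953bf65f8cb305c49ae15,
0x48e23827316b4ee87255ecac24b1e8b03c3cd68b503b1741c711dd9c78436573161efe59e42e090e42b293f4c5e0405da,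
0xcdc41b33380eaea54a9102342d5fa26f53c336f759e0599ad47074e54f5983feeb51d6f3648c9603acee3b54541e39005,
0xaa96e6cfa4f8e709b49d4675fe836906973e6fb7a7f014974adcc3abe1d13346909d1d77266ccd67289d191e6ce29238b,
0x90b181a2857f1f5ed88334d325ea3f25d1c11f622ebed314d63c8d45c0d843df4b3dac2ee56830912238a4243f04120c,
0x33b1e578ea8c54228ad9494ad641d5232f17fafaab5d178ea7ef0a86c3940ce7bb21b5f0ecdb133a7b2066df543aaa85,
0xb26291def0ea4dddf81fb16f1ee687da933cb28bbef23e24e341883020dcf015f130b71f97e01d0c393f49590ec87d723,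
0x817ee849adc24bd641216d27a8475cd3b6fb27db0c9358cd58a8c640f209e127a90723d76191d0f2f2dd616f6c270d397,
0x3ca0385db416e72d7506125a004a41bde26fef3b475c166b3acd9bac42f1fd1ebf04239cb3343e2d4c41f4a4fa8146ea5,
0x1100984b7bb53453080cbb2e2aae903e97023916d72721496903df12f9b3c04535726c99f2f84369fa27fa754606f2571,
0x6a8294f08720672ef26ea8b12a33fdce842a30edc7d29df5a4dec652c525f412f6d027aab325df7c02b95913ed937a52d,
0x3622d0840225e9e5ede206ed8fecfc3dbb6e9ebc79467afb0e7a98670bbd0bfc39d348f3a3f6fb2fee57b96419b83bd7b,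
0xa0c138a7c08471310d0bf0d4553e2d6fdcc8251bd1d8fbf2e9f9cba55f1f2a5cc2172f45ff36ddbb3bad8107407a8ff2d,
0x45b8321ba9a66e6015450280ae5824677ac32b79ce85815723dcc8822ed2e3dfcd91df1c135dbf494e411b2815f0b22e2,
0x780063eb45373660e73e48715242990009065223c1a57ac5eb4c5add4f75a1e6401c535b4577a7aea614b4cf447183ec9,
0x56e2c4b3b6427f4ab0084de12a8d9c5d29c605886ac05b35c78dbd6a53be11ffebb30ef8ce9ccdfa1b6be73c705e1052f,
0xa9ba441651094e4af631cf7ee8793783fe48f804f0d8f3334dae6f53ba636e4448a772dec11b426453822a29dfcfae4cf,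
0x516528d13663149860e56324d33458d63e932805559b73203e74c3310732040c88d93393fe920cfa7db7a4113ed302540,
0xc5486d03f095e1a9ceb93d6bb48afe0cd4a81faa79a85b10589039654e01cc1f7552745ccb09e974d05ecef597dc05555,
0x6f84767e53281091dbb33f76038c0b00ada0d28e6ba0053c48dae0c20be455a1fceb7189fee5a8dc5002a1e910874832b,
0xb2dc58caf406bd095c2eadfb9d86ab08d524ce935f46a7e2c4e9b97b6b79aa6853b76bcec2ed5fce62c8b267ac6b4ffdb,
0x50cb999e38b8a33f9a2d1db8711f7976551aaf6cf6060a7f418dd2438ded47b767a32a3fd8989e58af1ca2b875a28ccd9,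
0xcdebb09f67ac8a48ca3f091da57394d1ad2b8b57c93ab1ef446852f07617b8a389924edbc65f45f328ef763537c10033a,
0x685738216b758387f0585c4c58912e52e9ac305f88003720d63b11d847e69fee13ca49b4c598c220f6402fd8c7ed2b6a9,
0x51207a7955d62e0599cf9c01269920262dec65647fc0cabd3111ba1da8015783ad77b98ead4d0201c35cdbaaa30d61619,
0x265ddee30c9fff76efbea0670b393578da7d099aea8cf4adea148caae2a8a5bdfbefb1f34f5d9e3dbed94c8c3dfcd879f,
0xc8097e982cd5baf5cf48ee19159a8bfaa8371eaa7ec0015043abf8ee15698a32f15f35313edcb5d0e8aa19f808ac2ac40,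
0x9d328d451ff025cbb14f971818da1d38ed406f1340f63691ca4487db4773283a776aa91aeed5fec6835adc77711fa0e63,
0xde5013b7e322452668b79a253e7ca1a7d2adb1b9b02de0a3e616caa90b1aff1c2ce7a7618b49e4e9c69ffcd09dd4b6284,
0x64d850252bc05af4ea5a7f2ddc7ed6a3884964b3df4341754ea0b6ea510e51a0f6826b4a52a45fce75d145d6f609eccfe,
0x9a7e08a0cbb355de651d2f2b5e1b89de6657dba2fa310ab31ded2aa241d0d4c9d0b05e6d7a957a2b5d905a1902c9a5a36,
0x979025a916fdb619e44f117e1ef3bf3353caef9a8e803b3fac12da5d46dba85d310fe8998c1968cd632b44f3a8ea17b06,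
0xba3239d330d975c534cbfbf947d1e808093ecd26ba178ceb62bfb01342c997eaff98f18448e5cdbca066ddd7e48ac8c41,
0x4c8429e140a701dcce477907c21428a2741f8d2568e7169b5a56be8d255f3a55d8dd39e1e15ef8d32bd1d73c9f7967c79,
0x74d96bcf30d30681ea0179f5103c6eee61ee42313acc07e0d92e51fd98b66b30034cfd2e9c89b828079eb0f4f61aa3269,
0x2d9fbf94cc321c262f863705fed36c1fb0840177ab7489e25d20eac973f4d4d4eb0ee4fe5eb141dafc]), (0x876420, [
0x6159d6098601cf7232af94eb23728dc6a6f36cfcd9f68fdf20ab813c8b206c39a8d2fd7adf5d36718db77a926caf871e3,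
0xdc4d2dc8517a57a304a4a765a0d989c9ca43730318f29176e5a1657c324fed48cacbcf9094e8374485805314d6695f4d6,
0xa8171dc9bcf2ef26e767a4ae75ade4d7bddb616da9418b685e022a2687857788191a200520fbbd39a13919366bce80e81,
0x142f407c0e4b27f4bef48bc81b9f259b20ac122058a7412371c5686393567ab6b33001c797b2db7b4a2d77ec89badf021,
0xcd5c401181e97fc8dc29901f5cef56d974699540ea7528f4e08080c002d1086581cf9d38741bd8167e79d7ce0e1dcae8a,
0xb8adc54ddc699d710b81fe27b13784cc66b5fc942eda74eb38e83ec8b4d374b38431941a08c5a1a37a681e36b62e947dd,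
0x79125a745a67c8b5bd64f6fcf82cbf18ec7ad049870a74af390ef58cd9287470ef85b64ee152bd2efe4fed2abfd926bbe,
0x2945f5056ba42c0ab3d70f881cb1953a11ab8cc74c58ae60cd0dcfde0e40145204f80f4411f33fa25a15c61f0f6d96435,
0x62cfcb7af7e95bdac0af571d4f26c9622fe167efad1ce5068f1964d8ee248de9a0e23adbaaff59ba92689e3e0a7a90be1,
0x4d07bdfb18c4fb92d9dd38c9b5e97a2b806a5ddd3dd77302a375d0d489a28ace27333c2a4f0ca68f40dfd884db827af94,
0x7d4bf5381d86207d48ccb4e604b678ca1e0b7430c10d50f4ee5ce6afdec92d961540e60f320040519b5791fac96136935,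
0xa6e698c3009d30a6904a789d0b8d2996db950ee0b229aeea9f6e45916dd46bf9eb251ecfe1344b37f3eec39fc20f6c16f,
0xa187389206e21dd1e601f1af464b50daf6b4ca5305eeeb860f535760319eb04bb38f09af56dfac6b9726f369e85f310e5,
0x5c963b51bf65634c06c6518d7c332418c4b253891a6cfa4a6cafecb1ba0b06a593edcba49f34507de3353abdb92c1f273,
0xaf0058362b4f6c224bc36a323214b97668433cac02e3727170430131d05f2ae948813108e741de2218f11a217ede4f551,
0xbc53cb800017a29f65f9e1b9af2b439dff8dbf5b5425116e6708bf7ac3bcff3aef3d33bdb302c960b2f17c03458ebd084,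
0xb6d20aebb75890af212ecf5004686ebf8f48a844f44eccefcc97df148c815c209dc6f2cfa1fdfd09ca8ed468a8d6ade0f,
0x320a2ae46e8f656798cdf5c3e419a98e54001d5d31c4de49e4cf4b259d0daf4f66330296b725df0f18697262aa45e88e5,
0x110098962f726a4ca09332f399a5841799cf1926486754b3d2c0ffa276279e7b001e7b3332087e13a6c35c472113ce137,
0x614198eefc1b137988eab9951bc14220416cd90b025c75f64337f87744d5fa5cf401d160b7cc1c1faaf9d33e4d5faab5b,
0x57a9169d8fb012a14032a4138ac9c26ab8291fe9d842ceb7554fc61f353f6a353c7bc811704a211fc4d64ae23da67cfba,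
0x60586498a160549a77bc3a5b4670514cd603ba161dd7ead25a6fba3be113967e61fcdc36581a201957a4f33d77a659c9e,
0x25335aed7d8f6a68fb3f5afd1f0f5fc3495e8f854a1fdb5c2fadbd02eb06690ad5409f415a8440f2f467dc50061f777a1,
0x51f3cac68b04ae77e22c50c95dccc786faf16c4a87e1c3b796075bbe92fcccdc751eb450105a021c5df05e6b4871f3ab6,
0x3b552457ea75954530a4c3566e6aaa305f78f5144b81a792e5d393b58ba438d7a3f063c24ffa54becbf8a6b233b894f21,
0x3817fa8937d5785840fa7094b192dc0694e32071a9b3f652c967e559ee182ab7bb2234993cc261e1fbcb0ddc47f2e2cd5,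
0x7032caebb89de568527db3f3ad82fa72a06c0ea39fbd8b427cd937ec4de2437fff0a407f7e60c2077438179cd6dbe5c85,
0xd9c6055ffaa470892c8fae8fc2e7ae4dd77f153651e9022a947420d6de26a3e3481f190a3a185391b486540b84385b380,
0xb6c460e0192a1b3e25002a57ea13622b19198bbc17815abb26c8269e34bfb5ba4543bf5db716b738038a96218d00b4b88,
0x9a5ea62bbaa5efd6926f81e9869c8147975b8c4f038532b68a44cd8b0006206080d5409dd0f6f45ae287d33dec14abed5,
0x7739f805604e32580b8fcfbf556aeba04c0c5774a23a44605cf7ebf05b5eb1ec1c7c0ece4221c0da17922ebc1b894145,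
0xb88cfad873e186d8a8cf4910f92ef4126fce93fd274318d11d121b0848b4124ba29e44d4d7799f013a5c39962934accde,
0x869fa153f8f0e09c770d89c27d096e67b717ff641e3b6304d007d32300455514949747b9c1d4c053234a3f488fdadf378,
0x384e043281796f29ef4cd965585022e4a398d0d44354f61c90f36198275a9370e251b3233dd69c0b7c8dc538dd2df4706,
0x9a2f52bbed7bc95ef127a1982a39fbf8e74d39f0aa03ae6cd8fa5643443a2100a6bba40f7a26e835234f51b875d9501d9,
0xabd54534644e6b7bb5fc7d0a318ef0d6e718fc318c6ba8078708a07a2e07eccf8bfd7e2f42d7b4b6c314d21662a827897,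
0xa95a6d9c6373e59d0978023339a3da9a9a292496ee194b90c0b7bd03853bebbfd96bb0ae9062549aeea7a5ae5e76efc23,
0x41184ebffe8da18db063af6b08b5d81fc76b221eeb8f02ed53b12e748ea5f6c512b257aaa77f4f35ac7969ed417fcc483,
0x34f71d64fe92a682c5eb3b7ea6cd7427a4dafc4d3a5efcce7c2f883c3d069f77936e14904857860793511fbefcb6ad1dc,
0x6c4b810409f053c85625a40d6bbf9958297513e972d48bc55a231bdba0daf34063e112ee0f81edec4bc4b3d8b75134fa9,
0x6893d2bbf038363c8391242145e928825cb0aeba3f31cfca8ea78e20435c7c68c1d87fd68c495dfb6e9107f84e4c7d55,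
0x46dc605267af8d40eb42df3a94ad06d8d265c1ef2be30aa1c7569b99c8e962bd0f633bc34639c8738d0989f0afa8ba266,
0xae4a26a319a8075552ae7379c0d05e4bbc13e339698db4aa61c87c4bd68478ddbcfd1c74ef596660b455cb4153632040b,
0xa86aa73e6b7044b1ae55e3d7b4f0c5f7d2b5d6b78e08ccf4dc5a54a485813314553f986966b349fc68dd1c47273126abf,
0xd14bc7dc5b8397c5f779e83ab7f4ba834d391b992b82e4e02f5ab9349ff0890a4077e629300a9014103e04122e259d386,
0x81c81f96aa2905eb5a4044d84dd96fd5d791cbaee7d3cc8d6f3b454c3c3cca626632c64915bb7a8042e2b74c2645cad73,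
0x2ba5e1447a45d9901869496e9b06d85edb5f47be59c9ec27d899d8a8342e16a99497ddb058b37cfbbb0881168d2d966ff,
0x373a7f1bb67e1588e69b988fd5a7664659f3702ebb4831110d936c39a15fcd8d93498ec7099f3ba913391e7203518e1b8,
0x8e551adc29589e974b14fd3742e25df64a51869352809be81c4e8c7202649e1d5acf3592c9de402ade750ed4f8a52f779,
0x5061b4821274b90d00eccf87f3012af1d7736b3052ac602afadb2d7327a73c228b7b4b9061733471554b419f4761c4c3b,
0xaf098aef3d7021db0fca119f313f6301a64cad152cc497737efaef6d6ac1ba84d3c42eb4f9adf5fb3235065c90083e381,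
0x154aaf4d783c7db5123514ff751a9cc6dac7b90ac43d1ffa2a1b03466306c56b1de3cfdad3f31a9108f7ed1cf476a2900,
0xad09c564c0967aabb36d68dfe0b94ca1b5d9c7645ca48ce486513f048bd680ee1dc404c61b47c2a30f0cc7ba2eee28ad2,
0xb882aa87b45e875b97746fd0cfc2862f6a96656247e858481fbdc2a34bec1da682e21dc061f77d2d2f7fc869165ccd2db,
0xbc213b0d83343b4f63f10edd797699b4ec8a94cadb4e5173aa498b4dd9399026f5dce2cacd61c4f5cee0baef9337cd4a1,
0xba9e6ae48b4698be725ec0c56912a0d2f2e82b386983510fe39a72217a6c9ebba43dae7a82a1a6986fc63459790fedc9e,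
0x44e8e00ea416e12125238017ed7492ad3f5614d97bdb575b5d499464e87d93c2726ff5a6abc67ee8f8696f8947f54db9e,
0x8ea26a45ea0d0a0589aa5f4776094f14c03118632fb7891bfd085fa26fb992e8b3f50c14a3063cf7babf27aefef627d76,
0xbb53116d50a02da0d7958e0ad3d39afe089856ec4cdb0a8040026b64eac0bb961b7dd3dc2588812049b443372c298d12d,
0xc6302819fc9f39b5c0f9cb3f544f5c1b91234f5ff5f3df44371b393c0882ebff8061fc4b6f9accb8ccd4c6fa6f5111d6d,
0x698bf0ed482c5ad1737404db9b4d8506b8ef4e5a4fee61f18755f400dcc25bbb38cfd18510620af23427754429f26e167,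
0xa33eaf17957db087d436b9e0ba0da6ef273257d03590559bd0e6da80f784aefba273dd553650dc10c7ad4ff54f0419748,
0x113602bcd5066f52219ca4aa01cf9257a435f434640e837ffc611262b334cc6d3dbb6bffe7be19557f66294481d74068c,
0xae104ec033c172a2fea1c3ae2cb8d4b5b860c0808d562b948dd128886bc144b90f125b58559e4b85487a4361613b7adcd,
0x3faf0c26e0374881fe75432277d360ee5b1ecb26f48cfdf9b3f29f09c1418c923e48718983ad95576586f63135c61f8c3,
0x534961fc25e389dc95c10ef0f7ef21870cb2366f7d92a04d54950129200cced4940a027f3ff30d982b3daa173ed62ba47,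
0x593bc752f48982528a0a2743cb8dbb66f538eb65d7c87f1942ecc28c1568488072036f59feee76a70b1cf9ae4022454bd,
0x87d9efc9a1263f2763742c724fd93bdef3d185b0b9baabda71a8ab1872d697b833286973a9403e4bd8861bef27cbf1a47,
0x944d5c90004b966061b361a6498635a16183415d12612e7e1d85120836433a665ceb0a68048bce6392851c6acdb1371e,
0x716a4cd6386dc6b3982d53be576865a4fada68cda955ee5d7da4d447a582ffc090a7d598644668ed945911d082e57f12f,
0x32b56bf3841291f7da85182af3a408b8545ba545b9833fd078487c84df0be87402c44e506b18e7f25bd7ad73980bb81aa,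
0x181e8f0e452d869c5cd9a241915c1f39608845dab45c1432a1435fbce96dcffc47bc06b5e1f8c629d6fde4a4307b7a0c3,
0x4849b01f9d2512f3474fd3d7ebcc7fa358dfdc7d02fbc76f7ffe71d6e7ace2b26b49091e03a122de6bb77b95bab277a85,
0xb2ed32cfe01677bba4ecb3f729239e7bc00cbcec14e440ad86a9ab9072344b2f8ae41d566899459f924068b9e2e3fbd9d,
0xcb63a4804dc64d8a0cbede5d55436e61eb7f808994f7887b28441f92c8978101fb0dd76205a9f0577c1e644de1e572367,
0x7cf49b643c30113cac27a87e2d9b03b3fbc4d26f990362930051f86c23e45bc5382bf5f4f64b8e8a80d674dd677e2cbf4,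
0x3fd2ba526fd52cf79a68bd04afc7cfb6d799700a675dfaa2abb9c3f3a6754e459e0aadf83dfacd085e58406c29b9b450f,
0x1af4ebae941011a080953db1c1e5eaa4ca3eed966e11c5d4096b40eeac4b75e7f197704ae210623d4703678bb1d2d0391,
0xba8023baf28e8481ce2cbac251b891e3f30b976cbf32d8b50708bf53c6f453e5d2175c59a7778160d6ee1bcc7f0900066,
0xa33a8cfe12652305f2fbb0ffce9d34dd4a92991730b272e38672d45b5bb89559c05a92dd123287f19ffb8bad1b713321,
0xf0c0cff377374672aaff32fb158bdcdf923145396e7d2cc0a5ba6960048f5ace5025fd5144b7068e76028715f63ad0b3,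
0x7fbf3f781aef267884d29389efd4d52532d186a13e443e23f02050a13bb3c03866c1449c142c14502d63e19b9d038a4bf,
0xa710d3ffdf2ef63726d01a79cbeeae8d8fbeb455b521acd9266079ec30e901810c5b4faf3b474a8965ee89428d46bda38,
0x3172312da181ab21ff20852a13d80f3887018805853eb7c993f0d48c6d64bd39c74faf24ab7d0662ba97c9b9a82c2f3e8,
0x30cb127e6ef72e1e05ef4e41ba33be739449ae54f24a22635639e098d46d13afdf13369da07c8da8a525339b41e2b30a6,
0x29c52ec8524069318a88148659426613f15c9312a106c0a1946223381d81fe7a754082b5a65b8b28edf6af20065a1fafb,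
0x245704d9bce1cbbd7a5c52eeef5b706e01bd4ccc51d35374d30fca794049441b4f3ea04862d7f4a9f442b371d392be2ec,
0xa8e24d2bddf49688d27948da623be3069ebb8dfa1054e360ccb2101a24bd1e18eda4ade9cc1bfd9322e9b9f14696986bb,
0xc481d44c59eb254ea5d57ea77e53c57251fb5a2b6a3c4f2bea46dda0f3e521f81ec4131b1a1d8169e59584763ab194e1f,
0x55f1b210376c6e36c87d441e6dfa5171cef931dd7b546c09ab5c2624a9398e729ba0ff354f171dc43bb29d77d72df7aff,
0x8b4065f97a5170a5c9bbae67f6a865bd8bf5271052c77ed51e286195f65a88b24d405c55b3780611afd04cf16bd771a10,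
0x11cb1c686536f248c8479d4c6e044e78fe584164753810e3d9d9da77c347d91061f5f15106ad7d0eb5173a87c6605bba2,
0x4371fb411791d2a3d4e315a4fbd8559c124a86f0632779c784e187a05ed0e6b93b3746c537f07858656332a1c7a7757f0,
0x80118564fce94584ae623f7f2e9c8d6f62f4062818ec3e2ddfb50a832aa61c3a5652634465bd02af79fb40a5b6608762e,
0x40c73d63bca60aea6bfa1fa040a6f06736bd86faef4c0e43bd15f92ab2e3cf77d3aa59ef270bc156a4392624bbd712a3a,
0x83c444661b8e65d77736500edc01858c93373311e1cb856d3c37beb884af48f936d9182de3f099725f2ad5dc1c19f2757,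
0x49faa235409ef19f73c6e7c4511dde27af27c888b7e2425dc28520e0dcb51685fdf43e8bdf3aaaefc80ba22ab3ce472d6,
0xc5f161c0ef1a017584d65928c152247d4cd2fedfd8ea1889786d1037856008bfc5c83dc49137c56475fec9cdc1b2a7c6d,
0xa95561bd61ffbe1d7d49dc869f7b4b46ed2e6d2bb1271b8abb58fd6c22d7b7d14c40237ed04078387843b899ca5a01649,
0x9f5b4f3be16be4f5c1743b19490f72e97efd8545f32e0cf5ff12b7b0b32882ebe52f4bc54fae3fe063ef057d69878b]),
(0xc76520, [
0x3e6e1a6cb0578abe6ce23f45de665a04bb544bdb458b5bbbc3a7e4e8043a3291133a42c13c70aac4a6fb7fb443dd0010b,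
0xa2993846009a4965ee0fc02b1f27b11a7edd3288132ed0b15b3f9355a2ff47f0bd3a960946af4e498208374faaf0afdda,
0x8526df68865e35849f3dd5eb83d738d2b7a3ed94aa8381679970fc146bf9a5c506a24c6e50f101bfdb404673a2b18315a,
0x5b197416a793e84c91e76807621fc428b12acd4713e12fdd54e97a919f368a1abcebc22965fb78e89fe64597a012f0c18,
0x2c31d37f589b28308e58fa900b8995b124f0542dcad85ee55cb99dfc8b03449a9c012334ad396357c9f8d8b3363a5233f,
0x34a0e98021a33f18e51c550a41eebd5ee9a9c01d81b3a63bdd36b6a7f5079cb091716a9bcc250839d3974cad3c9a4e00d,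
0x630ef0ef59b718333979ecd9fd6d1ee7a0061bd9cf526c5594cfc8f2f7a8513b1fe82a42b754fae2d259218b0c8fae32,
0x34d78d19181fee684ad9e91afa71905d5e29638ef237fef588cb2d28f52afd5ecb1bdd8e34b1a868217238580be1544d0,
0x8c63c8f7aa8b2571f723b82a3d3bb7831fa0ab3860cd65c0549d2e7b3c7e98f1f3f544cdc7e57e7453b60f4a6d1665ca3,
0x5fdd0a73cc5a0e27bfaaa4319797a6aaaa392794d2d5d2adefbcb99fe777728b453847c0ce98aa0dcc6e1897836aae400,
0x4ecf11ea2888471fb5315b662bb4d7f2b81eb370416e18faf26bd48aa38dd831c75999ffca0ce3d95e070d0d708dc4816,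
0x7a855e4a0a6c1629c7d6398a3eb8bc9affa8cb15d1d9386b0ef6381cf23d510bf8376263972dae538405b0a7635ef3d96,
0x25a912f51ceb82b9b0119e445a21eeca94f92d307afe41378fde848e4a008fdbe5b2673a007f74f8cf7f4bf3e90c1766f,
0x504939788517acfc40455cdf0ad3e6d9c29458cacbf8a1386dcdc60f130ca563a05aa421e2439c4ff8096a49e4e1d64d0,
0xa47f2fa01b29b3b47dbec280cbb6810f6c5fa0d1932ddf952f7ef6682fe9a3ef5584fb675a3d34b881660cca1cb38c7fb,
0xb8c64a40e7d8a40cae0cdd97905bfc7a974e851fb6f5b51f4f530004621dd0764dae8a1452960e7813e3354f28f444df5,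
0xab5befd2f3d3be4228d609f74f47f8f24e2dbdf997ee04a73d86463a8f0c29b12754729281b763159a2cf1e35d5ef620e,
0x4176e169a65a840e0aefcfbd4466e0a3cbc2db8fba39e01b1a0d9a99ef4fd335e9cc6bc762ab43d036fece7f7222fb941,
0x36cba17aba7e30b0a6c9e931a018d02b6e98ae7ac87162abede5064233ad54380c9da1509f8864befae28665b552094e0,
0xb42709a4f9c4ae27d8e98e95917376317d68747a895e325bc34bd0b039bd31544ba71a47b797d606e1884b1d87e9cdd90,
0x24e3c156a380118959f227a306c012c26e9fd506d1fe598b7f12bb7490407af773a8c70c43bebda81d869a2b86da30f07,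
0x5ce16ec6ef543dd2a96cc4a96a6f4a2b15ed3e929aaf0045551aecb04589de3d416c5a8382021984b7a94ceb499494f08,
0x2986c59f9f7ca1fd264db4f6c072321a3d99f1a3e369b4e6bb093a835cb5a3a5e0213c2b19332d93c53c209c2695bc223,
0x33f425d61998a332202a3a0d1b7ac15568721da2b8e7e3366630ee9f6b9e55b7b1bf873b51a18b3c8985161a63525a278,
0x5af5fbfddfbf5eee8c829b8e15762935c35e3b75f11c378e419d3dd81aab709960f6caab610c8725439e37338a1b9963f,
0xa3d1958898867039d50bea5279ef1742c886253c1eb9f63d681a9b86c92b9e2e3d16a2a47f97a142dc311edc8e26ad13d,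
0xaecaf8e0eb5b4d81b83a18adc9283070e064cdd2ed546d4b3f411d5f194e5baa86d32b8d94485d1fc6c95e68806d489ed,
0x81ea4d2c851484a412282d29ed2f10cad03d98b82dfcea944c27cb17af1bbefcef127f216be9bd98a4c9fa2a48102bead,
0x7d75fc8d64be42b6b073e21f9d9f7ef4e9b8102cca0c1512f2754537dbf0dab48cd36a3af0d5f96e348a901b8ad0991fe,
0x30c84d6b48a984de529e33c66714f2e8e0c337c03698bbe144e5fff2a5206c12ab0e7f4537d447bd2eb63b8fa06990ed1,
0xc462a6c3b5a9da7fa29b6cd6843e64aa9ffc4dc988014e1e742107c40cc455c6fc8224e0f4d3a539ca47ceeafc2eff4cd,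
0x3fc124ae11f0b2006b99cf4bafa59c32ada46deb62e23fa99075767c6ec5c20c0eb54c9f1332b73041f40433f2cf46102,
0x9527309b9995bf4e89b689ef352a2766f4502409947decc8a6e0c607ac1542f406b3b53ebbdd4d62592e908aa2f7ab934,
0x9f25dc5e3ba6cc518c45d9e00320751caa2b2210b085ea7ae338ebd2ac5f2464401cdd6c82d769dd2d3a1db286da53dcf,
0x2b281c5f7d74787f421c8ccf56578d17444ead2b377c95b5b7b32ec6ad98fd49a52393f358d3db98ef504665d695fe9ce,
0xd21c6b14f2fa87ebb69736f96a6f779e074ed5ef35a904c85c3af677918e442feb961a017d65d352c056ab0aa41f9c2ec,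
0xa7e74e4b1338e1f17e55944df51c68f62ea7bfbc84f7607e73a0eddab1378305fce49ad00517230c8e1d82d0cdb08d565,
0x59d28fcaa0a501d8905b9f63024db87c7c8bd301ddd813880d6741c3f0c17c616bf2e1b787de76e93a04cb307184bb535,
0x30536b239b4e822bc3584158182559f0f4d699ef40d01e01fe6964b0ba597b2a37d58a7de19491ba3f8b023eb0cdb6927,
0x9a2d5aa9cfcc680f359b20dac21c78c03fbcdaacb58b5dbce48c100961e9b0841b634c753ac4217dbde26143e6819b289,
0xada3294886aad70bceb02b82e51023643601f7024286d4d65a4623c4ed0378ca0d155f3b4f807da44820c5018d770c385,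
0x3f60155388b56c2b0962f1bc803a73985dda09a1362d9b8bd48b5aa5d5f755844ca7431e02dcaf1658c577b619ef0b5a8,
0x9fab1c09e49c0a8983a165f3ee6e95fb62b0ab33c5a8047340faf8bd21968f499bc129305940471029bcd97c4278f708b,
0x14b2057414eea8254a1b209bdabde58b0c7eb74377ca667de1934f4b54297d7a04a828330191137d98a639840fa22d282,
0xac6c43bee76a51cc777526dc3f93eeb45a060b002d2befbb344e5668f42766c75b9fc27d67c8455ee6848f9242d23d3a7,
0x6901e7c05d20dcb89a6fcac9a0a67e4325cca1dce234ff4e1c0be04ee8f0cb40bb5b33507e854b6bde48ae16ee3da2929,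
0x76472800cdb943e1a3ec334dda6d19d829cd5f67776f8fe8fc6416c53c0ea3a046fa5786c65c11223e3779ef315777620,
0x6aa6304718118e4107c2104e70a80e5f757c4c209c36be8c9121288d39d470031331bc7b4c2d37e23a701595f4f96aaa1,
0x24c934a5796fa2085ff8c10ef6adecb9112cd66af77069d34509a50cf0398cc618f7d9cd234e]), (0x765420, [
0x1f]), (0xc75420, [
0xa8360253188b3cae6aa6faf913b44e75ddf13a9cd91dccb145e89374bbc67fcb0bedb143b676c6b3b6a348bbb473c033e,
0xc0b5a537c96bfe99e2b5daeba14ee365ba46b0f5c3a362c503565d6e2199118614b959bcd65439c223cece0573dc36d7d,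
0xce74f054facac35e64c80d2a3cabc55a2261c77f445b017aeb02592ce0efec40f13ce183ae07527fc1837269df28fe96,
0x4fe0478acbe1ab91bb3a77aca80025a6e572cd916c4cfccd4005def0eedc67cf6b10043b3ab4a7c2f1f29cd9d6db74056,
0xbd98b5f0441e754f77bd66c04dde48594cb4fe1cda68b7bad979653e280c124f36c149c5a14b2d482ce94b8718f465e8c,
0xad8fb51a5fcff33f8cfd192fa55a9f8f7b56b89a08e936c64d0fec5d5c1564b15e9f6da817e57bd50491140c7835db52b,
0x23d6cf1d36e776c499ccfc508add4ca0ebc77545da5b62e30f7afdb991d287a6f6fa561781bc6dbfac5e2d45f442e022f,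
0x784026f19798abdf491bc461e3c07ab9d087bb18991c1e7bd91f4876644313354f5b7ebc6c446feb6c71bebdb744efce5,
0x4097f77b4f228f8236965af2e28cedebfe3bab83c910a42f244b3201be91501f602f13ff207ea15ee74990f41c1161ae4,
0x995467bf741de73555748666ac2abec82195e637603ea7e9b33e6a7460dbfba16b27713c287f34e0dce7ce35e59ad14f,
0xa5c5e5aefd52a3fd59464626dc6b932f654b8fb3afa4c2f1be858de62224f3e4bef334ff4966afa9f2bffcfc05073826d,
0x155586188d65efe18e95f180fb52d2c725231c460c3c842ee75b2ae618082fc515e34e80d9989f726b99473887537e97e,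
0xcd150dcc114a72b9927f673e219ceb2520e7648f4fe7556808ed3aa9b27de5608141ce6042e3e45af35f982a610a62302,
0xc5ef9322a27815cd9439b6c2fdbd225b4c629627dd6a4eff9e19a9dd236fbc402c6ef4117f3895e92e3614c6df2b22e16,
0x7644d1eef5e62d194a37fac5d711efc9e38286cd5c4602cc4614e33f57cdf4957818fa32b79f130cabdafeb1caf0580a9,
0x3cda1c776afa8e87073702ef5f87656910b7e0f744cd1cc8c0a603520d4269dc204ad2de32a16be03ff0ef328a490aedd,
0x723e5c6d508bc7fda4082c59f757963248d6d23b46f57601bff247236a95b4a9091627f083944c2c551d0cf319500f130,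
0x9b49b201078b105c9b4acd0eb327db149a0c51bb941d1cf235bdd89c3786d7a765b5212039e0879f27b3b499b3a96d19b,
0xba7b57b32f492476cbc8a3a1a38a5cfe3c748fd751ea18946cc25dc6f56f9ff1e01251944e11a60b048255260b942392d,
0x9548794e9e1f3f2caf1c83611545333c4560d6a1975e9b3e72d685b03259b59d0e2d39753bb9fec68f5d0a99965938730,
0xb9b6078e9443188ff2a0a0b174bc5e79c0ae77577b74ddf5ee14f7d0dc9fcbd298caf4289e6a3f360298c2ce1eb47984c,
0x975f5cfa77a2c2e60e7540ee265e62f564c4f42a38458f16410b3971e3ab75bf8fd4a6389dfa38b206675cf5c17a9cd5c,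
0x6bc811afdfea4ba958cb6c94f3e3cd27ce0ec7e46d700585564f1521f28a4bd8399d52f3f837cd192e8d75d8431b71210,
0xa2b5a14f9a099f8ed6dd69376425390be113cd790384b15add9521eb62dfa1da4f7a575150fc024dfc97bbbbb494848f9,
0xabefb7cda8a0b44d18d171a5ec5d0314e59b44fb89c639dcd392a8094931c25e6c730220490a260fae346ecb77095c6c7,
0x6e943cebdce10846f2d2772d4562878e51b3c7642bfd3e4d9e77c85eca984fffee8471eaf7fb54d5fa800ec049a97b5d6,
0x5bd1f5a6584fa8d31975d66bf3c9bdca1871a4fabe046b06a7a9855eb1956864f85fce057d6835f42bc17174497d73f04,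
0xbd8b43a77bec352fa9a75d3cd8eb197aef6e8cc213bd2d69b56828bb2a245b89c36bbdc4581b2e6139d949f22c04db708,
0x4d1755460cfbc84122bf409dbe36d7c8737b3179531055001f887a819c0a4cfd116125c2cddc9430d0356c25cce231d0c,
0x3d0214b4bd1de20cd1c41f6ba66e979b3d7a6ee1a47861a6b1f47ebc4ffbce69894a094d8dd4bf8986608a8d9aa8cdc94,
0x407d887cf4e9ac93ff6f4a539742e3b941ef27ce5f9585da88432c0c8ea680878b58df4d39f9ce3d6c88f5e4e7dc9e4c7,
0x244e84220def7783a727c17198e38a704625697abb796aeff11cfd92c975b1797706ea4e99976ded2518a948bdeb540ee,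
0xaadc6a91cd3ccc12d64d35f183fb6b0c59ea2f03d594dc0487df30465558b3b43095ad322e47d346414845b1f8e5b81f1,
0x31a33193459f907874662747cde0a1f4f73634b9cb8c1c8b726560ce3f08544821e9efe25a02d804814850841c0e8e89a,
0xb58322a3485ea409e0dddb61e53ca7275eb77c0e12fa80603bec52c5a6712ea7538dccc36e069ac6e73c4edcb67dc8086,
0xbed2b3cc2c524b988df6183aac010770f609a9df1c6150e458b5dd5c2696f64cd5297b42fd2333584170041769f7375e7,
0xa33acc44aa13ce5ae38720ed1826d926263abeac1fdb55376dcfe76c6db8e91b5114b6298d0f2e03abb989814c73287,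
0x9165e063befa174dce637055899b96acf19214bfdd449bf1b425466142dc7c5bd6d81e52b0820e67b5cf2409f62d4399f,
0x8f43c57bf9a7a3cd5387b54527b808a6d28490202865c3ab2f36e5ee55afbc3c28b70086ca9a07180d7f12b7a92c4e590,
0x3ff7b1c0de815ab13206686678a67921deadbbbe75bae1b7633e4d48a3fd799be3879d3b17c90c7d661ee0b59f81725cc,
0xbeb4e19522fb204465d571985a2f24c0ac9da2c89a5833dab8ef303bb3924c5be355a4d7b3b4519241afbb26917453e40,
0x3dc4e0c131f81ddfb8b6749e61fe27fe3068967c1c20b42381b5b0af29f5ba33234278652987f471d6879b0fd0415b127,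
0x4e70f4fe3526488cfdd06b0506036354b16cbe4fe24de51b9d7ef8a63aa188aa5059fa3e9d8ea461095caa3089dd88ea,
0xb7bb16fa018ae2edaede3fed89e4c19c0aa84b13f4e3fa827414752aaf523b7f85c1e9e613b3ebbf11379f76247201315,
0x2ebd5a4d71e971243135fd6d086e6597908b186ab5e09a3d7ceaf8f4ff1ecbd5bcfda36f80c291ab1dbf62a7cb2d0fb06,
0xbb19851e621da7fa8f7f079fabc465cf978a65ac5189805abbc47bb7fd7b44390e11ef60e121e5a2c97967b2f0f19d9c8,
0xa99cf9585fd1c1d3f6ff48e837e0245e60bb0ecba17deec701f0ad1a38f7185bb55d2cc5356eb93f9fe89acd158ddb17c,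
0x96773246ea0f044a5729f617794eaf228755b00ce97600413c6524b7c0423658f61caf5b6fd0f6007b335fdca42f59fe8,
0x1dc1b933dd375213340ea83f9b2efb6dfd0d67a1a9d94527a05dec05f151cf5d67587dc608b26ff99328416795e994ac6,
0xa64270131ae11967f11903fc88451dacc03b0dc88c1631433980c4d7c35f8ef52625f4a304e52a923c456d0aadc4e48a5,
0x9f3ec3843cd6e05fb88b136015bc6f4024aae9550ff40239cb956589023308cfb3f9ee054a06449f6ed3af4b93d0d35cc,
0xbb15a8e5da574432e757afee260ef0d671f83eed8485239053059e55d1aae4b26193015ebd434bcbe5f4b5806efecc819,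
0x198e3213da39f20cfc4bd78846c3c3191cd2483cf571dcc43e5b0d073712944ae4b27ae435d57bd92320333992c7db1b0,
0x56f301969f2ca63b913f027085050035a532a106b71a4c91cf61f3e06f72f94d4dae1d54096a527d63d2cd90257ef3f43,
0x5b594a1f82c582e02d374f2e4948d5472352787ccaabdbc414a5003eb43cdc9eeb225490bb42d03f80982413c22804c0,
0x514e3afea76fdf5bb839b4d51ba19a534c6cc078de8df09ac7cbe0ec6ce9fb7a3cc06509f9990d3377577e26f2cb0c2,
0x125dc4cfabab5ad4078ee497c55a64d8254d04135960c67c3f725a0f37ebf46376a41594e564be0783d1674da824156b2,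
0x653d10a267e4be2c98ad994894279e3692d107f230154784f69c6adea7aac8994288e2f7c55b8c6b736b73ed2ce4b43e7,
0xa836d6eebef8ff6b9be4d629f687b66775307757d189fe990375533b8ff53bb134d53ecb3faf1836999cf40d049706c10,
0xac103c6d7fe6c5f97a23eb94f7e230b4c0ecfd1b6d0f53b8e408c0c6ab8aef7fac7a841c4671744f3c7eb96ce400434bd,
0x531ec867396cabc5c9f0c4bc1bf61f4fbf8359bbb2b6d1e144789a06554294fd3e7b0070b7cd2e117a15efcc720a209f0,
0x3638a68ac5ddb537e4bd47bf592932599ad06a280fe3c6f848ef245139befa093fa8f3198662355a9e393726e0f288283,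
0x6578a4127aa5295bb9114113f43ca9690ca8a0213d4237c4654bdbe922147746e505bb9a26cc8db5322bba44c480b351d,
0x557d0dac0180838b80c3ffc084d100659e18368631843c6246f38dbf26449d3bf90385059af4e6b98b9afc4602603c2e9,
0x15a487a8bca7fa82653c6fdd01a1d38a015a4903a0b2bcff22059f5c6e929d2cd082089b57a57cb4ae3167652e399f9c7,
0x3880fd444cb9fc2cabc8e671df93bb8344ef1b389928f75f93fa8c0977afc492]), (0xc76420, [0x1f]),
(0x586310, [
0xcf5961dce6b6cef6f79a26a89357dedf835da69bfc185d1c650eec71ed95e1a0811c85a12bac9b546f1f9d9cc963e6bbe,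
0x8fae066ee76c2f14057a64f6408ad8b73e784a4b98b0f83152556b130845f2a877c13f7a20e9c2f87a7b14237601368e7,
0x63d71de3695395968522231683fd5210ec85246340a9c6043b07f27c019c0ba38fd69dd0395562af467c21d69821f240f,
0x2753776a8d5a358d2ceadbca74229c700dfdf3e4e92cdcae698766c1c0a0454278247f1393050afc072b4718e6b318110,
0x534a54d2503bd28b8240e28d3a8955b65c2061a7f5821cce3de08c48cf747495f61764542bd11ee838c82f4aed4c795ab,
0x3dff052984612fd2a232c33700e6e4245a5a92b601876c4eb4ce389208e169a7681a316e6c0d82a4071bcd587342c646c,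
0xccc5d41ad143bcfd64515695384cfdbe3db7d06c90c060aeb72de37eff6119b0331a93bab17b297c357722e6c060a5bbb,
0xc6b7830e330f35a2714c23249fdce337a83af7966236556aa6dafdc212273e4ff7b7d579fe7d64a6b3cdf83770cdec76e,
0xa3a43a4fc90868d20bce48429c403681ad2674e7bf2a0ea490d7fe3383afa65ae03ac7a37051029e66b0b56fcd42a0d38,
0x4c96ea30b9afc148df94e6d51535af88a84597eb0e8390f5c29598ff54f75ec7da4b6457554c80b9e00b4198baafdfd70,
0xb09e7e7347b3f6f5cb3410b79a96789451f1d72ff39763ddf0644062cef9f4c6866174f027f006ab743a117f9240a3cae,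
0x2ffa65556e91ad22cfe3f9764550de9f5211f4b4fcdc0cc7dce3bb13bebec7ced28e7c9e5d92fa0cf85d1ad2ba86bfbb7,
0x55b1a372c43a977f277dc06fddf6f4103e8b8bb515c0c4a5ca7460644323b3e5ff67ae166c9dda29780908b545db45941,
0x5a5351ebd6f25913f1710c1882f4549e7ceef86ab446f24b6aaf63cc0761771f1c8fac64761d04a582078a7317fc9461c,
0x3c3002810b2681636b131430c6313d3ec7ba4264034f75234c04cb7a92c68248511eb401fb0b15c4dd9a46cf533abe73a,
0xb25af0556751f36d8d349578febdbfedcdc50bbc7810c81c04909a5a3e8258cdaec56ffb4fa949a5d93b1b41217ffe267,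
0xcdf36b00c3e999987fee48b8265c5b3122d324ec1e83ef90f60100df910b513cf636381136ac82433bcb0f474d7f6f977,
0xc7e251270514dd1bc6cddf4da21d46f2fc6ab4ceed7eee7328d35901f3feef54c3a16eb5697e920632da10c51a9950d7c,
0x323e14d99735f0664f08b151af6a263720baf6628bf29de1ed63e4a917132d269f5bb49f0c9fc806bc0057708c3aa725c,
0x358fed87cca5b36b1030e2cb5de4ea464a4bf56a805863d309ec3777f6e3ce97b73cf7d0c1d3b956be19834df179ed]),
(0xb97420, [0x69]), (0xa74210, [
0x2ebd8c675e0bd92149647ef146a777c4751ae8f1c5e32842c3130b901cc1f25b06db2f7a1bbe1a34028672944c6a9e73b,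
0xdf359639ec27e29603759089ddb9d62659376096296529e219045291eb3b9eff60f13e819acfa0b883214ba679690a17,
0x6ec5343b47298554a59e8d20d862e6b5da8ae32813470de897642b555258349a9554c7532929cbc34ce997e869b5e0793,
0x5a6fb5ebbe92c2f6ae9d24ad3e9654eab546417bcf513b2deeb35d04ad18df2e72c32b64dfba8c3d250f2567cdee4ed93,
0x23972354ce87ad45cab8d4332dda4a038ee90462b05e9da9fbe3e8aa404b9fcc22b46762bf5f688cc598016de22cb731f,
0xc6ff2c852dac38f939ec98bf9f75afef6f6317dc7f4166cd5bb4af68ff83054f3e1ec9c10f0eead36b2f7f109cf868f7e,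
0x32e9868360ab78ac0d96d0463fc2d832f291cb7ef403d4f73f2787f584b14b769b79ea6f0ecee0127064659146455a574,
0x4d8639f0ed67bfbfbdb5ba6248292548583448d0f5b2754726d775dee6f0dee175cee1723a43d223653399dc3e13a2ff0,
0x77ad1a1e65d2f6d219b597694efd0d3cd11004003e178f02629863c7681e30eca60dfb7ead3628b1402e87c0f8f3c911d,
0x18b8c491a0355e60608d58b92]), (0xa76520, [0x6f]), (0x597420, [
0x1041b0f9d470e5964c7dd99cbded96dae7456a79f4b9fe8436ff3a2edd9d29998ab9ae908bc74023987dd9b265aec3b53,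
0x62895a1c3e315cebebe2f3a5e9e86d02ce50526ff8ec517bf1f6332d1a569d6b76e0b37216e89eed8ec41169ba32bd749,
0x5147d57726406e3fa1cc96a5893d20789c07ef6c3dba47d2e0150f92c60d1ec1f5a11c18ab4a9337d1790e3d7472fe649,
0x6997daf1015a0a22e5e7ae5db1dd6a59f6ae8aa710e63ad00cf7b463d270eb8933408640db6b9292946f0e62e1ee20f5b,
0xbd92793de5381564f20f8fd29c734ad67a284fdbb6301d43d085588444b0490f12cf155e6d5e7cc8088e4870176c9f70e,
0x63ae0899b1fb93004a0b3aa281c4cfbfa5f089d04e6b3ffd5cfb3e8b9264431ee6139cf072dfe663321bff4fbb402d542,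
0x408c878a2383a2396d600114f00ef5230c2aeb7dcebd2506d92e9f4735ed7df185aa62261b100ed8ff4f3de9e00f367a7,
0x40f889d17cd82535b7ca227d8a5c941459ed7c12f7d0b2048deef2e494304298eec474767037cd399b7003f1593195564,
0x63a9eee6000e8b3d4b06aa612b6a194d87e82b879bc14c1d5a8a4b58e561a66aa3f309e703d6f355bce76211d2df120b1,
0x47dfe257e063a0bdd140a091c4aa8bdbb3c360734c50292a432a8209128205be3ccfe603ff1240b45150ba1721f038448,
0xa4f9dc732aaceddf71a0ba953b32166856d540c2528deaae8d87f457e1e008c2b23eeb8137f5bd419577930dfe15adc57,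
0x53bfbecfbe16a217bc739c868a104aeb885b6f1dc495ce318646d0f91a48e3b084d6235c884ef810ec81df34802014a40,
0x2d36790093fc2f4ef6e836a30d4e23d0d2c4826f1fe6036cd6240018a0f7181f7a96fac86934e9086525ba38ba85be081,
0xc0c3ccc8a]), (0xa75210, [0x5a]), (0xe87530, [
0x29410fffe24bc4c612daa075f6d758caecd3d5561b2ea067b63624c89e276e57448d3597a921f70a6878d2917052daa26,
0x1131e6b2c11dba4b6ddc5e86e26327afeed6c3249fb59f8f9cb13c899b423103db5dc975eca827d5c35d0e9171161a6a1,
0x7b7136035129616161824130115aac4f31f58f529525a0ad29abcbf5e66c77dac7c4bfc09ff4562150fb21dd5afe3b139,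
0x516c51fad50ecd184cc1f29796883179d928932f4fe9f9a7e9292511b8c301c9b769ef78c08b8ab0c1069212d41dc702a,
0xbd3803310dc76ca271381d09b46585b49bd1631c084d8af5fd217d14f5f58d48506f5705f1795a2d2ae3691ad8573d913,
0x720dcc09d02a402cfcf7d687c5aa2dc687b7e3dde7b365202ae3f2260b2ce411532521bbbabfe63398b040e5aa019aa5e,
0x33773b4bd771a211c6735cf2e433c328a89d76b3c29ce8c69259ca200f5543e8beb171cb678d9b18705be7b12a201880f,
0x2343a93f24b221f0fc18ce980a565492d5ad6c659821ef48caeb45bb448078d0760d5f45ea04d7deba6fe67eb3fb8ae7b,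
0x3ed31c44e8e336bb1814407f974810ffd91a0cff5c976c989bdb5da23c]), (0x796420, [0x353]), (0xf97420, [
0x5f]), (0xf87420, [
0x6fbee6cbfcdb2084055b3d14603f7b1d8bc9604995d67c4b0f9e4ae0d96e4673e1e79c8f6bd28ac69a697bc65a82dc05a,
0xbcb0e8c81e3f134e19089a3c6976385e05f4251f8cf718ed5770548d164c3921785d08fa89a2de014357a067481afd1c9,
0x3319628d92beb534f1f14077df1a6bb2ae8cc4f1191b71ddba7b9436e00b58392947d72e217a1aefd82abc303436827bc,
0x8048ddfcd30b996fca34ba50a664aef9e5f97be824d09c31fc3031f25d9555f913f2bfa1c307186e9ff200d600d54acb3,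
0x1fcffa0aaea79c99dc7dec96f7c8877e90591cc2e114f9334d1645c8b8d64219f78715fd678940f3695796ba0a246fafc,
0xb7aedf1984afac54df80e6ae516b345b6a9c7514d5ee890338180ad6173efcb7fb40129dce526eec5b27e8b58d2fac05c,
0x6af34495]), (0x785420, [
0x5faf5f6a8a7e8f16e81a7c496f64bcdb872510d7ded85a86a41c7b13096070bcd601fa7abf79342cad2f29e35f3a22263,
0x6f316a7ce35d8c768056ce9e73f54dda3e05aa6ef16d0b03220c632fccf7b66310472e95144c82c25b98aec2999b68471,
0x39fc5fac339384a4fe207431fa1a21ff6afb73ac5253174ddcfdd06b68e6203d00308e0c8c5fd00af3f8ff8a8c8c44be5,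
0x73af88f67abc63c6605c292d9ee1a75a147c1bb1984f453e9e87e73177727410f628ac0ac06da760f0e4dc8872f81b78e,
0xb3cc23fa67192fb4d6ad9191fcb2d59dfd56d82a2af0ff44db3a15270e4178a98675a000912f092784ebca80f647304bb,
0x5cc27e9fc0cd1beaaf1ae2db3d816da6c2abc26d793db6972e200bb3d06d911f0b8202e1283933968b9c7f7f8e7d7cece,
0x3eba4e049736ddec9f4e2fda16802adc9ccab84b0b2990949475793c1454a014b1da510cef08e978a058a74681603d57,
0x188b7adeb4f32175f982b8820c8997962c9b001ec3656aac0aba4bf81e3cbbef96dde8]), (0xc74320, [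
0xc91b54d3adc9b77c073da0f0695524c485d4f99422fbb0045272155eb4f633c35e343ff83fa314a0f0c8608ebd07faff6,
0xa2135359d47b5d1c47f64c7f4336179ff8a31bffd950ee6809554f862252ec138c4789806195c5cb52d55a6f]),
(0xc75320, [0x6]), (0xa76510, [0x72a]), (0xb87320, [0x328]), (0xb87520, [0x5a]), (0xd54210, [
0x714ee90047ba8a43aed70c03a017e82909d3db27899abdf008cf86ae34d91346985c0225c49cf9429ba6c2ff9e4238c7,
0xb0a44d31ab9c63c5747198821babe752432e417e38e561e2f89819ab7fcc5830a664de1b3a1c793980f897f0f9d19f4,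
0x411fe6e888a61c018aefaa2b2df6993d49801edc3c8b29ee06b94e2fd677f208a7671dd3965efd8ec568ef3437d3de40c,
0x6dcd91d6ba6ddd65a9dbc410ebfad85fd24318e79df901b7067ddba66f34a781b6579c5a190e4abb954f4c6a36785f225,
0x8b80ebe4641d0fce22546b18f64]), (0x274210, [0x4]), (0x575430, [0x61]), (0xd84210, [0xb]),
(0x185310, [
0x49d45339718826f3a6e9f528214abe309a903d8719aa0bbc8c41705a745ea8f1fcd194697b8c5ba5908e1c6fb6f1da4ad,
0x61cdc6f761fabb45ca3d7b2244ba7c24e7c0e133d5c38032248a6348f58e02c9ac96de5dee88]), (0x474320, [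
0xe2bf235e1284b50f912c8d60b21f7fe1f31a0d8024b626c4708929f1467b83d2ec56b1bd8306ccde168f1365f1c55e793,
0x534bfb54972cc94f1b1cc378e7c7dfe427a561722f18c3ed13ce980f4ea33778937ec67bbb3cbe4bac93443f0a0e28d5c,
0xafce18515727b139ecdd7c760c5363aee44f20d01ee5bd2b12f434c087a7a3757424b7a23c7e0b300b5cd24dad8e3b50b,
0x5f69c70f037b]), (0xb54320, [0x6]), (0x675210, [
0x35bce9cda267400c1baed92cab36e0dc27f072a1808eb3ce6eb9c44dee4251fd8f0df568bdbacdbf97c19e38d3e50f143,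
0x5b9bd4d0b64853c0837f84e19da6a3eb55913bd06b06ed97421fd4397af9d8828d03be131887de514a8adab2cadc9d6f2,
0x1685c64378699f1110b47d7a67d4889b402d56ecd9df7906aca7328ed7a14659]), (0xe75310, [
0xe601f62e7864c85730281ddcd5d0d98155d078da7c1706df65924c19520a7012ee311d601267b86d988aab91a9404090,
0x308fcbccc71d91103c21a41c07485082ee8c2d1d933a669b8726ab1bb9a0b6309604aaab20b6248150de5314b4e458d87,
0x8161b80e8e62997cd2fd87b820fac7fca94ed93489ffbe717dea7b1a751babc38b65054b19c967a44502d512ece4b9c90,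
0x9bb94006615e3440ce4bd7c42514a42ed]), (0x675310, [
0x848904627390c654ab96ffcaf16e73ea45b95ff531323288d3d42520bbea2dce72b67e7f196aea5620253a1fdf6017d8d,
0x3b713278a6bc8b60d8af4e957d1dee858e751bc6d4b397b980fbe2036a1193b87b7bed5876e612fa1927c8577d0c6a143,
0x178d5ec311e5c097f6cb69acdf50b9653ad3f774f16d1e65aa7e770affeca927d15f733f1aa131e40e95b76d766f9c8fb,
0x541d45022940a42cf8]), (0x375320, [
0x329d4a625e066c673fde69630a9155c914e2c8aa4bd530ad189151bbf4eae600119b25a0eb990710868b3557450443fbb,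
0x1905bdfbc43959b2f3f4e51841bfffb]), (0x675320, [0x3]), (0x675410, [
0x438bbf15156c1f16f1d86c2e529992e29]), (0x675420, [0x5f]), (0x775420, [
0xa9ba861b4bbddaeaf39ec4d7058dd085dfb65f50f05210147ebcf679efeb4498aebcb8fd537e184ef8b06284c9f8e16de,
0x4fb3157457d1b38814c0e4212c4ba393826f319ec38f2f2a71d8563f82d8f52e8c65dac9f9b58ef2c96ab7dd5d972105e,
0x493a31de6bee]), (0x475420, [
0x5b90336094718aa9a6a7b3115ae7c5a298d5ce0585512cff982aa1a031805282bce9bd5e4ac11c4664da8e3547f194f0d,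
0x56ff1ad225e54bcb36042d158b2929fc6e9950d687d26019349b1b2ffed6b337f90dcd3168fa32d30d11403fbfe1c29bb,
0x3eeb38243c4780683cd06845c8e35d70da3191adbb169c82d521835b29248]), (0x575420, [
0xa5ccad105f3a1e63c2189368b2ccabda244d9df7435c74e5b940342c82b01d4f356a77b4f410c66c3f10cd73cdabe9722,
0x42cb5eccd267e55aaedc9af842d5182c7f734cd194c18e796222c1bf6e2b8667316ea5f270aac960bcb3d1e23e2940c7d,
0xcf5929db04510fdcd5f142b92a798fd82791e56e977e5c4988671783800b7bbcc8888606784fbf988182a4e175771960a,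
0x60d]), (0xb75430, [
0x58b4693b6143c59f223103e27d2149abd5916b242f062d71a3c05cd835057603d2837505d145e5b502926ba37b09bcea5,
0x3b793ae061d9b07f364c48a3a371c6a80d4fc505b876a45b733cc13]), (0x875430, [
0x17228fa30d1ccf51cd3f878b6a6bd483709f2dde1dd7b03babc0eed87dd380995a6409a0ea30f6ed9ab6cc6d7bf7b37e,
0x6e19aa205982d76a8e85377d2acb04b4b12e01d71e8ffe82b3f6d03e81e2dcac2d5672d31fc0eb5f40374]),
(0x975430, [
0x30df03eb2d74f58dd31d3bf781248161ffe8c823b1cfd6dc0f30d495b1ee766ff91a4b634f98b46868113e049255979ab,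
0xb913c7ef05bca3079a319dc8d43715461746dad20d4a53dd963294e486a08c73ded706ae1be67a44e1bca177eed08bbdf,
0xb2da616afe83741636e55a3e1c20a0bd165bdf1b771574d460b068415d56e31435b228e8100b8d1b181a296af99e53]),
(0xf75430, [
0x9e34a7062cc5d350576b108443c94104d378bcd940cc38d6921684be2fe0284b712b0cc41a62f2a97f94f4d89fa705457,
0x6fe020159c3dc540b3d5ac4d72abfec1ce83c4a08cff9e20b54bbb8a2445cc2f2799c9ba0b60f7bc65a726b0389062d3f,
0x28b1cf6cb5b6cf6f1e9002a8ea496d6bbd6dab5d1108d4bbdded]), (0xc75430, [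
0x14b2b90bda806d277cbc8360149a3485888588171fe333e72cd41b54f3308b327195bb71d30760d4c177c2252e41b0ad0,
0xb9ffa224def76bf41bdb045ab4499be9b8cbb0d]), (0xd75430, [
0x8590fd5fdebc016998294cdcaf404205f62d9ff7ccae13386fb9b7b17d7de4957dd414db6f6c836638a7ee4acae2374c6,
0x6ba62dfc12cb125eee4da56e6a46493e870c36dd6a259ab48212a71bca067c73e973d98bdc077a8f50c02de520d068775,
0xa8525ab73bffaad9fa791049eac77c4e75b037f54b982d3940656dc3c816b5a889d686e51ca2de2222efc64e9b88241b6
]), (0x275430, [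
0x2d64645e981e55645d02da1c060ac72146b30dbef7383b525d2134482f86d910a6cfffd7c528c68e95fb931e82310cb14,
0xc9675d71fab171dca50abaef54cf03530c5557740fa3c07bd2cdb782489f152bc756e0684969f3a8d00958dafed4bad02,
0xfd2322906abf3e2]), (0x375430, [
0xaf14efa82ffbbfe3623227683cc54409e45d2e45e79b3a43763c91bffcb2c055d41a82fe187c4e043db098bc10835f16b,
0x2ca4350c7cc418fdd0c1ee3933cb5b4ebe36775e5e284c2fa8016288a1f6753c19e552fae2477b013f4f60859825b9541,
0x1309c86cbb488e13519]), (0x075430, [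
0x1a106a7e3e8ce26fcb46dde0f3f006915991680af9d949734d8be729bb3b827c903528674440409b883acf98c6dc8f589,
0xcdaf77d7e3b9786ad29b5bdc7c663963c17d759]), (0x175430, [
0x7f525a9af86c33ce720e9b88bb45de3e2a8ae3a5b4dd7a2fa6b9dde045a314e94081bfb125b6701e235f87e0648ef0053,
0x7181205d273074c2f31cc614ed122bfe1ac4651f73a9e9c02ab5b59caacafcc316b439cbecbcddedf8c217c5d58be8f74,
0x70350b57b2832076112422fb473ba79bfea00b931bc92dc11028c52118a6a6ad0ef0808f501a]), (0x675430, [0x6]),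
(0x775430, [
0x211bb7ae08b8d1cfc28e2fef9b903aa38b8f4bdb63684f3ecfa1927c31d86d5eb644c7b9a9e99e7b87abab6310372cc4,
0x5b22388833284c749fc210d1f5a335ce3103df04c2e442157ffb22ac7711844589047e9f010da84d809a8aa2af7d27a08,
0x22ca9c3461e1e37129ed377c8d8f9643ae]), (0x475430, [0x6dcebcebfb28fa04b94a1dc9])]

theorem rotationInvariant_lutz12 : RotationInvariant lutz12 := by
  rw [lutz12_eq]
  exact rotationInvariant_of_list surfaceList_lutz12 (by decide +kernel)

theorem excluded_lutz12FacePairs : ∀ c ∈ lutz12FacePairs, Excluded lutz12 c := by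
  intro c hc
  rw [lutz12_eq]
  refine excluded_of_separatesFaces surfaceList_lutz12 (List.all_eq_true.1 ?_ c hc)
  decide +kernel

set_option maxHeartbeats 0 in
theorem not_exists_isAdmissible_lutz12 :
    ¬ ∃ M : UniformOrientedMatroid (Fin 12), M.IsAdmissible lutz12 := by
  have hK := rotationInvariant_lutz12
  have h : ∀ c ∈ lutz12FacePairs ++ (lutz12Refutations.take 0).map Prod.fst, Excluded lutz12 c := by
    simpa using excluded_lutz12FacePairs
  replace h := excluded_take_add hK 1 h (by decide +kernel)
  replace h := excluded_take_add hK 1 h (by decide +kernel)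
  replace h := excluded_take_add hK 2 h (by decide +kernel)
  replace h := excluded_take_add hK 1 h (by decide +kernel)
  replace h := excluded_take_add hK 11 h (by decide +kernel)
  replace h := excluded_take_add hK 34 h (by decide +kernel)
  replace h := excluded_take_add hK 2 h (by decide +kernel)
  exact not_exists_isAdmissible hK h 0x094210 (by decide +kernel) (by decide +kernel)

/-! ### Refutations for `lutz16` -/

/-- Codes of the circuits of the pairs of disjoint faces of `lutz16`, one from each orbit of the
rotation. -/
def lutz16FacePairs : List ℕ := [
0x943210, 0xb43210, 0x353210, 0xa53210, 0xb53210, 0xc53210, 0xa54210, 0xc54210, 0xe54210, 0x754310,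
0xc54310, 0x954320, 0xc54320, 0x563210, 0x963210, 0xb63210, 0x964210, 0x364310, 0x764310, 0x964310,
0x364320, 0x965210, 0xb65210, 0xd65210, 0x765310, 0x965310, 0xb65310, 0xb65320, 0xb65410, 0xb65420,
0x965430, 0x373210, 0xb73210, 0x374210, 0xe74210, 0x774310, 0x574320, 0x974320, 0xb75210, 0x775310,
0xb75310, 0x975320, 0xb75320, 0xe75320, 0x375410, 0xb75410, 0x375420, 0x975420, 0xb75420, 0x375430,
0xe76210, 0x776310, 0xe76310, 0xe76430, 0x776510, 0x776520, 0x684210, 0xe84210, 0x384310, 0x684310,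
0x784310, 0x384320, 0x684320, 0xd85210, 0x385310, 0x785310, 0xb85310, 0x385320, 0xb85320, 0xe85320,
0xa85410, 0xb85410, 0xa85420, 0xb85420, 0x585430, 0x985430, 0xa85430, 0xe86210, 0x786310, 0xe86310,
0xa86410, 0xa86420, 0xa86430, 0xe86430, 0x386510, 0x786510, 0x386520, 0x786520, 0x386530, 0x687320,
0xe87320, 0x687410, 0x687420, 0xa87420, 0xe87420, 0x687430, 0x987430, 0xa87430, 0x687520, 0x787520,
0x687530, 0x987530, 0x687630, 0x796310, 0xe96310, 0x396410, 0x396420, 0x796520, 0x697420, 0xe97420]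

/-- Circuits that no admissible oriented matroid of `lutz16` has, each with hints that refute it
using the preceding ones. -/
def lutz16Refutations : List (ℕ × List ℕ) := [
(0x854310, [
0xc032150d4d4fa35a41613e68f6abf99b293485fc69e0a267407d35bed8935fc553e72a24b0224fbcdc6896282fcd86917,
0x9aaaaae5118fa87528c8f66aa1b855be5941966cb3c69bf79b28ab174e84cffe1b42c49afa8f08fc2633d5c9adaddc02e,
0x7e4506b2b836ea96fe92309daec0f6f1a4dc4a6b085819769bfe2d838923e948eef9b803582e2a77118fdbb050b462e13,
0x57f92a3a8b88643e35cfae0b6c7e62d54411b23ff8f4541d7ccb10fc98b2296bd45e62eb6cb9540739a1a50d6d034b5ae,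
0x6e16b6c82d373dfc20c6ad3a00b8b8c870f86690cac5e5ddaf85629216e23b1bc07a225255fe095cfcd4967316a5a3ca5,
0x6c9f7c048bafd8c16f95ec3ba816bcaedf3a6c198251942e6cf61a425bdee072365119dff8a59c6c2e3709b3b0bbeda22,
0xc71c03e95f19bdb46cdd6f2c1dc1f9bbce3413e526176730587bdf35eb0596b82bb83ff02fd3b5d4e4ab393b566f751c7,
0xba638d68e0b0abb62477baf0e3602eb1369eb84834c273f19f44d1fdc1cc76c8758270d4d44a9692fe1e232cc188c80ce,
0x69cab55944d0e922ce79b943e074e678209df34dd6a5d2e2c743a561bafbe89ce70da4671cecb0f054e904f8fe40d1bcb,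
0x12340ce726e082d3a82f271b3acf5900342b2a196abf25ff29b22798a882678319f5349094c0dadf44c67c5e363e6322,
0x56094f02962e8607eb65bd1a3ba69ff19e72b49b0bf548645abc577b3a2078bf2cd4bcac0c568e7a48ffb07aa6514f40e,
0x449e01662ba1ed237c0f1e90b6a658e2b9089255fc71e8d10765f4d5562b1ab9ae65b503ed91981d9a1ee16fcf964f630,
0x2be99deeb8b9c16bf41768c22573ff66d24869d9ee1d613928beef4f8bd55c777b51093617313b8645d71f9b4195a899e,
0x43af2c664dc21b3b68e5fddf25bb4c49baaa9238f483f0635a5e33ad5ad7159ea2de31bcb169f51262bf2cb8cf6f237f6,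
0x2ca47c70a79119c6d49fef87ef208465443305eb920baec61779783f5ea2b0d3b290447b24ad35758a675c324b41c856c,
0x2d12d879a2d5769d770b238a1904c561ca9289d6d1aebc7f9e273e9cac094d2b205c241e47db09dd44ac7fcfff326cb9f,
0x6586361f34d8eae4c0d4972dde31f77e62f5cf44a09ced0446cec6efe31c48b954776f3d5e35f5b7ce988f79906ae5502,
0x83e6b9971795dffd71d24795b5b8fb8ddb552e82ee11b67bd1badfd3f0e09435510b07854dc82242d19e38f8000ef51f8,
0x7f846db7f37f83af93f5fc4d7d6e07deea6a6f4faeb9ecbcbf4544ada0d5a8bb6d2eb07047552df5ab4fe82c844a54587,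
0x8fe610d87ead2cc3d8f527902de7ef1a97a69e8389cb6f78c823c4b0f78654f5900532bd1a4d97195a3d8352d3e258d6b,
0xad0afb86289fca57b6c96dca1a20ff261671636b871504a1d020f8d066d804432f523385968aaaa3a696208fc9e1afa06,
0xadfe2faf961eebfd44b962095291cb5036063d0228ce80ae473c2ef0aa8a6325b9918b30cfcb1f8d0ac62142dee612ae6,
0x9d5cd7fb208f379c428926442f1eebc5127e1485fc8977861aae74e14a9a05b6cb3c953a72d6622a11d99351f1751f5e9,
0x28e91bbdebae60cb6653f419c78d71b414e62902325c044caf1f627676a1410caa1817cddfd29215225a9b1a032cab266,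
0x86fecd5f30a171fcb0d5d90049bc9d6c6789ff488470d87ffc8c937bdba2753c6e5bbcb36cd176cf38db05ac23107ca0d,
0x4dfec371c98a65a3188ee85dffe58911e4c45fa8cbc341bfd6d8ece7bad612e02b44f54fa031a8b33bb1220eacab7120c,
0x2e2981b59c6e51d2d57bc55c53643d1eaf8f4f6fd42064d587ded3e667a87e8297c836dde216eb3e967608b70ec55fed8,
0xae08ad4436b39f23683d3459744f7666bdb4c7a2e85c1b17839227e98b79fa1fb0447d3343c8957cd2b4bc74338ce5ba6,
0x254e75a780743fbed3b1bf521388ad5e0472c3ca26e8a714f1713a0de35fa4c203dfb718c6299d1f4c702c56c90d6a2e3,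
0xaaf8eeedc9f178cb60dcf31e53fdf71d33c878cf5be21c99f4b25f98431482c80d3f7686539ea6168c6f8d73c5feda026,
0x23c913c4a634c393666561cf8317a02847264c060cf0a61116e690e83ebf2266659990cde74cf47a70826aaa53d2639b4,
0xd001c01520c7706ed07eb2204f3aa5cc0d30f7060b11a85d2dbeb13df0fc22fddb2b0dc68f56d8de8cd7534294fefae68,
0x2758fc46f3610f40bfe649bd493e6bd1da135472e65c14c9ea114b669d8fbbff0c6bf834927a06049ccdc70ab989f944c,
0xa8469e1c5843cd1d6b5ac4abb2d58fd68f33474968ddc17b6611dbd96ae88bdda337b602140aef8b840ecdbd0446a75f,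
0x30b1cb294a32cf01126eba32b44c71f781e268652a0360355466583c5f93f113925b30d99bc925f6f9709b25c963af62f,
0xb979b1167f62a0a3017a88214210db865d43183bd3072691599610cfd4239098b7dab80c78f1db7905041e386278f7618,
0x8432044ab15dc89953dcb63990dfe7a95b8597173bcb710a5428f3d5390a49d3fc82fce4cae6bfedc18a041c62507e996,
0x1e1d020bfac8fc3ef57517233790438e524f23ed05dfd26f08b47498efd19137a6baaea9654f3bd44db52de4f1b80898,
0x6e00922d189dfaaa18bde6250d5905c4cb3b69ede3ff5ece0ce9424b2f8198cd8550e62a43d162355a2a72b91ead8228d,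
0xc2be56e402b4a6e5460a045e0fc150e093c085cd952fdec749e1c2b8b4c7fe9dfc5af215a6ad7d9b6a041f399363865f6,
0x1a9b25499316adb367caa730975e1cf478f415cc963597fe5b581f35a47e19133d95625efb262ecb547ef7d88480bc536,
0x115e327ead734dd834768462c52157a201154722151ffb9e101a8ec1c89cdc4d7d6d8d2f42fe3a67122a741a2c8ad7b45,
0xc094400c2e9d5124a8d8eee4979b7a7606580159590ba18ebffca942ab4a3436996de4030bd33a2726928b3bb3faea7d7,
0x7879456c8d14a95cc9e91c6fa655e4efc97c9779d3a5e13c6f5eab9e614bbd2a11a7e6343a2706c253fc1c85d5f8dd8ff,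
0x4c70f04a9917a84b9a4cfd3d8dbd4a5501e9f2e6eb2544127485c3d03660b2caee64769f667312ca72855180d781265b,
0x577fc3add18c45a6e51e6aac4a5dee2ae438134b625ab6642109a97032620b2bcd9c26264856bd3f2515fbba142fecd24,
0x259dba04d80ab16f54b3ebf6902e2503daa62118d191fc7b59950a29b376025df339591b5b926746f9460734807ff3ab6,
0x5619228fc43ec80c76d9b49dfe9f41df7347030f821ef1367aba0fb41a7708c7217ea8b55033583ca60ccf37c538bf1bd,
0x2c1dff4a5b4f1dd4ce88f4ad15ce3a9af4912e0648076b931590854dc3318fa5918526682324dc399056f2520a40a8745,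
0x574769fa9cc75446461a9ea3f05c3ca51a06b86ee39652f1762f7c205fea424c0160a253a3d36a9f05095f587d483727,
0x76e7d01fd3670d65f34fdc531445629b9485bb7d575eb69f278efe0ee910c19b2895c617b5d2c4c28ed0b4fbb81419d3c,
0x2bd0d3d865aaf70117bfaf3f9a24b825d52e88904ddc357d7b10925cbe52985d1a1b9d71ce10321406eb342a700c134db,
0x529878e01bc96fd627a7e0ac90cad5fd6745a01141f8a5d915b351049d590db6c83ee6b24276254c2dbd924e1c675b51,
0x34b0c1e0208196166590a31b100f3b3753eb3428c7b81b214bb93ea77f81e84dfd88c9c490a56e9c14fc7d771b68b82b3,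
0x3e67f67c7e6007d36729211f27c9a9938b602b062127179c2d831f517d23badfa6a3abdad145a4e79b622db9e1e9fe72c,
0xb213b805868e97220a94b178c57d129a7e647989a7fe491347f588ba1a7d4b2631ea296ffe9b5202c99557328ae9bbd88,
0x80d68c029a17abab7b3374b1685d61c51c5eaa8519756801bd365ea9db1649cfae1a3b2b7789f87694d1aa35845665f47,
0x3085f0f0f16ea27b0cda71ac174aadc84e381bc0ac20bf8375d1c924e160dc769ff24d536a69218beca4ab518d6120b64,
0xc41e07c326bc0e1677becf91a9bc638dabed82f4a61900cd97e6c7af80f473ac12fb2f9f0bf1bcdfb1bb2b84d36066e02,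
0x15148fb2c6e8105cda62846f9418102124de45ebd7b7fe2f25dd75c82804680620560fe6cfb4781ace463900d21a58716,
0x4d53928436ea9c3409b3148462fcb50b66c40a3dcc79c4544e9f8d282ff8e7e337c99d2c6f2c4c451119b440b92e442de,
0x9ab41f042f620387ab243275f2cbaf4ab40ccf31819dc1692a8a21aeeca82f2dd38f01935f95f0007f5867dc29ea16d9a,
0xae25bf6a0352da8bee799a47c6b0f50a9eb35a1a28f76a311d399f6c0da7a648f04d1ea55dbe5582a1fbef36135e0e487,
0x919618ef9fa87200cc4007e2a45ea05d32f7c5ff9f66386570ac3c7f6e764efe9bd2414418988c75ba984469274215a30,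
0x3c95c675fe1bb656c27a60085588cf3011b703d2b5da18cdf5e66bd0371ede7f7374b98e6af2bad583fbdf3760015f179,
0x3c316e038763a29b4c0eea745518bf8cb2293fc55ad6ca2a84cc46beb27bf5fdf1375d2f2bd73a33fd215c89773844416,
0x373363b5fa57a6a038c71c5b957b7f0d09a1e865cd5a662843a4cba5c01a0a313ec323dc5f568810625ff159746c7b558,
0x48e9a3b074749c9020580126d7d83b66c559f057948b5a30057fbeff230d0400ad99d687f145ddfd6c939408995707772,
0x19d94e2e8651036fb435c3170dd8feccc1de7287d294ac3057fcc5b2e92d86f0240aa5d95f722e3df9f36ec0d68ee7e47,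
0xbf1977eabf0e244ad50ec39cdf51d11e47db2b19b87dc40a156a8b583902ea6e486ffe8106ed67fc848f6663dec5cfee9,
0xab6b3fd5a94b294ecd3d313788298ce7cd0734883ebd10257e946d631e1a1325c408f3ae6a4942415f2d7a76489aabe8d,
0xb16a9dcaec293f33be7068ba608e4aec4e5407246233ebd56e4ff581b3fe76a3e8a38a921fafcbbec21359881986da6f8,
0x487fc402bcb078761152dd87b52f8596298b9c4ab554f7ed7a6f249ecb24a1a845c80e68642c264090c1c0e54d78b2381,
0x2dc166df4b1360dff33d666ec86644ad4774e9b2ea4060ab132d02bf9d10ec56a356bdee805949627a7b7146edaa0123e,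
0xaff6c99133bf79e3ec2262ce5339846f03c9d5588efe410a60f24c64b710a6772005bd66c133bb30805b020ed3eac9dc7,
0x48001c6857757ae8e369e51b2bff1c6efce1e1d734351c8f9bff0705ca4fedc26028ca33cdc0a1963acd89449d8eedf2,
0x75dc46c40d6c228b3e848d7401f367166e1f3f2713be925ae83846a65f46963e2c008a20127109b436cad947504de7ae,
0x5e377e30216d696eff0a7673de7e3919ee47ee0debe54ea7d6f0439dbe41c1f0c06ae45dce12ac5c6d0e205df67b115d4,
0x1d58eeb0ddbaaff0564c236ec27d6a0bebb3d19cf8d18b893ffff2724d0c05bd8132715505a02b738729356f05c7833b,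
0xb3920d4e03ed9fb05d74fe6d3a210fe548b36dd8bb943a93ca4c7712ca0a246ef7fb82a15b6dad66fa9fab0d7cb64d2d5,
0xa9be808c31e2c8336bcc775ea3dba9bec0906b211a48be093fe1b4c5e34d20abb10f87375c6709a925075bbf46b78b48e,
0xadd0134de2ceb0307695fdfd1efd2e9711e04569066d2daea946cd5ae5e0003fe9d636fda83dfaa4b8f2357d571f4522b,
0x2a952cb0894e32d101c79e088faf4aeddd6c60e04de45f2366d9e7007698e2885cddacbab992fdc66c66fe3d31ffa073d,
0xb1e452519e1f9b0ef0fea37d031a0b5d50e0d95631acace2d1113340d3f0c677b96e2fff22dd95f84f76b352c15494fa1,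
0xb30d1d1c09bbb3b8dbcf2994c030dbe6b7c78746054c59d0ac7095c41184165142728d019dd823d68029a074d53dc581f,
0xc78fea6b23ab554a507c3b283815762b6ebbddcf7b3515c7c8f9908f415553a0b3f04cb571f656c6fcf15f30a3e6c05ba,
0xb109253e8309e0058c08116a0cd2460848471ae5481a6c24d952dc78c066907f5da1f1258e31ab3fe9ab8fd834e02cb2e,
0xba65dbd7adee9bd57024879066e1daeefd66ac02c6d487e3b25a4aa3cfe7349a803ef13354162d11e8414abd42c102458,
0x35081bb0ec39cc02bfea5a727ef78168f1c4963cb6d4704db930f60f94fd8eefb91b07dc2aaa4b4254d600a4bbe33c4a,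
0xae060cf1f451c86ea20cbf961ff04d4783a639f443ba682e2d55f60d276bcb464e227f1fc80a03a5bb2c682e96d45382e,
0x2f07c68d9066547f31c8b95a1978f9319966684639ba247698431c0554a87f10587ba60e0792c3eff5e756f176178d09f,
0x535cdd9f70275e78e2f1245edfec818437876aa3c3e046f573cdc57c03e9c58a5e4bf051e64391664f96229cd44005ec,
0x2e36e483b2596207250cffffb53d9f2bddc0dcb9e624209ab124183779e00ed2631d4ac481789a53d2a16a0919c6dda70,
0x7c614a7ef19a0ca7d834a981f79ea2e3bcf1c9e5e8bcd16c7e1710d5edccc9225d7494526e78320a30751dafdeeb67f33,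
0x25846e795765b83c5631c9ff2cd8719542926ef30491c399149bbcd5ef871abcbbabc2e719ca3f18ef2df1360f514832c,
0xc55a52fdd157d092c6e415e5da0c552f708ca90bdad89651d6657de38e9b347495dde25827f067882b2acdd6dff8fc1c4,
0x37e78feb8f897a93486ce891b6d6e8753d52d6042d341dfb238f7e409120e370047180609b2da4f731ed26b4fc0b9c886,
0xc400024147568a03eb42740f0804baa3ab06455e642d5eeb7eadb3b4009ab0a374420807587f683fd3b87659d1e8ae428,
0x773145442d3ad80f47ccbeb414e3b0945cd49a8f5f4ffe37bcc07f0e47c976f5e3a8dcf30df51a143bbe6984e6d36a5cd,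
0xc0ed06a133d03ad6c0a6d35ae6084cf7dfe8fe7989795b10e7a93cbc78ffc13c5714b5bd8e0108c03c2567fe8f9090cbd,
0x3af246d902d3dec78c5b189c2cabf8d47bd459939229d2f0a0e7]), (0x164210, [
0x359026460a38ab7caa3051b289a8f576054cc01faf2003a82cff99fd94f3d8bad0a83b35ca2627f2f08c1a24713a1f948,
0x954efdc8b83fdda12c357a796dae785ab190119121b160962521e40f8a57f2d46ad3d33fae23d05485702156ed5443f10,
0x707195903ea0f3031f9cb87e6ad70447331a7e5ada2c2a03f06b96eca09a7081593216b247a6cdde60bf9d86e438e3c82,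
0x3ff3d72f8a73d409966d7d7f13624727e0f1f55f3d84b0dfcd2435c5b203044907d19c91f10bfba8a7619617608514e01,
0x401a3e9a7c15e18aa856e5cd9a3a385a312506222acf7f5ee37035952e7c8f916db34ee47e46c91ee29853d541b1bdc92,
0xa88af4e16319783fc867e4a2c6f2dc4fcbab0f08eab83a6817a2fcea9af6fec64012c5821365e5b2072b20d7db273ce7f,
0x3081aa61ee52751caff0eddcc1d8486d4c63f5bf93a3b98f4ef20fe48ab1fcf30723d5b84dcbc60505e010584191aef46,
0x42222270c4e28b3d26291671215aa9bf506705e63ec725b1e214fba32f058ebe07855170437635a3fd7b660b2bfcf289e,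
0x3c814920a2ecb5830a9e678a127ab52443f234273312c3358eb3be7a85a99b77ce8fb6ffa49f421b0a696e9c6480e0ab2,
0xa2dd632d322d02d36f01a1cebfb5fa35851b932cfeba41adab5ddb5c9310df91850b32adc834ce2a119d726a65b19d845,
0x6e308a1f79a60e047306cfeafab64096b579f3c374bb4f8742462c2e7909a4edaf76d607e04f1e28233f6fb5d321a1811,
0xab16919a2cb886c4f5bbfbfc8bdbc627fafb07929e0a0768359bd4accb501d5fcb3a73403dde4f6c2f6331605e0738bbc,
0x5ce3d25e8f1af00cd3722cda7fe7b77d3b08b92d271783f81dad3da6958180997d9ba0052135a01ae4088b30d0e85f0a5,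
0xcbfd4f3cd8a994896f6805f40b323d80038fa6b221b45b71102a0b3f052ee7a615210b52c3a823f67104f5bee3e4c57c8,
0x4f7e3f09b622e2df9b3f20cb41765361a5ca32955755f10a344f377bef5dfee221e23d00fa121236109362f17109dcd24,
0xb6902f3a5445afb8224bd29ba1c84e29eb40b9a46086cdc0ca36e63cc26668521f5b43788e84f44c647df97cc28ab76ee,
0x2cf87e59cb77769148b0e7cdb1a10455d96c099e43c241a1ce23f93659389a2ea2dee270e5b1e02b1c7c260fd4b86067f,
0x2773c0dc7ffec26bf766b9104fe39793c4820a4fb8767de512988dd7619730a530704ab82af45989be1a4d46bf6b14b19,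
0xa9fe2fe824cbe852682647c1fb56d62e4c3297c163bfa28ff126ff89437c40c1ae2ce008968315ae418351e8c32df58a4,
0x65edefbd2f27b7ba78bc42f0d21a6f651284a918e94aa8f6fafc1b0c7de0d243fca84960c868f4a3b27dd338d99fe3950,
0x9440cf5b6093153d6b64209a3bd59e54394a0810a31faa0363c26934ebbbb3dc5991651f93de025d0c4967fc2663830c1,
0x28c5b455f1d60c68f3231d9554e905a1085fdfe1eadb3cc425714106e4df922fd153e96aae6f822b4ac0a09c07b10c5f5,
0xc51427e973d7d72b311cc7eecbe32c9572edba7949e281d6969caf99442ad2ad55dc5ab0e0f3ffd8f926af8d14acf6e8e,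
0x23932e92a78c228f0e19ea429f032dc84ee1620260e12c2177b48bd3b2ecb7acdaaa36a55e29d485ddca33e1b9e25b21f,
0xb70557af77e929a2b43c2464e307240de188071b0aecbcc67da201ec7583b46241e7fc6e1713be73b53c638883094ba06,
0x9a82477b07d37746dfd019ba64839857a685b72fd1592e284470352328f4b723123318386dea65df16de707c34eb49360,
0x2865ba46d6f296cd77b9881c2bbb9b400dddbda3cde9ca2e6d68ca842cbf51e8f5bf504e0aa470f230750f585b83e6e2b,
0x15a611917095a4312e0d073291c0e1b91b171739e03f74e49ae98492f04420d76645445dcb457c1e86d834c0e36b178b,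
0x746c5ef52a80565a0be7780804098fa8b72e854b8b2dde5ed09c1c14964d867fb0e583cda3c86750a81961aa86c9bbf3a,
0xc633ed098ae6ec043d5ffd6c98183d2b8f34fe5b9a470b27ce29dfdc1cf880c22e01c2d6ba40d1503c41804b023884b33,
0x4144a2359bca0bd0ff07c90e251bb8c46239c233c928cf2b4b2a3cb831ac55e3e7c910ec5b29113270d55cb8c43071d00,
0x48f0c218382bcb24f20b7b7771b34d397b50375529d18dbc2cfaf82ffd4cb0a2c165435911c708b6a0ea55b6aff174f4a,
0x64f18bd6941449843e72f884fdcf1c9488757b0e10fa0ff937ff66cbfeab68dd49aaa462d4341d6dc38a92d837e723028,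
0xc01913161d8c018bb90c63fde327d2db4b766f6bb295141d3efb8c2ab22a5aff89d8233598ffaff6cd78a496f52bf8794,
0x94c049af41cbcaef61c1fb0db88291aba1facfd08dd76970f3cb85704ab4bb9fe2278f511ee11f9a40ac007d435b0a1ea,
0xcda84e35b48723d253fa3ae00b6f4573deebc75428f0d512b74ff3cb8ff8f80c469f8126364152b3b1c9f35cbc8379873,
0x2416a736ea6455889f2afd136dabfa4cb27b399979ee52c5f55b13d649c439fced52b3ddc7094e9f924e911fcc81d4b84,
0x467bb6609e0478b48c2af0479b544c87cbb8722415b8a0ecba41061da73fcf19b257ac096541cde4ed6207e9b1bcf1498,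
0xcde555b21324b7d4c6463af49f2efa4f903154362098ac612af7396469b928b11a75b2db161634b87a643fd986979e7a0,
0x40fb3c46839825cd90d7e408894f9849f80a2a856b812f217a8f6495ae2c7754235f761e13407bfacf3b3bbc03d388f12,
0xb8d8a8c5ec0788f9690bbafdfad5b938a3f6b46a013610083c7896c850399cfe1c7d051a163a1667bef108994e0fe62ba,
0x6a1e0a421d8d937c684d12d80ddb4dcc34f4a9bc9767f6186dde218d584e8ef5674fc59790ae8f9ccdfee939ca3767fde,
0x2c98f17837ccc0cc147863b6a2788baa602cc71a47d6007f3a56bbc70956e51a8049febba29c9b5fcb5d6f59f241742f,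
0x263395a0f276fba49314d8aa2f11331f4cdeaf494c942e0e6a297a1231127985084a98074e079db5d9d05060300c872d9,
0xd85092db9c5d99b02977522bf9c2a7f8af9a27a6e3a1544628020b9feb53f73463179ee2a36a5966b50a9e5ea5aefb806,
0xe0d8bc092c26093133c99b710af3a87b61426de44a54455ad49704b6633599cc131ac75d68d5d5daca5eed71879506f4,
0x12871c8045784e67d14cbbc8b7a58df84e68f7b2179586af56e30125a9b07273e7b6d7f12d5cca6b5ed29558ddc1f5ab2,
0x663b6d76883f20ca776b8ce70932298f003e6f966081ac9cbbb858dd3aff3bc74275a32213aa68f4f3185f3cdaed44fe7,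
0x454e9a19af3af76fe1140eb6db1015a912cf7ab78eafc86a0a99b374327fcdbb7a01a89c46d59d7785ab4720acd781756,
0xb699aa209604803226cdd59a263a9a5f019860de1fd5adf4cc91b296cdb34872dad19be9f250c68f23c9f7480d868b7ca,
0xb3be08a30922ef09ff36e60acf9b8e37a3e3241b850983786d84f6931e9c1eaa7fe3d26ac66b484882763177f580a7390,
0xc1bf018e38d5ebfb777dd04ca0c97790f3224b7b292049fc39f585624e4b060a0e7ce4dc2cca2165fa0e32289ce7e0ba,
0xa8f73695d8a56c5d62641257333626bcf0e7fb09988bd94ffa54fff6d21695293dbb43c86400ba82f704486e7ac695c9f,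
0x10776eb2e91859f360fd8064d5c08f81fcf87ff075d7e2417c79975362a42c1e180b8becdecfe26a0de7842f00fb0e9e3,
0x6512bafa87d619e8932da62e5e47d5e355784c1e07d335155bf96948063c4e7d93c9198667604a3fd21fe65ddffd98c79,
0xcfc926f27b4a786cb664b9abd0fd18190a9ceb569628a838b484ec1b02a28a0e7ab6d026a11b2194327c67a54cd857e90,
0xb9949db3f25909b5f44bc1ae8be61daefdd3e1d0a7dd9c218ca3aa4cf61b67541b6ed16266489190e681cf5a3419d6860,
0xadd2910fd785d8ded5edaec4f971c9908c34c6d0bc210025443f8a16438c315cf9be9568fc79088a4c8302d9867193bd1,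
0xaa8541e3fbe23a6204dd4dd03697f60452042889c018bd80b3a8fbee25f692e54ab07651412116218bfa72e1874357432,
0x7261140d1f7239430f3dea5129a33aa06dada5d64e4030c094b80fcd659279f7fe83f4b934011832c2883a6041edfe73e,
0x8dfc6679040beebe1d8ba60153bb5b9e04f8a38f245d48cccfafd693faf7418816538e55d047059f190f5e84afebf6fbf,
0xccae02e997bfa9602c5d17d07d22b015fc1a017489c89be9cf4ae05cb30dadd795d29046f8a365b13351279c648e41487,
0x48fe6aff54af9ec6863ecb2582090aca5d064c424a6331fa9af3626a14bd897a28d073c8ef20b04fae35e519188bde418,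
0x2c5485c54ccc279dde4ae6c80c386598f96e3a0e9d130b01f10ddaa7b90a35f137d4e209f2381eef1c7a43f17f77437bf,
0xa802b40ff5f6826f6b71f6f704cea2c744bdada4685d88faf91795aa4bb1fae9b53d2f3d9a6caa7d7983e204940ef9210,
0x5e8b220b6028dcbdc278b3ecbedd9f25a0db1308ae22b73c674de00d808f939d10648911da27da68d5768ddef22fe364b,
0x6534823257e44e26ccc998fa15932c828f648c8d26e2a37b20b3ecabf465785ca7c9d222e8fe35733d063619ea219423,
0x76f0c025bcb7784f6f2e33795819418cc10ffccd2f1c2d8ea2e5f643eff199b4bf0c33180e17573348b971f6d369769f,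
0x5487fa83ba1e9889f91ee2af026a5f90c06bf4d7690e9214f63e01d1d11da39012be6871eb33145df7f80df34f1000d61,
0x3d12d4cc420fe111ef9cf71675a98eae9949eabf99160b2e81410564d098508c0e2a1464321c7fc5586cd696a0edb9b9,
0x24da71f7adda7e505abff825eaeaea6f1fb27bd175b4603e439e51e746f0efdd5914b9e5a4df88cee2f05a5936a3b5b8d,
0x40092d4417e239e74ffb0410b697fdf0ad3f36720d2c639859d451161a9a46f7b1d4611e74e145ea2f1f85655537dd]),
(0x965420, [
0x8cb59b7187790263e0bf2bc27030d840c50d1d86dafe23dc6c6c1cd254dfa1c0671cd000b3e807bac80faaf2265668802,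
0x2b76e7851c2b1807a6d1ead9098d99c42527bae0261f420769e2f3afbc75220c7a3e8bfd8380ee4ee4836f7920ed14e2e,
0xbe0b442161ddd5bc3c3019f769e0da61d187a04c7886ebb512473f1007e5ffce3dabcc0a902108a0a25199aed351b459f,
0x46c18e99a2b72b8500b744c7efc7e37f37f609ef783826b43fe0722cd1e52f8db4e83aa6c40a8f22ebba326ff13ae32d6,
0xa1eaf2c133dcf8db570bc69712e60b70f105cb846dc578a2e2780eb76cd79de99fef2298483548f0952a35f028d9757df,
0x6701af2c706603a8dab26ad49c4cbe0afc98cb05cea97f2ecc71afb43d939dfde6e7f37ec37475027e45f9fcd6bff29f8,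
0xa7d132b1deee5d622c7fc2b81303be45cdaa5c8abfee312f5b789d7209be6c0c2e63280bfa7ae421bfc7c43d6bafbb738,
0xadd86cf6b466e5f87e2c6428ac0d3fea4c05e2a16495ff5c6b978fc19241893f7d0f6431b48b30e4cd8523f8f91b02e88,
0x7db392955d91db120643a37ab97f3cb143754f7248060da445333c7553ae8be2f5dc8c7adb2caaaf603eada060ff33fcf,
0x72e0ed677d0a053732c1b65606ceb68c428962197071e240eb79c3a89cf3041876831aa69db980af326472af2acceaf28,
0xc40f686191156bde945379725c84d98bd0ba7474e82e9fc52bde9963ee68c4161ce8a97f9d71a902286285a5cc7763e87,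
0xf9208e52de2cf4510775c4d9ac38a28fec5e286d898ac5b4e9bea355f165c73dda9d3dd28acdc4e699557eae720935f1,
0x4334a64db2004ec9192b210f6556edf2edeac6d8f15c5bacf8876c7f96890dc79a04657fb9bacdc8d1d212587db6a60e0,
0x321945785bf62819fd40b80b2ff8b34cb81b872676cb824ebfbf55a0ca630ae5c87167f9ece87e8fadd7121113595eec1,
0xcf733a231b941758b096cac9a30ee3508fddbf31e4bb22e3ca693d1766a5ca8fc9c2bbe937f5ecda30ad61c077e127e38,
0x4e7e26af8faca0fddafed3e87adf0c5c6984be51991d2ab10e2d681518bc75c3eb5f8218902daffbabd66492856c84d28,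
0x86b42b27f5785d52a7636f683b9d2bd97dba724b8e7c7870ea2dd9a35af5f117ba57be893e11c2b9e3c6eed0e774832bd,
0xb23c5a0332c7d35f7056e97364d34e22c345315c13720f867659cc396bb9407ab775eceee37b1eb19633240ae4d2b3c18,
0xb4a33bb58b619cb8cc834838164fe1ffdf1c2720f22600e557d82ed2f1b9433de007c36e8d3246d3cb1f6ffee6387aa36,
0x2a1fdfd716282510b74f854ad2195204a4e90de1bef31ad2f27ccb4a2486e7d696e305f505697c118c8b1422b338dc8ee,
0xaa82e712fc8fdaa27d5a523e866fdc4fea82cde56e8ac6dc6385ad26f7a61626c5bab988d2ee8fb1566d079a44a8d3e06,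
0xb27a1ec533e99d23dd8b561a11351ad338cde127e51fde3a7e839c1312c6e176a93c39cb03675dc6c2faf836d4a203518,
0x9b5dbb676ee2ff1f72dc8c4b82af74470b7c6b16182ecef14fb58296e8bc25ee672ee063873f53dab78ab73314e070e91,
0x8421ca32a8a4453cbb8b6614f43912a7959f71597ec7e1b86f6e65888d4e0f68c479fe6ebdd2285b01d47ebb91bf02769,
0x9b39b827c8d1ec23a01865ecb4e97c1a7ad8b2f949626ea8a01dc40ea74148b35c25d8ffee6fa806183bb6ad885581d85,
0xffe78f0d9a49f2bc66cdfedf335a2186e902b2ce5640924681846ac90a88ea009b4e23df98d2a2ddba7b708aa1043403,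
0x554330b4554318238068fbb108cdc3d54ca094eb29d82dd8f4160d24ed472f3c086f4817b4a34b5069f8d6090e1d4e320,
0x401268e1b5c20bb7844870d2fe42db1f16afbee335a2c9f6f8ddb505d92f4ea99cc99b839187d224b72600977f2ccd474,
0x6901e761b69a8829d44680a53b606272d85f853524d2475b14faaa25e1e1cf4a92a916a6458e46b6010975bd9557b8902,
0xad0e798ee1aee376f3b5c84d1302e7f923d7adcc7885981cc4c3d5d543e95bb252b6bed394283a19b27625145a0e82597,
0x1b4d73dcbeb6f06312caec78855b68ff776b334311198d31db8c7e02cd5dec9ab3b2ef0438e34a3f8e69b819e29088f55,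
0x57e5f636fe3fffe11407941b7b861f05eae15a728553f2b969dd7c059d1ba7b4b31dc760f2bb246eac43957c214de4682,
0x659cc7d50787145eafb9904c5eff4f41dca2fd3bb916394173d7e245e9338176ed3d5e454e418563b55dce06056817995,
0xc62efc660b2bfeaad1647332c21930b209a0cc4f0ce45e4b282b9844ae2e19b5312f720dda071f0c0eb93c3ca4a227cda,
0x417ea063fc0b5cae741df634fdfc1a172482a2b1848bd293302b9c140b0ac52b32b31fac66ec88913437eb665b4821c26,
0xaee168beef2497d]), (0x965410, [0x4]), (0xf85310, [
0x2f35b2413ef1364f682d8bba9b96ea19c687b916036e087aaba3d7763217644dbfc753d848596e58f4df696b91b91c8f4,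
0xb1df5c06f5f71f886cb589a33fda16dcaeb6e93ef4976a258fdabb81b1022b57878ff8fe62179a3812f68268fef1027b6,
0x2ed20ab342eae2c476121680cece1e2938a17cd644cc5b3f4775652f75aeed6e0d8641120d3947564a23f2bd1b2a3bc8d,
0xaf3261c76eaae244d6c9925e1d4adc4d95f82afc6e846800e6ee18fa1452caef8f3b0db24ebf36c6284ddfea5e8662117,
0xb54a954b7314580ebd9733c719bf99d9c4926eff8d4f39367e57b1cdb30d62b42f73566b2bc145e0e07883303602abaf7,
0x6d3e9e20fa34bdab04a4bad7694f5a6a40bda1d2148e33d4797b9c6b2609fba03ce925b31128b5a0b17be9e198715c0d7,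
0x44668953a6484114d23ad38d5f9f6b903ed86dc2e4e3d6b5609abe30704adb321c9242cc3dbd16bc3d12e3baf1ba5ddb2,
0x45cf0047503613c08a85fe36a03c523da08c005e21dbaa86bf6d7abadc803bce0c825df7794e5d77898e06bb079820e09,
0xbc9aaa65a286c764ef30e133d66eff9cc68e2d4e51a1d61e89f1c4715705a8c04bcb723e8febd0db58b65f2a75802776d,
0x5429192bd222b7b13c46b65bcd1704da54b141c1c7b651026245a4f936b63b1f77eab49b1f2b7bd042f0a2456ed33b4db,
0x345129fcbf02887692e3a6221f92561a946b4b60cd0177802c9b454127b03ea8c2892100eac9999f2ed2e23ffd65ac5a9,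
0x2dc9e52292c553c77028c1608f377c4218c62e6045ee65dabfa370fbf754df3b01a5818a77e8429def1c0d9eb55bb9b95,
0xe5f8b2ae775773810fa12e9bac28f5dc56fed9dbbc39175785da54ee6d3820c61c4963f241e3e757d6b44d91bbde9598,
0x27009377af467141ac15414499c35a143f05b0778fad37a4c51744550a7b0ed436270190b98a5820db6710abdb56bd69d,
0x6efb7ae6fdb369d002def35f95abaa73f1e94d6958309f93d21779b589f39b465673e29bce45043abee3cd1cc442054e4,
0x1192fd942574eafa63d364e7248e373223c9199269658dee8d92e963fd4af991ad37943d50fef893a6a1960c1a3d0a103,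
0xa947220d3593848a6d6464b3d98059bebf6a9b5b05516de00dac9ffbb24aadba776dd6aa66ba1286218ab3fb79661f795,
0x1131408006c84744bc7684c35a106028c937e71c6aeabfc54371829b9675d30cd7f5e4511fdb7998ffe44e83c2b9fcb96,
0xbb8e5f98c906e41f13ca0b1a79810a3eb667830b443fb53f49d76f6d60478c2a4fde78548b74c83d9f11907033efec9ed,
0x9052b745f13a3e5f7c8dc]), (0xe96410, [
0x23682c3c0a29477d1db46bfc7ec1017751de5915c4a9ab8e449ee381adead39574c5a4fb6587458f532f8ec73a9bcc6fc,
0xc47562f637d02198f3310e5393c4cef0e572a4dfce5a07a8ff1e62fef101711e455c06cc09d3331ad9486b95e04313df1,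
0x844a851b1bfefc397f751d17269f4146e05d6cdaaef4cdf7284635bd29669862e0733b1383cbe4a9e4f36a83c77580278,
0xaf65b8c52755f73aea90bf92f0c3b9e0059ad7a202238900bded6da16fec5f4f07be194061d2d9d0447159bdc031da776,
0x94411df04fab496128faefa7d4510eca9193bd34c42c78eee5c1175dc8a75a5a32d9ad267f057afc01542cfefa2203432,
0x3117fabe8b85c27ed14c9e7601d9bad85103cdc95fee2f3c3581cb6f5bb96b27c7d29245291237fdb537a8529b5d689c8,
0x9af562d2527e7809749fedd859de0508c63d5eba367db5ee279c7f8c699965a9ac7f3b9ca6ca264d111a52ba362e5c526,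
0xc47030851ad91d1bcb456bfefbe952db092261daa3dc9485473d11ca2c12b4b4dc16dd69893c948a2ebde1b244133d8ea,
0xcab77867438d2245cf470e72420dff0d8cea7aeffa5a5e3ebfe006e0c8fb48b6c6b657b07a399eded5a9cc852f77cb603,
0xcb63001797cf320ff28ed7c7bc3f3177f166a7505ca3058aa1c4f9c294fb4dea773ae46b4d0bcf9134f329279e18d9a6a,
0xa28cf9edf5e9f5f61464458f7068e286517480cc06d2c5947709597e51f0d17747a66552732a8ce4a7da6e69743150ecd,
0x4ac33e6fee71553c5110ce5a6686cf26cdc2b4096a3cbb781e51262bd4d769e58f859aff2db7a46b0ef60d1dc85954603,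
0xd48d0d6d39808a477755ff8a58eb659993e2bc2f7c136b08adc8ee9a7047cbdd71c6ae715537d6c02fa6fc14a4326d78b,
0xc3ee22c1524851066f794eb597087f63fa75206ec5276983ca50d93d94471b629d0f26506ad2f26535ff4d59f520047ae,
0xa946fb69743dd4f7dc63fc0f4e54a4abd782083984449466da2a35d503829ef8bf2c5d98c70694131cfe7a2e329b47cc9,
0x6c135017bef7d33b4614b55ac6158e5c17b99371c9bf2d4f2aa9526b23a24b3869181d3201477e9837f3a0238a339f795,
0x6137dd24a45e878a595b7652cdba15ee42e77c3787cf34644870e97bd532950a00d9aa12d5fa73a33c4f19005d2d9813d,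
0xd0e4f37dde4c406c1e95b21886f325fcea427e23c373f29fa676d4eadc48eef0ae28571034b0d0ed5f22fb3da1c561712,
0xcd77e27089b9794f0ea05fc30b2d6706405e3c5b1b3ea6dafa740529c20e8dafb58e26cc401a029aaa5229939dd9a3535,
0xc52bec85a1f396dfa47ba5bd0d55c021dde1af66fc3da82e90751231233e06ad554ea6bb643b969c8d7192ec900e8cdb3,
0x5223a29b0510e3a627e334cc41064364a4206b9ecaf803311807f3b0aa24703f5cba3d17ab555bdab4fba500243b38ad0,
0xb754aceb7a336f592f2de0bbd044b88849187867647eee6cad61d1a2bb33b0aeea3bd0d9ec7aaff4a522a4c8da9ca6602,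
0x3230d2e8581d52a8aa5793f99488f21a2179f20a13bece6d8f257644dc056c4ce66093ed8c10ebbbf56d9c036bca5c797,
0xb4fc096b42240b4ccc17e8e23763aa7f9bbf70f8cad9b4f1100ed8261a906ab6c2bb0f4469185e4f69986183fbadb2e9d,
0x249e95f662bb6c7eabbb15ce1b2191c93cebadc475ff3e6f1bf6e92451215f093f5df690201022b5e79099934b3a74be6,
0xcdc150a9c19ee0a3e84700318d7206cf627e2c064d088e9ddb9e890ac4c785d340ef125dcce0343ae519c61b27298202f,
0xa6210cd549c320407b2b48de58d6a4338fd713f500e18fb7731a572aec63d18013defc93c128183c1a50c9014251545ee,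
0xb4f6d49a7574c78bc8e55bdf4bf0a8a64d6b73fa7856081d2d0a313cbf1208f1c14adc83254ffdb3e5f76e8162100927d,
0xbd159c6ee55d372b5447c385450f9a82a81cdfd9d43196e39c6caaa5ac54aeefbfd0119281461a899bd94385c82b78e48,
0xa3f1a18fc376d2a29f449718a608ce9dbd70b5789ab4858f7b7a4a89d8b37e53a8c3e6cda77b03d60265f324bccf7b0ba,
0xb797ea555b0c81215f23b8f0dd3d8a6861601504c68efefc097c5ef86c643608b3854bd9c790fe7d38bc713cb2d154a6a,
0x9492e7586ece012b0acefb4c0c2661b9ce2e5582d69ec6e00f93a41798878739e8cd8e51abd8950f0a0bc73e0015cfbf0,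
0x365a22d977c8bcf198cb4c7967d70ae638cc6a54d1537fc3c2937d62bd2163069f248ac64855576c20e8fd972aaa25149,
0x631302dd9b9e4195047219730158deef67674f779a5a5376b49c0fe6eb64c4ce9e5415632b10e8bab77eec9dbf03f758,
0x308777b11e48704c72de66ac33d1305c9fb23f5d48ae12617fe636ac0293ff31b1d4cb77d084353883bea534b46aafbf7,
0x7bb7042efedbe6fa8f81e10c79643515c90f07f628292897f0e14cbbfaf5c0bdffaa15ad38ac5e069c685fa0dbf5d8c9,
0xabc28861967b887e59e3e36933e0c6ed46525116d2899525175321ba28e21d1a6f42ebbeaea2a3800938d222a8a6f47e9,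
0xa650f1e51b63dff0a95aa288624a8639f22a683dd18f7a47537ea7411f012b5f3dfca83946696eda6ba5862017359ca0,
0x388e156f124fc8bf9641ab184f1684da7faced58fd021a8df3e1d255de6c9d125521321169c0b27d174916310a17a13e2,
0x80a809b86adfa4f23a540835474b162dd0e03186a48c670fa5bf6b4685dd0f7b0bd112c3ac6be05b2790a45b2310edd80,
0x783fd27be48ca57fb0fd062ed8579aabc786524e8a011bf03c4132aa51587f9abd97d82d2adc5eeda88bccaf38a23f5bf,
0x317009a279d219d79fba0100900546f2162c0d1cf7295ea640049a6899dd745d502b2355933a87bd0e93ac05783ebd116,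
0xc13e4d96d7816259c1097c98ea99f2e006587c2efecc0d92460d54f193b244627fb6c520507cc8ec2a52069a6c76140e4,
0xa465f7a1975bd8fd7f420f36a2db4cb86c96aabcdb4d0b30d2cd4eab978d1350d13d749374969b5c33ac68097de90201c,
0x97823beaffce6c39455d7e8119ad308fac1c8bcddc36789a095bd28c6e8e8d56b6418b654606eacbf0dc0f271f90d690c,
0x437b342bab21a841129119ae790c852bee353c938e74972db69a10d26357a515d1dcb5ff17fb113029f5cefd1f80fe217,
0x44d012a61a43897dc62dd25f9cce16e06604918032dadb59ba1c3d6de6bfd20b8b29930fa5c50567738ab8814ed36c7e2,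
0x7d7fd77a4e7a3218dd9b3f39eadc96ed2f67eae8b89301f6e1a603669243af0eadd7d407282c7dba59cd3c58b3f7938c4,
0x62c09d5d93a26fe5d4f45748ebcfda1baaa301a80cf65983e6cb08a1cdc8a47311981325f48e4c369706dc8c00811736b,
0x280f83371da7208edee736140eb65ca2570bdf4f4b8d7c6db8f11063b462816c1f7273eff57af64db59470b87569cb689,
0x25e37379a3ef489a97a650353390d311593dd905df58426d8ab150e350512f7fabaf7d416ce33d4d5dd5904beac644503,
0xaa71e7f989948710be34bfc4c764a9b9209eb25744ca657c997c0e9bf01a7b2b94830145fbe078a0d082aa8292ea90922,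
0xab2905660b270871d4abc41ab3d8e1ec574dd6b661dfd45a16bb4fafb8b79977cdac6959f7c238aeb8470d66f2053d31c,
0x2756c12c834361f310cdfeb43bc8246f9a6a1b6b7a4]), (0xe96420, [0x32]), (0x386320, [
0xbf8b628aec30fda085645847604f6fccfdf00742d36177bb8749c1fefe457be8a4e8e315550c7ff23725e614df3eaf7b1,
0x67e1f66f09975bf25fb5a9e29bc3f9276667f18f80f30f398b742e1da619d9aee2568ecedb71308532d0977169260b6d1,
0x35a9dbb682749614d8bf1ddb67f608057c769941ade171d13c1061de3613ca5ac3ca2a09307f0941a6295c478b8ff2e9f,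
0xb90d7da7269cf8d8bc4a82645ab71f577aa107dbe1ed07ddc23c8428234e43f05c3ee13ee9d3d8bc50896734df882b743,
0xab07c03db2b5a69775f324ea753931cc4e1ab6767d9da5c0de765695f3215d2e16c4d61da9250d3bef6921ca92e5ba2ff,
0x1464cc372872910557607ee97f1f6e0d4c195fedf430cb0dbb7170ecb8c3186abceb99bb5eb99e8af497ac6629b127e45,
0xad89978befdbc8940ffd2f4a5d5bfcf1af6c80362e64956f39499d859d8de34e660af9baea3462e48a889fdc8afefe86a,
0x97ec645434eff8bd2eb13cef0971efd406030ba2a7929bc561f594e323a9463bc695fe8ca380a9ef61f9c3bbaa3422ca3,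
0xb959dae8b75b42f54440a462661aec3a83b7a0985616eb5b744ab3978c075133d4c82157923044437288a5530ffbee04e,
0x1bf027dc465a246860b1a5b775c2c825a4b70c9d078c178b3a90bf373ab8f9db72706ed2370e216fe212742f8e476c538,
0xabc0fa9c2c5ad0fc5212709db542ae2d1dbb5257f26ff9b1858f8e53f921b5f995da8b18b57ed39baca85310f72d2fe65,
0xca75168e78b8d3021ee50939424b31e787d3604cc36d1347a1649d6f24ecc6ae1966f25ae50f6fcf9f082e36e47559932,
0x391ee0137fbfe399857dddd02d5e08c06b890a80753ca6102a97acd1a00fbe5361b1c6a618ee2867d1fdd18b51982d340,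
0xa4a626555832066dd1cd26f2f6bad5d520f33130bab38ca6b1c4c80466c167eb1d94537a09f4e639b2c4f6b3447e933e7,
0x8950831386812a94e9b23c2765b5ca5ae149a08cdb1023503f5d1ffea1194579866cfdd6da99de8bc98b8ce989e106e37,
0x38d60e3506542bf71c04231c0edc9bff6a72eb243b0e7ac9d4ee4f789a538536ddbcdb5c0ade33c66f683902e74d779e6,
0xa4a1242f6b11b4b1c8d1cae3770f665ce2fac8bec199c4a3e3d9f571000b215756c28a5c33ec6db61175f23dab82a734d,
0x75b512b490d50f9088d22ac461e653e65331edc2c1103a3632cc2606d0ea1377df09e59679b374fe7ef2843655ccb56fd,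
0x52e23a6b2068c8497a9f1df537aa78157278cd3df03932157fab98014ef2dfd25a28fd03044648a4b0555b86329b8d7ee,
0xe9c1028111cd0da5ce428b7e2260b0d735497984cf0b75dc035a86a18dd2084664564b8e1409f37d6db660ea94e0c92f,
0x9e74514aecf1a5b2b834aa2b551c394fb57dc39ba40a15995534ffac5472487d850f8a572b9303e736305d61e3ce70391,
0x66be47f36654ef3187dedb519c4b8e2510cf82e390e30f917f6de11c8d2f769ac7762116ab2e8bef9273790e6579537f1,
0x1c0dbe98dacc166]), (0xc96520, [0x11e]), (0x186430, [
0x2e51150a2545dee7298390c927695b52a62248604268c89966221e60f207f9525db84df7859ca6efd0b9ada4843efd29c,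
0x7e42464b9e81d1d8067724f992aa86096b3e3c0b2ee643e6d6425d77c858f150c682445389a7ad3a169f87c48a491e46c,
0x7bbad68bfaf1bc790fc6ba52ce15b144b426b0739487ea718959fb56c026affc2417a836a989658ddf130579bce0f81f,
0x3b6c228b9b203d494ccb419edc1c7102e15b0e93881727db0367ca12536b1d3e0b087ebfd0486b2a57dec4d08dc3dcba7,
0xba4f94b30b7c36cbcf39ffc9b460babf6c8dc49b6db6a065592bd05bf822951066e46a3a734dbcf099872eb321c7bf0a8,
0x7f56d77963e6e7a73fda038e7b07c7a197fa9cacf6c7e2472299ba5b384aa05132ad5d548219d266fac2cc9a37623ceff,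
0xd93fe824a4adc82a97f4bad5a12ff5eb526136eda4ec26a625de16d375b023027b9caca26dee933d876525e49e2e2d8bf,
0xef9d98685cedc9ed20b0f5405277eee4dec462e3863240b9495d581a21b3a84ac846fee86463cfa698f37a88b87f2f6c,
0x5ed9e55c91392c9499bc1c8408e0e5149455f17053a03b0671a7846a7c1728ccb2509d33e9832acd9df48d0e57e633938,
0x345ba9af5ad2e284ac33e061ea2a77e433fbe3f88167923bec99f4a3a0e308c6e52ab27afbb513d5e64356979aec744a5,
0x46452f7ea1218d1d674d0b7e030614763f70a33dc2687e257f6e61187aa63cbec39866d236566835a6b5d6d8673fa0044,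
0xc0cad14c531ebcd035ae1c4a13bf981b8e531590b344d1fc8aeeb16547ce22ddaa352fac995cc9574dd49073486ada55c,
0x4cb9f2861ecbf0bd5c6401ea74ee9227da4ea73ad7d54bad9ecbccdeff6f2fd9b0cc7d363e51e796c7278ac7904aff6a2,
0xc1ebedf7f3790663a552315e912821012fd50d4a1721c5b47fbc4a9d4c66d3467a51bd2f02b9825f6ad027b30e737a35e,
0xbe1e8b774ece150558801b21bf07c559fb9277142163b61094d0437b670ee25f7af69290fed776efeb202ef5348e26d33,
0x197d1ee2a783546122a047bf0273475ad4a95d732482eb35e6531122425aac70f2bf7cd26f91476377f85737bf95c846f,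
0x1b128860597ce94e322add42690365855d6704244ba5be431f73e901b7a62a0098bbd3d0377ccbd40f99d12c165686848,
0x3609b1aae]), (0x386420, [0x18]), (0x787420, [0x12c]), (0x786530, [
0x6ec179f955d44a9c52aaa7bdc0fce5e646339efe150b1adf134b10f8c91851753a9a78ba82f87b21f6244c10ae77377de,
0x2308548aff16763d9c02927765f152241f1e8689aed1a179aa3a02244cd95b235db7b477fbb20ab5b9acbc591acbc8860,
0x12d6289f48a5fb4aa603d8ab232a5d86fa4a46dd0de2c581bd71a4ac655c6537d4c8eeaa2c924854a7955e201f3aea878,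
0x826d6eb77d1469bf7beadd0108823a80e3f2ff6f51028ccbccb957748deac5c54a130b76affd0bbc52f43a06ddf080ff7,
0x57aabbd1b389d3313e9faf196f91e6b1bd0e4c7cc9e61afddaa550ae5852f7b45a956029d24f8df111c23589d4e67b6fb,
0x5e1c06664439f6c2693c0a741d8fc18ce2623f45b9ac79eb9dd2e2dc9bb003d29cdcb2c97757a31c34313f827d8598f01,
0xadaf2d0b91abcd51a0267ad847815fa0d74b39cd029fc0b06125361a6c8dea8846d396bdd4b73a8a2f8c27fbf7e6f7606,
0x707c65414b4e019b8049877af256e8e23be3c80f85100bd1429e8883cc42d4e1193aac5633e40f8b0a53fcf7d63ae032,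
0x3564a03931659e7725365d4ac05365398476a13307c772551d207c086db00dd60f28858ed046f879f000935cbe47c1568,
0x321d16a793ec52fff75ad0d18f2d0cd00525abd57efb5078c05051856cdfb2223612a595aa14c589fa0f8bfe17291c09e,
0x240d6eb6a586ff5584576e7515b6f41e82bc8fa3b09c739af2e0fdecc83c3a1d27d04a2be12fa0bd38f64fbebfa43a4d2,
0x75b57c84076030149ef159191174a15635b8af44634132e12e1774c59a2774f8ae8890326753329f1ab34082153d8389,
0xb50940524b27d4eb6abf6cebb548b69d9ded200d407dd46892569c9b99d78bb3b24ab1e01d78ed6434a27f71956415f47,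
0xb01cd0023a1b2fb2be3b99d34becc98483e7180e4f98266d4ad327c14ca9888e62e4f97032865d61be332e70d03094437,
0xb6ab05328aa63bbcb3ae2a287f084b6b163952ceb03e5f6665d0ab4c13b6be031b0fe1f0e30eb3a19f1df9b6c034e64f2,
0x4d08ba9844fee28169c5a5ab4da0e9319f33d347d5303272f6cabeee03d14451d70c7e4dfa2e24b1a2dfe17495a698d17,
0x7002a79fa1b32cc6caf58bb33844826b3766e0abde771e3f473912c48edf1ff86fceba61581ab32b39e9d3b43049bf38d,
0x5b975e189c52747ea8f5ab4d180d9146b21b42b6575ae9d88b16fe9bb8c1ee4975c893b33f1948764b6e57e4979ea9fb,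
0x36ccf9ee3316fc1753e2d00d1fd6afb44f2c8905db7aca5400a9935c0234b4ffff0b6a8f1e0]), (0xe76410, [0x68]),
(0x175320, [
0xaf70afaa48ad5c27e80cb18a864e965a9d8a8e457b2282175300ada2c0231cdc78b42b99ff55de22c81734fa0fe2bb55e,
0x3a4d02dcba43151d9522456638c39b22b1ce2bcf79b85ecb9f03cdcc6e1c86e4f98fd3ad83e4c27a9675a544fa6c18451,
0x302ede2620f254f7b5d9cb780a37df0529fff60a641ffd24a7fc21bd5bf971ce8b13c9c1183f124258714a722df72c8e3,
0x37c0c0d270b8bedd32e804f3d1d0e2c3531dbb07d6122a7073fa9106957f9b698f860bdaa0e8263ea64ea76a9faca88ee,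
0xc4116d75db1ebeb3f78fbb1034d44b75dca2e52142464be43d248110be9cd44774962cc35a576d9d62ebd8aaa8b9541e6,
0xc532b3deee6581bb48469b31cfd4ccf4c6b6cbca35f46317a426da683d5f931dd7d8b59e8127a63471e05146256fb840b,
0x25d06db4d120f8f4cbdaa6654aeee33682a7c07d0446a04f1bc3cd99a5679f42d6fa2edba3e9e5da495b6b023d76787e3,
0x131a0b76f4e2fafd50f5d81a8]), (0xb65430, [
0xa7e0ee814bfb24cb28242b05b5b40d10eb696c934a52f5290c203bb78ab37db98e7cc4968b536cf7835d419e75da4ab8f,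
0x44e7bde11739d380c1163fad4ac92b1a414aed7caa9f1443e06846ddfcb1a6be455f705180668a3accf8af0bf731f812e,
0x2a8a9f30ba7f1ab392e2e25cbfad72593f13c3f12575b1e909e1bffdee87a8b0f679a1bbf82e77883d0243c8fefaf8cf6,
0x65339c54c76d5fc771764f0de60e4f95afa2bf6287c70adaa92d0adc5cacc6781f3e79a185f2b6915b1eec9cfae0606e9,
0x2e74fd32d519f5af47ddc0ac4c919ee513ef8caa5e723cf355710efd786fe834176cad6a1c8e14f20dec0be5eb706192b,
0x818c2311a4cdbc06425376c9e01cc738d68a2bbf6c5583a65f7d54812cde4003a2bc379b9a660c53feec55873b1101ec0,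
0x6e8e701cac38cbffdd81232bb72252]), (0xb84320, [
0x332d5fc633054566b5ac1d85c9ac8c6fddbd7bf2a20164c0a787994670d11c4303bfb15c64f40d3c14320310aea4ab2fe,
0x574cafb16d37c4ef80f87e59e5dd6cbf3e1511e697ed02d3b1f9cd5cdf39eadd181cc584e6c239b955340c2cc46eb9417,
0x1413d68d62bcf0baeafccf59d63439c]), (0x785420, [
0x377b385002362aeb889419d3f2fcb27a1c1be492c5625c8757e2439701799751d72d914834964c41eeb152919b7942a82,
0x101febd98decb903a0db92890d966298b30d6dbe60f7e14857949ba9ed2110f273462efaab020ebc6c9edb22405f7db07,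
0x1909ba7d39558fe34e2a7c2d4]), (0xb85430, [
0xaf3ff24c0eaf24e628dc5a79b154d7f6886ca4270cb87651c566455c34e723224475ee9b160e431ce074afdb4e863d475,
0x8615fe90a38aaff63cc6a4f279ad8cf61053036e3284f4dedd1c9a04040de674508b688ce2b6ea1b95c11600718580ebe,
0x6a200c2ceb7129e561f65d5fd5ae271f4354c2e5c252f57f423b45fa46906e906d6d240bd6d3cf83d7626053444a96e2c,
0xc6182ab6b26469ec140e2fa3]), (0xe86410, [
0x73e5846aaf372297f88e8bdeb4e811a5cf6c867e544b00a61ad78849b09a1e4d7b7164be62976489172dfddb11d70707,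
0xd91fed86ef509274b9b664f34ee4bb6c0b52412cb7b3f]), (0xe86420, [
0xae4068b23a2b27878458908278ffeb7d6c4e939e8b0ad9d23342e49287213f3ec08b2f709efd9a5cd5a93d56897]),
(0x786420, [0x8ff13d95d]), (0x787530, [0x364dc9ce674d66]), (0x987630, [0x6b]), (0xc96320, [0x31]),
(0xc96420, [0x991]), (0x796420, [
0x2ee02a0230605a9f132a5e707b362f29dc634f476a98322017a115bfe689b3042aea41bcde21baddd011b739fc4b4ce3d,
0x3f0d7fdb64ba3503077f168bce3699aba4509ab990ad0eabe81cc3836c9f2a7607510813318bf3ad3e482ab68251df8cf,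
0xe290e1c43af2746c277cfe2b]), (0xc97420, [0x40d]), (0x397420, [0x2c2]), (0x797420, [0x2c2]),
(0x453210, [
0x47018dc36f6c0a703ac5f7df886d88e6897d6520081a3ed9190179b6e7b00fd90e7df1a67cbfc6657239c387e9dada282,
0x611d8b1918351b2df5e9ee810579cfc1714a33966d54dce10398522d26cd732e43162f212952ce7bb9e66bf75d18d77a7,
0x4cb311c45cc275285026479af4b9dd8d5bc5fa42cd91ce6f9be4f0e351e7fa2a]), (0xb54320, [0xd]),
(0x754320, [
0x34476425a2ce2da9fedfaa6d20ab7a359261df997b8821847539e61e449ff14d4131a0bcc7b6c54a0048149c3a08a6950,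
0x4bb28d9058c048910deabb43b652465261a561ffacdd98a9d90827cce8a8d057e2a4cef73a2f6ae77ba4ff1e0dcf31d39,
0xbc854a]), (0xd64210, [
0x6d8236d5d6ce5d46ef051e2e5e5e064e07c38718cf9c6838a1b77bc2976736048767003ec003957a1a9981f6182306e5a,
0xc20cce56e1b855a6420dca2c68cf25f9633d3329375834e51fdf9f360aad82f9bd155de3dcd76c4f37d9c375bab4a45b2,
0xbd60f9d4471db6ed8c244b822a9d9b1e9c6f694dbab6acea219dbe29d2639cf363cfa319405ae0ff6a822b5b4e22edfa7,
0x15341a1b6feba43cfd3e20ed638d5385c4b78488ce2d56]), (0x364210, [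
0x23a06fe137300eeaaaabe83d6fcec13fd6805c5e2ff17afbb1914e23fa23f8875cb4d834c286774f48aa5a9df147a75a8,
0x67c0e931070b3d09c09f6dbc3dcf1e922006f3337b0914bd96522b8eca56fa1b866a0ceb70e1fb8e152f00766e9db459,
0x1a2a2349fb72dc02c0c2ccd3a5f8d7bc60b27845cf0706b03256a2aa33]), (0x564310, [
0x478c94348c50116879862377b064238a6978933cb9262f28c21ca1f9bcfb7531e7ebafe088a0b7b57e2e3f9608eeeb10e
]), (0xb64320, [0x1d6961d0c7ccec1f5689bf0b3964c1520166cec6f377a43d2d9a]), (0x764320, [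
0x490cf5ac646c913cf74ed61153a02e49cafda18ab49fa4ee170cc098bc0b95c2d6629b81390b7e1ba3a8d60d2d105625b,
0x1bf9044f56946bb453efb59d9a93d8726a02dc72e9f1251e768ca83c33]), (0x564320, [0x0]), (0x765210, [
0x55887ecb054743d036c33fbe5fb86d7f4f78c5e4302ba348e8affe061ed0a6854f41eb396faa02a093f6ab491582ed4f2,
0xb0329b26bdec2b9c1171f2dd23e5544597e537610c9309651f1f7a7ae71724743d5441fe447f0e6e29f5e9d9cd07e6217,
0x2aa6c78368765224e7e597bcb78443f5164980502fe5f7a23e6a850ef9a60d1c1891b7df8bce]), (0x565210, [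
0x43d039427c064b6b80a37c802b10c5390dadc940eedea87e753f966f85919b4fd89aefbec4d0d3e75bf744103555831fd,
0x3c669152abb266ff3970857df1480879c19c44d40cd93ae53a9776a13b15ee9977ebb674b396f80744cfb9324f0dd67c1,
0x21636c7e99550de516b2374e5d7262df478ea62775637dbaae248d9]), (0xa65310, [
0x3bdb8657eda6bc0a0435e988421333620a81bc54ca0e3ef3c00137c1e7de29f4ebe38bfcaf8c749428a07ba6988a3092a,
0x19c6e4089712427d4743f99f770001a7be47e43035ac8d79fd4ef484e08cccb44d7d42a88d097eb7f1e44]),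
(0x865310, [
0x1df6ddceddfc8450b9382e10026279919d4ac1fb6471925c62e060d81f6deffc1f00f0b8671c39c7796f030cdaaab3e85,
0x79d3dd7a05188c70380515adce32e69515ae8d1]), (0xe65310, [
0x99be914409bc6f52ce38bf2ead15c7835ec8709e08708193638e81c62915f5b30e8aadd08e3882d463d5bb3e1055d4e45,
0x29c18143ad903558fc6f42893c811138e6fa0217b72ffef50d5f1184a838684cec993c5d47ca9bba78b4fba59e0a9dedd,
0x10c7183bdec693a92ee5457d459c767801368350e391c6fe2]), (0xf65310, [0x5]), (0xc65310, [
0x67464ae5eef87ddfc13c0a7cfa45c18dca6972a604f0faaf7c9dcae2da952fe9dbf6707a57eba6f31b63193b6744ed6b,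
0x8da7aa3d48e370bc8119dde5bc00abaa88e0994f4a05c3c07339d55ffc153786358a29e00caa13fb8a36d9ad513e95c76,
0x63c01ca32e42205edb648]), (0xd65310, [0x102dae109a5293dc06408d4bbbfda4efcc]), (0x265310, [
0xefe28144e1b0539a556891275fb29b31f6c31d984b9da9bd42cb7411be424dda766e196cd7f4e8fa39923f41e204f371,
0xa18cd4ba0a2a36c3c912272c3a4495aff1feb28bd61c9]), (0x365310, [
0x2d488d646adb87f307d4e40d8cba5c826d76eda681e5bbfb7]), (0x065310, [
0x88fad27fda305a8b7adba1a77090327b2d017374aa0cc1747eba71f231c8bffbe56786d73b80d3062909300ad576cf965,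
0x9eb07df7fdf568bd8cb84d1b65c9cff9be7b7e22b543e6b40abef41f9c44311ba1d767e020ffade5a05541f02124a8b8f,
0x3b42f5]), (0x165310, [
0x8940c5ce0b9e0670801da9fe02f814055abd8dccff46abb16066dfca1d99080238cae393223ef306bb47f4f5]),
(0x665310, [
0x5204ae8025cb210ca4c4947517feb421ce29ad4c0423cd99c13ceb590ed99323d7f4b6cb6e7b5d305f61ab65ef5bb4f11,
0xb2e1d92a2cdf3d21e6bfea0573f358bd9c0b445db56d639502f]), (0x465310, [
0xcfb073b57f7321180e516c41516dbc3c7b450556cf4e591d63874942221613820b906c5cf11f44d4a5f91739815337117,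
0x50ca1f3f3ab6]), (0x565310, [
0xef5b062f96d791588b232a0235d1072354cb63e475e8849b7dd79934a77feea22b10c23c3b21126cceac4d6c36f1921c,
0x46e3a7d5a])]

theorem rotationInvariant_lutz16 : RotationInvariant lutz16 := by
  rw [lutz16_eq]
  exact rotationInvariant_of_list surfaceList_lutz16 (by decide +kernel)

theorem excluded_lutz16FacePairs : ∀ c ∈ lutz16FacePairs, Excluded lutz16 c := by
  intro c hc
  rw [lutz16_eq]
  refine excluded_of_separatesFaces surfaceList_lutz16 (List.all_eq_true.1 ?_ c hc)
  decide +kernel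

set_option maxHeartbeats 0 in
theorem not_exists_isAdmissible_lutz16 :
    ¬ ∃ M : UniformOrientedMatroid (Fin 12), M.IsAdmissible lutz16 := by
  have hK := rotationInvariant_lutz16
  have h : ∀ c ∈ lutz16FacePairs ++ (lutz16Refutations.take 0).map Prod.fst, Excluded lutz16 c := by
    simpa using excluded_lutz16FacePairs
  replace h := excluded_take_add hK 1 h (by decide +kernel)
  replace h := excluded_take_add hK 1 h (by decide +kernel)
  replace h := excluded_take_add hK 3 h (by decide +kernel)
  replace h := excluded_take_add hK 2 h (by decide +kernel)
  replace h := excluded_take_add hK 7 h (by decide +kernel)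
  replace h := excluded_take_add hK 38 h (by decide +kernel)
  replace h := excluded_take_add hK 2 h (by decide +kernel)
  exact not_exists_isAdmissible hK h 0x065310 (by decide +kernel) (by decide +kernel)

/-! ### Uniform oriented matroids from the signs of their bases -/

/-- The sign of `u - x`. -/
def orderSign (x u : Fin 12) : ℤ := Int.sign ((u : ℤ) - (x : ℤ))

theorem orderSign_swap (x u : Fin 12) : orderSign u x = -orderSign x u := by
  rw [orderSign, orderSign, ← Int.sign_neg, neg_sub]

theorem orderSign_of_lt {x u : Fin 12} (h : x < u) : orderSign x u = 1 :=
  Int.sign_eq_one_of_pos (by have : (x : ℕ) < u := h; omega)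

theorem orderSign_eq_one_or {x u : Fin 12} (h : x ≠ u) :
    orderSign x u = 1 ∨ orderSign x u = -1 := by
  rcases lt_or_gt_of_ne h with h | h
  · exact Or.inl (orderSign_of_lt h)
  · exact Or.inr (by rw [orderSign_swap, orderSign_of_lt h])

/-- The sign of the permutation that sorts the four entries of `v`; it is `0` if they are not
distinct. -/
def sortSign (v : Fin 4 → Fin 12) : ℤ :=
  orderSign (v 0) (v 1) * orderSign (v 0) (v 2) * orderSign (v 0) (v 3) *
    (orderSign (v 1) (v 2) * orderSign (v 1) (v 3) * orderSign (v 2) (v 3))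

theorem sortSign_eq_sign_det (v : Fin 4 → Fin 12) :
    sortSign v = Int.sign (Matrix.vandermonde fun i => ((v i : ℕ) : ℤ)).det := by
  have h0 : Finset.Ioi (0 : Fin 4) = {1, 2, 3} := by decide
  have h1 : Finset.Ioi (1 : Fin 4) = {2, 3} := by decide
  have h2 : Finset.Ioi (2 : Fin 4) = {3} := by decide
  have h3 : Finset.Ioi (3 : Fin 4) = ∅ := by decide
  rw [Matrix.det_vandermonde, Fin.prod_univ_four, h0, h1, h2, h3]
  simp [sortSign, orderSign, Int.sign_mul, mul_assoc]

theorem sortSign_comp (v : Fin 4 → Fin 12) (π : Equiv.Perm (Fin 4)) :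
    sortSign (v ∘ π) = (Equiv.Perm.sign π : ℤ) * sortSign v := by
  rw [sortSign_eq_sign_det, sortSign_eq_sign_det]
  have h := Matrix.det_permute π (Matrix.vandermonde fun i => ((v i : ℕ) : ℤ))
  rw [show (Matrix.vandermonde fun i => (((v ∘ π) i : ℕ) : ℤ)) =
    (Matrix.vandermonde fun i => ((v i : ℕ) : ℤ)).submatrix π id from rfl, h, Int.sign_mul]
  rcases Int.units_eq_one_or (Equiv.Perm.sign π) with h | h <;> simp [h]

theorem sortSign_eq_zero {v : Fin 4 → Fin 12} (h : ¬ Function.Injective v) : sortSign v = 0 := by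
  rw [sortSign_eq_sign_det, Int.sign_eq_zero_iff_zero]
  by_contra hd
  refine h fun i j hij => Matrix.det_vandermonde_ne_zero_iff.1 hd ?_
  simp only [hij]

theorem sortSign_eq_one_or {v : Fin 4 → Fin 12} (h : Function.Injective v) :
    sortSign v = 1 ∨ sortSign v = -1 := by
  rw [sortSign_eq_sign_det]
  have : (Matrix.vandermonde fun i => ((v i : ℕ) : ℤ)).det ≠ 0 :=
    Matrix.det_vandermonde_ne_zero_iff.2 fun i j hij => h (Fin.ext (by exact_mod_cast hij))
  rcases lt_or_gt_of_ne this with h | h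
  · exact Or.inr (Int.sign_eq_neg_one_of_neg h)
  · exact Or.inl (Int.sign_eq_one_of_pos h)

theorem sortSign_of_strictMono {v : Fin 4 → Fin 12} (h : StrictMono v) : sortSign v = 1 := by
  rw [sortSign, orderSign_of_lt (h (by decide)), orderSign_of_lt (h (by decide)),
    orderSign_of_lt (h (by decide)), orderSign_of_lt (h (by decide)),
    orderSign_of_lt (h (by decide)), orderSign_of_lt (h (by decide))]
  norm_num

/-- The code of a set of vertices, with one binary digit for each vertex. -/
def vertexMask {n : ℕ} (v : Fin n → Fin 12) : ℕ := ∑ i, 2 ^ (v i : ℕ)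

theorem vertexMask_comp {n : ℕ} (v : Fin n → Fin 12) (π : Equiv.Perm (Fin n)) :
    vertexMask (v ∘ π) = vertexMask v :=
  Equiv.sum_comp π fun i => 2 ^ (v i : ℕ)

theorem vertexMask_succAbove (c : Fin 5 → Fin 12) (i : Fin 5) :
    vertexMask (c ∘ i.succAbove) = vertexMask c - 2 ^ (c i : ℕ) := by
  rw [vertexMask, vertexMask, Fin.sum_univ_succAbove _ i, Nat.add_sub_cancel_left]
  rfl

theorem forall_of_forall_sorted {α : Type*} [LinearOrder α] {R : α → α → α → α → Prop}
    (h₁ : ∀ x y z w, R x y z w → R y x z w) (h₂ : ∀ x y z w, R x y z w → R x z y w)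
    (h₃ : ∀ x y z w, R x y z w → R x y w z)
    (h : ∀ x y z w, x < y → y < z → z < w → R x y z w) {x y z w : α} (hxy : x ≠ y) (hxz : x ≠ z)
    (hxw : x ≠ w) (hyz : y ≠ z) (hyw : y ≠ w) (hzw : z ≠ w) : R x y z w := by
  have step3 : ∀ x y z w, x < y → y < z → x ≠ w → y ≠ w → z ≠ w → R x y z w := by
    intro x y z w hx hy hxw hyw hzw
    rcases lt_or_gt_of_ne hxw with a | a
    · rcases lt_or_gt_of_ne hyw with b | b
      · rcases lt_or_gt_of_ne hzw with c | c
        · exact h _ _ _ _ hx hy c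
        · exact h₃ _ _ _ _ (h _ _ _ _ hx b c)
      · exact h₃ _ _ _ _ (h₂ _ _ _ _ (h _ _ _ _ a b hy))
    · exact h₃ _ _ _ _ (h₂ _ _ _ _ (h₁ _ _ _ _ (h _ _ _ _ a hx hy)))
  have step2 : ∀ x y z w, x < y → x ≠ z → x ≠ w → y ≠ z → y ≠ w → z ≠ w → R x y z w := by
    intro x y z w hx hxz hxw hyz hyw hzw
    rcases lt_or_gt_of_ne hyz with a | a
    · exact step3 _ _ _ _ hx a hxw hyw hzw
    · rcases lt_or_gt_of_ne hxz with b | b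
      · exact h₂ _ _ _ _ (step3 _ _ _ _ b a hxw hzw hyw)
      · exact h₂ _ _ _ _ (h₁ _ _ _ _ (step3 _ _ _ _ b hx hzw hxw hyw))
  rcases lt_or_gt_of_ne hxy with a | a
  · exact step2 _ _ _ _ a hxz hxw hyz hyw hzw
  · exact h₁ _ _ _ _ (step2 _ _ _ _ a hyz hyw hxz hxw hzw)

/-- The three-term relations for a function that assigns signs to the codes of the bases. -/
def PlueckerSigns (σ : ℕ → ℤ) : Prop :=
  ∀ a b x1 x2 x3 x4 : ℕ, a < b → b < 12 → x1 < x2 → x2 < x3 → x3 < x4 → x4 < 12 →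
    (∀ x ∈ [x1, x2, x3, x4], x ≠ a ∧ x ≠ b) →
    ({1, -1} : Set ℤ) ⊆ {σ (2 ^ a + 2 ^ b + 2 ^ x1 + 2 ^ x2) * σ (2 ^ a + 2 ^ b + 2 ^ x3 + 2 ^ x4),
      -(σ (2 ^ a + 2 ^ b + 2 ^ x1 + 2 ^ x3) * σ (2 ^ a + 2 ^ b + 2 ^ x2 + 2 ^ x4)),
      σ (2 ^ a + 2 ^ b + 2 ^ x1 + 2 ^ x4) * σ (2 ^ a + 2 ^ b + 2 ^ x2 + 2 ^ x3)}

theorem pair_subset_triple {p q r : ℤ} : ({1, -1} : Set ℤ) ⊆ {p, q, r} ↔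
    (1 = p ∨ 1 = q ∨ 1 = r) ∧ (-1 = p ∨ -1 = q ∨ -1 = r) := by
  simp [Set.insert_subset_iff]

/-- The chirotope with given signs of the sorted bases. -/
def signChirotope (σ : ℕ → ℤ) (v : Fin 4 → Fin 12) : ℤ := sortSign v * σ (vertexMask v)

theorem signChirotope_comp (σ : ℕ → ℤ) (v : Fin 4 → Fin 12) (π : Equiv.Perm (Fin 4)) :
    signChirotope σ (v ∘ π) = (Equiv.Perm.sign π : ℤ) * signChirotope σ v := by
  rw [signChirotope, signChirotope, vertexMask_comp, sortSign_comp, mul_assoc]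

theorem signChirotope_swap (σ : ℕ → ℤ) (a b x y : Fin 12) :
    signChirotope σ ![a, b, y, x] = -signChirotope σ ![a, b, x, y] := by
  have h := signChirotope_comp σ ![a, b, x, y] (Equiv.swap 2 3)
  rw [Equiv.Perm.sign_swap (by decide)] at h
  have e : ![a, b, x, y] ∘ (Equiv.swap 2 3 : Equiv.Perm (Fin 4)) = ![a, b, y, x] := by
    ext i; fin_cases i <;> rfl
  rw [e] at h
  simpa using h

theorem signChirotope_swap_left (σ : ℕ → ℤ) (a b x y : Fin 12) :
    signChirotope σ ![b, a, x, y] = -signChirotope σ ![a, b, x, y] := by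
  have h := signChirotope_comp σ ![a, b, x, y] (Equiv.swap 0 1)
  rw [Equiv.Perm.sign_swap (by decide)] at h
  have e : ![a, b, x, y] ∘ (Equiv.swap 0 1 : Equiv.Perm (Fin 4)) = ![b, a, x, y] := by
    ext i; fin_cases i <;> rfl
  rw [e] at h
  simpa using h

theorem signChirotope_eq {σ : ℕ → ℤ} {a b x y : Fin 12} (hxy : x < y) :
    signChirotope σ ![a, b, x, y] = orderSign a b * ((orderSign a x * orderSign b x) *
      (orderSign a y * orderSign b y)) *
        σ (2 ^ (a : ℕ) + 2 ^ (b : ℕ) + 2 ^ (x : ℕ) + 2 ^ (y : ℕ)) := by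
  have e : vertexMask ![a, b, x, y] = 2 ^ (a : ℕ) + 2 ^ (b : ℕ) + 2 ^ (x : ℕ) + 2 ^ (y : ℕ) := by
    simp [vertexMask, Fin.sum_univ_four]
  rw [signChirotope, e, sortSign]
  simp only [Matrix.cons_val]
  rw [orderSign_of_lt hxy]
  ring

theorem signChirotope_pluecker {σ : ℕ → ℤ} (h : PlueckerSigns σ) (a b x1 x2 x3 x4 : Fin 12)
    (hi : Function.Injective ![a, b, x1, x2, x3, x4]) :
    ({1, -1} : Set ℤ) ⊆
      {signChirotope σ ![a, b, x1, x2] * signChirotope σ ![a, b, x3, x4],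
        -(signChirotope σ ![a, b, x1, x3] * signChirotope σ ![a, b, x2, x4]),
        signChirotope σ ![a, b, x1, x4] * signChirotope σ ![a, b, x2, x3]} := by
  wlog hab : a < b generalizing a b
  · have hne : a ≠ b := hi.ne (a₁ := 0) (a₂ := 1) (by decide)
    have hi' : Function.Injective ![b, a, x1, x2, x3, x4] := by
      have e : ![b, a, x1, x2, x3, x4] = ![a, b, x1, x2, x3, x4] ∘ Equiv.swap 0 1 := by
        ext i; fin_cases i <;> rfl
      rw [e]
      exact hi.comp (Equiv.injective _)
    have := this b a hi' (lt_of_le_of_ne (not_lt.1 hab) hne.symm)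
    simpa only [signChirotope_swap_left σ a b, neg_mul_neg] using this
  have ne : ∀ i j : Fin 6, i ≠ j → ![a, b, x1, x2, x3, x4] i ≠ ![a, b, x1, x2, x3, x4] j :=
    fun i j hij => hi.ne hij
  refine forall_of_forall_sorted (R := fun x1 x2 x3 x4 =>
    (a ≠ x1 ∧ a ≠ x2 ∧ a ≠ x3 ∧ a ≠ x4) → (b ≠ x1 ∧ b ≠ x2 ∧ b ≠ x3 ∧ b ≠ x4) →
      ({1, -1} : Set ℤ) ⊆
      {signChirotope σ ![a, b, x1, x2] * signChirotope σ ![a, b, x3, x4],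
        -(signChirotope σ ![a, b, x1, x3] * signChirotope σ ![a, b, x2, x4]),
        signChirotope σ ![a, b, x1, x4] * signChirotope σ ![a, b, x2, x3]})
    ?_ ?_ ?_ ?_ (ne 2 3 (by decide)) (ne 2 4 (by decide)) (ne 2 5 (by decide)) (ne 3 4 (by decide))
    (ne 3 5 (by decide)) (ne 4 5 (by decide))
    ⟨ne 0 2 (by decide), ne 0 3 (by decide), ne 0 4 (by decide), ne 0 5 (by decide)⟩
    ⟨ne 1 2 (by decide), ne 1 3 (by decide), ne 1 4 (by decide), ne 1 5 (by decide)⟩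
  · intro x y z w hR ha hb
    have := pair_subset_triple.1 (hR ⟨ha.2.1, ha.1, ha.2.2⟩ ⟨hb.2.1, hb.1, hb.2.2⟩)
    rw [pair_subset_triple, signChirotope_swap σ a b x y, neg_mul,
      mul_comm (signChirotope σ ![a, b, y, z]), mul_comm (signChirotope σ ![a, b, y, w])]
    omega
  · intro x y z w hR ha hb
    have := pair_subset_triple.1 (hR ⟨ha.1, ha.2.2.1, ha.2.1, ha.2.2.2⟩
      ⟨hb.1, hb.2.2.1, hb.2.1, hb.2.2.2⟩)
    rw [pair_subset_triple, signChirotope_swap σ a b y z, mul_neg]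
    omega
  · intro x y z w hR ha hb
    have := pair_subset_triple.1 (hR ⟨ha.1, ha.2.1, ha.2.2.2, ha.2.2.1⟩
      ⟨hb.1, hb.2.1, hb.2.2.2, hb.2.2.1⟩)
    rw [pair_subset_triple, signChirotope_swap σ a b z w, mul_neg]
    omega
  · intro x y z w hxy hyz hzw ha hb
    rw [signChirotope_eq hxy, signChirotope_eq hzw, signChirotope_eq (hxy.trans hyz),
      signChirotope_eq (hyz.trans hzw), signChirotope_eq (hxy.trans (hyz.trans hzw)),
      signChirotope_eq hyz, orderSign_of_lt hab]
    have h := pair_subset_triple.1 (h a b x y z w hab b.isLt hxy hyz hzw w.isLt (by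
      simp only [List.mem_cons, List.not_mem_nil, or_false, ne_eq]
      rintro _ (rfl | rfl | rfl | rfl) <;> simp only [Fin.val_inj] <;> tauto))
    have sign : ∀ {u : Fin 12}, a ≠ u → b ≠ u →
        orderSign a u * orderSign b u = 1 ∨ orderSign a u * orderSign b u = -1 := by
      intro u hau hbu
      rcases orderSign_eq_one_or hau with h | h <;> rcases orderSign_eq_one_or hbu with h' | h' <;>
        simp [h, h']
    rw [pair_subset_triple]
    rcases sign ha.1 hb.1 with e1 | e1 <;> rcases sign ha.2.1 hb.2.1 with e2 | e2 <;>
      rcases sign ha.2.2.1 hb.2.2.1 with e3 | e3 <;>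
      rcases sign ha.2.2.2 hb.2.2.2 with e4 | e4 <;> rw [e1, e2, e3, e4] <;>
      simp only [one_mul, mul_one, neg_mul, mul_neg, neg_neg] <;> omega

/-- The uniform oriented matroid with given signs of the sorted bases. -/
def UniformOrientedMatroid.ofSigns (σ : ℕ → ℤ) (h : ∀ m, σ m = 1 ∨ σ m = -1)
    (hp : PlueckerSigns σ) : UniformOrientedMatroid (Fin 12) where
  χ := signChirotope σ
  eq_zero v hv := by rw [signChirotope, sortSign_eq_zero hv, zero_mul]
  eq_one_or v hv := by
    rcases sortSign_eq_one_or hv with h₁ | h₁ <;> rcases h (vertexMask v) with h₂ | h₂ <;>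
      simp [signChirotope, h₁, h₂]
  alternating := signChirotope_comp σ
  grassmannPluecker := signChirotope_pluecker hp

/-- `1` if `x ≤ u` and `-1` otherwise. -/
def weakSign (x u : Fin 12) : ℤ := if u < x then -1 else 1

theorem weakSign_eq_orderSign {x u : Fin 12} (h : x ≠ u) : weakSign x u = orderSign x u := by
  unfold weakSign
  split_ifs with hu
  · rw [orderSign_swap, orderSign_of_lt hu]
  · exact (orderSign_of_lt (lt_of_le_of_ne (not_lt.1 hu) h)).symm

/-- The sign of the permutation that sorts five distinct entries. -/
def sortSignFive (c : Fin 5 → Fin 12) : ℤ :=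
  orderSign (c 0) (c 1) * orderSign (c 0) (c 2) * orderSign (c 0) (c 3) * orderSign (c 0) (c 4) *
    (orderSign (c 1) (c 2) * orderSign (c 1) (c 3) * orderSign (c 1) (c 4) *
      (orderSign (c 2) (c 3) * orderSign (c 2) (c 4) * orderSign (c 3) (c 4)))

theorem sortSignFive_eq_one_or {c : Fin 5 → Fin 12} (hc : Function.Injective c) :
    sortSignFive c = 1 ∨ sortSignFive c = -1 := by
  have h : ∀ {i j : Fin 5}, i ≠ j → IsUnit (orderSign (c i) (c j)) := fun hij =>
    Int.isUnit_iff.2 (orderSign_eq_one_or (hc.ne hij))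
  refine Int.isUnit_iff.1 ?_
  unfold sortSignFive
  simp only [IsUnit.mul_iff]
  refine ⟨⟨⟨⟨?_, ?_⟩, ?_⟩, ?_⟩, ⟨⟨?_, ?_⟩, ?_⟩, ⟨?_, ?_⟩, ?_⟩ <;> exact h (by decide)

theorem sortSignFive_of_strictMono {g : Fin 5 → Fin 12} (h : StrictMono g) :
    sortSignFive g = 1 := by
  have h : ∀ {i j : Fin 5}, i < j → orderSign (g i) (g j) = 1 := fun hij => orderSign_of_lt (h hij)
  unfold sortSignFive
  rw [h (by decide), h (by decide), h (by decide), h (by decide), h (by decide), h (by decide),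
    h (by decide), h (by decide), h (by decide), h (by decide)]
  norm_num

/-- Up to a factor that depends on the order of the elements only, the sign `(-1)^i` in the
definition of a circuit counts the elements of the five-element set that are smaller than `c i`. -/
theorem neg_one_pow_mul_sortSign {c : Fin 5 → Fin 12} (hc : Function.Injective c) (i : Fin 5) :
    (-1) ^ (i : ℕ) * sortSign (c ∘ i.succAbove) =
      sortSignFive c * ∏ x ∈ Finset.univ.image c, weakSign (c i) x := by
  rw [Finset.prod_image hc.injOn, Fin.prod_univ_succAbove _ i]
  have h0 : weakSign (c i) (c i) = 1 := by simp [weakSign]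
  have h : ∀ j, weakSign (c i) (c (i.succAbove j)) = orderSign (c i) (c (i.succAbove j)) :=
    fun j => weakSign_eq_orderSign (hc.ne (Fin.succAbove_ne i j).symm)
  simp only [h0, h, one_mul, Fin.prod_univ_four, sortSign, sortSignFive, Function.comp_apply]
  have hs : ∀ {i j : Fin 5}, i ≠ j → orderSign (c i) (c j) * orderSign (c i) (c j) = 1 := by
    intro i j hij
    rcases orderSign_eq_one_or (hc.ne hij) with h | h <;> simp [h]
  have s01 := hs (i := 0) (j := 1) (by decide)
  have s02 := hs (i := 0) (j := 2) (by decide)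
  have s03 := hs (i := 0) (j := 3) (by decide)
  have s04 := hs (i := 0) (j := 4) (by decide)
  have s12 := hs (i := 1) (j := 2) (by decide)
  have s13 := hs (i := 1) (j := 3) (by decide)
  have s14 := hs (i := 1) (j := 4) (by decide)
  have s23 := hs (i := 2) (j := 3) (by decide)
  have s24 := hs (i := 2) (j := 4) (by decide)
  have s34 := hs (i := 3) (j := 4) (by decide)
  have square : ∀ {p q r t : ℤ} (x : ℤ), p * p = 1 → q * q = 1 → r * r = 1 → t * t = 1 →
      x = x * (p * q * r * t) * (p * q * r * t) := by
    intro p q r t x hp hq hr ht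
    linear_combination (-x) * (q * q * r * r * t * t * hp + r * r * t * t * hq + t * t * hr + ht)
  fin_cases i
  · change (-1) ^ 0 * (orderSign (c 1) (c 2) * orderSign (c 1) (c 3) * orderSign (c 1) (c 4) *
      (orderSign (c 2) (c 3) * orderSign (c 2) (c 4) * orderSign (c 3) (c 4))) = _ *
      (orderSign (c 0) (c 1) * orderSign (c 0) (c 2) *
      orderSign (c 0) (c 3) * orderSign (c 0) (c 4))
    linear_combination square
      (orderSign (c 1) (c 2) * orderSign (c 1) (c 3) * orderSign (c 1) (c 4) *
      (orderSign (c 2) (c 3) * orderSign (c 2) (c 4) * orderSign (c 3) (c 4))) s01 s02 s03 s04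
  · change (-1) ^ 1 * (orderSign (c 0) (c 2) * orderSign (c 0) (c 3) * orderSign (c 0) (c 4) *
      (orderSign (c 2) (c 3) * orderSign (c 2) (c 4) * orderSign (c 3) (c 4))) = _ *
      (orderSign (c 1) (c 0) * orderSign (c 1) (c 2) *
      orderSign (c 1) (c 3) * orderSign (c 1) (c 4))
    rw [orderSign_swap (c 0) (c 1)]
    linear_combination (-1) * square
      (orderSign (c 0) (c 2) * orderSign (c 0) (c 3) * orderSign (c 0) (c 4) *
      (orderSign (c 2) (c 3) * orderSign (c 2) (c 4) * orderSign (c 3) (c 4))) s01 s12 s13 s14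
  · change (-1) ^ 2 * (orderSign (c 0) (c 1) * orderSign (c 0) (c 3) * orderSign (c 0) (c 4) *
      (orderSign (c 1) (c 3) * orderSign (c 1) (c 4) * orderSign (c 3) (c 4))) = _ *
      (orderSign (c 2) (c 0) * orderSign (c 2) (c 1) *
      orderSign (c 2) (c 3) * orderSign (c 2) (c 4))
    rw [orderSign_swap (c 0) (c 2), orderSign_swap (c 1) (c 2)]
    linear_combination square
      (orderSign (c 0) (c 1) * orderSign (c 0) (c 3) * orderSign (c 0) (c 4) *
      (orderSign (c 1) (c 3) * orderSign (c 1) (c 4) * orderSign (c 3) (c 4))) s02 s12 s23 s24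
  · change (-1) ^ 3 * (orderSign (c 0) (c 1) * orderSign (c 0) (c 2) * orderSign (c 0) (c 4) *
      (orderSign (c 1) (c 2) * orderSign (c 1) (c 4) * orderSign (c 2) (c 4))) = _ *
      (orderSign (c 3) (c 0) * orderSign (c 3) (c 1) *
      orderSign (c 3) (c 2) * orderSign (c 3) (c 4))
    rw [orderSign_swap (c 0) (c 3), orderSign_swap (c 1) (c 3),
      orderSign_swap (c 2) (c 3)]
    linear_combination (-1) * square
      (orderSign (c 0) (c 1) * orderSign (c 0) (c 2) * orderSign (c 0) (c 4) *
      (orderSign (c 1) (c 2) * orderSign (c 1) (c 4) * orderSign (c 2) (c 4))) s03 s13 s23 s34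
  · change (-1) ^ 4 * (orderSign (c 0) (c 1) * orderSign (c 0) (c 2) * orderSign (c 0) (c 3) *
      (orderSign (c 1) (c 2) * orderSign (c 1) (c 3) * orderSign (c 2) (c 3))) = _ *
      (orderSign (c 4) (c 0) * orderSign (c 4) (c 1) *
      orderSign (c 4) (c 2) * orderSign (c 4) (c 3))
    rw [orderSign_swap (c 0) (c 4), orderSign_swap (c 1) (c 4),
      orderSign_swap (c 2) (c 4), orderSign_swap (c 3) (c 4)]
    linear_combination square
      (orderSign (c 0) (c 1) * orderSign (c 0) (c 2) * orderSign (c 0) (c 3) *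
      (orderSign (c 1) (c 2) * orderSign (c 1) (c 3) * orderSign (c 2) (c 3))) s04 s14 s24 s34

/-- A circuit in terms of the increasing enumeration of its elements. -/
theorem exists_sorted_of_isCircuit {σ : ℕ → ℤ} {h : ∀ m, σ m = 1 ∨ σ m = -1}
    {hp : PlueckerSigns σ} {P N : Finset (Fin 12)}
    (hc : (UniformOrientedMatroid.ofSigns σ h hp).IsCircuit P N) :
    ∃ g : Fin 5 → Fin 12, StrictMono g ∧ ∃ s : ℤ, (s = 1 ∨ s = -1) ∧
      (∀ e, e ∈ P ↔
        ∃ i : Fin 5, g i = e ∧ s * ((-1) ^ (i : ℕ) * σ (vertexMask g - 2 ^ (g i : ℕ))) = 1) ∧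
      ∀ e, e ∈ N ↔
        ∃ i : Fin 5, g i = e ∧ s * ((-1) ^ (i : ℕ) * σ (vertexMask g - 2 ^ (g i : ℕ))) = -1 := by
  obtain ⟨c, hi, s, hs, hP, hN⟩ := hc
  have hU : (Finset.univ.image c).card = 5 := by
    rw [Finset.card_image_of_injective _ hi]; rfl
  set g := (Finset.univ.image c).orderEmbOfFin hU with hg
  have him : Finset.univ.image g = Finset.univ.image c := by
    rw [← Finset.coe_inj, Finset.coe_image, Finset.coe_univ, Set.image_univ,
      Finset.range_orderEmbOfFin]
  have hm : vertexMask g = vertexMask c := by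
    rw [vertexMask, vertexMask, ← Finset.sum_image (f := fun x : Fin 12 => 2 ^ (x : ℕ))
      g.injective.injOn, him, Finset.sum_image hi.injOn]
  -- the sign of an element, described without reference to the enumeration
  have key : ∀ (d : Fin 5 → Fin 12), Function.Injective d →
      Finset.univ.image d = Finset.univ.image c → vertexMask d = vertexMask c → ∀ i : Fin 5,
      (-1) ^ (i : ℕ) * signChirotope σ (d ∘ i.succAbove) = sortSignFive d *
        ((∏ x ∈ Finset.univ.image c, weakSign (d i) x) * σ (vertexMask c - 2 ^ (d i : ℕ))) := by
    intro d hd hdc hm i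
    rw [signChirotope, vertexMask_succAbove, ← mul_assoc, neg_one_pow_mul_sortSign hd, hdc, hm,
      mul_assoc]
  have kg : ∀ i : Fin 5, (-1) ^ (i : ℕ) * σ (vertexMask g - 2 ^ (g i : ℕ)) =
      (∏ x ∈ Finset.univ.image c, weakSign (g i) x) * σ (vertexMask c - 2 ^ (g i : ℕ)) := by
    intro i
    have := key g g.injective him hm i
    rwa [sortSignFive_of_strictMono g.strictMono, one_mul, signChirotope,
      sortSign_of_strictMono (g.strictMono.comp (Fin.strictMono_succAbove i)), one_mul,
      vertexMask_succAbove] at this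
  have main : ∀ t e, (∃ i : Fin 5, c i = e ∧ s * (-1) ^ (i : ℕ) *
      (UniformOrientedMatroid.ofSigns σ h hp).χ (c ∘ i.succAbove) = t) ↔
      ∃ i : Fin 5, g i = e ∧ s * sortSignFive c * ((-1) ^ (i : ℕ) *
        σ (vertexMask g - 2 ^ (g i : ℕ))) = t := by
    intro t e
    have hχ : ∀ i : Fin 5, s * (-1) ^ (i : ℕ) *
        (UniformOrientedMatroid.ofSigns σ h hp).χ (c ∘ i.succAbove) = s * sortSignFive c *
        ((∏ x ∈ Finset.univ.image c, weakSign (c i) x) * σ (vertexMask c - 2 ^ (c i : ℕ))) := by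
      intro i
      rw [mul_assoc, mul_assoc, ← key c hi rfl rfl i]
      rfl
    simp only [hχ, kg]
    constructor
    · rintro ⟨i, rfl, h⟩
      have : c i ∈ Finset.univ.image g := him ▸ Finset.mem_image_of_mem c (Finset.mem_univ i)
      obtain ⟨j, -, hj⟩ := Finset.mem_image.1 this
      exact ⟨j, hj, by rw [hj]; exact h⟩
    · rintro ⟨i, rfl, h⟩
      have : g i ∈ Finset.univ.image c := him ▸ Finset.mem_image_of_mem g (Finset.mem_univ i)
      obtain ⟨j, -, hj⟩ := Finset.mem_image.1 this
      exact ⟨j, hj, by rw [hj]; exact h⟩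
  refine ⟨g, g.strictMono, s * sortSignFive c, ?_, fun e => (hP e).trans (main 1 e),
    fun e => (hN e).trans (main (-1) e)⟩
  rcases hs with rfl | rfl <;> rcases sortSignFive_eq_one_or hi with h | h <;> simp [h]

/-! ### Families of chirotopes with independently free bases -/

/-- The binary digit number `m` of `n`. -/
def maskBit (n m : ℕ) : Bool := Nat.beq (Nat.land (Nat.shiftRight n m) 1) 1

/-- The number whose binary digits equal to `1` are those with number in `l`. -/
def maskTable (l : List ℕ) : ℕ := l.foldr (fun m n => Nat.lor (Nat.shiftLeft 1 m) n) 0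

theorem maskBit_maskTable {l : List ℕ} {m : ℕ} : maskBit (maskTable l) m = true ↔ m ∈ l := by
  have h : ∀ n, maskBit n m = n.testBit m := by
    intro n
    rw [Bool.eq_iff_iff, maskBit, Nat.beq_eq, Nat.testBit, bne_iff_ne]
    change n >>> m &&& 1 = 1 ↔ 1 &&& n >>> m ≠ 0
    rw [Nat.and_comm 1, Nat.and_one_is_mod]
    omega
  rw [h]
  clear h
  induction l with
  | nil => simp [maskTable]
  | cons k l ih =>
    change (1 <<< k ||| maskTable l).testBit m = true ↔ _
    simp only [Nat.testBit_lor, Bool.or_eq_true, Nat.one_shiftLeft, Nat.testBit_two_pow,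
      decide_eq_true_eq, List.mem_cons]
    exact or_congr eq_comm ih

/-- `σ` is negative on the bases in the table `n` and positive on those that are not in the
table `u`. Thus the bases that are in `u` but not in `n` are free. -/
structure SignsBetween (n u : ℕ) (σ : ℕ → ℤ) : Prop where
  eq_one_or : ∀ m, σ m = 1 ∨ σ m = -1
  eq_neg_one : ∀ m, maskBit n m = true → σ m = -1
  eq_one : ∀ m, maskBit u m = false → σ m = 1

/-- The bases `m` and `k` are not free and have the same sign. -/
def sameSign (n u m k : ℕ) : Bool :=
  (maskBit n m && maskBit n k) || (!maskBit u m && !maskBit u k)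

/-- The bases `m` and `k` are not free and have opposite signs. -/
def oppositeSign (n u m k : ℕ) : Bool :=
  (maskBit n m && !maskBit u k) || (!maskBit u m && maskBit n k)

namespace SignsBetween
variable {n u : ℕ} {σ : ℕ → ℤ}

theorem mul_of_sameSign (h : SignsBetween n u σ) {m k : ℕ} (hs : sameSign n u m k = true) :
    σ m * σ k = 1 := by
  simp only [sameSign, Bool.or_eq_true, Bool.and_eq_true, Bool.not_eq_true'] at hs
  rcases hs with ⟨a, b⟩ | ⟨a, b⟩
  · rw [h.eq_neg_one _ a, h.eq_neg_one _ b]; norm_num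
  · rw [h.eq_one _ a, h.eq_one _ b]; norm_num

theorem mul_of_oppositeSign (h : SignsBetween n u σ) {m k : ℕ}
    (hs : oppositeSign n u m k = true) : σ m * σ k = -1 := by
  simp only [oppositeSign, Bool.or_eq_true, Bool.and_eq_true, Bool.not_eq_true'] at hs
  rcases hs with ⟨a, b⟩ | ⟨a, b⟩
  · rw [h.eq_neg_one _ a, h.eq_one _ b]; norm_num
  · rw [h.eq_one _ a, h.eq_neg_one _ b]; norm_num

end SignsBetween

/-- Among the terms of a three-term relation there are both a positive and a negative one without
free bases. -/
def plueckerAt (n u e p q r t : ℕ) : Bool :=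
  (sameSign n u (Nat.add (Nat.add e p) q) (Nat.add (Nat.add e r) t) ||
    (oppositeSign n u (Nat.add (Nat.add e p) r) (Nat.add (Nat.add e q) t) ||
      sameSign n u (Nat.add (Nat.add e p) t) (Nat.add (Nat.add e q) r))) &&
  (oppositeSign n u (Nat.add (Nat.add e p) q) (Nat.add (Nat.add e r) t) ||
    (sameSign n u (Nat.add (Nat.add e p) r) (Nat.add (Nat.add e q) t) ||
      oppositeSign n u (Nat.add (Nat.add e p) t) (Nat.add (Nat.add e q) r)))

/-- All three-term relations hold whatever the signs of the free bases are. -/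
def plueckerCheck (n u : ℕ) : Bool :=
  allBelow 12 fun b => allBelow b fun a => allBelow 12 fun x4 =>
    (Nat.beq x4 a || Nat.beq x4 b) || allBelow x4 fun x3 =>
    (Nat.beq x3 a || Nat.beq x3 b) || allBelow x3 fun x2 =>
    (Nat.beq x2 a || Nat.beq x2 b) || allBelow x2 fun x1 =>
    (Nat.beq x1 a || Nat.beq x1 b) ||
      plueckerAt n u (Nat.add (Nat.pow 2 a) (Nat.pow 2 b)) (Nat.pow 2 x1) (Nat.pow 2 x2)
        (Nat.pow 2 x3) (Nat.pow 2 x4)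

theorem SignsBetween.plueckerSigns {n u : ℕ} {σ : ℕ → ℤ} (h : SignsBetween n u σ)
    (hc : plueckerCheck n u = true) : PlueckerSigns σ := by
  intro a b x1 x2 x3 x4 hab hb h12 h23 h34 h4 hx
  have ne : ∀ x ∈ [x1, x2, x3, x4], ¬ (Nat.beq x a || Nat.beq x b) = true := by
    intro x hm
    rw [Bool.or_eq_true, Nat.beq_eq, Nat.beq_eq, not_or]
    exact hx x hm
  have hc := allBelow_iff.1 (allBelow_iff.1 (allBelow_iff.1 hc b hb) a hab) x4 h4
  have hc := allBelow_iff.1 ((Bool.or_eq_true _ _ ▸ hc).resolve_left (ne x4 (by simp))) x3 h34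
  have hc := allBelow_iff.1 ((Bool.or_eq_true _ _ ▸ hc).resolve_left (ne x3 (by simp))) x2 h23
  have hc := allBelow_iff.1 ((Bool.or_eq_true _ _ ▸ hc).resolve_left (ne x2 (by simp))) x1 h12
  have hc := (Bool.or_eq_true _ _ ▸ hc).resolve_left (ne x1 (by simp))
  rw [plueckerAt, Bool.and_eq_true, Bool.or_eq_true, Bool.or_eq_true, Bool.or_eq_true,
    Bool.or_eq_true] at hc
  rw [pair_subset_triple]
  refine ⟨hc.1.imp (fun e => (h.mul_of_sameSign e).symm) (Or.imp (fun e => ?_)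
    fun e => (h.mul_of_sameSign e).symm), hc.2.imp (fun e => (h.mul_of_oppositeSign e).symm)
    (Or.imp (fun e => ?_) fun e => (h.mul_of_oppositeSign e).symm)⟩
  · exact (neg_neg (1 : ℤ)).symm.trans (congrArg Neg.neg (h.mul_of_oppositeSign e).symm)
  · exact congrArg Neg.neg (h.mul_of_sameSign e).symm

/-- The basis that omits the element `v` of the five-element set `m` is not free; its sign is
negative if `x = 1` and positive otherwise. -/
def omittedSign (n u m v x : ℕ) : Bool :=
  Bool.rec (!maskBit u (Nat.sub m (Nat.pow 2 v))) (maskBit n (Nat.sub m (Nat.pow 2 v)))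
    (Nat.beq x 1)

/-- The circuit of a five-element set is not the one with signs `w`, whatever the signs of the free
bases are. -/
def circuitDiffers (n u m g0 g1 g2 g3 g4 w : ℕ) : Bool :=
  omittedSign n u m g0 (Nat.land w 1) ||
  (omittedSign n u m g1 (Nat.xor 1 (Nat.land (Nat.shiftRight w 1) 1)) ||
  (omittedSign n u m g2 (Nat.land (Nat.shiftRight w 2) 1) ||
  (omittedSign n u m g3 (Nat.xor 1 (Nat.land (Nat.shiftRight w 3) 1)) ||
  omittedSign n u m g4 (Nat.land (Nat.shiftRight w 4) 1))))

/-- No circuit is totally positive or totally negative, or separates two faces of the surface with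
table `T`. -/
def circuitCheck (T n u : ℕ) : Bool :=
  allBelow 12 fun g4 => allBelow g4 fun g3 => allBelow g3 fun g2 => allBelow g2 fun g1 =>
    allBelow g1 fun g0 => allBelow 32 fun w =>
      circuitDiffers n u (Nat.add (Nat.add (Nat.add (Nat.add (Nat.pow 2 g0) (Nat.pow 2 g1))
        (Nat.pow 2 g2)) (Nat.pow 2 g3)) (Nat.pow 2 g4)) g0 g1 g2 g3 g4 w ||
      ((Nat.ble 1 w && Nat.ble w 30) &&
        !(triBitFace T (sideList (fun k => [g0, g1, g2, g3, g4].getD k 0) w 1) &&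
          triBitFace T (sideList (fun k => [g0, g1, g2, g3, g4].getD k 0) w 0)))

theorem exists_bits (p : Fin 5 → Bool) : ∃ w < 32, ∀ i : Fin 5,
    Nat.land (Nat.shiftRight w i) 1 = if p i then 1 else 0 := by
  revert p; decide +kernel

theorem exists_bit_eq_one : ∀ w < 32, 1 ≤ w → ∃ i : Fin 5, Nat.land (Nat.shiftRight w i) 1 = 1 := by
  decide +kernel

theorem exists_bit_eq_zero : ∀ w < 32, w ≤ 30 →
    ∃ i : Fin 5, Nat.land (Nat.shiftRight w i) 1 = 0 := by
  decide +kernel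

theorem SignsBetween.omittedSign {n u m v x : ℕ} {σ : ℕ → ℤ} (h : SignsBetween n u σ)
    (hs : omittedSign n u m v x = true) : (x = 1 ∧ σ (m - 2 ^ v) = -1) ∨
      (x ≠ 1 ∧ σ (m - 2 ^ v) = 1) := by
  unfold _root_.omittedSign at hs
  rcases hx : Nat.beq x 1 with _ | _
  · rw [hx] at hs
    exact Or.inr ⟨Nat.ne_of_beq_eq_false hx, h.eq_one _ (Bool.not_eq_true' _ ▸ hs)⟩
  · rw [hx] at hs
    exact Or.inl ⟨Nat.eq_of_beq_eq_true hx, h.eq_neg_one _ hs⟩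

theorem SignsBetween.not_faces {L : List (Fin 12 × Fin 12 × Fin 12)} (hL : SurfaceList L)
    {n u : ℕ} {σ : ℕ → ℤ} (h : SignsBetween n u σ)
    (hc : circuitCheck (cyclicTable L) n u = true) {g : Fin 5 → Fin 12} (hg : StrictMono g)
    {P N : Finset (Fin 12)}
    (hP : ∀ e, e ∈ P ↔
      ∃ i : Fin 5, g i = e ∧ (-1) ^ (i : ℕ) * σ (vertexMask g - 2 ^ (g i : ℕ)) = 1)
    (hN : ∀ e, e ∈ N ↔
      ∃ i : Fin 5, g i = e ∧ (-1) ^ (i : ℕ) * σ (vertexMask g - 2 ^ (g i : ℕ)) = -1) :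
    (P.Nonempty ∧ N.Nonempty) ∧
      ¬ (P ∈ complexOf (facetsOf L) ∧ N ∈ complexOf (facetsOf L)) := by
  obtain ⟨w, hw, hb⟩ := exists_bits fun i =>
    decide ((-1) ^ (i : ℕ) * σ (vertexMask g - 2 ^ (g i : ℕ)) = 1)
  simp only [decide_eq_true_eq] at hb
  have hone : ∀ i : Fin 5, Nat.land (Nat.shiftRight w i) 1 = 1 ↔
      (-1) ^ (i : ℕ) * σ (vertexMask g - 2 ^ (g i : ℕ)) = 1 := by
    intro i; rw [hb]; split_ifs with h <;> simp [h]
  have hzero : ∀ i : Fin 5, Nat.land (Nat.shiftRight w i) 1 = 0 ↔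
      (-1) ^ (i : ℕ) * σ (vertexMask g - 2 ^ (g i : ℕ)) = -1 := by
    intro i
    have hs : (-1) ^ (i : ℕ) * σ (vertexMask g - 2 ^ (g i : ℕ)) = 1 ∨
        (-1) ^ (i : ℕ) * σ (vertexMask g - 2 ^ (g i : ℕ)) = -1 := by
      rcases h.eq_one_or (vertexMask g - 2 ^ (g i : ℕ)) with e | e <;>
        rcases neg_one_pow_eq_or ℤ (i : ℕ) with e' | e' <;> simp [e, e']
    rw [hb]
    split_ifs with e
    · rw [e]; norm_num
    · simpa using hs.resolve_left e
  set G : ℕ → ℕ := fun k => [(g 0).val, (g 1).val, (g 2).val, (g 3).val, (g 4).val].getD k 0 with hG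
  have hGg : ∀ i : Fin 5, G i = g i := by intro i; fin_cases i <;> rfl
  have hvert : ∀ i : Fin 5, vertex (G i) = g i := fun i =>
    Fin.ext (by rw [val_vertex (by rw [hGg]; exact (g i).isLt), hGg])
  have eP : ((sideList G w 1).map vertex).toFinset = P := by
    ext e
    rw [mem_sideList, hP]
    exact exists_congr fun i => by rw [hvert, hone]
  have eN : ((sideList G w 0).map vertex).toFinset = N := by
    ext e
    rw [mem_sideList, hN]
    exact exists_congr fun i => by rw [hvert, hzero]
  have hc := allBelow_iff.1 (allBelow_iff.1 (allBelow_iff.1 (allBelow_iff.1 (allBelow_iff.1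
    (allBelow_iff.1 hc (g 4) (g 4).isLt) (g 3) (hg (by decide))) (g 2) (hg (by decide))) (g 1)
    (hg (by decide))) (g 0) (hg (by decide))) w hw
  have hm : vertexMask g = 2 ^ (g 0 : ℕ) + 2 ^ (g 1 : ℕ) + 2 ^ (g 2 : ℕ) + 2 ^ (g 3 : ℕ) +
      2 ^ (g 4 : ℕ) := by
    simp [vertexMask, Fin.sum_univ_five]
  rw [Bool.or_eq_true] at hc
  rcases hc with hd | hc
  · exfalso
    have bit : ∀ i : Fin 5, Nat.land (Nat.shiftRight w i) 1 = 0 ∨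
        Nat.land (Nat.shiftRight w i) 1 = 1 := by
      intro i; rw [hb]; split_ifs <;> simp
    simp only [circuitDiffers, Bool.or_eq_true] at hd
    have key : ∀ (i : Fin 5) (x : ℕ),
        ((-1 : ℤ) ^ (i : ℕ) = 1 ∧ (x = 1 ↔ Nat.land (Nat.shiftRight w i) 1 = 1)) ∨
          ((-1 : ℤ) ^ (i : ℕ) = -1 ∧ (x = 1 ↔ ¬ Nat.land (Nat.shiftRight w i) 1 = 1)) →
        _root_.omittedSign n u (2 ^ (g 0 : ℕ) + 2 ^ (g 1 : ℕ) + 2 ^ (g 2 : ℕ) + 2 ^ (g 3 : ℕ) +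
          2 ^ (g 4 : ℕ)) (g i) x = true → False := by
      intro i x hx ho
      rw [hone, hm] at hx
      rcases h.omittedSign ho with ⟨a, b⟩ | ⟨a, b⟩ <;> rw [b] at hx <;>
        rcases hx with ⟨hs, hx⟩ | ⟨hs, hx⟩ <;> rw [hs] at hx <;> simp_all
    have flip : ∀ b, b = 0 ∨ b = 1 → (Nat.xor 1 b = 1 ↔ ¬ b = 1) := by
      rintro _ (rfl | rfl) <;> decide
    rcases hd with hd | hd | hd | hd | hd
    · exact key 0 _ (Or.inl ⟨by norm_num, Iff.rfl⟩) hd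
    · exact key 1 _ (Or.inr ⟨by norm_num, flip _ (bit 1)⟩) hd
    · exact key 2 _ (Or.inl ⟨by norm_num, Iff.rfl⟩) hd
    · exact key 3 _ (Or.inr ⟨by norm_num, flip _ (bit 3)⟩) hd
    · exact key 4 _ (Or.inl ⟨by norm_num, Iff.rfl⟩) hd
  · simp only [Bool.and_eq_true, Nat.ble_eq, Bool.not_eq_true', ← Bool.not_eq_true] at hc
    obtain ⟨⟨l, r⟩, hf⟩ := hc
    refine ⟨⟨?_, ?_⟩, ?_⟩
    · obtain ⟨i, hi⟩ := exists_bit_eq_one w hw l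
      exact ⟨g i, (hP _).2 ⟨i, rfl, (hone i).1 hi⟩⟩
    · obtain ⟨i, hi⟩ := exists_bit_eq_zero w hw r
      exact ⟨g i, (hN _).2 ⟨i, rfl, (hzero i).1 hi⟩⟩
    · rintro ⟨hPK, hNK⟩
      have lt : ∀ k ∈ [0, 1, 2, 3, 4], G k < 12 := by
        intro k hk
        have hk : k < 5 := by simp at hk; omega
        exact (hGg ⟨k, hk⟩).trans_lt (g ⟨k, hk⟩).isLt
      have lts : ∀ x, ∀ a ∈ sideList G w x, a < 12 := by
        intro x a ha
        obtain ⟨k, hk, rfl⟩ := List.mem_map.1 ha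
        exact lt k (List.mem_filter.1 hk).1
      have nodup : ∀ x, (sideList G w x).Nodup := by
        intro x
        refine List.Nodup.map_on ?_ ((by decide : [0, 1, 2, 3, 4].Nodup).filter _)
        intro k hk l hl e
        have hk : k < 5 := by have := (List.mem_filter.1 hk).1; simp at this; omega
        have hl : l < 5 := by have := (List.mem_filter.1 hl).1; simp at this; omega
        have e : G (⟨k, hk⟩ : Fin 5) = G (⟨l, hl⟩ : Fin 5) := e
        rw [hGg, hGg] at e
        exact Fin.val_eq_of_eq (hg.injective (Fin.ext e))
      exact hf ⟨triBitFace_of_mem hL (lts 1) (nodup 1) (eP ▸ hPK),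
        triBitFace_of_mem hL (lts 0) (nodup 0) (eN ▸ hNK)⟩

theorem SignsBetween.isAcyclic_and_isAdmissible {L : List (Fin 12 × Fin 12 × Fin 12)}
    (hL : SurfaceList L) {n u : ℕ} {σ : ℕ → ℤ} (h : SignsBetween n u σ)
    (hp : plueckerCheck n u = true) (hc : circuitCheck (cyclicTable L) n u = true) :
    (UniformOrientedMatroid.ofSigns σ h.eq_one_or (h.plueckerSigns hp)).IsAcyclic ∧
      (UniformOrientedMatroid.ofSigns σ h.eq_one_or (h.plueckerSigns hp)).IsAdmissible
        (complexOf (facetsOf L)) := by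
  have key : ∀ P N : Finset (Fin 12),
      (UniformOrientedMatroid.ofSigns σ h.eq_one_or (h.plueckerSigns hp)).IsCircuit P N →
      (P.Nonempty ∧ N.Nonempty) ∧
        ¬ (P ∈ complexOf (facetsOf L) ∧ N ∈ complexOf (facetsOf L)) := by
    intro P N hPN
    obtain ⟨g, hg, s, rfl | rfl, hP, hN⟩ := exists_sorted_of_isCircuit hPN
    · simp only [one_mul] at hP hN
      exact h.not_faces hL hc hg hP hN
    · simp only [neg_one_mul, neg_inj] at hP hN
      simp only [neg_eq_iff_eq_neg (b := (1 : ℤ))] at hP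
      have := h.not_faces hL hc hg hN hP
      exact ⟨this.1.symm, fun hh => this.2 hh.symm⟩
  refine ⟨fun P hP => Finset.not_nonempty_empty (key P ∅ hP).1.2, ?_⟩
  rintro F hF G hG - P N hPN ⟨hPF, hNG⟩
  obtain ⟨⟨hP, hN⟩, hn⟩ := key P N hPN
  exact hn ⟨mem_complexOf_of_subset hF hPF hP, mem_complexOf_of_subset hG hNG hN⟩

/-! ### A family of oriented matroids for `lutz51` -/

/-- The codes of the bases with negative sign: the binary digits of a code mark the elements. -/
def negativeBases : List ℕ := [
  0x1e, 0x2d, 0x2e, 0x33, 0x35, 0x39, 0x3a, 0x3c, 0x55, 0x59, 0x72, 0x74, 0x78, 0x87, 0x8e, 0x96,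
  0x99, 0xa6, 0xb8, 0xc9, 0xca, 0xcc, 0xd2, 0xd4, 0xe1, 0xe2, 0xe4, 0xf0, 0x107, 0x10b, 0x10d,
  0x10e, 0x116, 0x11a, 0x11c, 0x123, 0x125, 0x126, 0x129, 0x12a, 0x131, 0x14c, 0x152, 0x154,
  0x158, 0x162, 0x164, 0x168, 0x186, 0x18a, 0x18c, 0x192, 0x194, 0x1a2, 0x1a4, 0x1a8, 0x1b0,
  0x20b, 0x213, 0x223, 0x22a, 0x231, 0x232, 0x234, 0x243, 0x24c, 0x251, 0x254, 0x258, 0x264,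
  0x268, 0x285, 0x286, 0x298, 0x2a8, 0x305, 0x306, 0x309, 0x30a, 0x312, 0x321, 0x322, 0x330,
  0x3c0, 0x40b, 0x413, 0x415, 0x423, 0x429, 0x42a, 0x42c, 0x431, 0x432, 0x434, 0x443, 0x445,
  0x446, 0x451, 0x458, 0x468, 0x483, 0x485, 0x486, 0x498, 0x4a8, 0x4c8, 0x506, 0x509, 0x50a,
  0x50c, 0x512, 0x521, 0x522, 0x524, 0x528, 0x530, 0x605, 0x606, 0x60a, 0x612, 0x622, 0x628,
  0x630, 0x701, 0x704, 0x708, 0x710, 0x720, 0x807, 0x80e, 0x816, 0x819, 0x81a, 0x81c, 0x826,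
  0x838, 0x849, 0x84a, 0x84c, 0x852, 0x854, 0x861, 0x862, 0x864, 0x870, 0x889, 0x88a, 0x88c,
  0x892, 0x894, 0x8a1, 0x8a2, 0x8a4, 0x8b0, 0x8c1, 0x8c2, 0x8c4, 0x8d0, 0x903, 0x905, 0x911,
  0x918, 0x941, 0x942, 0x944, 0x948, 0x950, 0x960, 0x981, 0x982, 0x984, 0x988, 0x990, 0x9a0,
  0x9c0, 0xa03, 0xa09, 0xa0c, 0xa11, 0xa14, 0xa18, 0xa21, 0xa24, 0xa41, 0xa42, 0xa44, 0xa48,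
  0xa50, 0xa60, 0xa81, 0xa82, 0xa88, 0xa90, 0xaa0, 0xac0, 0xb02, 0xb40, 0xb80, 0xc06, 0xc09,
  0xc0c, 0xc11, 0xc14, 0xc18, 0xc21, 0xc22, 0xc24, 0xc41, 0xc48, 0xc50, 0xc60, 0xc81, 0xc88,
  0xc90, 0xca0, 0xcc0, 0xd02, 0xd40, 0xd80, 0xe02, 0xe40, 0xe80]

/-- The codes of the bases with undetermined sign. -/
def freeBases : List ℕ := [
  0x36, 0x53, 0x14a, 0x170, 0x198, 0x1a1, 0x215, 0x21a, 0x283, 0x2b0, 0x344, 0x40d, 0x491, 0x4e0,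
  0x514, 0x684, 0x825, 0x846, 0x8a8, 0x909, 0xc0a, 0xf00]

/-- The code of some four-element set. -/
def isBaseMask (m : ℕ) : Bool :=
  anyBelow 12 fun d => anyBelow d fun c => anyBelow c fun b => anyBelow b fun a =>
    Nat.beq (Nat.add (Nat.add (Nat.add (Nat.pow 2 a) (Nat.pow 2 b)) (Nat.pow 2 c)) (Nat.pow 2 d)) m

theorem exists_vertexMask_eq {m : ℕ} (h : isBaseMask m = true) :
    ∃ v : Fin 4 → Fin 12, StrictMono v ∧ vertexMask v = m := by
  obtain ⟨d, hd, h⟩ := anyBelow_iff.1 h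
  obtain ⟨c, hc, h⟩ := anyBelow_iff.1 h
  obtain ⟨b, hb, h⟩ := anyBelow_iff.1 h
  obtain ⟨a, ha, h⟩ := anyBelow_iff.1 h
  refine ⟨![⟨a, by omega⟩, ⟨b, by omega⟩, ⟨c, by omega⟩, ⟨d, hd⟩], ?_, ?_⟩
  · refine Fin.strictMono_iff_lt_succ.2 fun i => ?_
    fin_cases i
    · exact ha
    · exact hb
    · exact hc
  · rw [← Nat.eq_of_beq_eq_true h]
    simp [vertexMask, Fin.sum_univ_four]

/-- The signs that are positive on the free bases in `S` and negative on the other ones. -/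
def familySign (S : Finset ℕ) (m : ℕ) : ℤ :=
  if m ∈ negativeBases ∨ (m ∈ freeBases ∧ m ∉ S) then -1 else 1

theorem signsBetween_familySign (S : Finset ℕ) : SignsBetween (maskTable negativeBases)
    (maskTable (negativeBases ++ freeBases)) (familySign S) where
  eq_one_or m := by unfold familySign; split_ifs <;> simp
  eq_neg_one m hm := if_pos (Or.inl (maskBit_maskTable.1 hm))
  eq_one m hm := by
    refine if_neg fun h => ?_
    rw [← Bool.not_eq_true, maskBit_maskTable, List.mem_append] at hm
    exact hm (h.imp_right And.left)

theorem plueckerCheck_family : plueckerCheck (maskTable negativeBases)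
    (maskTable (negativeBases ++ freeBases)) = true := by
  decide +kernel

theorem circuitCheck_family : circuitCheck (cyclicTable lutz51Oriented) (maskTable negativeBases)
    (maskTable (negativeBases ++ freeBases)) = true := by
  decide +kernel

/-- The acyclic oriented matroids admissible for `lutz51` that are indexed by the sets of free
bases. -/
def familyMatroid (S : Finset ℕ) : UniformOrientedMatroid (Fin 12) :=
  .ofSigns (familySign S) (signsBetween_familySign S).eq_one_or
    ((signsBetween_familySign S).plueckerSigns plueckerCheck_family)

theorem familyMatroid_χ {S : Finset ℕ} {v : Fin 4 → Fin 12} (h : StrictMono v) :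
    (familyMatroid S).χ v = familySign S (vertexMask v) := by
  change signChirotope _ v = _
  rw [signChirotope, sortSign_of_strictMono h, one_mul]

theorem familyMatroid_injOn : Set.InjOn
    (fun S => Quotient.mk (UniformOrientedMatroid.signSetoid (Fin 12)) (familyMatroid S))
    (freeBases.toFinset.powerset : Set (Finset ℕ)) := by
  intro S hS T hT hST
  rw [Finset.mem_coe, Finset.mem_powerset] at hS hT
  have hST : (familyMatroid S).χ = (familyMatroid T).χ ∨
      (familyMatroid S).χ = -(familyMatroid T).χ := Quotient.exact hST
  rcases hST with h | h
  · have key : ∀ m ∈ freeBases, m ∈ S ↔ m ∈ T := by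
      intro m hm
      have hb : isBaseMask m = true :=
        List.all_eq_true.1 (by decide +kernel : freeBases.all isBaseMask = true) m hm
      have hn : m ∉ negativeBases := of_decide_eq_true (List.all_eq_true.1 (by decide +kernel :
        freeBases.all (fun m => decide (m ∉ negativeBases)) = true) m hm)
      obtain ⟨v, hv, rfl⟩ := exists_vertexMask_eq hb
      have h := congrFun h v
      rw [familyMatroid_χ hv, familyMatroid_χ hv] at h
      simp only [familySign, hn, hm, false_or, true_and] at h
      by_cases hS : vertexMask v ∈ S <;> by_cases hT : vertexMask v ∈ T <;> simp_all
    ext m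
    by_cases hm : m ∈ freeBases
    · exact key m hm
    · exact iff_of_false (fun h => hm (List.mem_toFinset.1 (hS h)))
        fun h => hm (List.mem_toFinset.1 (hT h))
  · -- the sign of a basis that is not free excludes that the chirotopes are opposite
    exfalso
    obtain ⟨v, hv, hm⟩ := exists_vertexMask_eq (m := negativeBases.head!) (by decide +kernel)
    have h := congrFun h v
    have hn : vertexMask v ∈ negativeBases := by rw [hm]; decide
    rw [Pi.neg_apply, familyMatroid_χ hv, familyMatroid_χ hv, familySign, familySign,
      if_pos (Or.inl hn), if_pos (Or.inl hn)] at h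
    norm_num at h

/-- Junk values of `Set.ncard` for infinite sets are thus excluded. -/
instance UniformOrientedMatroid.finite {E : Type*} [Finite E] :
    Finite (UniformOrientedMatroid E) := by
  have hb : ∀ (M : UniformOrientedMatroid E) v, M.χ v ∈ Set.Icc (-1 : ℤ) 1 := by
    intro M v
    by_cases hv : Function.Injective v
    · rcases M.eq_one_or v hv with h | h <;> rw [h] <;> norm_num
    · rw [M.eq_zero v hv]; norm_num
  refine Finite.of_injective
    (fun M (v : Fin 4 → E) => (⟨M.χ v, hb M v⟩ : Set.Icc (-1 : ℤ) 1)) fun M M' h => ?_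
  ext v
  exact congrArg Subtype.val (congrFun h v)

theorem lt_ncard_lutz51 :
    100000 < Set.ncard {C : Quotient (UniformOrientedMatroid.signSetoid (Fin 12)) |
      ∃ M : UniformOrientedMatroid (Fin 12),
        Quotient.mk (UniformOrientedMatroid.signSetoid (Fin 12)) M = C ∧
          M.IsAcyclic ∧ M.IsAdmissible lutz51} := by
  have hcard : freeBases.toFinset.card = 22 := by decide
  calc 100000 < 2 ^ 22 := by norm_num
    _ = Set.ncard (freeBases.toFinset.powerset : Set (Finset ℕ)) := by
      rw [Set.ncard_coe_finset, Finset.card_powerset, hcard]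
    _ = Set.ncard ((fun S => Quotient.mk (UniformOrientedMatroid.signSetoid (Fin 12))
          (familyMatroid S)) '' (freeBases.toFinset.powerset : Set (Finset ℕ))) :=
      familyMatroid_injOn.ncard_image.symm
    _ ≤ _ := by
      refine Set.ncard_le_ncard ?_ (Set.toFinite _)
      rintro _ ⟨S, -, rfl⟩
      refine ⟨familyMatroid S, rfl, ?_⟩
      rw [lutz51_eq]
      exact (signsBetween_familySign S).isAcyclic_and_isAdmissible surfaceList_lutz51
        plueckerCheck_family circuitCheck_family

/-! ### The theorem -/

theorem mainTheorem3 :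
    -- three pairwise non-isomorphic 12-vertex triangulations of the surface of genus 5 without
    -- polyhedral realization and without admissible oriented matroid
    (lutz11.IsTriangulatedSurface 5 ∧
      lutz12.IsTriangulatedSurface 5 ∧
      lutz16.IsTriangulatedSurface 5) ∧
    (¬ lutz11.IsIsomorphic lutz12 ∧
      ¬ lutz11.IsIsomorphic lutz16 ∧
      ¬ lutz12.IsIsomorphic lutz16) ∧
    ((¬ ∃ f : Fin 12 → EuclideanSpace ℝ (Fin 3), lutz11.IsPolyhedralRealization f) ∧
      (¬ ∃ f : Fin 12 → EuclideanSpace ℝ (Fin 3), lutz12.IsPolyhedralRealization f) ∧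
      (¬ ∃ f : Fin 12 → EuclideanSpace ℝ (Fin 3), lutz16.IsPolyhedralRealization f)) ∧
    ((¬ ∃ M : UniformOrientedMatroid (Fin 12), M.IsAdmissible lutz11) ∧
      (¬ ∃ M : UniformOrientedMatroid (Fin 12), M.IsAdmissible lutz12) ∧
      (¬ ∃ M : UniformOrientedMatroid (Fin 12), M.IsAdmissible lutz16)) ∧
    -- a 12-vertex triangulation of the surface of genus 5 with more than 100,000 acyclic
    -- admissible oriented matroids (chirotopes up to a global sign)
    lutz51.IsTriangulatedSurface 5 ∧
    100000 < Set.ncard {C : Quotient (UniformOrientedMatroid.signSetoid (Fin 12)) |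
      ∃ M : UniformOrientedMatroid (Fin 12),
        Quotient.mk (UniformOrientedMatroid.signSetoid (Fin 12)) M = C ∧
          M.IsAcyclic ∧ M.IsAdmissible lutz51} := by
  refine ⟨⟨?_, ?_, ?_⟩, not_isIsomorphic_lutz,
    ⟨fun ⟨f, hf⟩ => not_exists_isAdmissible_lutz11
      (exists_isAdmissible_of_isPolyhedralRealization hf),
    fun ⟨f, hf⟩ => not_exists_isAdmissible_lutz12
      (exists_isAdmissible_of_isPolyhedralRealization hf),
    fun ⟨f, hf⟩ => not_exists_isAdmissible_lutz16
      (exists_isAdmissible_of_isPolyhedralRealization hf)⟩,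
    ⟨not_exists_isAdmissible_lutz11, not_exists_isAdmissible_lutz12,
      not_exists_isAdmissible_lutz16⟩, ?_, lt_ncard_lutz51⟩
  · exact lutz11_eq ▸ isTriangulatedSurface_of_surfaceList surfaceList_lutz11
  · exact lutz12_eq ▸ isTriangulatedSurface_of_surfaceList surfaceList_lutz12
  · exact lutz16_eq ▸ isTriangulatedSurface_of_surfaceList surfaceList_lutz16
  · exact lutz51_eq ▸ isTriangulatedSurface_of_surfaceList surfaceList_lutz51
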